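/- Let $d\in\{1,2\}$, $\mathbb T=\mathbb R/2\pi\mathbb Z$, $\mathcal M=\mathbb T^d$ and $s>-\frac23$. The Cauchy problem $$i\partial_t u+\Delta u=\overline u^{\,2},\qquad u|_{t=0}=u_0,$$ is locally well-posed in $H^s(\mathcal M)$ in the following sense. For every $R>0$ there is $T=T(R)>0$ (depending only on $d,s,R$) such that for every $u_0\in H^s(\mathcal M)$ with $\|u_0\|_{H^s}\le R$ there is a solution $u\in C([-T,T];H^s(\mathcal M))\cap Z_T^{s,\frac23}$ on $[-T,T]$; it is the only solution in $C([-T,T];H^s(\mathcal M))\cap Z^{s,\frac23}_T$; and the map $u_0\mapsto u$ is continuous from $\{u_0\in H^s(\mathcal M):\|u_0\|_{H^s}\le R\}$ to $C([-T,T];H^s(\mathcal M))$. Notation. $\langle\cdot\rangle=(1+|\cdot|^2)^{1/2}$; $\widehat u(n)$ ($n\in\mathbb Z^d$) are the Fourier coefficients, $u=\sum_n\widehat u(n)e^{in\cdot x}$, and $\|u\|_{H^s}=\|\langle n\rangle^s\widehat u(n)\|_{\ell^2_n}$. Solution means Duhamel's formula $u(t)=e^{it\Delta}u_0-i\int_0^te^{i(t-t')\Delta}\overline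 u^{\,2}(t')\,dt'$ for $|t|\le T$, where the $n$-th Fourier coefficient of the integral is the absolutely convergent sum $$\sum_{k\in\mathbb Z^d}\int_0^te^{-i(t-t')|n|^2}\;\overline{\widehat{u(t')}(k)}\;\overline{\widehat{u(t')}(-n-k)}\,dt'$$ (absolute convergence of the sum over $k$ of these time integrals is part of the definition of a solution). For $v$ on $\mathcal M\times\mathbb R$ with space-time Fourier transform $\widehat v(n,\tau)$, normalized so that $v(t)$ has $n$-th Fourier coefficient $\int_{\mathbb R}e^{it\tau}\widehat v(n,\tau)\,d\tau$, let $$\|v\|_{X^{s,b}}=\|\langle n\rangle^s\langle\tau+|n|^2\rangle^b\,\widehat v\|_{\ell^2_nL^2_\tau},\qquad \|v\|_{Y^{s,b}}=\|\langle n\rangle^s\,\widehat v\|_{\ell^2_nL^1_\tau}+\|\langle\tau+|n|^2\rangle^{\frac s2+b}\,\widehat v\|_{\ell^2_nL^2_\tau},$$ $$\|v\|_{Z^{s,b}}=\|P_{\rm lo}v\|_{X^{s,b}}+\|P_{\rm hi}v\|_{Y^{s,b}},$$ where $P_{\rm lo}$ and $P_{\rm hi}$ are the space-time frequency projections onto $\{|\tau+|n|^2|<2^{-10}|n|^2\}$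 and $\{|\tau+|n|^2|\ge2^{-10}|n|^2\}$. Finally $\|u\|_{Z^{s,b}_T}=\inf\{\|v\|_{Z^{s,b}}:v|_{[-T,T]}=u\}$, and $u\in Z_T^{s,b}$ means that this is finite. -/

import Mathlib

open Set Filter Topology MeasureTheory
open scoped ENNReal ComplexConjugate

noncomputable section

namespace PeriodicNLS

/-- The lattice `ℤ^d` of frequencies of the torus `𝕋^d = (ℝ / 2πℤ)^d`. -/
abbrev Freq (d : ℕ) : Type := Fin d → ℤ

/-- `|n|²` for a frequency `n`; `-|n|²` is the eigenvalue of the Laplacian on `e^{i n · x}`. -/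
def freqSq {d : ℕ} (n : Freq d) : ℝ := ∑ i, (n i : ℝ) ^ 2

/-- The Japanese bracket `⟨n⟩ = (1 + |n|²)^{1/2}` of a frequency. -/
def freqBracket {d : ℕ} (n : Freq d) : ℝ := √(1 + freqSq n)

/-- The Japanese bracket `⟨x⟩ = (1 + x²)^{1/2}` of a real number. -/
def bracket (x : ℝ) : ℝ := √(1 + x ^ 2)

/-- Periodic distributions are identified with their Fourier coefficients `n ↦ û(n)`,
`u = ∑ û(n) e^{i n · x}`; those in `H^s(𝕋^d)` are the ones with `⟨n⟩^s û(n) ∈ ℓ²(ℤ^d)`. -/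
def hsSubmodule (d : ℕ) (s : ℝ) : Submodule ℂ (Freq d → ℂ) where
  carrier := {f | Memℓp (fun n => ((freqBracket n ^ s : ℝ) : ℂ) * f n) 2}
  add_mem' := by
    intro f g hf hg
    have h := Memℓp.add hf hg
    refine (congrArg (fun F : Freq d → ℂ => Memℓp F 2) ?_).mp h
    funext n
    simp [mul_add]
  zero_mem' := by
    refine (congrArg (fun F : Freq d → ℂ => Memℓp F 2) ?_).mp
      (zero_memℓp (E := fun _ : Freq d => ℂ) (p := 2))
    funext n
    simp
  smul_mem' := by
    intro c f hf
    have h := Memℓp.const_smul hf c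
    refine (congrArg (fun F : Freq d → ℂ => Memℓp F 2) ?_).mp h
    funext n
    simp [mul_left_comm]

/-- The Sobolev space `H^s(𝕋^d)`. It is a separate type so that it carries the `H^s` topology and
not the topology of pointwise convergence of Fourier coefficients. -/
def Hs (d : ℕ) (s : ℝ) : Type := hsSubmodule d s

namespace Hs

variable {d : ℕ} {s : ℝ}

instance : AddCommGroup (Hs d s) := inferInstanceAs (AddCommGroup (hsSubmodule d s))

instance : Module ℂ (Hs d s) := inferInstanceAs (Module ℂ (hsSubmodule d s))

/-- The Fourier coefficient `û(n)`. -/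
def coeff (u : Hs d s) (n : Freq d) : ℂ := u.1 n

/-- The linear embedding `u ↦ (⟨n⟩^s û(n))_n` of `H^s` into `ℓ²(ℤ^d)`. -/
def toL2 : Hs d s →ₗ[ℂ] lp (fun _ : Freq d => ℂ) 2 where
  toFun u := ⟨fun n => ((freqBracket n ^ s : ℝ) : ℂ) * u.coeff n, u.2⟩
  map_add' u v := by
    ext n
    exact mul_add _ _ _
  map_smul' c u := by
    ext n
    exact mul_left_comm _ _ _

theorem freqBracket_pos (n : Freq d) : 0 < freqBracket n :=
  Real.sqrt_pos.2 (add_pos_of_pos_of_nonneg one_pos (Finset.sum_nonneg fun _ _ => sq_nonneg _))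

theorem toL2_injective : Function.Injective (toL2 : Hs d s →ₗ[ℂ] _) := by
  intro u v h
  refine Subtype.ext (funext fun n => ?_)
  have hn : ((freqBracket n ^ s : ℝ) : ℂ) * u.coeff n
      = ((freqBracket n ^ s : ℝ) : ℂ) * v.coeff n :=
    congrFun (congrArg Subtype.val h) n
  exact mul_left_cancel₀
    (Complex.ofReal_ne_zero.2 (Real.rpow_pos_of_pos (freqBracket_pos n) s).ne') hn

/-- The norm `‖u‖_{H^s} = ‖⟨n⟩^s û(n)‖_{ℓ²}`. -/
instance : NormedAddCommGroup (Hs d s) :=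
  NormedAddCommGroup.induced (Hs d s) (lp (fun _ : Freq d => ℂ) 2) toL2 toL2_injective

theorem norm_sq_eq (u : Hs d s) :
    ‖u‖ ^ 2 = ∑' n, (freqBracket n ^ s * ‖u.coeff n‖) ^ 2 := by
  have h := lp.norm_rpow_eq_tsum (p := 2) (by norm_num) (toL2 u)
  simp only [ENNReal.toReal_ofNat, Real.rpow_ofNat] at h
  have h0 : ‖u‖ = ‖toL2 u‖ := rfl
  rw [h0, h]
  refine tsum_congr fun n => ?_
  have hp := (Real.rpow_pos_of_pos (freqBracket_pos n) s).le
  have h1 : (toL2 u : Freq d → ℂ) n = ((freqBracket n ^ s : ℝ) : ℂ) * u.coeff n := rfl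
  rw [h1, norm_mul, Complex.norm_real, Real.norm_of_nonneg hp]

end Hs

/-- The mixed norm `‖g‖_{ℓ²_n L^p_τ(ℤ^d × ℝ)}`, with values in `[0, ∞]`. -/
def mixedNorm {d : ℕ} (p : ℝ≥0∞) (g : Freq d → ℝ → ℂ) : ℝ≥0∞ :=
  (∑' n, eLpNorm (g n) p volume ^ 2) ^ (1 / 2 : ℝ)

/-- The modulation `τ + |n|²`. -/
def modulation {d : ℕ} (n : Freq d) (τ : ℝ) : ℝ := τ + freqSq n

/-- The `X^{s,b}` norm of the space-time distribution with space-time Fourier transform `g`. -/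
def XNorm {d : ℕ} (s b : ℝ) (g : Freq d → ℝ → ℂ) : ℝ≥0∞ :=
  mixedNorm 2 fun n τ => ((freqBracket n ^ s * bracket (modulation n τ) ^ b : ℝ) : ℂ) * g n τ

/-- The `Y^{s,b}` norm of the space-time distribution with space-time Fourier transform `g`. -/
def YNorm {d : ℕ} (s b : ℝ) (g : Freq d → ℝ → ℂ) : ℝ≥0∞ :=
  mixedNorm 1 (fun n τ => ((freqBracket n ^ s : ℝ) : ℂ) * g n τ) +
    mixedNorm 2 (fun n τ => ((bracket (modulation n τ) ^ (s / 2 + b) : ℝ) : ℂ) * g n τ)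

/-- The projection `P_lo` onto `|τ + |n|²| < 2^{-10} |n|²`, on the Fourier side. -/
def projLo {d : ℕ} (g : Freq d → ℝ → ℂ) : Freq d → ℝ → ℂ := fun n =>
  {τ : ℝ | |modulation n τ| < 2⁻¹ ^ 10 * freqSq n}.indicator (g n)

/-- The projection `P_hi` onto `|τ + |n|²| ≥ 2^{-10} |n|²`, on the Fourier side. -/
def projHi {d : ℕ} (g : Freq d → ℝ → ℂ) : Freq d → ℝ → ℂ := fun n =>
  {τ : ℝ | 2⁻¹ ^ 10 * freqSq n ≤ |modulation n τ|}.indicator (g n)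

/-- The `Z^{s,b}` norm `‖P_lo v‖_{X^{s,b}} + ‖P_hi v‖_{Y^{s,b}}` of the space-time distribution
`v` with space-time Fourier transform `g`. -/
def ZNorm {d : ℕ} (s b : ℝ) (g : Freq d → ℝ → ℂ) : ℝ≥0∞ :=
  XNorm s b (projLo g) + YNorm s b (projHi g)

/-- `g` is the space-time Fourier transform of a `v` on `𝕋^d × ℝ` with `v = u` for `t ∈ [-T, T]`,
where `v(t)` has the Fourier coefficients `∫ e^{i t τ} g(n, τ) dτ`. A measurable `g` with finite
`Z^{s,b}` norm has all `g(n, ·)` in `L¹` (`P_lo` restricts `τ` to a bounded interval, and the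
`Y^{s,b}` norm contains the `ℓ²_n L¹_τ` norm), so asking for integrability excludes nothing. -/
structure IsExtension {d : ℕ} {s : ℝ} (T : ℝ) (u : ℝ → Hs d s) (g : Freq d → ℝ → ℂ) : Prop where
  integrable : ∀ n, Integrable (g n) volume
  eq_on : ∀ t ∈ Icc (-T) T, ∀ n,
    (u t).coeff n = ∫ τ : ℝ, Complex.exp (Complex.I * t * τ) * g n τ

/-- The norm of the restriction space `Z_T^{s,b}`: the infimum of the `Z^{s,b}` norms of the
extensions (`∞` if there is none). Only the values of `u` on `[-T, T]` matter. -/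
def ZTNorm {d : ℕ} {s : ℝ} (b T : ℝ) (u : ℝ → Hs d s) : ℝ≥0∞ :=
  ⨅ (g : Freq d → ℝ → ℂ) (_ : IsExtension T u g), ZNorm s b g

/-- `u` belongs to `Z_T^{s,b}`. -/
def MemZT {d : ℕ} {s : ℝ} (b T : ℝ) (u : ℝ → Hs d s) : Prop := ZTNorm b T u < ∞

/-- The `n`-th Fourier coefficient of `e^{i t Δ} f`. -/
def freeCoeff {d : ℕ} {s : ℝ} (t : ℝ) (f : Hs d s) (n : Freq d) : ℂ :=
  Complex.exp (-(Complex.I * t * freqSq n)) * f.coeff n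

/-- The contribution of the pair of frequencies `(k, -n - k)` to the `n`-th Fourier coefficient of
`∫₀ᵗ e^{i (t - t') Δ} (ū²)(t') dt'`. Indeed the `n`-th Fourier coefficient of `ū²` is the sum over
`k` of the products of the conjugates of `û(k)` and `û(-n - k)`. -/
def duhamelInteraction {d : ℕ} {s : ℝ} (u : ℝ → Hs d s) (t : ℝ) (n k : Freq d) : ℂ :=
  ∫ t' in (0 : ℝ)..t, Complex.exp (-(Complex.I * (t - t') * freqSq n)) *
    (conj ((u t').coeff k) * conj ((u t').coeff (-n - k)))

/-- `u ∈ C([-T, T]; H^s)` solves `i ∂ₜ u + Δ u = ū²`, `u(0) = u₀` on `[-T, T]`, in the Duhamel form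
`u(t) = e^{i t Δ} u₀ - i ∫₀ᵗ e^{i (t - t') Δ} (ū²)(t') dt'`. For `s < 0` the square of `ū(t')` need
not exist as a distribution at a fixed time; the Duhamel integral is therefore the sum of the
contributions of all pairs of frequencies, each integrated in time, and this sum has to converge
unconditionally (equivalently, absolutely). If `s ≥ 0` this is the usual Duhamel integral. -/
structure IsSolution {d : ℕ} {s : ℝ} (T : ℝ) (u₀ : Hs d s) (u : ℝ → Hs d s) : Prop where
  continuousOn : ContinuousOn u (Icc (-T) T)
  initial : u 0 = u₀
  duhamel : ∀ t ∈ Icc (-T) T, ∀ n, ∃ S : ℂ,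
    HasSum (duhamelInteraction u t n) S ∧
      (u t).coeff n = freeCoeff t u₀ n - Complex.I * S

end PeriodicNLS

end

/-! Work with the modulation `σ = τ + |n|²`. Both factors of the nonlinearity are conjugated, so the
modulations of the output `n` and of the inputs `k`, `-n - k` add up to `|n|² + |k|² + |n + k|²`,
the `phase`. This is a sum of squares without cancellation, hence the largest of the three
modulations is at least a third of the phase (`phase_le_of_dominant`): every interaction is
nonresonant, and this pays for the negative regularity. The number of interactions with a given
phase is controlled by arithmetic. Twice the phase equals `|2n + k|² + 3|k|²`, so for fixed `k` the
frequencies `n` of a given phase lie on a circle, and in dimension at most two a circle of squared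
radius `l` carries `O((1 + l)^ε)` lattice points (`exists_ncard_normFiber_le`).

The analysis takes place on the time scale `1 / M`, in a norm whose square `energy` consists of an
`ℓ²L¹` part and an `L²` part with weight `M^(-1/3) (M + |σ|)^(4/3) (⟨n⟩² + |σ|)^s`. For fixed `M`
and negative `s` this is comparable to the square of the `Z^{s,2/3}` norm: the last factor is of
size `⟨n⟩^(2s)` for low and `⟨σ⟩^s` for high modulation. The bilinear estimate
`exists_energy_interaction_le` gains `M^(-(2/3 + s))`. The exponent is negative exactly when `s >
-2/3`, so data of any size are handled by taking `M` large. The Duhamel operator is truncated by a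
smooth cutoff that equals one for `|t| ≤ 1 / M`, hence it is exact there (`hasSum_duhamel_evol`),
and Picard iteration gives a fixed point that is Lipschitz in the data
(`IsBilinear.exists_fixedPoint`, `IsBilinear.resEnergy_fixedPoint_sub_le`).

The estimates are proved for `-2/3 < s ≤ -1/2` only. A larger `s` is written as `s₀ + 2ρ` with `s₀`
in that range, and a weight `spread ^ ρ`, which obeys a Leibniz rule, is carried through all
estimates.

For uniqueness, two solutions in the class have extensions of finite energy at the regularity `s₀`.
Localizing them to an interval of length comparable to `1 / M` costs a constant that does not depend
on `M` (`exists_resEnergy_timeCut_le`), so `M` can be chosen after the solutions. The difference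
then has extensions of arbitrarily small norm near any time at which the solutions agree, and `[-T,
T]` is exhausted in steps of length `1 / M` (`SolvesOn.evol_eq`). -/

noncomputable section

namespace PeriodicNLS

/-! ### Lattice points on circles: the divisor bound through the Gaussian integers. -/

section

/-- The Gaussian integers of norm `l`, that is, the representations of `l` as a sum of two
squares. -/
def normFiber (l : ℕ) : Set GaussianInt := {z | z.norm = l}

theorem mem_normFiber {l : ℕ} {z : GaussianInt} :
    z ∈ normFiber l ↔ z.re ^ 2 + z.im ^ 2 = (l : ℤ) := by
  simp only [normFiber, mem_ofPred_eq, Zsqrtd.norm_def]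
  constructor <;> intro h <;> linarith

theorem ncard_box_le (s : Set GaussianInt) (b : ℕ)
    (h : ∀ z ∈ s, |z.re| ≤ b ∧ |z.im| ≤ b) : s.Finite ∧ s.ncard ≤ (2 * b + 1) ^ 2 := by
  let B : Finset (ℤ × ℤ) := Finset.Icc (-(b : ℤ)) b ×ˢ Finset.Icc (-(b : ℤ)) b
  let e : GaussianInt → ℤ × ℤ := fun z => (z.re, z.im)
  have he : Function.Injective e := by
    intro z w hzw
    simp only [e, Prod.mk.injEq] at hzw
    exact Zsqrtd.ext hzw.1 hzw.2
  have hmap : ∀ z ∈ s, e z ∈ (B : Set (ℤ × ℤ)) := by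
    intro z hz
    have := h z hz
    simp only [abs_le] at this
    simp [e, B, this.1, this.2]
  have hfin : s.Finite :=
    Set.Finite.of_injOn (f := e) (fun z hz => hmap z hz) he.injOn B.finite_toSet
  refine ⟨hfin, ?_⟩
  have h1 := Set.ncard_le_ncard_of_injOn e hmap he.injOn B.finite_toSet
  refine h1.trans ?_
  rw [Set.ncard_coe_finset, Finset.card_product, Int.card_Icc]
  have : ((b : ℤ) + 1 - -(b : ℤ)).toNat = 2 * b + 1 := by omega
  rw [this, sq]

theorem finite_normFiber (l : ℕ) : (normFiber l).Finite := by
  refine (ncard_box_le _ l ?_).1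
  intro z hz
  rw [mem_normFiber] at hz
  constructor <;> apply abs_le_of_sq_le_sq _ (by positivity) <;>
    nlinarith [sq_nonneg z.re, sq_nonneg z.im, sq_nonneg ((l : ℤ) - 1),
      (by positivity : (0 : ℤ) ≤ l), Int.le_self_sq (l : ℤ)]

/-- The factor of norm `a` is `u = gcd(z, a)`. Bézout for the gcd gives `a ∣ u ū`, since `z z̄ =
ab`; Bézout for `a` and `b` writes `a` as a combination of `a²` and `z z̄`, both divisible by `u ū`.
Hence `u` has norm exactly `a`. -/
theorem exists_mul_of_norm_eq_mul {a b : ℕ} (hab : a.Coprime b) {z : GaussianInt}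
    (hz : z ∈ normFiber (a * b)) : ∃ u ∈ normFiber a, ∃ v ∈ normFiber b, u * v = z := by
  rcases Nat.eq_zero_or_pos a with rfl | ha
  · have hb : b = 1 := by simpa using hab
    subst hb
    exact ⟨z, by simpa using hz, 1, by simp [normFiber], mul_one z⟩
  classical
  have hz' : (z : GaussianInt) * star z = ((a : ℤ) : GaussianInt) * ((b : ℤ) : GaussianInt) := by
    rw [← Zsqrtd.norm_eq_mul_conj, hz]; push_cast; rfl
  set u := EuclideanDomain.gcd z ((a : ℤ) : GaussianInt) with hu
  have huz : u ∣ z := EuclideanDomain.gcd_dvd_left _ _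
  have hua : u ∣ ((a : ℤ) : GaussianInt) := EuclideanDomain.gcd_dvd_right _ _
  have star_dvd : ∀ {x y : GaussianInt}, x ∣ y → star x ∣ star y := by
    rintro x y ⟨c, rfl⟩
    exact ⟨star c, by rw [star_mul, mul_comm]⟩
  have hsa : star ((a : ℤ) : GaussianInt) = ((a : ℤ) : GaussianInt) := by
    ext <;> simp
  have h1 : ((a : ℤ) : GaussianInt) ∣ u * star u := by
    have := EuclideanDomain.gcd_eq_gcd_ab z ((a : ℤ) : GaussianInt)
    rw [← hu] at this
    set x := EuclideanDomain.gcdA z ((a : ℤ) : GaussianInt)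
    set y := EuclideanDomain.gcdB z ((a : ℤ) : GaussianInt)
    have h2 : u * star u = z * star z * (x * star x) +
        ((a : ℤ) : GaussianInt) * (y * (star z * star x) + z * x * star y
          + y * star y * ((a : ℤ) : GaussianInt)) := by
      rw [this]
      simp only [star_add, star_mul, hsa]
      ring
    rw [h2, hz']
    exact dvd_add (Dvd.dvd.mul_right (dvd_mul_right _ _) _) (dvd_mul_right _ _)
  have h2 : u * star u ∣ ((a : ℤ) : GaussianInt) := by
    have hc : IsCoprime (a : ℤ) (b : ℤ) := Nat.isCoprime_iff_coprime.2 hab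
    obtain ⟨α, β, hαβ⟩ := hc
    have h3 : ((a : ℤ) : GaussianInt) = (α : GaussianInt) *
        (((a : ℤ) : GaussianInt) * ((a : ℤ) : GaussianInt)) + (β : GaussianInt) * (z * star z) := by
      rw [hz']
      have : (1 : GaussianInt) = (α : GaussianInt) * ((a : ℤ) : GaussianInt) +
          (β : GaussianInt) * ((b : ℤ) : GaussianInt) := by
        rw [← Int.cast_mul, ← Int.cast_mul, ← Int.cast_add, hαβ, Int.cast_one]
      calc ((a : ℤ) : GaussianInt) = ((a : ℤ) : GaussianInt) * 1 := (mul_one _).symm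
        _ = _ := by rw [this]; ring
    rw [h3]
    refine dvd_add (Dvd.dvd.mul_left (mul_dvd_mul hua ?_) _)
      (Dvd.dvd.mul_left (mul_dvd_mul huz (star_dvd huz)) _)
    have := star_dvd hua
    rwa [hsa] at this
  rw [← Zsqrtd.norm_eq_mul_conj, Zsqrtd.intCast_dvd_intCast] at h1 h2
  have hnu : u.norm = a := Int.dvd_antisymm (GaussianInt.norm_nonneg u) (by positivity) h2 h1
  obtain ⟨v, hv⟩ := huz
  refine ⟨u, hnu, v, ?_, hv.symm⟩
  have h4 : u.norm * v.norm = a * b := by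
    rw [← Zsqrtd.norm_mul, ← hv, hz]; push_cast; rfl
  rw [hnu] at h4
  exact mul_left_cancel₀ (by positivity) h4

theorem ncard_normFiber_mul_le {a b : ℕ} (hab : a.Coprime b) :
    (normFiber (a * b)).ncard ≤ (normFiber a).ncard * (normFiber b).ncard := by
  rw [← Set.ncard_prod]
  have hf := (finite_normFiber a).prod (finite_normFiber b)
  refine (Set.ncard_le_ncard (t := (fun q : GaussianInt × GaussianInt => q.1 * q.2) ''
    (normFiber a ×ˢ normFiber b)) ?_ (hf.image _)).trans (Set.ncard_image_le hf)
  intro z hz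
  obtain ⟨u, hu, v, hv, h⟩ := exists_mul_of_norm_eq_mul hab hz
  exact ⟨(u, v), ⟨hu, hv⟩, h⟩

/-- If `q` divides the cross term of two vectors of squared length `q`, they agree up to a
rotation by a multiple of a right angle. -/
theorem eq_rotation_of_dvd {q x y u v : ℤ} (hq : 0 < q) (hz : x ^ 2 + y ^ 2 = q)
    (hw : u ^ 2 + v ^ 2 = q) (h : q ∣ x * v - y * u) :
    (u = x ∧ v = y) ∨ (u = -x ∧ v = -y) ∨ (u = -y ∧ v = x) ∨ (u = y ∧ v = -x) := by
  obtain ⟨t, ht⟩ := h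
  have hsum : (x * u + y * v) ^ 2 + (x * v - y * u) ^ 2 = q ^ 2 := by
    calc _ = (x ^ 2 + y ^ 2) * (u ^ 2 + v ^ 2) := by ring
      _ = q ^ 2 := by rw [hz, hw, sq]
  have hu : u * q = (x * u + y * v) * x - (x * v - y * u) * y := by rw [← hz]; ring
  have hv : v * q = (x * u + y * v) * y + (x * v - y * u) * x := by rw [← hz]; ring
  -- The squares of the inner product and of the cross term add up to `q²`, so a cross term
  -- divisible by `q` is `0` or `±q`, and the inner product is then determined up to sign.
  have ht2 : t ^ 2 ≤ 1 := by
    have : q ^ 2 * t ^ 2 ≤ q ^ 2 * 1 := by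
      have : (x * v - y * u) ^ 2 = q ^ 2 * t ^ 2 := by rw [ht]; ring
      nlinarith [sq_nonneg (x * u + y * v)]
    exact le_of_mul_le_mul_left this (by positivity)
  have ht3 : -1 ≤ t ∧ t ≤ 1 := by constructor <;> nlinarith
  have h3 : t = -1 ∨ t = 0 ∨ t = 1 := by omega
  have hq0 : q ≠ 0 := hq.ne'
  rcases h3 with rfl | rfl | rfl
  · have h4 : x * u + y * v = 0 := by
      have : (x * u + y * v) ^ 2 = 0 := by rw [ht] at hsum; linarith
      exact pow_eq_zero_iff (two_ne_zero) |>.1 this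
    right; right; right
    rw [h4, ht] at hu hv
    exact ⟨mul_right_cancel₀ hq0 (by linarith), mul_right_cancel₀ hq0 (by linarith)⟩
  · have h4 : (x * u + y * v - q) * (x * u + y * v + q) = 0 := by
      rw [ht] at hsum; linear_combination hsum
    rw [ht] at hu hv
    rcases mul_eq_zero.1 h4 with h4 | h4
    · left
      have h5 : x * u + y * v = q := by linarith
      rw [h5] at hu hv
      exact ⟨mul_right_cancel₀ hq0 (by linarith), mul_right_cancel₀ hq0 (by linarith)⟩
    · right; left
      have h5 : x * u + y * v = -q := by linarith
      rw [h5] at hu hv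
      exact ⟨mul_right_cancel₀ hq0 (by linarith), mul_right_cancel₀ hq0 (by linarith)⟩
  · have h4 : x * u + y * v = 0 := by
      have : (x * u + y * v) ^ 2 = 0 := by rw [ht] at hsum; linarith
      exact pow_eq_zero_iff (two_ne_zero) |>.1 this
    right; right; left
    rw [h4, ht] at hu hv
    exact ⟨mul_right_cancel₀ hq0 (by linarith), mul_right_cancel₀ hq0 (by linarith)⟩

/-- `p ^ a` divides the product of the cross terms of `(u, v)` with `(x, y)` and with its conjugate.
As `p` is odd and both vectors are primitive, `p` cannot divide both cross terms, so `p ^ a` divides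
one of them and `eq_rotation_of_dvd` applies to `(x, y)` or to `(x, -y)`. -/
theorem eq_rotation_or_conj {p a : ℕ} (hp : p.Prime) (hp2 : p ≠ 2) (ha : a ≠ 0) {x y u v : ℤ}
    (hz : x ^ 2 + y ^ 2 = (p : ℤ) ^ a) (hw : u ^ 2 + v ^ 2 = (p : ℤ) ^ a)
    (hzp : ¬((p : ℤ) ∣ x ∧ (p : ℤ) ∣ y)) (hwp : ¬((p : ℤ) ∣ u ∧ (p : ℤ) ∣ v)) :
    ((u = x ∧ v = y) ∨ (u = -x ∧ v = -y) ∨ (u = -y ∧ v = x) ∨ (u = y ∧ v = -x)) ∨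
    ((u = x ∧ v = -y) ∨ (u = -x ∧ v = y) ∨ (u = y ∧ v = x) ∨ (u = -y ∧ v = -x)) := by
  have hpp : Prime (p : ℤ) := Nat.prime_iff_prime_int.1 hp
  have hpos : (0 : ℤ) < (p : ℤ) ^ a := by have := hp.pos; positivity
  have hpa : (p : ℤ) ∣ (p : ℤ) ^ a := dvd_pow_self _ ha
  have key : ∀ {x y : ℤ}, x ^ 2 + y ^ 2 = (p : ℤ) ^ a → (p : ℤ) ∣ x → (p : ℤ) ∣ y := by
    intro x y h hx
    refine hpp.dvd_of_dvd_pow (n := 2) ?_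
    have : y ^ 2 = (p : ℤ) ^ a - x ^ 2 := by linarith
    rw [this]
    exact dvd_sub hpa (hx.trans (dvd_pow_self _ two_ne_zero))
  have hprod : (p : ℤ) ^ a ∣ (x * v - y * u) * (x * v + y * u) := by
    refine ⟨x ^ 2 - u ^ 2, ?_⟩
    have h1 : y ^ 2 = (p : ℤ) ^ a - x ^ 2 := by linarith
    have h2 : v ^ 2 = (p : ℤ) ^ a - u ^ 2 := by linarith
    calc (x * v - y * u) * (x * v + y * u) = x ^ 2 * v ^ 2 - y ^ 2 * u ^ 2 := by ring
      _ = _ := by rw [h1, h2]; ring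
  have hnot : ¬((p : ℤ) ∣ x * v - y * u ∧ (p : ℤ) ∣ x * v + y * u) := by
    rintro ⟨h1, h2⟩
    have h3 : (p : ℤ) ∣ 2 * (x * v) := by
      have := dvd_add h1 h2
      rwa [show x * v - y * u + (x * v + y * u) = 2 * (x * v) by ring] at this
    rcases hpp.dvd_or_dvd h3 with h3 | h3
    · have : p ∣ 2 := by exact_mod_cast h3
      exact hp2 ((Nat.prime_dvd_prime_iff_eq hp Nat.prime_two).1 this)
    · rcases hpp.dvd_or_dvd h3 with h3 | h3
      · exact hzp ⟨h3, key hz h3⟩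
      · exact hwp ⟨key (by rw [add_comm]; exact hw) h3, h3⟩
  by_cases h1 : (p : ℤ) ∣ x * v - y * u
  · have h2 : ¬(p : ℤ) ∣ x * v + y * u := fun h => hnot ⟨h1, h⟩
    have hc : IsCoprime ((p : ℤ) ^ a) (x * v + y * u) :=
      ((Prime.coprime_iff_not_dvd hpp).2 h2).pow_left
    left
    exact eq_rotation_of_dvd hpos hz hw (hc.dvd_of_dvd_mul_right hprod)
  · have hc : IsCoprime ((p : ℤ) ^ a) (x * v - y * u) :=
      ((Prime.coprime_iff_not_dvd hpp).2 h1).pow_left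
    right
    have h3 := hc.dvd_of_dvd_mul_left hprod
    have h4 := eq_rotation_of_dvd (x := x) (y := -y) (u := u) (v := v) hpos (by rw [neg_sq, hz]) hw
      (by rwa [neg_mul, sub_neg_eq_add])
    simpa using h4

/-- For odd `p` at most eight vectors arise from one by rotation and conjugation; for `2 ^ a` with
`a ≥ 2` a sum of two squares divisible by four has even entries, so none is primitive. -/
theorem ncard_primitive_le {p : ℕ} (hp : p.Prime) (a : ℕ) :
    {z ∈ normFiber (p ^ a) | ¬((p : ℤ) ∣ z.re ∧ (p : ℤ) ∣ z.im)}.ncard ≤ 9 := by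
  set s := {z ∈ normFiber (p ^ a) | ¬((p : ℤ) ∣ z.re ∧ (p : ℤ) ∣ z.im)} with hs
  -- The bound nine, rather than eight, comes from the crude count of the box `{-1, 0, 1}²`.
  have small : (p ^ a) ≤ 2 → s.ncard ≤ 9 := by
    intro h
    refine (ncard_box_le s 1 ?_).2
    rintro z ⟨hz, -⟩
    rw [mem_normFiber] at hz
    have h' : ((p ^ a : ℕ) : ℤ) ≤ 2 := by exact_mod_cast h
    constructor <;> rw [abs_le] <;> constructor <;>
      push_cast <;> nlinarith [sq_nonneg z.re, sq_nonneg z.im]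
  rcases eq_or_ne a 0 with rfl | ha
  · exact small (by simp)
  rcases eq_or_ne p 2 with rfl | hp2
  · rcases eq_or_ne a 1 with rfl | ha1
    · exact small (by simp)
    · have : s = ∅ := by
        rw [Set.eq_empty_iff_forall_notMem]
        rintro z ⟨hz, hn⟩
        rw [mem_normFiber] at hz
        obtain ⟨b, rfl⟩ : ∃ b, a = b + 2 := ⟨a - 2, by omega⟩
        have h4 : (4 : ℤ) ∣ z.re ^ 2 + z.im ^ 2 := by
          rw [hz]; push_cast; exact ⟨2 ^ b, by ring⟩
        apply hn
        push_cast
        rcases Int.even_or_odd' z.re with ⟨c, hc | hc⟩ <;>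
          rcases Int.even_or_odd' z.im with ⟨e, he | he⟩ <;> rw [hc, he] at h4 ⊢
        · exact ⟨dvd_mul_right _ _, dvd_mul_right _ _⟩
        all_goals ring_nf at h4; omega
      rw [this]; simp
  · rcases s.eq_empty_or_nonempty with h | ⟨z, hz, hzp⟩
    · rw [h]; simp
    · rw [mem_normFiber] at hz
      push_cast at hz
      set x := z.re
      set y := z.im
      let F : List GaussianInt := [⟨x, y⟩, ⟨-x, -y⟩, ⟨-y, x⟩, ⟨y, -x⟩, ⟨x, -y⟩,
        ⟨-x, y⟩, ⟨y, x⟩, ⟨-y, -x⟩]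
      classical
      have hsub : s ⊆ (F.toFinset : Set GaussianInt) := by
        rintro w ⟨hw, hwp⟩
        rw [mem_normFiber] at hw
        push_cast at hw
        have := eq_rotation_or_conj hp hp2 ha hz hw hzp hwp
        simp only [F, List.coe_toFinset, List.mem_cons, List.not_mem_nil, or_false, mem_ofPred_eq,
          Zsqrtd.ext_iff]
        rcases this with (h | h | h | h) | (h | h | h | h)
        · exact Or.inl h
        · exact Or.inr (Or.inl h)
        · exact Or.inr (Or.inr (Or.inl h))
        · exact Or.inr (Or.inr (Or.inr (Or.inl h)))
        · exact Or.inr (Or.inr (Or.inr (Or.inr (Or.inl h))))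
        · exact Or.inr (Or.inr (Or.inr (Or.inr (Or.inr (Or.inl h)))))
        · exact Or.inr (Or.inr (Or.inr (Or.inr (Or.inr (Or.inr (Or.inl h))))))
        · exact Or.inr (Or.inr (Or.inr (Or.inr (Or.inr (Or.inr (Or.inr h))))))
      refine (Set.ncard_le_ncard hsub (Finset.finite_toSet _)).trans ?_
      rw [Set.ncard_coe_finset]
      exact (List.toFinset_card_le F).trans (by simp [F])

/-- Imprimitive elements are `p` times elements of norm `p ^ (a - 2)`, so each step of the induction
adds at most nine primitive ones. -/
theorem ncard_normFiber_prime_pow_le {p : ℕ} (hp : p.Prime) (a : ℕ) :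
    (normFiber (p ^ a)).ncard ≤ 9 * (a + 1) := by
  induction a using Nat.strong_induction_on with
  | _ a ih =>
  set P : GaussianInt → Prop := fun z => (p : ℤ) ∣ z.re ∧ (p : ℤ) ∣ z.im
  have hsplit : normFiber (p ^ a) = {z ∈ normFiber (p ^ a) | ¬P z} ∪ {z ∈ normFiber (p ^ a) | P z} := by
    ext z; simp only [mem_union, mem_ofPred_eq]; tauto
  rw [hsplit]
  refine (Set.ncard_union_le _ _).trans ?_
  have h1 := ncard_primitive_le hp a
  have hp0 : (p : ℤ) ≠ 0 := by exact_mod_cast hp.ne_zero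
  suffices h2 : {z ∈ normFiber (p ^ a) | P z}.ncard ≤ 9 * a by
    have : 9 * (a + 1) = 9 + 9 * a := by ring
    rw [this]; exact add_le_add h1 h2
  rcases lt_or_ge a 2 with ha | ha
  · have : {z ∈ normFiber (p ^ a) | P z} = ∅ := by
      rw [Set.eq_empty_iff_forall_notMem]
      rintro z ⟨hz, ⟨c, hc⟩, ⟨e, he⟩⟩
      rw [mem_normFiber, hc, he] at hz
      have h3 : (p : ℤ) ^ 2 ∣ (p : ℤ) ^ a := ⟨c ^ 2 + e ^ 2, by push_cast at hz; rw [← hz]; ring⟩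
      have h4 : p ^ 2 ∣ p ^ a := by exact_mod_cast h3
      have := (Nat.pow_dvd_pow_iff_le_right hp.one_lt).1 h4
      omega
    rw [this]; simp
  · obtain ⟨b, rfl⟩ : ∃ b, a = b + 2 := ⟨a - 2, by omega⟩
    have hsub : {z ∈ normFiber (p ^ (b + 2)) | P z} ⊆
        (fun z : GaussianInt => ((p : ℤ) : GaussianInt) * z) '' normFiber (p ^ b) := by
      rintro z ⟨hz, ⟨c, hc⟩, ⟨e, he⟩⟩
      refine ⟨⟨c, e⟩, ?_, ?_⟩
      · rw [mem_normFiber] at hz ⊢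
        rw [hc, he] at hz
        push_cast at hz ⊢
        have : (p : ℤ) ^ 2 * (c ^ 2 + e ^ 2) = (p : ℤ) ^ 2 * (p : ℤ) ^ b := by
          rw [← pow_add, add_comm 2 b, ← hz]; ring
        exact mul_left_cancel₀ (pow_ne_zero 2 hp0) this
      · ext <;> simp [hc, he]
    refine (Set.ncard_le_ncard hsub ((finite_normFiber _).image _)).trans ?_
    refine (Set.ncard_image_le (finite_normFiber _)).trans ((ih b (by omega)).trans ?_)
    omega

/-- A submultiplicative function that grows linearly along prime powers is `O(n^ε)`. -/
theorem exists_le_rpow_of_submultiplicative (f : ℕ → ℕ)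
    (hmul : ∀ a b : ℕ, a.Coprime b → f (a * b) ≤ f a * f b)
    (hpow : ∀ p a : ℕ, p.Prime → f (p ^ a) ≤ 9 * (a + 1)) {ε : ℝ} (hε : 0 < ε) :
    ∃ C : ℝ, 1 ≤ C ∧ ∀ n : ℕ, n ≠ 0 → (f n : ℝ) ≤ C * (n : ℝ) ^ ε := by
  -- For primes `p ≥ P` the bound `9 (a + 1) ≤ 18 ^ a` is absorbed by `p ^ (aε)` without any
  -- constant.
  obtain ⟨P, hP⟩ : ∃ P : ℕ, ∀ p : ℕ, P ≤ p → (18 : ℝ) ≤ (p : ℝ) ^ ε := by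
    have := (tendsto_rpow_atTop hε).comp tendsto_natCast_atTop_atTop
    exact (tendsto_atTop.1 this 18).exists_forall_of_atTop
  -- Each of the finitely many primes below `P` costs a constant `c`.
  obtain ⟨c, hc1, hc⟩ : ∃ c : ℝ, 1 ≤ c ∧ ∀ a : ℕ, (9 * (a + 1) : ℝ) ≤ c * ((2 : ℝ) ^ ε) ^ a := by
    have h2 : (1 : ℝ) < (2 : ℝ) ^ ε := Real.one_lt_rpow one_lt_two hε
    set d := (2 : ℝ) ^ ε - 1 with hd
    have hd0 : 0 < d := by linarith
    refine ⟨9 * (1 + d⁻¹), by nlinarith [inv_pos.2 hd0], fun a => ?_⟩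
    have hb : 1 + (a : ℝ) * d ≤ ((2 : ℝ) ^ ε) ^ a := by
      have := one_add_mul_le_pow (a := d) (by linarith) a
      rwa [show 1 + d = (2 : ℝ) ^ ε by rw [hd]; ring] at this
    have : (a + 1 : ℝ) ≤ (1 + d⁻¹) * (1 + a * d) := by
      have h3 : d⁻¹ * (a * d) = a := by field_simp
      have h4 : 0 < d⁻¹ := inv_pos.2 hd0
      have h5 : (0 : ℝ) ≤ a * d := by positivity
      nlinarith
    calc (9 * (a + 1) : ℝ) ≤ 9 * ((1 + d⁻¹) * (1 + a * d)) := by linarith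
      _ ≤ 9 * ((1 + d⁻¹) * ((2 : ℝ) ^ ε) ^ a) := by
        have := inv_pos.2 hd0
        gcongr
      _ = _ := by ring
  have hfactor : ∀ p a : ℕ, p.Prime → a ≠ 0 →
      (f (p ^ a) : ℝ) ≤ (if p < P then c else 1) * ((p ^ a : ℕ) : ℝ) ^ ε := by
    intro p a hp ha
    have h1 : (f (p ^ a) : ℝ) ≤ 9 * (a + 1) := by exact_mod_cast hpow p a hp
    have h2 : ((p ^ a : ℕ) : ℝ) ^ ε = ((p : ℝ) ^ ε) ^ a := by
      push_cast
      rw [← Real.rpow_natCast, ← Real.rpow_natCast, ← Real.rpow_mul (by positivity),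
        ← Real.rpow_mul (by positivity), mul_comm]
    rw [h2]
    refine h1.trans ?_
    split_ifs with h
    · refine (hc a).trans ?_
      have : (2 : ℝ) ≤ p := by exact_mod_cast hp.two_le
      gcongr
    · rw [one_mul]
      have h3 : (9 * (a + 1) : ℝ) ≤ 18 ^ a := by
        have : ∀ b : ℕ, (9 * ((b + 1 : ℕ) + 1) : ℝ) ≤ 18 ^ (b + 1) := by
          intro b
          induction b with
          | zero => norm_num
          | succ b ihb =>
            rw [pow_succ]; push_cast at ihb ⊢
            have : (0 : ℝ) ≤ b := by positivity
            nlinarith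
        obtain ⟨b, rfl⟩ := Nat.exists_eq_succ_of_ne_zero ha
        exact this b
      refine h3.trans ?_
      have := hP p (not_lt.1 h)
      gcongr
  -- The bound that multiplies over coprime factors is the second one. The factor 9 in the first
  -- serves only `n = 1`, where `f 1 ≤ 9` is all that is known.
  have main : ∀ n : ℕ, n ≠ 0 →
      (f n : ℝ) ≤ 9 * c ^ (n.primeFactors.filter (· < P)).card * (n : ℝ) ^ ε ∧
      (n ≠ 1 → (f n : ℝ) ≤ c ^ (n.primeFactors.filter (· < P)).card * (n : ℝ) ^ ε) := by
    intro n
    induction n using Nat.recOnPosPrimePosCoprime with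
    | zero => simp
    | one =>
      intro _
      have : f 1 ≤ 9 := by simpa using hpow 2 0 Nat.prime_two
      have h' : (f 1 : ℝ) ≤ 9 := by exact_mod_cast this
      simp [h']
    | prime_pow p a hp ha =>
      intro _
      have h1 := hfactor p a hp ha.ne'
      have h2 : (f (p ^ a) : ℝ) ≤ c ^ ((p ^ a).primeFactors.filter (· < P)).card *
          ((p ^ a : ℕ) : ℝ) ^ ε := by
        rw [Nat.primeFactors_prime_pow ha.ne' hp]
        refine h1.trans (le_of_eq ?_)
        by_cases h : p < P <;> simp [Finset.filter_singleton, h]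
      refine ⟨h2.trans ?_, fun _ => h2⟩
      rw [mul_assoc]
      have : (0 : ℝ) ≤ c ^ ((p ^ a).primeFactors.filter (· < P)).card * ((p ^ a : ℕ) : ℝ) ^ ε := by
        positivity
      linarith
    | coprime a b ha hb hab iha ihb =>
      intro _
      have h1 := (iha (by omega)).2 (by omega)
      have h2 := (ihb (by omega)).2 (by omega)
      have h3 : (f (a * b) : ℝ) ≤ c ^ ((a * b).primeFactors.filter (· < P)).card *
          ((a * b : ℕ) : ℝ) ^ ε := by
        have h4 : (f (a * b) : ℝ) ≤ f a * f b := by exact_mod_cast hmul a b hab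
        refine h4.trans ((mul_le_mul h1 h2 (by positivity) (by positivity)).trans (le_of_eq ?_))
        rw [hab.primeFactors_mul, Finset.filter_union, Finset.card_union_of_disjoint, pow_add]
        · push_cast
          rw [Real.mul_rpow (by positivity) (by positivity)]
          ring
        · exact Finset.disjoint_filter_filter hab.disjoint_primeFactors
      refine ⟨h3.trans ?_, fun _ => h3⟩
      rw [mul_assoc]
      have : (0 : ℝ) ≤ c ^ ((a * b).primeFactors.filter (· < P)).card * ((a * b : ℕ) : ℝ) ^ ε := by
        positivity
      linarith
  refine ⟨9 * c ^ P, ?_, fun n hn => (main n hn).1.trans ?_⟩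
  · have : 1 ≤ c ^ P := one_le_pow₀ hc1
    linarith
  · have hcard : (n.primeFactors.filter (· < P)).card ≤ P := by
      refine (Finset.card_le_card (t := Finset.range P) ?_).trans (by simp)
      intro q hq
      exact Finset.mem_range.2 (Finset.mem_filter.1 hq).2
    gcongr

/-- The number of representations of `l` as a sum of two squares is `O((1 + l)^ε)`. -/
theorem exists_ncard_normFiber_le {ε : ℝ} (hε : 0 < ε) :
    ∃ C : ℝ, 1 ≤ C ∧ ∀ l : ℕ, ((normFiber l).ncard : ℝ) ≤ C * (1 + l : ℝ) ^ ε := by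
  obtain ⟨C, hC, h⟩ := exists_le_rpow_of_submultiplicative (fun l => (normFiber l).ncard)
    (fun a b hab => ncard_normFiber_mul_le hab)
    (fun p a hp => ncard_normFiber_prime_pow_le hp a) hε
  refine ⟨C, hC, fun l => ?_⟩
  rcases eq_or_ne l 0 with rfl | hl
  · have : (normFiber 0).ncard ≤ 1 := by
      refine (ncard_box_le _ 0 ?_).2
      intro z hz
      rw [mem_normFiber] at hz
      have h1 : z.re = 0 := by push_cast at hz; nlinarith [sq_nonneg z.re, sq_nonneg z.im]
      have h2 : z.im = 0 := by push_cast at hz; nlinarith [sq_nonneg z.re, sq_nonneg z.im]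
      simp [h1, h2]
    have h' : ((normFiber 0).ncard : ℝ) ≤ 1 := by exact_mod_cast this
    simp only [CharP.cast_eq_zero, add_zero, Real.one_rpow, mul_one]
    linarith
  · refine (h l hl).trans ?_
    have : (0 : ℝ) ≤ l := by positivity
    gcongr
    linarith

end

/-! ### Level sets of the phase and sums over frequencies. -/

section

variable {d : ℕ}

theorem freqSq_nonneg (n : Freq d) : 0 ≤ freqSq n := Finset.sum_nonneg fun _ _ => sq_nonneg _

/-- `1 + |n|²`, the square of the Japanese bracket of a frequency. -/
def freqWeight (n : Freq d) : ℝ := 1 + freqSq n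

theorem one_le_freqWeight (n : Freq d) : 1 ≤ freqWeight n := by
  unfold freqWeight; linarith [freqSq_nonneg n]

theorem freqWeight_pos (n : Freq d) : 0 < freqWeight n := one_pos.trans_le (one_le_freqWeight n)

/-- The resonance function `|n|² + |k|² + |n + k|²` of the interaction of the conjugates of the
frequencies `k` and `-n - k`. -/
def phase (n k : Freq d) : ℝ := freqSq n + freqSq k + freqSq (-n - k)

theorem phase_comm (n k : Freq d) : phase n k = phase k n := by
  unfold phase
  rw [show -n - k = -k - n by abel]; ring

theorem phase_swap (n k : Freq d) : phase n (-n - k) = phase n k := by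
  unfold phase
  rw [show -n - (-n - k) = k by abel]; ring

theorem phase_nonneg (n k : Freq d) : 0 ≤ phase n k := by
  unfold phase; linarith [freqSq_nonneg n, freqSq_nonneg k, freqSq_nonneg (-n - k)]

theorem freqSq_le_phase (n k : Freq d) : freqSq n ≤ phase n k := by
  unfold phase; linarith [freqSq_nonneg n, freqSq_nonneg k, freqSq_nonneg (-n - k)]

theorem freqSq_le_phase_right (n k : Freq d) : freqSq k ≤ phase n k := by
  unfold phase; linarith [freqSq_nonneg n, freqSq_nonneg k, freqSq_nonneg (-n - k)]

theorem freqSq_le_phase_third (n k : Freq d) : freqSq (-n - k) ≤ phase n k := by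
  unfold phase; linarith [freqSq_nonneg n, freqSq_nonneg k, freqSq_nonneg (-n - k)]

/-- `|n|²` as an integer. -/
def freqSqInt (n : Freq d) : ℤ := ∑ i, n i ^ 2

theorem freqSqInt_cast (n : Freq d) : (freqSqInt n : ℝ) = freqSq n := by
  simp [freqSqInt, freqSq]

/-- Completing the square turns a level set of the phase, for fixed `y`, into a circle in the
variable `2n + y`. -/
theorem two_mul_phase (n y : Freq d) :
    2 * (freqSqInt n + freqSqInt y + freqSqInt (-n - y)) =
      freqSqInt (2 • n + y) + 3 * freqSqInt y := by
  simp only [freqSqInt, Finset.mul_sum, ← Finset.sum_add_distrib]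
  refine Finset.sum_congr rfl fun i _ => ?_
  simp only [Pi.sub_apply, Pi.neg_apply, Pi.add_apply, nsmul_eq_mul, Nat.cast_ofNat, Pi.mul_apply,
    Pi.ofNat_apply]
  ring

theorem exists_phase_eq_natCast (n y : Freq d) : ∃ m : ℕ, phase n y = m := by
  refine ⟨(freqSqInt n + freqSqInt y + freqSqInt (-n - y)).toNat, ?_⟩
  have h : 0 ≤ freqSqInt n + freqSqInt y + freqSqInt (-n - y) := by
    have : (0 : ℝ) ≤ ((freqSqInt n + freqSqInt y + freqSqInt (-n - y) : ℤ) : ℝ) := by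
      push_cast; simp only [freqSqInt_cast]; exact phase_nonneg n y
    exact_mod_cast this
  have h2 : (((freqSqInt n + freqSqInt y + freqSqInt (-n - y)).toNat : ℤ) : ℝ) =
      ((freqSqInt n + freqSqInt y + freqSqInt (-n - y) : ℤ) : ℝ) := by rw [Int.toNat_of_nonneg h]
  rw [Int.cast_natCast] at h2
  rw [h2]; push_cast; simp only [freqSqInt_cast]; rfl

/-- An embedding of the frequencies in dimension at most two into the Gaussian integers that
preserves the norm. -/
theorem exists_gaussian_embedding (hd : d = 1 ∨ d = 2) :
    ∃ e : Freq d → GaussianInt, Function.Injective e ∧ ∀ n, (e n).norm = freqSqInt n := by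
  rcases hd with rfl | rfl
  · refine ⟨fun n => ⟨n 0, 0⟩, fun n m h => ?_, fun n => ?_⟩
    · funext i
      rw [Subsingleton.elim i 0]
      exact congrArg Zsqrtd.re h
    · simp [Zsqrtd.norm_def, freqSqInt, sq]
  · refine ⟨fun n => ⟨n 0, n 1⟩, fun n m h => ?_, fun n => ?_⟩
    · funext i
      fin_cases i
      · exact congrArg Zsqrtd.re h
      · exact congrArg Zsqrtd.im h
    · simp [Zsqrtd.norm_def, freqSqInt, sq]

open Classical in
-- The point `2n + y` lies on the circle of squared radius `2m - 3|y|²`. This is at most `2m`, which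
-- makes the divisor bound uniform in `y`.
theorem exists_tsum_phase_eq_le (hd : d = 1 ∨ d = 2) {ε : ℝ} (hε : 0 < ε) :
    ∃ C : ℝ, 1 ≤ C ∧ ∀ (y : Freq d) (m : ℕ),
      ∑' n : Freq d, (if phase n y = m then (1 : ℝ≥0∞) else 0) ≤
        ENNReal.ofReal (C * (1 + m) ^ ε) := by
  obtain ⟨C, hC, h⟩ := exists_ncard_normFiber_le hε
  obtain ⟨e, he, hnorm⟩ := exists_gaussian_embedding hd
  refine ⟨C * 2 ^ ε, ?_, fun y m => ?_⟩
  · have : (1 : ℝ) ≤ 2 ^ ε := Real.one_le_rpow one_le_two hε.le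
    nlinarith
  have h0 : ∀ n : Freq d, (0 : ℤ) ≤ freqSqInt n := fun n =>
    Finset.sum_nonneg fun _ _ => sq_nonneg _
  -- If the integer is negative, the level set is empty and the truncated value is irrelevant.
  set l : ℕ := (2 * (m : ℤ) - 3 * freqSqInt y).toNat with hl
  set s : Set (Freq d) := {n | phase n y = m} with hs
  have hmap : ∀ n ∈ s, e (2 • n + y) ∈ normFiber l := by
    intro n hn
    have h1 : freqSqInt n + freqSqInt y + freqSqInt (-n - y) = m := by
      have h2 : phase n y = m := hn
      unfold phase at h2
      simp only [← freqSqInt_cast] at h2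
      exact_mod_cast h2
    have h3 := two_mul_phase n y
    rw [h1] at h3
    have h4 := h0 (2 • n + y)
    change (e (2 • n + y)).norm = (l : ℤ)
    rw [hnorm, hl, Int.toNat_of_nonneg (by linarith)]
    linarith
  have hinj : Set.InjOn (fun n => e (2 • n + y)) s := by
    intro a _ b _ hab
    have h1 := add_right_cancel (he hab)
    funext i
    have h2 := congrFun h1 i
    simp only [Pi.smul_apply, nsmul_eq_mul, Nat.cast_ofNat] at h2
    omega
  have hcard := Set.ncard_le_ncard_of_injOn _ hmap hinj (finite_normFiber l)
  have hfin : s.Finite := Set.Finite.of_injOn (fun n hn => hmap n hn) hinj (finite_normFiber l)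
  have htsum : ∑' n : Freq d, (if phase n y = m then (1 : ℝ≥0∞) else 0) = (s.ncard : ℝ≥0∞) := by
    have h1 : (fun n : Freq d => if phase n y = m then (1 : ℝ≥0∞) else 0) =
        s.indicator (fun _ => 1) := by
      funext n; simp [hs, Set.indicator_apply]
    rw [h1, ← tsum_subtype, ENNReal.tsum_set_one, ← hfin.cast_ncard_eq]
    simp
  rw [htsum, ← ENNReal.ofReal_natCast]
  apply ENNReal.ofReal_le_ofReal
  calc (s.ncard : ℝ) ≤ (normFiber l).ncard := by exact_mod_cast hcard
    _ ≤ C * (1 + l : ℝ) ^ ε := h l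
    _ ≤ C * (2 * (1 + m) : ℝ) ^ ε := by
      have h1 : (l : ℝ) ≤ 2 * m := by
        have : (l : ℤ) ≤ 2 * m := by
          have := h0 y
          omega
        exact_mod_cast this
      gcongr
      linarith
    _ = C * 2 ^ ε * (1 + m) ^ ε := by
      rw [Real.mul_rpow (by norm_num) (by positivity)]; ring

open Classical in
/-- Sums over frequencies of a function of the phase. -/
theorem exists_tsum_comp_phase_le (hd : d = 1 ∨ d = 2) {ε : ℝ} (hε : 0 < ε) :
    ∃ C : ℝ, 1 ≤ C ∧ ∀ (y : Freq d) (g : ℝ → ℝ≥0∞),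
      ∑' n : Freq d, g (phase n y) ≤
        ∑' m : ℕ, g m * ENNReal.ofReal (C * (1 + m) ^ ε) := by
  obtain ⟨C, hC, h⟩ := exists_tsum_phase_eq_le hd hε
  refine ⟨C, hC, fun y g => ?_⟩
  have h1 : ∀ n : Freq d, g (phase n y) =
      ∑' m : ℕ, g m * (if phase n y = m then (1 : ℝ≥0∞) else 0) := by
    intro n
    obtain ⟨m, hm⟩ := exists_phase_eq_natCast n y
    rw [tsum_eq_single m]
    · simp [hm]
    · intro m' hm'
      have : phase n y ≠ m' := by
        rw [hm]; exact_mod_cast hm'.symm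
      simp [this]
  simp_rw [h1]
  rw [ENNReal.tsum_comm]
  refine ENNReal.tsum_le_tsum fun m => ?_
  rw [ENNReal.tsum_mul_left]
  gcongr
  exact h y m

theorem summable_int_rpow {b : ℝ} (hb : 1 < b) : Summable fun j : ℤ => (1 + |(j : ℝ)|) ^ (-b) := by
  have h : Summable fun m : ℕ => ((m : ℝ) + 1) ^ (-b) := by
    have := (summable_nat_add_iff 1).2 (Real.summable_nat_rpow.2 (by linarith : -b < -1))
    simpa using this
  refine Summable.of_nat_of_neg ?_ ?_
  · refine h.congr fun m => ?_
    simp [add_comm]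
  · refine h.congr fun m => ?_
    simp [add_comm]

/-- Translating by `⌊c⌋` compares the sum with one over all integers, uniformly in `c`. -/
theorem exists_tsum_shifted_le {b : ℝ} (hb : 1 < b) :
    ∃ C : ℝ, 0 < C ∧ ∀ c : ℝ,
      ∑' m : ℕ, ENNReal.ofReal ((1 + |(m : ℝ) - c|) ^ (-b)) ≤ ENNReal.ofReal C := by
  have hs := summable_int_rpow hb
  refine ⟨2 ^ b * (∑' j : ℤ, (1 + |(j : ℝ)|) ^ (-b)), ?_, fun c => ?_⟩
  · have : 0 < ∑' j : ℤ, (1 + |(j : ℝ)|) ^ (-b) :=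
      hs.tsum_pos (fun j => by positivity) 0 (by simp)
    positivity
  rw [ENNReal.ofReal_mul (by positivity), ENNReal.ofReal_tsum_of_nonneg (fun j => by positivity) hs,
    ← ENNReal.tsum_mul_left]
  have hinj : Function.Injective (fun m : ℕ => (m : ℤ) - ⌊c⌋) := by
    intro a b hab
    simpa using hab
  refine le_trans ?_ (ENNReal.tsum_comp_le_tsum_of_injective hinj _)
  refine ENNReal.tsum_le_tsum fun m => ?_
  rw [← ENNReal.ofReal_mul (by positivity)]
  apply ENNReal.ofReal_le_ofReal
  set j : ℤ := (m : ℤ) - ⌊c⌋ with hj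
  have h1 : |(j : ℝ)| ≤ |(m : ℝ) - c| + 1 := by
    have h2 : (j : ℝ) = ((m : ℝ) - c) + Int.fract c := by
      rw [hj]; push_cast; rw [← Int.self_sub_floor]; ring
    rw [h2]
    refine (abs_add_le _ _).trans ?_
    rw [abs_of_nonneg (Int.fract_nonneg c)]
    linarith [Int.fract_lt_one c]
  have h3 : (1 + |(j : ℝ)|) / 2 ≤ 1 + |(m : ℝ) - c| := by
    linarith [abs_nonneg ((m : ℝ) - c)]
  calc (1 + |(m : ℝ) - c|) ^ (-b) ≤ ((1 + |(j : ℝ)|) / 2) ^ (-b) :=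
        Real.rpow_le_rpow_of_nonpos (by positivity) h3 (by linarith)
    _ = 2 ^ b * (1 + |(j : ℝ)|) ^ (-b) := by
      rw [Real.div_rpow (by positivity) (by norm_num), Real.rpow_neg (by norm_num : (0:ℝ) ≤ 2)]
      field_simp

/-- Since `phase n 0 = 2|n|²`, this is a sum over values of the phase. Half of `b - 1` pays for the
multiplicities and the other half for convergence. -/
theorem exists_tsum_freqWeight_le (hd : d = 1 ∨ d = 2) {b : ℝ} (hb : 1 < b) :
    ∃ C : ℝ, 0 < C ∧
      ∑' n : Freq d, ENNReal.ofReal (freqWeight n ^ (-b)) ≤ ENNReal.ofReal C := by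
  set ε := (b - 1) / 2 with hε
  have hε0 : 0 < ε := by rw [hε]; linarith
  obtain ⟨C, hC, h⟩ := exists_tsum_comp_phase_le hd hε0
  obtain ⟨C', hC', h'⟩ := exists_tsum_shifted_le (b := 1 + ε) (by linarith)
  refine ⟨2 ^ b * C * C', by positivity, ?_⟩
  have h1 : ∀ n : Freq d, ENNReal.ofReal (freqWeight n ^ (-b)) ≤
      (fun x : ℝ => ENNReal.ofReal (2 ^ b * (1 + |x|) ^ (-b))) (phase n 0) := by
    intro n
    apply ENNReal.ofReal_le_ofReal
    have h2 : phase n 0 = 2 * freqSq n := by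
      unfold phase
      have h3 : freqSq (-n - 0) = freqSq n := by simp [freqSq]
      have h4 : freqSq (0 : Freq d) = 0 := by simp [freqSq]
      rw [h3, h4]; ring
    rw [h2, abs_of_nonneg (by linarith [freqSq_nonneg n])]
    have h5 : (1 + 2 * freqSq n) / 2 ≤ freqWeight n := by unfold freqWeight; linarith
    have h0 := freqSq_nonneg n
    calc freqWeight n ^ (-b) ≤ ((1 + 2 * freqSq n) / 2) ^ (-b) :=
          Real.rpow_le_rpow_of_nonpos (by positivity) h5 (by linarith)
      _ = _ := by
        rw [Real.div_rpow (by positivity) (by norm_num), Real.rpow_neg (by norm_num : (0:ℝ) ≤ 2)]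
        field_simp
  refine (ENNReal.tsum_le_tsum h1).trans ((h 0
    (fun x : ℝ => ENNReal.ofReal (2 ^ b * (1 + |x|) ^ (-b)))).trans ?_)
  have h2 : ∀ m : ℕ, ENNReal.ofReal (2 ^ b * (1 + |(m : ℝ)|) ^ (-b)) *
      ENNReal.ofReal (C * (1 + m) ^ ε) =
      ENNReal.ofReal (2 ^ b * C) * ENNReal.ofReal ((1 + |(m : ℝ) - 0|) ^ (-(1 + ε))) := by
    intro m
    rw [← ENNReal.ofReal_mul (by positivity), ← ENNReal.ofReal_mul (by positivity), sub_zero,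
      Nat.abs_cast]
    congr 1
    have : (1 + (m : ℝ)) ^ (-(1 + ε)) = (1 + (m : ℝ)) ^ (-b) * (1 + (m : ℝ)) ^ ε := by
      rw [← Real.rpow_add (by positivity)]
      congr 1; rw [hε]; ring
    rw [this]; ring
  simp_rw [h2]
  rw [ENNReal.tsum_mul_left, ENNReal.ofReal_mul (q := C') (by positivity)]
  gcongr
  exact h' 0

open Classical in
-- The sum is logarithmically divergent, but on its range `1 + m` and `1 + |m - c|` are at most
-- `5Y`. One factor `(5Y)^(ε/2)` pays for the multiplicity of the phase, another one improves the
-- exponent `-1` to the summable `-(1 + ε/2)`.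
theorem exists_lattice_sum_le (hd : d = 1 ∨ d = 2) {ε : ℝ} (hε : 0 < ε) :
    ∃ C : ℝ, 0 < C ∧ ∀ (y : Freq d) (c Y : ℝ), 1 ≤ Y → |c| ≤ Y →
      ∑' n : Freq d, (if phase n y ≤ 3 * Y then
        ENNReal.ofReal ((1 + |phase n y - c|)⁻¹) else 0) ≤ ENNReal.ofReal (C * Y ^ ε) := by
  obtain ⟨C, hC, h⟩ := exists_tsum_comp_phase_le hd (half_pos hε)
  obtain ⟨C', hC', h'⟩ := exists_tsum_shifted_le (b := 1 + ε / 2) (by linarith)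
  refine ⟨C * 5 ^ ε * C', by positivity, fun y c Y hY hc => ?_⟩
  refine (h y (fun x => if x ≤ 3 * Y then ENNReal.ofReal ((1 + |x - c|)⁻¹) else 0)).trans ?_
  calc _ ≤ ∑' m : ℕ, ENNReal.ofReal (C * 5 ^ ε * Y ^ ε) *
        ENNReal.ofReal ((1 + |(m : ℝ) - c|) ^ (-(1 + ε / 2))) := by
        refine ENNReal.tsum_le_tsum fun m => ?_
        split_ifs with hm
        · rw [← ENNReal.ofReal_mul (by positivity), ← ENNReal.ofReal_mul (by positivity)]
          apply ENNReal.ofReal_le_ofReal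
          have hm0 : (0 : ℝ) ≤ m := by positivity
          have h1 : 1 + |(m : ℝ) - c| ≤ 5 * Y := by
            have := abs_sub (m : ℝ) c
            rw [abs_of_nonneg hm0] at this
            linarith
          have h2 : (1 + |(m : ℝ) - c|)⁻¹ ≤
              (5 * Y) ^ (ε / 2) * (1 + |(m : ℝ) - c|) ^ (-(1 + ε / 2)) := by
            calc (1 + |(m : ℝ) - c|)⁻¹ = (1 + |(m : ℝ) - c|) ^ (ε / 2) *
                  (1 + |(m : ℝ) - c|) ^ (-(1 + ε / 2)) := by
                  rw [← Real.rpow_add (by positivity), ← Real.rpow_neg_one]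
                  congr 1; ring
              _ ≤ _ := by gcongr
          have h3 : (1 + (m : ℝ)) ^ (ε / 2) ≤ (5 * Y) ^ (ε / 2) := by
            gcongr; linarith
          have h4 : (5 : ℝ) ^ ε * Y ^ ε = (5 * Y) ^ (ε / 2) * (5 * Y) ^ (ε / 2) := by
            rw [← Real.rpow_add (by positivity), ← Real.mul_rpow (by norm_num) (by positivity)]
            congr 1; ring
          calc (1 + |(m : ℝ) - c|)⁻¹ * (C * (1 + (m : ℝ)) ^ (ε / 2))
              ≤ ((5 * Y) ^ (ε / 2) * (1 + |(m : ℝ) - c|) ^ (-(1 + ε / 2))) *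
                (C * (5 * Y) ^ (ε / 2)) := by gcongr
            _ = C * (5 ^ ε * Y ^ ε) * (1 + |(m : ℝ) - c|) ^ (-(1 + ε / 2)) := by rw [h4]; ring
            _ = _ := by ring
        · rw [zero_mul]; exact zero_le
    _ = ENNReal.ofReal (C * 5 ^ ε * Y ^ ε) *
        ∑' m : ℕ, ENNReal.ofReal ((1 + |(m : ℝ) - c|) ^ (-(1 + ε / 2))) := ENNReal.tsum_mul_left
    _ ≤ ENNReal.ofReal (C * 5 ^ ε * Y ^ ε) * ENNReal.ofReal C' := by gcongr; exact h' c
    _ = ENNReal.ofReal (C * 5 ^ ε * C' * Y ^ ε) := by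
      rw [← ENNReal.ofReal_mul (by positivity)]
      congr 1; ring

open Classical in
-- The gain `M^(-1/3)` is needed to cancel the factor `M^(1/3)` in the inverse of one of the input
-- weights when an input modulation is dominant.
theorem exists_weighted_lattice_sum_le (hd : d = 1 ∨ d = 2) {ε s : ℝ} (hε : 0 < ε)
    (hs : s ≤ -(1 / 2)) :
    ∃ C : ℝ, 0 < C ∧ ∀ (y : Freq d) (c Y M : ℝ), 1 ≤ M → M ≤ Y → |c| ≤ Y →
      ∑' n : Freq d, (if phase n y ≤ 3 * Y then
        ENNReal.ofReal ((freqWeight n ^ s + M ^ (-(1 / 2) : ℝ)) * (M + |phase n y - c|)⁻¹) else 0)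
        ≤ ENNReal.ofReal (C * (M ^ (-(1 / 3) : ℝ) * Y ^ ε)) := by
  obtain ⟨C, hC, h⟩ := exists_lattice_sum_le hd hε
  obtain ⟨C', hC', h'⟩ := exists_tsum_freqWeight_le hd (b := 1 + ε) (by linarith)
  refine ⟨2 * C + C', by positivity, fun y c Y M hM hMY hc => ?_⟩
  have hM0 : 0 < M := by linarith
  have hY : 1 ≤ Y := hM.trans hMY
  have hterm : ∀ n : Freq d, (if phase n y ≤ 3 * Y then
        ENNReal.ofReal ((freqWeight n ^ s + M ^ (-(1 / 2) : ℝ)) * (M + |phase n y - c|)⁻¹) else 0)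
      ≤ ENNReal.ofReal (2 * M ^ (-(1 / 3) : ℝ)) * (if phase n y ≤ 3 * Y then
        ENNReal.ofReal ((1 + |phase n y - c|)⁻¹) else 0) +
        ENNReal.ofReal (M ^ (-(1 / 3) : ℝ) * Y ^ ε) *
          ENNReal.ofReal (freqWeight n ^ (-(1 + ε))) := by
    intro n
    have hp := freqWeight_pos n
    have hp1 := one_le_freqWeight n
    split_ifs with hn
    · rw [← ENNReal.ofReal_mul (by positivity), ← ENNReal.ofReal_mul (by positivity),
        ← ENNReal.ofReal_add (by positivity) (by positivity)]
      apply ENNReal.ofReal_le_ofReal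
      have hM1 : M ^ (-(1 / 2) : ℝ) ≤ M ^ (-(1 / 3) : ℝ) :=
        Real.rpow_le_rpow_of_exponent_le hM (by norm_num)
      have hx : (M + |phase n y - c|)⁻¹ ≤ (1 + |phase n y - c|)⁻¹ := by gcongr
      -- Below the threshold there are few frequencies, and `M⁻¹` is at most `M^(-1/3)` times a
      -- summable power of `freqWeight n`, up to `Y^ε`. Above it, `s ≤ -1/2` gives `freqWeight n ^ s
      -- ≤ M^(-1/3)`.
      rcases le_or_gt (freqWeight n) (M ^ (2 / 3 : ℝ)) with hk | hk
      · have h1 : freqWeight n ^ s ≤ 1 := Real.rpow_le_one_of_one_le_of_nonpos hp1 (by linarith)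
        have h2 : (M + |phase n y - c|)⁻¹ ≤ M⁻¹ := by
          gcongr
          linarith [abs_nonneg (phase n y - c)]
        have h3 : M⁻¹ ≤ M ^ (-(1 / 3) : ℝ) * Y ^ ε * freqWeight n ^ (-(1 + ε)) := by
          have h4 : freqWeight n ^ (1 + ε) ≤ M ^ (2 / 3 : ℝ) * Y ^ ε := by
            calc freqWeight n ^ (1 + ε) ≤ (M ^ (2 / 3 : ℝ)) ^ (1 + ε) := by gcongr
              _ = M ^ (2 / 3 : ℝ) * M ^ (2 / 3 * ε) := by
                rw [← Real.rpow_mul hM0.le, ← Real.rpow_add hM0]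
                congr 1; ring
              _ ≤ M ^ (2 / 3 : ℝ) * M ^ ε := by
                gcongr
                linarith
              _ ≤ _ := by gcongr
          rw [Real.rpow_neg hp.le, ← div_eq_mul_inv, le_div_iff₀ (by positivity)]
          calc M⁻¹ * freqWeight n ^ (1 + ε) ≤ M⁻¹ * (M ^ (2 / 3 : ℝ) * Y ^ ε) := by gcongr
            _ = M ^ (-(1 / 3) : ℝ) * Y ^ ε := by
              rw [← mul_assoc, ← Real.rpow_neg_one, ← Real.rpow_add hM0]
              norm_num
        calc _ = freqWeight n ^ s * (M + |phase n y - c|)⁻¹ +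
              M ^ (-(1 / 2) : ℝ) * (M + |phase n y - c|)⁻¹ := by ring
          _ ≤ 1 * M⁻¹ + M ^ (-(1 / 3) : ℝ) * (1 + |phase n y - c|)⁻¹ := by gcongr
          _ ≤ _ := by
            have : 0 ≤ M ^ (-(1 / 3) : ℝ) * (1 + |phase n y - c|)⁻¹ := by positivity
            linarith
      · have h1 : freqWeight n ^ s ≤ M ^ (-(1 / 3) : ℝ) := by
          calc freqWeight n ^ s ≤ freqWeight n ^ (-(1 / 2) : ℝ) :=
                Real.rpow_le_rpow_of_exponent_le hp1 (by linarith)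
            _ ≤ (M ^ (2 / 3 : ℝ)) ^ (-(1 / 2) : ℝ) :=
              Real.rpow_le_rpow_of_nonpos (by positivity) hk.le (by norm_num)
            _ = _ := by rw [← Real.rpow_mul hM0.le]; norm_num
        calc _ ≤ (M ^ (-(1 / 3) : ℝ) + M ^ (-(1 / 3) : ℝ)) * (1 + |phase n y - c|)⁻¹ := by gcongr
          _ = 2 * M ^ (-(1 / 3) : ℝ) * (1 + |phase n y - c|)⁻¹ := by ring
          _ ≤ _ := le_add_of_nonneg_right (by positivity)
    · exact zero_le
  refine (ENNReal.tsum_le_tsum hterm).trans ?_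
  rw [ENNReal.tsum_add, ENNReal.tsum_mul_left, ENNReal.tsum_mul_left]
  calc _ ≤ ENNReal.ofReal (2 * M ^ (-(1 / 3) : ℝ)) * ENNReal.ofReal (C * Y ^ ε) +
        ENNReal.ofReal (M ^ (-(1 / 3) : ℝ) * Y ^ ε) * ENNReal.ofReal C' := by
        gcongr
        exact h y c Y hY hc
    _ = _ := by
      rw [← ENNReal.ofReal_mul (by positivity), ← ENNReal.ofReal_mul (by positivity),
        ← ENNReal.ofReal_add (by positivity) (by positivity)]
      congr 1; ring

end

/-! ### Cauchy–Schwarz, its converse, and integrals of brackets. -/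

section

section Tools

variable {α : Type*} [MeasurableSpace α]

theorem sq_rpow_half (x : ℝ≥0∞) : (x ^ (1 / 2 : ℝ)) ^ 2 = x := by
  rw [← ENNReal.rpow_natCast, ← ENNReal.rpow_mul]; norm_num

theorem rpow_half_sq (x : ℝ≥0∞) : (x ^ 2) ^ (1 / 2 : ℝ) = x := by
  rw [← ENNReal.rpow_natCast, ← ENNReal.rpow_mul]; norm_num

/-- The Cauchy–Schwarz inequality for functions with `f² ≤ u v`. -/
theorem sq_lintegral_le_mul {μ : Measure α} {f u v : α → ℝ≥0∞} (hu : Measurable u)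
    (hv : Measurable v) (h : ∀ x, f x ^ 2 ≤ u x * v x) :
    (∫⁻ x, f x ∂μ) ^ 2 ≤ (∫⁻ x, u x ∂μ) * ∫⁻ x, v x ∂μ := by
  have h1 : ∫⁻ x, f x ∂μ ≤ ∫⁻ x, ((fun x => u x ^ (1 / 2 : ℝ)) * fun x => v x ^ (1 / 2 : ℝ)) x ∂μ := by
    refine lintegral_mono fun x => ?_
    rw [← rpow_half_sq (f x), Pi.mul_apply, ← ENNReal.mul_rpow_of_nonneg _ _ (by norm_num)]
    exact ENNReal.rpow_le_rpow (h x) (by norm_num)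
  have h2 := ENNReal.lintegral_mul_le_Lp_mul_Lq μ Real.HolderConjugate.two_two
    (hu.pow_const (1 / 2 : ℝ)).aemeasurable (hv.pow_const (1 / 2 : ℝ)).aemeasurable
  have h3 : ∀ x : ℝ≥0∞, (x ^ (1 / 2 : ℝ)) ^ (2 : ℝ) = x := by
    intro x; rw [← ENNReal.rpow_mul]; norm_num
  simp only [h3] at h2
  calc (∫⁻ x, f x ∂μ) ^ 2 ≤
        ((∫⁻ x, u x ∂μ) ^ (1 / 2 : ℝ) * (∫⁻ x, v x ∂μ) ^ (1 / 2 : ℝ)) ^ 2 := by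
        gcongr; exact h1.trans h2
    _ = _ := by rw [mul_pow, sq_rpow_half, sq_rpow_half]

theorem sq_tsum_le_mul {ι : Type*} {f u v : ι → ℝ≥0∞} (h : ∀ i, f i ^ 2 ≤ u i * v i) :
    (∑' i, f i) ^ 2 ≤ (∑' i, u i) * ∑' i, v i := by
  let _ : MeasurableSpace ι := ⊤
  have := sq_lintegral_le_mul (μ := Measure.count) (f := f) (u := u) (v := v)
    (measurable_from_top) (measurable_from_top) h
  simpa only [lintegral_count] using this

/-- Cauchy–Schwarz for a sum of integrals. -/
theorem sq_tsum_lintegral_le_mul {ι : Type*} {μ : Measure α} {f u v : ι → α → ℝ≥0∞}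
    (hu : ∀ i, Measurable (u i)) (hv : ∀ i, Measurable (v i))
    (h : ∀ i x, f i x ^ 2 ≤ u i x * v i x) :
    (∑' i, ∫⁻ x, f i x ∂μ) ^ 2 ≤ (∑' i, ∫⁻ x, u i x ∂μ) * ∑' i, ∫⁻ x, v i x ∂μ :=
  sq_tsum_le_mul fun i => sq_lintegral_le_mul (hu i) (hv i) (h i)

/-- The converse of the Cauchy–Schwarz inequality. -/
theorem lintegral_sq_le_of_forall {μ : Measure α} [SigmaFinite μ] {F : α → ℝ≥0∞}
    (hF : Measurable F) {C : ℝ≥0∞}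
    (h : ∀ c : α → ℝ≥0∞, Measurable c → (∫⁻ x, c x * F x ∂μ) ^ 2 ≤ C * ∫⁻ x, c x ^ 2 ∂μ) :
    ∫⁻ x, F x ^ 2 ∂μ ≤ C := by
  -- Testing against `F` itself gives `X² ≤ C X`, from which `X` can be cancelled only if it is
  -- finite; hence the truncation in height and in space, removed by monotone convergence.
  set G : ℕ → α → ℝ≥0∞ := fun j => (spanningSets μ j).indicator fun x => min (F x) j with hG
  have hGm : ∀ j, Measurable (G j) := fun j =>
    (hF.min measurable_const).indicator (measurableSet_spanningSets μ j)
  have hGle : ∀ j x, G j x ≤ F x := by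
    intro j x
    exact (Set.indicator_le_self _ _ x).trans (min_le_left _ _)
  have hfin : ∀ j, ∫⁻ x, G j x ^ 2 ∂μ < ∞ := by
    intro j
    calc ∫⁻ x, G j x ^ 2 ∂μ ≤ ∫⁻ x, (spanningSets μ j).indicator (fun _ => (j : ℝ≥0∞) ^ 2) x ∂μ := by
          refine lintegral_mono fun x => ?_
          by_cases hx : x ∈ spanningSets μ j
          · simp only [hG, Set.indicator_of_mem hx]
            gcongr; exact min_le_right _ _
          · simp [hG, Set.indicator_of_notMem hx]
      _ = (j : ℝ≥0∞) ^ 2 * μ (spanningSets μ j) :=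
        lintegral_indicator_const (measurableSet_spanningSets μ j) _
      _ < ∞ := ENNReal.mul_lt_top (by simp) (measure_spanningSets_lt_top μ j)
  have hbound : ∀ j, ∫⁻ x, G j x ^ 2 ∂μ ≤ C := by
    intro j
    set X := ∫⁻ x, G j x ^ 2 ∂μ with hX
    have h1 : X ^ 2 ≤ C * X := by
      refine le_trans ?_ (h (G j) (hGm j))
      gcongr
      rw [hX]
      refine lintegral_mono fun x => ?_
      rw [sq]
      gcongr
      exact hGle j x
    rcases eq_or_ne X 0 with h0 | h0
    · rw [h0]; exact zero_le
    · rw [sq] at h1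
      exact (ENNReal.mul_le_mul_iff_left h0 (hfin j).ne).1 h1
  have hmono : Monotone fun j x => G j x ^ 2 := by
    intro i j hij x
    by_cases hx : x ∈ spanningSets μ i
    · simp only [hG, Set.indicator_of_mem hx, Set.indicator_of_mem (monotone_spanningSets μ hij hx)]
      gcongr
    · simp [hG, Set.indicator_of_notMem hx]
  have hsup : ∀ x, F x ^ 2 = ⨆ j, G j x ^ 2 := by
    intro x
    refine (tendsto_nhds_unique (tendsto_atTop_iSup fun i j hij => hmono hij x) ?_).symm
    have hx := mem_spanningSetsIndex μ x
    have h1 : Tendsto (fun j : ℕ => (min (F x) (j : ℝ≥0∞)) ^ 2) atTop (𝓝 ((min (F x) ∞) ^ 2)) :=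
      (ENNReal.continuous_pow 2).continuousAt.tendsto.comp
        (tendsto_const_nhds.min ENNReal.tendsto_nat_nhds_top)
    rw [min_eq_left le_top] at h1
    refine h1.congr' ?_
    filter_upwards [eventually_ge_atTop (spanningSetsIndex μ x)] with j hj
    simp only [hG]
    rw [Set.indicator_of_mem (monotone_spanningSets μ hj hx)]
  calc ∫⁻ x, F x ^ 2 ∂μ = ∫⁻ x, ⨆ j, G j x ^ 2 ∂μ := by simp_rw [← hsup]
    _ = ⨆ j, ∫⁻ x, G j x ^ 2 ∂μ := lintegral_iSup (fun j => (hGm j).pow_const 2) hmono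
    _ ≤ C := iSup_le hbound

theorem lintegral_comp_div {M : ℝ} (hM : 0 < M) (f : ℝ → ℝ≥0∞) :
    ∫⁻ x, f (x / M) = ENNReal.ofReal M * ∫⁻ x, f x := by
  have h1 : (fun x : ℝ => x / M) = fun x => M⁻¹ * x := by funext x; rw [div_eq_inv_mul]
  have hM' : M⁻¹ ≠ 0 := (inv_pos.2 hM).ne'
  have h2 : MeasurableEmbedding fun x : ℝ => M⁻¹ * x :=
    (Homeomorph.mulLeft₀ M⁻¹ hM').measurableEmbedding
  have h3 := h2.lintegral_map (μ := volume) f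
  rw [Real.map_volume_mul_left hM', inv_inv, abs_of_pos hM, lintegral_smul_measure] at h3
  simp_rw [div_eq_inv_mul]
  rw [← h3, smul_eq_mul]

theorem exists_lintegral_bracket_le {b : ℝ} (hb : 1 < b) :
    ∃ C : ℝ, 0 < C ∧ ∀ M : ℝ, 0 < M →
      ∫⁻ x : ℝ, ENNReal.ofReal ((M + |x|) ^ (-b)) ≤ ENNReal.ofReal (C * M ^ (1 - b)) := by
  have h := finite_integral_one_add_norm (E := ℝ) (μ := volume) (r := b) (by simpa using hb)
  set I := ∫⁻ x : ℝ, ENNReal.ofReal ((1 + ‖x‖) ^ (-b)) with hI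
  refine ⟨I.toReal + 1, by positivity, fun M hM => ?_⟩
  have h1 : ∀ x : ℝ, ENNReal.ofReal ((M + |x|) ^ (-b)) =
      ENNReal.ofReal (M ^ (-b)) * ENNReal.ofReal ((1 + ‖x / M‖) ^ (-b)) := by
    intro x
    rw [← ENNReal.ofReal_mul (by positivity), ← Real.mul_rpow hM.le (by positivity)]
    congr 2
    rw [Real.norm_eq_abs, abs_div, abs_of_pos hM]
    field_simp
  simp_rw [h1]
  rw [lintegral_const_mul' _ _ ENNReal.ofReal_ne_top,
    lintegral_comp_div hM (fun x : ℝ => ENNReal.ofReal ((1 + ‖x‖) ^ (-b))), ← hI]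
  calc ENNReal.ofReal (M ^ (-b)) * (ENNReal.ofReal M * I)
      ≤ ENNReal.ofReal (M ^ (-b)) * (ENNReal.ofReal M * ENNReal.ofReal (I.toReal + 1)) := by
        gcongr
        rw [← ENNReal.ofReal_toReal h.ne]
        apply ENNReal.ofReal_le_ofReal
        rw [ENNReal.toReal_ofReal (by positivity)]
        linarith
    _ = _ := by
      rw [← ENNReal.ofReal_mul hM.le, ← ENNReal.ofReal_mul (by positivity)]
      congr 1
      rw [sub_eq_add_neg, Real.rpow_add hM, Real.rpow_one]
      ring

/-- With `u = M + |x|` and `v = M + |c - x|` one has `M + |c| ≤ u + v`. So the factor `(M + |c|)⁻¹`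
can be extracted, and what remains is bounded by integrable powers `u^(-4/3)`, `v^(-4/3)` of
integral `O(M^(-1/3))`. -/
theorem exists_lintegral_bracket_mul_le :
    ∃ C : ℝ, 0 < C ∧ ∀ M c : ℝ, 0 < M →
      ∫⁻ x : ℝ, ENNReal.ofReal ((M + |x|)⁻¹ * (M + |c - x|) ^ (-(4 / 3) : ℝ)) ≤
        ENNReal.ofReal (C * (M ^ (-(1 / 3) : ℝ) * (M + |c|)⁻¹)) := by
  obtain ⟨C, hC, h⟩ := exists_lintegral_bracket_le (b := 4 / 3) (by norm_num)
  refine ⟨3 * C, by positivity, fun M c hM => ?_⟩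
  have hpt : ∀ x : ℝ, (M + |x|)⁻¹ * (M + |c - x|) ^ (-(4 / 3) : ℝ) ≤
      (M + |c|)⁻¹ * (2 * (M + |c - x|) ^ (-(4 / 3) : ℝ) + (M + |x|) ^ (-(4 / 3) : ℝ)) := by
    intro x
    set u := M + |x| with hu
    set v := M + |c - x| with hv
    have hu0 : 0 < u := by positivity
    have hv0 : 0 < v := by positivity
    have hw0 : 0 < M + |c| := by positivity
    have hw : M + |c| ≤ u + v := by
      have := abs_add_le x (c - x)
      rw [add_sub_cancel] at this
      linarith
    have h1 : u⁻¹ * v ^ (-(1 / 3) : ℝ) ≤ u ^ (-(4 / 3) : ℝ) + v ^ (-(4 / 3) : ℝ) := by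
      have split : ∀ y : ℝ, 0 < y → y ^ (-(4 / 3) : ℝ) = y⁻¹ * y ^ (-(1 / 3) : ℝ) := by
        intro y hy
        rw [← Real.rpow_neg_one, ← Real.rpow_add hy]; norm_num
      rcases le_total u v with huv | huv
      · have : v ^ (-(1 / 3) : ℝ) ≤ u ^ (-(1 / 3) : ℝ) :=
          Real.rpow_le_rpow_of_nonpos hu0 huv (by norm_num)
        calc _ ≤ u⁻¹ * u ^ (-(1 / 3) : ℝ) := by gcongr
          _ = u ^ (-(4 / 3) : ℝ) := (split u hu0).symm
          _ ≤ _ := le_add_of_nonneg_right (by positivity)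
      · calc _ ≤ v⁻¹ * v ^ (-(1 / 3) : ℝ) := by gcongr
          _ = v ^ (-(4 / 3) : ℝ) := (split v hv0).symm
          _ ≤ _ := le_add_of_nonneg_left (by positivity)
    rw [inv_mul_eq_div (M + |c|), le_div_iff₀ hw0]
    calc u⁻¹ * v ^ (-(4 / 3) : ℝ) * (M + |c|) ≤ u⁻¹ * v ^ (-(4 / 3) : ℝ) * (u + v) := by gcongr
      _ = v ^ (-(4 / 3) : ℝ) + u⁻¹ * (v ^ (-(4 / 3) : ℝ) * v) := by field_simp
      _ = v ^ (-(4 / 3) : ℝ) + u⁻¹ * v ^ (-(1 / 3) : ℝ) := by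
        congr 2
        nth_rewrite 2 [← Real.rpow_one v]
        rw [← Real.rpow_add hv0]; norm_num
      _ ≤ _ := by linarith
  calc _ ≤ ∫⁻ x : ℝ, ENNReal.ofReal ((M + |c|)⁻¹) *
        (2 * ENNReal.ofReal ((M + |c - x|) ^ (-(4 / 3) : ℝ)) +
          ENNReal.ofReal ((M + |x|) ^ (-(4 / 3) : ℝ))) := by
        refine lintegral_mono fun x => ?_
        refine (ENNReal.ofReal_le_ofReal (hpt x)).trans (le_of_eq ?_)
        rw [ENNReal.ofReal_mul (by positivity), ENNReal.ofReal_add (by positivity) (by positivity),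
          ENNReal.ofReal_mul (by norm_num)]
        norm_num
    _ = ENNReal.ofReal ((M + |c|)⁻¹) * (2 * (∫⁻ x : ℝ, ENNReal.ofReal ((M + |x|) ^ (-(4 / 3) : ℝ))) +
          ∫⁻ x : ℝ, ENNReal.ofReal ((M + |x|) ^ (-(4 / 3) : ℝ))) := by
      rw [lintegral_const_mul' _ _ ENNReal.ofReal_ne_top, lintegral_add_right _ (by fun_prop),
        lintegral_const_mul' _ _ (by norm_num),
        lintegral_sub_left_eq_self (fun x : ℝ => ENNReal.ofReal ((M + |x|) ^ (-(4 / 3) : ℝ))) c]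
    _ ≤ ENNReal.ofReal ((M + |c|)⁻¹) * (2 * ENNReal.ofReal (C * M ^ (1 - 4 / 3 : ℝ)) +
          ENNReal.ofReal (C * M ^ (1 - 4 / 3 : ℝ))) := by
      gcongr <;> exact h M hM
    _ = _ := by
      rw [show (2 : ℝ≥0∞) = ENNReal.ofReal 2 by norm_num, ← ENNReal.ofReal_mul (by norm_num),
        ← ENNReal.ofReal_add (by positivity) (by positivity), ← ENNReal.ofReal_mul (by positivity)]
      congr 1
      rw [show (1 - 4 / 3 : ℝ) = -(1 / 3) by norm_num]
      ring

end Tools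

end

/-! ### Weights, the nonresonance of the interaction, and bounds for the Cauchy–Schwarz kernels. -/

section

variable {d : ℕ}

/-- The weight of the `L²` part of the resolution space on the time scale `1 / M`, as a function of
the frequency and the modulation. -/
def modWeight (M s : ℝ) (n : Freq d) (σ : ℝ) : ℝ :=
  M ^ (-(1 / 3) : ℝ) * (M + |σ|) ^ (4 / 3 : ℝ) * (freqWeight n + |σ|) ^ s

theorem modWeight_pos {M : ℝ} (hM : 0 < M) (s : ℝ) (n : Freq d) (σ : ℝ) :
    0 < modWeight M s n σ := by
  have := freqWeight_pos n
  unfold modWeight; positivity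

theorem measurable_modWeight (M s : ℝ) (n : Freq d) : Measurable (modWeight M s n) := by
  unfold modWeight; fun_prop

theorem inv_modWeight_le {M s : ℝ} (hM : 0 < M) (hs : s ≤ 0) {n : Freq d} {σ Z : ℝ}
    (hZ : freqWeight n + |σ| ≤ Z) :
    (modWeight M s n σ)⁻¹ ≤ M ^ (1 / 3 : ℝ) * (M + |σ|) ^ (-(4 / 3) : ℝ) * Z ^ (-s) := by
  have hp := freqWeight_pos n
  have h1 : (freqWeight n + |σ|) ^ (-s) ≤ Z ^ (-s) :=
    Real.rpow_le_rpow (by positivity) hZ (by linarith)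
  unfold modWeight
  rw [mul_inv, mul_inv, ← Real.rpow_neg hM.le, ← Real.rpow_neg (by positivity),
    ← Real.rpow_neg (by positivity), neg_neg]
  gcongr

open Classical in
/-- The indicator function of the interactions in which the first modulation is dominant. -/
def dominant (x y z : ℝ) : ℝ≥0∞ := if |y| ≤ |x| ∧ |z| ≤ |x| then 1 else 0

theorem dominant_sq (x y z : ℝ) : dominant x y z ^ 2 = dominant x y z := by
  unfold dominant; split_ifs <;> simp

theorem dominant_le_one (x y z : ℝ) : dominant x y z ≤ 1 := by
  unfold dominant; split_ifs <;> simp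

theorem measurable_dominant : Measurable fun q : ℝ × ℝ × ℝ => dominant q.1 q.2.1 q.2.2 := by
  unfold dominant
  refine Measurable.ite ?_ measurable_const measurable_const
  exact (measurableSet_le (f := fun q : ℝ × ℝ × ℝ => |q.2.1|) (g := fun q => |q.1|)
    (by fun_prop) (by fun_prop)).inter (measurableSet_le (f := fun q : ℝ × ℝ × ℝ => |q.2.2|)
    (g := fun q => |q.1|) (by fun_prop) (by fun_prop))

theorem one_le_sum_dominant (x y z : ℝ) :
    1 ≤ dominant x y z + (dominant y x z + dominant z x y) := by
  have key : ∀ {a b c : ℝ}, |b| ≤ |a| → |c| ≤ |a| → 1 ≤ dominant a b c := by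
    intro a b c h1 h2
    simp [dominant, h1, h2]
  rcases le_total |y| |x| with h1 | h1
  · rcases le_total |z| |x| with h2 | h2
    · exact le_add_right (key h1 h2)
    · exact le_add_left (le_add_left (key h2 (h1.trans h2)))
  · rcases le_total |z| |y| with h2 | h2
    · exact le_add_left (le_add_right (key h1 h2))
    · exact le_add_left (le_add_left (key (h1.trans h2) h2))

/-- The source of all smoothing: the largest modulation controls the squares of all three
frequencies. -/
theorem phase_le_of_dominant {n k : Freq d} {x y z : ℝ} (h : x + y + z = phase n k)
    (hy : |y| ≤ |x|) (hz : |z| ≤ |x|) : phase n k ≤ 3 * |x| := by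
  rw [← h]
  linarith [le_abs_self x, le_abs_self y, le_abs_self z]

/-- This is the kernel left by Cauchy–Schwarz over the inputs when the output modulation `σ`
dominates. Then the input frequencies and modulations are `O(1 + |σ|)`, so the negative powers in
the input weights cost at most `(1 + |σ|)^(-2s)`; the integral over `x` and the sum over `k` are the
two model sums above. -/
theorem exists_out_kernel_le (hd : d = 1 ∨ d = 2) {s : ℝ} (hs : -(2 / 3) < s)
    (hs' : s ≤ -(1 / 2)) :
    ∃ C : ℝ, 0 < C ∧ ∀ M : ℝ, 1 ≤ M → ∀ (n : Freq d) (σ : ℝ),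
      ENNReal.ofReal (modWeight M s n σ * ((M + |σ|)⁻¹) ^ 2) *
        ∑' k, ∫⁻ x, dominant σ x (phase n k - σ - x) *
          (ENNReal.ofReal (modWeight M s k x)⁻¹ *
            ENNReal.ofReal (modWeight M s (-n - k) (phase n k - σ - x))⁻¹) ≤
      ENNReal.ofReal (C * M ^ (-(1 / 3) : ℝ)) := by
  classical
  -- Half of the available room `2/3 + s` is spent on the arithmetic loss.
  set η := 1 / 3 + s / 2 with hη
  have hη0 : 0 < η := by rw [hη]; linarith
  obtain ⟨C₁, hC₁, h₁⟩ := exists_lintegral_bracket_mul_le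
  obtain ⟨C₂, hC₂, h₂⟩ := exists_lattice_sum_le hd hη0
  refine ⟨4 ^ (-2 * s) * C₁ * C₂, by positivity, fun M hM n σ => ?_⟩
  have hM0 : 0 < M := by linarith
  set Y := M + |σ| with hY
  have hσ : 0 ≤ |σ| := abs_nonneg σ
  have hY1 : 1 ≤ Y := by rw [hY]; linarith
  have hY0 : 0 < Y := by linarith
  set Z := 4 * (1 + |σ|) with hZ
  have hZ0 : 0 < Z := by rw [hZ]; positivity
  set A : ℝ := M ^ (1 / 3 : ℝ) * Z ^ (-2 * s) with hA
  have hA0 : 0 ≤ A := by positivity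
  have hterm : ∀ k : Freq d, ∫⁻ x, dominant σ x (phase n k - σ - x) *
          (ENNReal.ofReal (modWeight M s k x)⁻¹ *
            ENNReal.ofReal (modWeight M s (-n - k) (phase n k - σ - x))⁻¹) ≤
      ENNReal.ofReal (A * (C₁ * M ^ (-(1 / 3) : ℝ))) * (if phase k n ≤ 3 * Y then
        ENNReal.ofReal ((1 + |phase k n - σ|)⁻¹) else 0) := by
    intro k
    rw [phase_comm k n]
    have hpt : ∀ x, dominant σ x (phase n k - σ - x) *
          (ENNReal.ofReal (modWeight M s k x)⁻¹ *
            ENNReal.ofReal (modWeight M s (-n - k) (phase n k - σ - x))⁻¹) ≤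
        (if phase n k ≤ 3 * Y then ENNReal.ofReal A else 0) *
          ENNReal.ofReal ((M + |x|)⁻¹ * (M + |(phase n k - σ) - x|) ^ (-(4 / 3) : ℝ)) := by
      intro x
      set z := phase n k - σ - x with hz
      by_cases hdom : |x| ≤ |σ| ∧ |z| ≤ |σ|
      · have hph := phase_le_of_dominant (n := n) (k := k) (x := σ) (y := x) (z := z)
          (by rw [hz]; ring) hdom.1 hdom.2
        have hk : freqWeight k + |x| ≤ Z := by
          have := freqSq_le_phase_right n k
          unfold freqWeight; rw [hZ]; linarith [hdom.1]
        have hm : freqWeight (-n - k) + |z| ≤ Z := by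
          have := freqSq_le_phase_third n k
          unfold freqWeight; rw [hZ]; linarith [hdom.2]
        have i1 := inv_modWeight_le hM0 (by linarith : s ≤ 0) hk
        have i2 := inv_modWeight_le hM0 (by linarith : s ≤ 0) hm
        rw [if_pos (by rw [hY]; linarith)]
        rw [← ENNReal.ofReal_mul (inv_nonneg.2 (modWeight_pos hM0 _ _ _).le),
          ← ENNReal.ofReal_mul hA0]
        refine (mul_le_mul_left (dominant_le_one _ _ _) _).trans ?_
        rw [one_mul]
        apply ENNReal.ofReal_le_ofReal
        refine (mul_le_mul i1 i2 (inv_nonneg.2 (modWeight_pos hM0 _ _ _).le)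
          (by positivity)).trans ?_
        -- One of the two exponents `-4/3` is lowered to `-1` to match
        -- `exists_lintegral_bracket_mul_le`; the factor `M^(-1/3)` gained in exchange cancels an
        -- `M^(1/3)`.
        have h3 : (M + |x|) ^ (-(4 / 3) : ℝ) ≤ M ^ (-(1 / 3) : ℝ) * (M + |x|)⁻¹ := by
          have hx : 0 < M + |x| := by positivity
          calc (M + |x|) ^ (-(4 / 3) : ℝ) = (M + |x|) ^ (-(1 / 3) : ℝ) * (M + |x|)⁻¹ := by
                rw [← Real.rpow_neg_one (M + |x|), ← Real.rpow_add hx]; norm_num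
            _ ≤ _ := mul_le_mul_of_nonneg_right (Real.rpow_le_rpow_of_nonpos hM0
                (by linarith [abs_nonneg x] : M ≤ M + |x|) (by norm_num)) (by positivity)
        calc M ^ (1 / 3 : ℝ) * (M + |x|) ^ (-(4 / 3) : ℝ) * Z ^ (-s) *
              (M ^ (1 / 3 : ℝ) * (M + |z|) ^ (-(4 / 3) : ℝ) * Z ^ (-s))
            ≤ M ^ (1 / 3 : ℝ) * (M ^ (-(1 / 3) : ℝ) * (M + |x|)⁻¹) * Z ^ (-s) *
              (M ^ (1 / 3 : ℝ) * (M + |z|) ^ (-(4 / 3) : ℝ) * Z ^ (-s)) := by gcongr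
          _ = M ^ (1 / 3 : ℝ) * M ^ (-(1 / 3) : ℝ) * (M ^ (1 / 3 : ℝ) * (Z ^ (-s) * Z ^ (-s)) *
              ((M + |x|)⁻¹ * (M + |z|) ^ (-(4 / 3) : ℝ))) := by ring
          _ = _ := by
            rw [← Real.rpow_add hM0, ← Real.rpow_add hZ0, hA]
            rw [show (1 / 3 + -(1 / 3) : ℝ) = 0 by norm_num, Real.rpow_zero, one_mul,
              show -s + -s = -2 * s by ring]
      · unfold dominant
        rw [if_neg hdom, zero_mul]; exact zero_le
    refine (lintegral_mono hpt).trans ?_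
    split_ifs with hph
    · rw [lintegral_const_mul' _ _ ENNReal.ofReal_ne_top]
      refine (mul_le_mul_right (h₁ M (phase n k - σ) hM0) _).trans ?_
      rw [← ENNReal.ofReal_mul hA0, ← ENNReal.ofReal_mul (by positivity)]
      apply ENNReal.ofReal_le_ofReal
      have : (M + |phase n k - σ|)⁻¹ ≤ (1 + |phase n k - σ|)⁻¹ := by gcongr
      calc _ ≤ A * (C₁ * (M ^ (-(1 / 3) : ℝ) * (1 + |phase n k - σ|)⁻¹)) := by gcongr
        _ = _ := by ring
    · simp
  have hsum : ∑' k, ∫⁻ x, dominant σ x (phase n k - σ - x) *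
          (ENNReal.ofReal (modWeight M s k x)⁻¹ *
            ENNReal.ofReal (modWeight M s (-n - k) (phase n k - σ - x))⁻¹) ≤
      ENNReal.ofReal (A * (C₁ * M ^ (-(1 / 3) : ℝ))) * ENNReal.ofReal (C₂ * Y ^ η) := by
    refine (ENNReal.tsum_le_tsum hterm).trans ?_
    rw [ENNReal.tsum_mul_left]
    gcongr
    exact h₂ n σ Y hY1 (by rw [hY]; linarith)
  refine (mul_le_mul_right hsum _).trans ?_
  have hp1 := one_le_freqWeight n
  have hw0 := (modWeight_pos hM0 s n σ).le
  rw [← ENNReal.ofReal_mul (by positivity), ← ENNReal.ofReal_mul (by positivity)]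
  apply ENNReal.ofReal_le_ofReal
  have e1 : (freqWeight n + |σ|) ^ s * Z ^ (-2 * s) ≤ 4 ^ (-2 * s) * Y ^ (-s) := by
    have h4 : (freqWeight n + |σ|) ^ s ≤ (1 + |σ|) ^ s :=
      Real.rpow_le_rpow_of_nonpos (by positivity) (by linarith) (by linarith)
    calc _ ≤ (1 + |σ|) ^ s * Z ^ (-2 * s) := by gcongr
      _ = 4 ^ (-2 * s) * (1 + |σ|) ^ (-s) := by
        rw [hZ, Real.mul_rpow (by norm_num) (by positivity), mul_left_comm,
          ← Real.rpow_add (by positivity)]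
        congr 2; ring
      _ ≤ _ := by
        gcongr
        all_goals linarith
  -- The exponents add up to `-(1/3 + s/2) = -η`, which is negative because `s > -2/3`.
  have e2 : Y ^ (4 / 3 : ℝ) * (Y⁻¹) ^ 2 * Y ^ (-s) * Y ^ η ≤ 1 := by
    have : (Y⁻¹) ^ 2 = Y ^ (-2 : ℝ) := by
      rw [Real.rpow_neg hY0.le, inv_pow]; norm_num
    rw [this, ← Real.rpow_add hY0, ← Real.rpow_add hY0, ← Real.rpow_add hY0]
    exact Real.rpow_le_one_of_one_le_of_nonpos hY1 (by rw [hη]; linarith)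
  have e3 : M ^ (-(1 / 3) : ℝ) * M ^ (1 / 3 : ℝ) = 1 := by
    rw [← Real.rpow_add hM0]; norm_num
  calc _ = (M ^ (-(1 / 3) : ℝ) * M ^ (1 / 3 : ℝ)) * (((freqWeight n + |σ|) ^ s * Z ^ (-2 * s)) *
        (Y ^ (4 / 3 : ℝ) * (Y⁻¹) ^ 2 * Y ^ η)) * (C₁ * C₂ * M ^ (-(1 / 3) : ℝ)) := by
        rw [hA]; unfold modWeight; ring
    _ ≤ 1 * ((4 ^ (-2 * s) * Y ^ (-s)) * (Y ^ (4 / 3 : ℝ) * (Y⁻¹) ^ 2 * Y ^ η)) *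
        (C₁ * C₂ * M ^ (-(1 / 3) : ℝ)) := by
        rw [e3]; gcongr
    _ = 4 ^ (-2 * s) * (Y ^ (4 / 3 : ℝ) * (Y⁻¹) ^ 2 * Y ^ (-s) * Y ^ η) *
        (C₁ * C₂ * M ^ (-(1 / 3) : ℝ)) := by ring
    _ ≤ 4 ^ (-2 * s) * 1 * (C₁ * C₂ * M ^ (-(1 / 3) : ℝ)) := by gcongr
    _ = _ := by ring

/-- A common majorant of the output weights of the two components of the resolution norm in the
interactions in which an input modulation is dominant. -/
def outWeight (M s : ℝ) (n : Freq d) (σ : ℝ) : ℝ :=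
  (freqWeight n ^ s + M ^ (-(1 / 2) : ℝ)) * (M + |σ|) ^ (-1 + (1 / 3 + s / 2)) *
    M ^ (-(1 / 3 + s / 2))

theorem outWeight_nonneg {M : ℝ} (hM : 0 < M) (s : ℝ) (n : Freq d) (σ : ℝ) :
    0 ≤ outWeight M s n σ := by
  have := freqWeight_pos n
  unfold outWeight; positivity

theorem measurable_outWeight (M s : ℝ) (n : Freq d) : Measurable (outWeight M s n) := by
  unfold outWeight; fun_prop

/-- For `|σ| ≤ M` the weight is comparable to `freqWeight n ^ s` at most. For `|σ| ≥ M` it is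
bounded by `M^(-1/3) |σ|^(1/3 - 1/2) ≤ M^(-1/2)`, which explains the second summand in `outWeight`.
The factor `((M + |σ|) / M)^η ≥ 1` is free here; it is included because the `ℓ²L¹` component needs
it. -/
theorem modWeight_mul_le_outWeight {M s : ℝ} (hM : 1 ≤ M) (hs : -(2 / 3) < s)
    (hs' : s ≤ -(1 / 2)) (n : Freq d) (σ : ℝ) :
    modWeight M s n σ * ((M + |σ|)⁻¹) ^ 2 ≤ 4 * outWeight M s n σ := by
  have hM0 : 0 < M := by linarith
  have hp := freqWeight_pos n
  have hσ := abs_nonneg σ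
  set Y := M + |σ| with hY
  have hY0 : 0 < Y := by positivity
  set η := 1 / 3 + s / 2 with hη
  have hη0 : 0 < η := by rw [hη]; linarith
  have hYM : 1 ≤ Y ^ η * M ^ (-η) := by
    rw [Real.rpow_neg hM0.le, ← div_eq_mul_inv, one_le_div (by positivity)]
    gcongr; linarith
  have e1 : modWeight M s n σ * (Y⁻¹) ^ 2 =
      M ^ (-(1 / 3) : ℝ) * Y ^ (1 / 3 : ℝ) * (freqWeight n + |σ|) ^ s * Y⁻¹ := by
    have h1 : Y ^ (4 / 3 : ℝ) = Y ^ (1 / 3 : ℝ) * Y := by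
      nth_rewrite 3 [← Real.rpow_one Y]
      rw [← Real.rpow_add hY0]; norm_num
    unfold modWeight
    rw [← hY, h1]
    field_simp
  have e2 : (freqWeight n ^ s + M ^ (-(1 / 2) : ℝ)) * Y⁻¹ ≤ outWeight M s n σ := by
    have h1 : Y ^ (-1 + η) = Y⁻¹ * Y ^ η := by
      rw [Real.rpow_add hY0, Real.rpow_neg_one]
    unfold outWeight
    rw [← hη, ← hY, h1]
    calc _ = (freqWeight n ^ s + M ^ (-(1 / 2) : ℝ)) * Y⁻¹ * 1 := by ring
      _ ≤ (freqWeight n ^ s + M ^ (-(1 / 2) : ℝ)) * Y⁻¹ * (Y ^ η * M ^ (-η)) := by gcongr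
      _ = _ := by ring
  have e3 : M ^ (-(1 / 3) : ℝ) * Y ^ (1 / 3 : ℝ) * (freqWeight n + |σ|) ^ s ≤
      4 * (freqWeight n ^ s + M ^ (-(1 / 2) : ℝ)) := by
    rcases le_total |σ| M with h | h
    · have h1 : Y ^ (1 / 3 : ℝ) ≤ 2 * M ^ (1 / 3 : ℝ) := by
        calc Y ^ (1 / 3 : ℝ) ≤ (2 * M) ^ (1 / 3 : ℝ) := by gcongr; linarith
          _ = 2 ^ (1 / 3 : ℝ) * M ^ (1 / 3 : ℝ) := Real.mul_rpow (by norm_num) hM0.le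
          _ ≤ 2 ^ (1 : ℝ) * M ^ (1 / 3 : ℝ) := by
            gcongr
            · norm_num
            · norm_num
          _ = _ := by rw [Real.rpow_one]
      have h2 : (freqWeight n + |σ|) ^ s ≤ freqWeight n ^ s :=
        Real.rpow_le_rpow_of_nonpos hp (by linarith) (by linarith)
      calc _ ≤ M ^ (-(1 / 3) : ℝ) * (2 * M ^ (1 / 3 : ℝ)) * freqWeight n ^ s := by gcongr
        _ = 2 * (M ^ (-(1 / 3) : ℝ) * M ^ (1 / 3 : ℝ)) * freqWeight n ^ s := by ring
        _ = 2 * freqWeight n ^ s := by rw [← Real.rpow_add hM0]; norm_num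
        _ ≤ _ := by
          have : 0 ≤ freqWeight n ^ s := by positivity
          have : 0 ≤ M ^ (-(1 / 2) : ℝ) := by positivity
          linarith
    · have hσ1 : 1 ≤ |σ| := hM.trans h
      have hσ0 : 0 < |σ| := by linarith
      have h1 : Y ^ (1 / 3 : ℝ) ≤ 2 * |σ| ^ (1 / 3 : ℝ) := by
        calc Y ^ (1 / 3 : ℝ) ≤ (2 * |σ|) ^ (1 / 3 : ℝ) := by gcongr; linarith
          _ = 2 ^ (1 / 3 : ℝ) * |σ| ^ (1 / 3 : ℝ) := Real.mul_rpow (by norm_num) hσ0.le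
          _ ≤ 2 ^ (1 : ℝ) * |σ| ^ (1 / 3 : ℝ) := by
            gcongr
            · norm_num
            · norm_num
          _ = _ := by rw [Real.rpow_one]
      have h2 : (freqWeight n + |σ|) ^ s ≤ |σ| ^ (-(1 / 2) : ℝ) := by
        calc _ ≤ |σ| ^ s := Real.rpow_le_rpow_of_nonpos hσ0 (by linarith) (by linarith)
          _ ≤ _ := Real.rpow_le_rpow_of_exponent_le hσ1 hs'
      calc _ ≤ M ^ (-(1 / 3) : ℝ) * (2 * |σ| ^ (1 / 3 : ℝ)) * |σ| ^ (-(1 / 2) : ℝ) := by gcongr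
        _ = 2 * M ^ (-(1 / 3) : ℝ) * (|σ| ^ (1 / 3 : ℝ) * |σ| ^ (-(1 / 2) : ℝ)) := by ring
        _ = 2 * M ^ (-(1 / 3) : ℝ) * |σ| ^ (-(1 / 6) : ℝ) := by
          rw [← Real.rpow_add hσ0]; norm_num
        _ ≤ 2 * M ^ (-(1 / 3) : ℝ) * M ^ (-(1 / 6) : ℝ) := by
          have := Real.rpow_le_rpow_of_nonpos hM0 h (by norm_num : (-(1 / 6) : ℝ) ≤ 0)
          gcongr
        _ = 2 * M ^ (-(1 / 2) : ℝ) := by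
          rw [mul_assoc, ← Real.rpow_add hM0]; norm_num
        _ ≤ _ := by
          have : 0 ≤ freqWeight n ^ s := by positivity
          have : 0 ≤ M ^ (-(1 / 2) : ℝ) := by positivity
          linarith
  rw [e1]
  calc _ ≤ 4 * (freqWeight n ^ s + M ^ (-(1 / 2) : ℝ)) * Y⁻¹ := by gcongr
    _ = 4 * ((freqWeight n ^ s + M ^ (-(1 / 2) : ℝ)) * Y⁻¹) := by ring
    _ ≤ _ := by gcongr

/-- The dual kernel, for a fixed input `(k, x)` of dominant modulation: the integration and the
summation run over the output instead, whose weight `freqWeight n ^ s` is exploited through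
`exists_weighted_lattice_sum_le`. -/
theorem exists_in_kernel_le (hd : d = 1 ∨ d = 2) {s : ℝ} (hs : -(2 / 3) < s)
    (hs' : s ≤ -(1 / 2)) :
    ∃ C : ℝ, 0 < C ∧ ∀ M : ℝ, 1 ≤ M → ∀ (k : Freq d) (x : ℝ),
      ENNReal.ofReal (modWeight M s k x)⁻¹ *
        ∑' n, ∫⁻ σ, dominant x σ (phase n k - σ - x) *
          (ENNReal.ofReal (outWeight M s n σ) *
            ENNReal.ofReal (modWeight M s (-n - k) (phase n k - σ - x))⁻¹) ≤
      ENNReal.ofReal (C * M ^ (-(2 / 3 + s))) := by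
  classical
  set η := 1 / 3 + s / 2 with hη
  have hη0 : 0 < η := by rw [hη]; linarith
  obtain ⟨C₁, hC₁, h₁⟩ := exists_lintegral_bracket_mul_le
  obtain ⟨C₂, hC₂, h₂⟩ := exists_weighted_lattice_sum_le hd hη0 hs'
  refine ⟨4 ^ (-2 * s) * C₁ * C₂, by positivity, fun M hM k x => ?_⟩
  have hM0 : 0 < M := by linarith
  set Y := M + |x| with hY
  have hx : 0 ≤ |x| := abs_nonneg x
  have hY1 : 1 ≤ Y := by rw [hY]; linarith
  have hY0 : 0 < Y := by linarith
  set Z := 4 * Y with hZ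
  have hZ0 : 0 < Z := by rw [hZ]; positivity
  -- Otherwise `x` is too small for its frequency to be dominant in any interaction, and the kernel
  -- vanishes.
  by_cases hkx : freqWeight k + |x| ≤ Z
  swap
  · have hzero : ∀ n : Freq d, ∫⁻ σ, dominant x σ (phase n k - σ - x) *
          (ENNReal.ofReal (outWeight M s n σ) *
            ENNReal.ofReal (modWeight M s (-n - k) (phase n k - σ - x))⁻¹) = 0 := by
      intro n
      have : ∀ σ, dominant x σ (phase n k - σ - x) = 0 := by
        intro σ
        unfold dominant
        rw [if_neg]
        rintro ⟨h1, h2⟩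
        have hph := phase_le_of_dominant (n := n) (k := k) (x := x) (y := σ)
          (z := phase n k - σ - x) (by ring) h1 h2
        have := freqSq_le_phase_right n k
        apply hkx
        unfold freqWeight; rw [hZ, hY]; linarith
      simp [this]
    simp [hzero]
  set A : ℝ := M ^ (1 / 3 : ℝ) * Z ^ (-s) * Y ^ η with hA
  have hA0 : 0 ≤ A := by positivity
  have hterm : ∀ n : Freq d, ∫⁻ σ, dominant x σ (phase n k - σ - x) *
          (ENNReal.ofReal (outWeight M s n σ) *
            ENNReal.ofReal (modWeight M s (-n - k) (phase n k - σ - x))⁻¹) ≤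
      ENNReal.ofReal (A * (C₁ * M ^ (-(1 / 3) : ℝ))) * (if phase n k ≤ 3 * Y then
        ENNReal.ofReal ((freqWeight n ^ s + M ^ (-(1 / 2) : ℝ)) * (M + |phase n k - x|)⁻¹)
          else 0) := by
    intro n
    set w := freqWeight n ^ s + M ^ (-(1 / 2) : ℝ) with hw
    have hp := freqWeight_pos n
    have hw0 : 0 ≤ w := by positivity
    have hpt : ∀ σ, dominant x σ (phase n k - σ - x) *
          (ENNReal.ofReal (outWeight M s n σ) *
            ENNReal.ofReal (modWeight M s (-n - k) (phase n k - σ - x))⁻¹) ≤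
        (if phase n k ≤ 3 * Y then ENNReal.ofReal (w * A) else 0) *
          ENNReal.ofReal ((M + |σ|)⁻¹ * (M + |(phase n k - x) - σ|) ^ (-(4 / 3) : ℝ)) := by
      intro σ
      have hz' : (phase n k - x) - σ = phase n k - σ - x := by ring
      rw [hz']
      set z := phase n k - σ - x with hz
      by_cases hdom : |σ| ≤ |x| ∧ |z| ≤ |x|
      · have hph := phase_le_of_dominant (n := n) (k := k) (x := x) (y := σ) (z := z)
          (by rw [hz]; ring) hdom.1 hdom.2
        have hm : freqWeight (-n - k) + |z| ≤ Z := by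
          have := freqSq_le_phase_third n k
          unfold freqWeight; rw [hZ]; linarith [hdom.2]
        have i2 := inv_modWeight_le hM0 (by linarith : s ≤ 0) hm
        rw [if_pos (by rw [hY]; linarith)]
        rw [← ENNReal.ofReal_mul (outWeight_nonneg hM0 _ _ _),
          ← ENNReal.ofReal_mul (by positivity)]
        refine (mul_le_mul_left (dominant_le_one _ _ _) _).trans ?_
        rw [one_mul]
        apply ENNReal.ofReal_le_ofReal
        have i1 : outWeight M s n σ ≤ w * ((M + |σ|)⁻¹ * Y ^ η) := by
          have hσ0 : 0 < M + |σ| := by positivity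
          unfold outWeight
          rw [← hη, ← hw, Real.rpow_add hσ0, Real.rpow_neg_one]
          have j1 : M ^ (-η) ≤ 1 := Real.rpow_le_one_of_one_le_of_nonpos hM (by linarith)
          have j2 : (M + |σ|) ^ η ≤ Y ^ η := by
            gcongr
            linarith [hdom.1]
          calc w * ((M + |σ|)⁻¹ * (M + |σ|) ^ η) * M ^ (-η) ≤
                w * ((M + |σ|)⁻¹ * Y ^ η) * 1 := by gcongr
            _ = _ := mul_one _
        refine (mul_le_mul i1 i2 (inv_nonneg.2 (modWeight_pos hM0 _ _ _).le)
          (by positivity)).trans (le_of_eq ?_)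
        rw [hA]; ring
      · unfold dominant
        rw [if_neg hdom, zero_mul]; exact zero_le
    refine (lintegral_mono hpt).trans ?_
    split_ifs with hph
    · rw [lintegral_const_mul' _ _ ENNReal.ofReal_ne_top]
      refine (mul_le_mul_right (h₁ M (phase n k - x) hM0) _).trans ?_
      rw [← ENNReal.ofReal_mul (by positivity), ← ENNReal.ofReal_mul (by positivity)]
      apply ENNReal.ofReal_le_ofReal
      apply le_of_eq
      ring
    · simp
  have hsum : ∑' n, ∫⁻ σ, dominant x σ (phase n k - σ - x) *
          (ENNReal.ofReal (outWeight M s n σ) *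
            ENNReal.ofReal (modWeight M s (-n - k) (phase n k - σ - x))⁻¹) ≤
      ENNReal.ofReal (A * (C₁ * M ^ (-(1 / 3) : ℝ))) *
        ENNReal.ofReal (C₂ * (M ^ (-(1 / 3) : ℝ) * Y ^ η)) := by
    refine (ENNReal.tsum_le_tsum hterm).trans ?_
    rw [ENNReal.tsum_mul_left]
    gcongr
    exact h₂ k x Y M hM (by rw [hY]; linarith) (by rw [hY]; linarith)
  refine (mul_le_mul' (ENNReal.ofReal_le_ofReal
    (inv_modWeight_le hM0 (by linarith : s ≤ 0) hkx)) hsum).trans ?_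
  rw [← ENNReal.ofReal_mul (by positivity), ← ENNReal.ofReal_mul (by positivity)]
  apply ENNReal.ofReal_le_ofReal
  have e1 : Z ^ (-s) * Z ^ (-s) = 4 ^ (-2 * s) * Y ^ (-2 * s) := by
    rw [← Real.rpow_add hZ0, hZ, Real.mul_rpow (by norm_num) hY0.le]
    congr 2 <;> ring
  -- The exponents add up to `-(2/3 + s)`. The powers of `M` in the weights and in the two model
  -- sums cancel, so the whole gain comes from `Y ≥ M`.
  have e2 : Y ^ (-(4 / 3) : ℝ) * Y ^ (-2 * s) * Y ^ η * Y ^ η ≤ M ^ (-(2 / 3 + s)) := by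
    rw [← Real.rpow_add hY0, ← Real.rpow_add hY0, ← Real.rpow_add hY0]
    calc _ = Y ^ (-(2 / 3 + s)) := by congr 1; rw [hη]; ring
      _ ≤ _ := Real.rpow_le_rpow_of_nonpos hM0 (by rw [hY]; linarith) (by linarith)
  have e3 : M ^ (-(1 / 3) : ℝ) * M ^ (1 / 3 : ℝ) = 1 := by
    rw [← Real.rpow_add hM0]; norm_num
  calc _ = (M ^ (-(1 / 3) : ℝ) * M ^ (1 / 3 : ℝ)) * (M ^ (-(1 / 3) : ℝ) * M ^ (1 / 3 : ℝ)) *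
        (Z ^ (-s) * Z ^ (-s)) * (Y ^ (-(4 / 3) : ℝ) * Y ^ η * Y ^ η) * (C₁ * C₂) := by
        rw [hA]; ring
    _ = 4 ^ (-2 * s) * (Y ^ (-(4 / 3) : ℝ) * Y ^ (-2 * s) * Y ^ η * Y ^ η) * (C₁ * C₂) := by
        rw [e3, e1]; ring
    _ ≤ 4 ^ (-2 * s) * M ^ (-(2 / 3 + s)) * (C₁ * C₂) := by gcongr
    _ = _ := by ring

end

/-! ### The resolution energies and the Cauchy–Schwarz arguments for the space-time convolution. -/

section

variable {d : ℕ}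

/-- The square of the `ℓ²_n L¹_σ` component of the resolution norm. -/
def energyOne (s : ℝ) (a : Freq d → ℝ → ℝ≥0∞) : ℝ≥0∞ :=
  ∑' n, ENNReal.ofReal (freqWeight n ^ s) * (∫⁻ σ, a n σ) ^ 2

/-- The square of the weighted `L²` component of the resolution norm. -/
def energyTwo (M s : ℝ) (a : Freq d → ℝ → ℝ≥0∞) : ℝ≥0∞ :=
  ∑' n, ∫⁻ σ, ENNReal.ofReal (modWeight M s n σ) * a n σ ^ 2

/-- The square of the resolution norm on the time scale `1 / M`. -/
def energy (M s : ℝ) (a : Freq d → ℝ → ℝ≥0∞) : ℝ≥0∞ := energyOne s a + energyTwo M s a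

theorem add_sq_le_two_mul (x y : ℝ≥0∞) : (x + y) ^ 2 ≤ 2 * (x ^ 2 + y ^ 2) := by
  have := ENNReal.rpow_add_le_mul_rpow_add_rpow x y (p := 2) (by norm_num)
  norm_num at this
  exact this

theorem energyOne_mono_ae {s : ℝ} {a b : Freq d → ℝ → ℝ≥0∞} (h : ∀ n, ∀ᵐ σ, a n σ ≤ b n σ) :
    energyOne s a ≤ energyOne s b := by
  exact ENNReal.tsum_le_tsum fun n =>
    mul_le_mul_right (pow_le_pow_left' (lintegral_mono_ae (h n)) 2) _

theorem energyTwo_mono_ae {M s : ℝ} {a b : Freq d → ℝ → ℝ≥0∞} (h : ∀ n, ∀ᵐ σ, a n σ ≤ b n σ) :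
    energyTwo M s a ≤ energyTwo M s b := by
  refine ENNReal.tsum_le_tsum fun n => ?_
  refine lintegral_mono_ae ?_
  filter_upwards [h n] with σ hσ
  gcongr

theorem energy_mono_ae {M s : ℝ} {a b : Freq d → ℝ → ℝ≥0∞} (h : ∀ n, ∀ᵐ σ, a n σ ≤ b n σ) :
    energy M s a ≤ energy M s b :=
  add_le_add (energyOne_mono_ae h) (energyTwo_mono_ae h)

theorem energy_mono {M s : ℝ} {a b : Freq d → ℝ → ℝ≥0∞} (h : ∀ n σ, a n σ ≤ b n σ) :
    energy M s a ≤ energy M s b :=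
  energy_mono_ae fun n => ae_of_all _ (h n)

theorem energyOne_add_le {s : ℝ} {a b : Freq d → ℝ → ℝ≥0∞} (ha : ∀ n, Measurable (a n)) :
    energyOne s (fun n σ => a n σ + b n σ) ≤ 2 * (energyOne s a + energyOne s b) := by
  unfold energyOne
  rw [← ENNReal.tsum_add, ← ENNReal.tsum_mul_left]
  refine ENNReal.tsum_le_tsum fun n => ?_
  rw [lintegral_add_left (ha n)]
  calc _ ≤ ENNReal.ofReal (freqWeight n ^ s) *
        (2 * ((∫⁻ σ, a n σ) ^ 2 + (∫⁻ σ, b n σ) ^ 2)) := by gcongr; exact add_sq_le_two_mul _ _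
    _ = _ := by ring

theorem energyTwo_add_le {M s : ℝ} {a b : Freq d → ℝ → ℝ≥0∞} (ha : ∀ n, Measurable (a n)) :
    energyTwo M s (fun n σ => a n σ + b n σ) ≤ 2 * (energyTwo M s a + energyTwo M s b) := by
  unfold energyTwo
  rw [← ENNReal.tsum_add, ← ENNReal.tsum_mul_left]
  refine ENNReal.tsum_le_tsum fun n => ?_
  have hm := measurable_modWeight M s n
  have hadd := lintegral_add_left (μ := volume)
    (f := fun σ => ENNReal.ofReal (modWeight M s n σ) * a n σ ^ 2)
    ((hm.ennreal_ofReal).mul ((ha n).pow_const 2))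
    (fun σ => ENNReal.ofReal (modWeight M s n σ) * b n σ ^ 2)
  rw [← hadd, ← lintegral_const_mul' _ _ (by norm_num)]
  refine lintegral_mono fun σ => ?_
  calc _ ≤ ENNReal.ofReal (modWeight M s n σ) * (2 * (a n σ ^ 2 + b n σ ^ 2)) := by
        gcongr; exact add_sq_le_two_mul _ _
    _ = _ := by ring

theorem energy_add_le {M s : ℝ} {a b : Freq d → ℝ → ℝ≥0∞} (ha : ∀ n, Measurable (a n)) :
    energy M s (fun n σ => a n σ + b n σ) ≤ 2 * (energy M s a + energy M s b) := by
  refine (add_le_add (energyOne_add_le ha) (energyTwo_add_le ha)).trans (le_of_eq ?_)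
  unfold energy; ring

theorem energyOne_const_mul (s : ℝ) (c : ℝ≥0∞) (hc : c ≠ ∞) (a : Freq d → ℝ → ℝ≥0∞) :
    energyOne s (fun n σ => c * a n σ) = c ^ 2 * energyOne s a := by
  unfold energyOne
  rw [← ENNReal.tsum_mul_left]
  refine tsum_congr fun n => ?_
  rw [lintegral_const_mul' _ _ hc]; ring

theorem energyTwo_const_mul (M s : ℝ) (c : ℝ≥0∞) (hc : c ≠ ∞) (a : Freq d → ℝ → ℝ≥0∞) :
    energyTwo M s (fun n σ => c * a n σ) = c ^ 2 * energyTwo M s a := by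
  unfold energyTwo
  rw [← ENNReal.tsum_mul_left]
  refine tsum_congr fun n => ?_
  rw [← lintegral_const_mul' _ _ (ENNReal.pow_ne_top hc)]
  refine lintegral_congr fun σ => ?_
  ring

theorem energy_const_mul (M s : ℝ) (c : ℝ≥0∞) (hc : c ≠ ∞) (a : Freq d → ℝ → ℝ≥0∞) :
    energy M s (fun n σ => c * a n σ) = c ^ 2 * energy M s a := by
  unfold energy
  rw [energyOne_const_mul s c hc, energyTwo_const_mul M s c hc, mul_add]

/-- The part of the space-time convolution of `a` and `b` that is selected by `χ`, in terms of the
modulations. -/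
def interactionOn (χ : ℝ → ℝ → ℝ → ℝ≥0∞) (a b : Freq d → ℝ → ℝ≥0∞) (n : Freq d) (σ : ℝ) : ℝ≥0∞ :=
  ∑' k, ∫⁻ x, χ σ x (phase n k - σ - x) * (a k x * b (-n - k) (phase n k - σ - x))

theorem tsum_lintegral_swap {f : Freq d → Freq d → ℝ → ℝ → ℝ≥0∞}
    (hf : ∀ n k, Measurable fun q : ℝ × ℝ => f n k q.1 q.2) :
    ∑' n, ∫⁻ σ, ∑' k, ∫⁻ x, f n k σ x = ∑' k, ∫⁻ x, ∑' n, ∫⁻ σ, f n k σ x := by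
  have h1 : ∀ n, ∫⁻ σ, ∑' k, ∫⁻ x, f n k σ x = ∑' k, ∫⁻ σ, ∫⁻ x, f n k σ x := fun n =>
    lintegral_tsum fun k => (hf n k).lintegral_prod_right'.aemeasurable
  have h2 : ∀ k, ∫⁻ x, ∑' n, ∫⁻ σ, f n k σ x = ∑' n, ∫⁻ x, ∫⁻ σ, f n k σ x := fun k =>
    lintegral_tsum fun n => (hf n k).lintegral_prod_left'.aemeasurable
  simp_rw [h1, h2]
  rw [ENNReal.tsum_comm]
  refine tsum_congr fun k => tsum_congr fun n => ?_
  exact lintegral_lintegral_swap (hf n k).aemeasurable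

section Interaction

variable {χ : ℝ → ℝ → ℝ → ℝ≥0∞} {a b : Freq d → ℝ → ℝ≥0∞}

theorem measurable_interaction_integrand (hχ : Measurable fun q : ℝ × ℝ × ℝ => χ q.1 q.2.1 q.2.2)
    (ha : ∀ n, Measurable (a n)) (hb : ∀ n, Measurable (b n)) (n k : Freq d) :
    Measurable fun q : ℝ × ℝ => χ q.1 q.2 (phase n k - q.1 - q.2) *
      (a k q.2 * b (-n - k) (phase n k - q.1 - q.2)) := by
  have h1 : Measurable fun q : ℝ × ℝ => χ q.1 q.2 (phase n k - q.1 - q.2) :=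
    hχ.comp (g := fun q : ℝ × ℝ × ℝ => χ q.1 q.2.1 q.2.2)
      (f := fun q : ℝ × ℝ => (q.1, q.2, phase n k - q.1 - q.2)) (by fun_prop)
  exact h1.mul (((ha k).comp measurable_snd).mul ((hb (-n - k)).comp (by fun_prop)))

theorem measurable_interactionOn (hχ : Measurable fun q : ℝ × ℝ × ℝ => χ q.1 q.2.1 q.2.2)
    (ha : ∀ n, Measurable (a n)) (hb : ∀ n, Measurable (b n)) (n : Freq d) :
    Measurable (interactionOn χ a b n) :=
  Measurable.tsum fun k =>
    (measurable_interaction_integrand hχ ha hb n k).lintegral_prod_right'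

/-- The reflection `k ↦ -n - k`, `x ↦ phase n k - σ - x` exchanges the two inputs. Thus the case in
which the second input dominates reduces to the case of the first. -/
theorem interactionOn_swap (n : Freq d) (σ : ℝ) :
    interactionOn (fun x y z => χ x z y) a b n σ = interactionOn χ b a n σ := by
  unfold interactionOn
  rw [← (Equiv.subLeft (-n)).tsum_eq]
  refine tsum_congr fun k => ?_
  simp only [Equiv.subLeft_apply, phase_swap, sub_sub_cancel]
  rw [← lintegral_sub_left_eq_self _ (phase n k - σ)]
  refine lintegral_congr fun x => ?_
  simp only [sub_sub_cancel]
  rw [mul_comm (a _ _)]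

theorem ofReal_inv_mul_self {r : ℝ} (hr : 0 < r) :
    ENNReal.ofReal r⁻¹ * ENNReal.ofReal r = 1 := by
  rw [← ENNReal.ofReal_mul (inv_nonneg.2 hr.le), inv_mul_cancel₀ hr.ne', ENNReal.ofReal_one]

theorem tsum_lintegral_reflect (f : Freq d → ℝ → ℝ≥0∞) (n : Freq d) (c : Freq d → ℝ) :
    ∑' k, ∫⁻ x, f (-n - k) (c k - x) = ∑' k, ∫⁻ x, f k x := by
  have h : ∀ k, ∫⁻ x, f (-n - k) (c k - x) = ∫⁻ x, f (-n - k) x := fun k =>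
    lintegral_sub_left_eq_self (f (-n - k)) (c k)
  simp only [h]
  exact (Equiv.subLeft (-n)).tsum_eq (fun k => ∫⁻ x, f k x)

/-- Cauchy–Schwarz in `(k, x)` for a fixed output: the reciprocal weights form the kernel bounded by
`S`, and the weighted squares form a convolution whose total mass factorizes by Tonelli. -/
theorem tsum_lintegral_interactionOn_sq_le_of_out {M s : ℝ} (hM : 0 < M)
    (hχ : Measurable fun q : ℝ × ℝ × ℝ => χ q.1 q.2.1 q.2.2) (hχ2 : ∀ x y z, χ x y z ^ 2 ≤ χ x y z)
    (ha : ∀ n, Measurable (a n)) (hb : ∀ n, Measurable (b n)) {ω : Freq d → ℝ → ℝ≥0∞} {S : ℝ≥0∞}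
    (hS : ∀ n σ, ω n σ * ∑' k, ∫⁻ x, χ σ x (phase n k - σ - x) *
          (ENNReal.ofReal (modWeight M s k x)⁻¹ *
            ENNReal.ofReal (modWeight M s (-n - k) (phase n k - σ - x))⁻¹) ≤ S) :
    ∑' n, ∫⁻ σ, ω n σ * interactionOn χ a b n σ ^ 2 ≤ S * (energyTwo M s a * energyTwo M s b) := by
  have hw := measurable_modWeight M s (d := d)
  set A : Freq d → ℝ → ℝ≥0∞ := fun n σ => ENNReal.ofReal (modWeight M s n σ) * a n σ ^ 2 with hA
  set B : Freq d → ℝ → ℝ≥0∞ := fun n σ => ENNReal.ofReal (modWeight M s n σ) * b n σ ^ 2 with hB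
  have hAm : ∀ n, Measurable (A n) := fun n => (hw n).ennreal_ofReal.mul ((ha n).pow_const 2)
  have hBm : ∀ n, Measurable (B n) := fun n => (hw n).ennreal_ofReal.mul ((hb n).pow_const 2)
  have hpt : ∀ n σ, ω n σ * interactionOn χ a b n σ ^ 2 ≤
      S * ∑' k, ∫⁻ x, A k x * B (-n - k) (phase n k - σ - x) := by
    intro n σ
    have hc := sq_tsum_lintegral_le_mul (μ := (volume : Measure ℝ))
      (f := fun k x => χ σ x (phase n k - σ - x) * (a k x * b (-n - k) (phase n k - σ - x)))
      (u := fun k x => χ σ x (phase n k - σ - x) *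
          (ENNReal.ofReal (modWeight M s k x)⁻¹ *
            ENNReal.ofReal (modWeight M s (-n - k) (phase n k - σ - x))⁻¹))
      (v := fun k x => A k x * B (-n - k) (phase n k - σ - x))
      (fun k => by
        have h1 : Measurable fun x : ℝ => χ σ x (phase n k - σ - x) :=
          hχ.comp (g := fun q : ℝ × ℝ × ℝ => χ q.1 q.2.1 q.2.2)
            (f := fun x : ℝ => (σ, x, phase n k - σ - x)) (by fun_prop)
        exact h1.mul ((hw k).inv.ennreal_ofReal.mul
          (((hw (-n - k)).inv.ennreal_ofReal).comp (by fun_prop))))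
      (fun k => (hAm k).mul ((hBm (-n - k)).comp (by fun_prop)))
      (fun k x => by
        set z := phase n k - σ - x
        have h1 := ofReal_inv_mul_self (modWeight_pos hM s k x)
        have h2 := ofReal_inv_mul_self (modWeight_pos hM s (-n - k) z)
        calc (χ σ x z * (a k x * b (-n - k) z)) ^ 2
            = χ σ x z ^ 2 * (a k x ^ 2 * b (-n - k) z ^ 2) := by ring
          _ ≤ χ σ x z * (a k x ^ 2 * b (-n - k) z ^ 2) := by gcongr; exact hχ2 _ _ _
          _ = χ σ x z * ((ENNReal.ofReal (modWeight M s k x)⁻¹ *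
                ENNReal.ofReal (modWeight M s k x) * a k x ^ 2) *
              (ENNReal.ofReal (modWeight M s (-n - k) z)⁻¹ *
                ENNReal.ofReal (modWeight M s (-n - k) z) * b (-n - k) z ^ 2)) := by
            rw [h1, h2, one_mul, one_mul]
          _ = _ := by simp only [hA, hB]; ring)
    calc _ ≤ ω n σ * ((∑' k, ∫⁻ x, χ σ x (phase n k - σ - x) *
          (ENNReal.ofReal (modWeight M s k x)⁻¹ *
            ENNReal.ofReal (modWeight M s (-n - k) (phase n k - σ - x))⁻¹)) *
            ∑' k, ∫⁻ x, A k x * B (-n - k) (phase n k - σ - x)) := by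
          gcongr; exact hc
      _ ≤ _ := by rw [← mul_assoc]; gcongr; exact hS n σ
  have hABm : ∀ n k, Measurable fun q : ℝ × ℝ => A k q.2 * B (-n - k) (phase n k - q.1 - q.2) :=
    fun n k => ((hAm k).comp measurable_snd).mul ((hBm (-n - k)).comp (by fun_prop))
  calc _ ≤ ∑' n, ∫⁻ σ, S * ∑' k, ∫⁻ x, A k x * B (-n - k) (phase n k - σ - x) :=
        ENNReal.tsum_le_tsum fun n => lintegral_mono fun σ => hpt n σ
    _ = S * ∑' n, ∫⁻ σ, ∑' k, ∫⁻ x, A k x * B (-n - k) (phase n k - σ - x) := by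
        rw [← ENNReal.tsum_mul_left]
        refine tsum_congr fun n => ?_
        rw [lintegral_const_mul]
        exact Measurable.tsum fun k => (hABm n k).lintegral_prod_right'
    _ = S * ∑' k, ∫⁻ x, ∑' n, ∫⁻ σ, A k x * B (-n - k) (phase n k - σ - x) := by
        rw [tsum_lintegral_swap hABm]
    _ = S * ∑' k, ∫⁻ x, A k x * energyTwo M s b := by
        congr 1
        refine tsum_congr fun k => lintegral_congr fun x => ?_
        have h1 : ∀ n, ∫⁻ σ, A k x * B (-n - k) (phase n k - σ - x) =
            A k x * ∫⁻ σ, B (-k - n) ((phase n k - x) - σ) := by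
          intro n
          rw [lintegral_const_mul]
          · congr 1
            refine lintegral_congr fun σ => ?_
            rw [show -n - k = -k - n by abel, show phase n k - σ - x = phase n k - x - σ by ring]
          · exact (hBm _).comp (by fun_prop)
        simp_rw [h1]
        rw [ENNReal.tsum_mul_left, tsum_lintegral_reflect B k]
        rfl
    _ = _ := by
        have h1 : ∀ k, ∫⁻ x, A k x * energyTwo M s b = (∫⁻ x, A k x) * energyTwo M s b :=
          fun k => lintegral_mul_const _ (hAm k)
        simp_rw [h1]
        rw [ENNReal.tsum_mul_right]
        rfl

/-- By duality: after pairing with a test function `c`, Cauchy–Schwarz is applied in `(k, x)`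
against `a`, and then in `(n, σ)` for fixed `(k, x)`. So the kernel is summed over the output while
the dominant input is frozen. -/
theorem tsum_lintegral_interactionOn_sq_le_of_in {M s : ℝ} (hM : 0 < M)
    (hχ : Measurable fun q : ℝ × ℝ × ℝ => χ q.1 q.2.1 q.2.2) (hχ2 : ∀ x y z, χ x y z ^ 2 ≤ χ x y z)
    (ha : ∀ n, Measurable (a n)) (hb : ∀ n, Measurable (b n)) {ω : Freq d → ℝ → ℝ≥0∞}
    (hω : ∀ n, Measurable (ω n)) {S : ℝ≥0∞}
    (hS : ∀ k x, ENNReal.ofReal (modWeight M s k x)⁻¹ *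
        ∑' n, ∫⁻ σ, χ σ x (phase n k - σ - x) *
          (ω n σ * ENNReal.ofReal (modWeight M s (-n - k) (phase n k - σ - x))⁻¹) ≤ S) :
    ∑' n, ∫⁻ σ, ω n σ * interactionOn χ a b n σ ^ 2 ≤ S * (energyTwo M s a * energyTwo M s b) := by
  have hw := measurable_modWeight M s (d := d)
  set A : Freq d → ℝ → ℝ≥0∞ := fun n σ => ENNReal.ofReal (modWeight M s n σ) * a n σ ^ 2 with hA
  set B : Freq d → ℝ → ℝ≥0∞ := fun n σ => ENNReal.ofReal (modWeight M s n σ) * b n σ ^ 2 with hB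
  have hAm : ∀ n, Measurable (A n) := fun n => (hw n).ennreal_ofReal.mul ((ha n).pow_const 2)
  have hBm : ∀ n, Measurable (B n) := fun n => (hw n).ennreal_ofReal.mul ((hb n).pow_const 2)
  have hIm := measurable_interactionOn hχ ha hb
  set F : Freq d × ℝ → ℝ≥0∞ := fun q => ω q.1 q.2 ^ (1 / 2 : ℝ) * interactionOn χ a b q.1 q.2
    with hF
  have hFm : Measurable F := measurable_from_prod_countable_right fun n =>
    ((hω n).pow_const (1 / 2 : ℝ)).mul (hIm n)
  have hprod : ∀ G : Freq d × ℝ → ℝ≥0∞, Measurable G →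
      ∫⁻ q, G q ∂(Measure.count.prod volume) = ∑' n, ∫⁻ σ, G (n, σ) := by
    intro G hG
    rw [lintegral_prod _ hG.aemeasurable, lintegral_count]
  have key := lintegral_sq_le_of_forall (μ := (Measure.count : Measure (Freq d)).prod volume) hFm
    (C := S * (energyTwo M s a * energyTwo M s b)) ?_
  · rw [hprod _ (hFm.pow_const 2)] at key
    refine le_trans (le_of_eq ?_) key
    refine tsum_congr fun n => lintegral_congr fun σ => ?_
    simp only [hF]
    rw [mul_pow, sq_rpow_half]
  intro c hc
  have hcn : ∀ n, Measurable fun σ => c (n, σ) := fun n => hc.comp measurable_prodMk_left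
  rw [hprod (fun q => c q * F q) (hc.mul hFm), hprod _ (hc.pow_const 2)]
  -- The pairing with `c`, after Tonelli, is the pairing of `a` with `L`; a weighted `L²` bound for
  -- `L` in terms of `c` and `b` is what remains.
  set L : Freq d → ℝ → ℝ≥0∞ := fun k x => ∑' n, ∫⁻ σ, c (n, σ) * ω n σ ^ (1 / 2 : ℝ) *
    (χ σ x (phase n k - σ - x) * b (-n - k) (phase n k - σ - x)) with hL
  have hLint : ∀ n k, Measurable fun q : ℝ × ℝ => c (n, q.1) * ω n q.1 ^ (1 / 2 : ℝ) *
      (χ q.1 q.2 (phase n k - q.1 - q.2) * b (-n - k) (phase n k - q.1 - q.2)) := by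
    intro n k
    have h1 : Measurable fun q : ℝ × ℝ => χ q.1 q.2 (phase n k - q.1 - q.2) :=
      hχ.comp (g := fun q : ℝ × ℝ × ℝ => χ q.1 q.2.1 q.2.2)
        (f := fun q : ℝ × ℝ => (q.1, q.2, phase n k - q.1 - q.2)) (by fun_prop)
    exact (((hcn n).comp measurable_fst).mul (((hω n).pow_const (1 / 2 : ℝ)).comp
      measurable_fst)).mul (h1.mul ((hb (-n - k)).comp (by fun_prop)))
  have hLm : ∀ k, Measurable (L k) := fun k =>
    Measurable.tsum fun n => (hLint n k).lintegral_prod_left'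
  have e1 : ∑' n, ∫⁻ σ, c (n, σ) * F (n, σ) = ∑' k, ∫⁻ x, a k x * L k x := by
    have h1 : ∀ n σ, c (n, σ) * F (n, σ) = ∑' k, ∫⁻ x, a k x * (c (n, σ) * ω n σ ^ (1 / 2 : ℝ) *
        (χ σ x (phase n k - σ - x) * b (-n - k) (phase n k - σ - x))) := by
      intro n σ
      simp only [hF, interactionOn]
      rw [← mul_assoc, ← ENNReal.tsum_mul_left]
      refine tsum_congr fun k => ?_
      rw [← lintegral_const_mul]
      · refine lintegral_congr fun x => ?_
        ring
      · exact (measurable_interaction_integrand hχ ha hb n k).comp measurable_prodMk_left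
    simp_rw [h1]
    rw [tsum_lintegral_swap fun n k => ((ha k).comp measurable_snd).mul (hLint n k)]
    refine tsum_congr fun k => lintegral_congr fun x => ?_
    simp only [hL]
    rw [← ENNReal.tsum_mul_left]
    refine tsum_congr fun n => ?_
    rw [lintegral_const_mul]
    exact (hLint n k).comp measurable_prodMk_right
  rw [e1]
  have e2 : (∑' k, ∫⁻ x, a k x * L k x) ^ 2 ≤ energyTwo M s a *
      ∑' k, ∫⁻ x, ENNReal.ofReal (modWeight M s k x)⁻¹ * L k x ^ 2 := by
    refine sq_tsum_lintegral_le_mul hAm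
      (fun k => (hw k).inv.ennreal_ofReal.mul ((hLm k).pow_const 2)) fun k x => le_of_eq ?_
    have h1 := ofReal_inv_mul_self (modWeight_pos hM s k x)
    calc (a k x * L k x) ^ 2 = (ENNReal.ofReal (modWeight M s k x)⁻¹ *
          ENNReal.ofReal (modWeight M s k x)) * (a k x ^ 2 * L k x ^ 2) := by rw [h1]; ring
      _ = _ := by ring
  have hcB : ∀ n k, Measurable fun q : ℝ × ℝ =>
      c (n, q.1) ^ 2 * B (-n - k) (phase n k - q.1 - q.2) := fun n k =>
    (((hcn n).pow_const 2).comp measurable_fst).mul ((hBm (-n - k)).comp (by fun_prop))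
  have e3 : ∀ k x, ENNReal.ofReal (modWeight M s k x)⁻¹ * L k x ^ 2 ≤
      S * ∑' n, ∫⁻ σ, c (n, σ) ^ 2 * B (-n - k) (phase n k - σ - x) := by
    intro k x
    have hcs : L k x ^ 2 ≤ (∑' n, ∫⁻ σ, χ σ x (phase n k - σ - x) *
          (ω n σ * ENNReal.ofReal (modWeight M s (-n - k) (phase n k - σ - x))⁻¹)) *
        ∑' n, ∫⁻ σ, c (n, σ) ^ 2 * B (-n - k) (phase n k - σ - x) := by
      refine sq_tsum_lintegral_le_mul (fun n => ?_) (fun n => (hcB n k).comp measurable_prodMk_right)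
        fun n σ => ?_
      · have h1 : Measurable fun σ : ℝ => χ σ x (phase n k - σ - x) :=
          hχ.comp (g := fun q : ℝ × ℝ × ℝ => χ q.1 q.2.1 q.2.2)
            (f := fun σ : ℝ => (σ, x, phase n k - σ - x)) (by fun_prop)
        exact h1.mul ((hω n).mul (((hw (-n - k)).inv.ennreal_ofReal).comp (by fun_prop)))
      · set z := phase n k - σ - x
        have h2 := ofReal_inv_mul_self (modWeight_pos hM s (-n - k) z)
        calc (c (n, σ) * ω n σ ^ (1 / 2 : ℝ) * (χ σ x z * b (-n - k) z)) ^ 2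
            = c (n, σ) ^ 2 * (ω n σ ^ (1 / 2 : ℝ)) ^ 2 * (χ σ x z ^ 2 * b (-n - k) z ^ 2) := by ring
          _ ≤ c (n, σ) ^ 2 * ω n σ * (χ σ x z * b (-n - k) z ^ 2) := by
            rw [sq_rpow_half]; gcongr; exact hχ2 _ _ _
          _ = c (n, σ) ^ 2 * ω n σ * (χ σ x z * ((ENNReal.ofReal (modWeight M s (-n - k) z)⁻¹ *
                ENNReal.ofReal (modWeight M s (-n - k) z)) * b (-n - k) z ^ 2)) := by
            rw [h2, one_mul]
          _ = _ := by simp only [hB]; ring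
    refine (mul_le_mul_right hcs _).trans ?_
    rw [← mul_assoc]
    gcongr
    exact hS k x
  have e4 : ∑' k, ∫⁻ x, ENNReal.ofReal (modWeight M s k x)⁻¹ * L k x ^ 2 ≤
      S * ((∑' n, ∫⁻ σ, c (n, σ) ^ 2) * energyTwo M s b) := by
    calc _ ≤ ∑' k, ∫⁻ x, S * ∑' n, ∫⁻ σ, c (n, σ) ^ 2 * B (-n - k) (phase n k - σ - x) :=
          ENNReal.tsum_le_tsum fun k => lintegral_mono fun x => e3 k x
      _ = S * ∑' k, ∫⁻ x, ∑' n, ∫⁻ σ, c (n, σ) ^ 2 * B (-n - k) (phase n k - σ - x) := by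
          rw [← ENNReal.tsum_mul_left]
          refine tsum_congr fun n => ?_
          rw [lintegral_const_mul]
          exact Measurable.tsum fun k => (hcB k n).lintegral_prod_left'
      _ = S * ∑' n, ∫⁻ σ, ∑' k, ∫⁻ x, c (n, σ) ^ 2 * B (-n - k) (phase n k - σ - x) := by
          rw [← tsum_lintegral_swap hcB]
      _ = S * ∑' n, ∫⁻ σ, c (n, σ) ^ 2 * energyTwo M s b := by
          congr 1
          refine tsum_congr fun n => lintegral_congr fun σ => ?_
          have h1 : ∀ k, ∫⁻ x, c (n, σ) ^ 2 * B (-n - k) (phase n k - σ - x) =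
              c (n, σ) ^ 2 * ∫⁻ x, B (-n - k) ((phase n k - σ) - x) := by
            intro k
            rw [lintegral_const_mul]
            exact (hBm _).comp (by fun_prop)
          simp_rw [h1]
          rw [ENNReal.tsum_mul_left, tsum_lintegral_reflect B n]
          rfl
      _ = _ := by
          have h1 : ∀ n, ∫⁻ σ, c (n, σ) ^ 2 * energyTwo M s b =
              (∫⁻ σ, c (n, σ) ^ 2) * energyTwo M s b :=
            fun n => lintegral_mul_const _ ((hcn n).pow_const 2)
          simp_rw [h1]
          rw [ENNReal.tsum_mul_right]
  calc _ ≤ energyTwo M s a * (S * ((∑' n, ∫⁻ σ, c (n, σ) ^ 2) * energyTwo M s b)) :=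
        e2.trans (by gcongr)
    _ = _ := by ring

end Interaction

end

/-! ### The bilinear estimate. -/

section

variable {d : ℕ}

/-- The space-time convolution of `a` and `b` in terms of the modulations. -/
def interaction (a b : Freq d → ℝ → ℝ≥0∞) (n : Freq d) (σ : ℝ) : ℝ≥0∞ :=
  ∑' k, ∫⁻ x, a k x * b (-n - k) (phase n k - σ - x)

theorem measurable_dominant_swap :
    Measurable fun q : ℝ × ℝ × ℝ => dominant q.2.1 q.1 q.2.2 :=
  measurable_dominant.comp (f := fun q : ℝ × ℝ × ℝ => (q.2.1, q.1, q.2.2)) (by fun_prop)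

theorem measurable_interaction {a b : Freq d → ℝ → ℝ≥0∞} (ha : ∀ n, Measurable (a n))
    (hb : ∀ n, Measurable (b n)) (n : Freq d) : Measurable (interaction a b n) := by
  have := measurable_interactionOn (χ := fun _ _ _ => 1) measurable_const ha hb n
  have h : interaction a b n = interactionOn (fun _ _ _ => 1) a b n := by
    funext σ
    simp [interaction, interactionOn]
  rwa [h]

theorem interaction_le {a b : Freq d → ℝ → ℝ≥0∞} (ha : ∀ n, Measurable (a n))
    (hb : ∀ n, Measurable (b n)) (n : Freq d) (σ : ℝ) :
    interaction a b n σ ≤ interactionOn dominant a b n σ +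
      (interactionOn (fun x y z => dominant y x z) a b n σ +
        interactionOn (fun x y z => dominant y x z) b a n σ) := by
  rw [← interactionOn_swap (χ := fun x y z => dominant y x z) (a := a) (b := b)]
  unfold interaction interactionOn
  rw [← ENNReal.tsum_add, ← ENNReal.tsum_add]
  refine ENNReal.tsum_le_tsum fun k => ?_
  have m1 := (measurable_interaction_integrand measurable_dominant ha hb n k).comp
    (measurable_prodMk_left (x := σ))
  have m2 := (measurable_interaction_integrand (χ := fun x y z => dominant y x z)
    measurable_dominant_swap ha hb n k).comp (measurable_prodMk_left (x := σ))
  simp only [Function.comp_def] at m1 m2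
  rw [← lintegral_add_left m2, ← lintegral_add_left m1]
  refine lintegral_mono fun x => ?_
  simp only
  rw [← add_mul, ← add_mul]
  exact le_mul_of_one_le_left' (one_le_sum_dominant _ _ _)

/-- With a dominant output, `(M + |σ|)⁻¹` is bounded by `(M + phase / 3)⁻¹`, which does not depend
on the modulations. The integrals then decouple into `L¹` norms of the inputs, and a sum over `k`
remains that needs no `L²` information. -/
theorem exists_energyOne_out_le (hd : d = 1 ∨ d = 2) {s : ℝ} (hs : -(2 / 3) < s)
    (hs' : s ≤ -(1 / 2)) :
    ∃ C : ℝ, 0 < C ∧ ∀ M : ℝ, 1 ≤ M → ∀ a b : Freq d → ℝ → ℝ≥0∞, (∀ n, Measurable (a n)) →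
      (∀ n, Measurable (b n)) →
      energyOne s (fun n σ => ENNReal.ofReal (M + |σ|)⁻¹ * interactionOn dominant a b n σ) ≤
        ENNReal.ofReal (C * M ^ (-(1 / 6) : ℝ)) * (energyOne s a * energyOne s b) := by
  obtain ⟨C, hC, h⟩ := exists_tsum_freqWeight_le hd (b := s + 11 / 6) (by linarith)
  refine ⟨9 * C, by positivity, fun M hM a b ha hb => ?_⟩
  have hM0 : 0 < M := by linarith
  set α : Freq d → ℝ≥0∞ := fun n => ∫⁻ x, a n x with hα
  set β : Freq d → ℝ≥0∞ := fun n => ∫⁻ x, b n x with hβ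
  have h1 : ∀ n, ∫⁻ σ, ENNReal.ofReal (M + |σ|)⁻¹ * interactionOn dominant a b n σ ≤
      ∑' k, ENNReal.ofReal (M + phase n k / 3)⁻¹ * (α k * β (-n - k)) := by
    intro n
    have hm := measurable_interaction_integrand measurable_dominant ha hb n
    have hr : Measurable fun q : ℝ × ℝ => ENNReal.ofReal (M + |q.1|)⁻¹ := by fun_prop
    have hrm : ∀ k, Measurable fun q : ℝ × ℝ => ENNReal.ofReal (M + |q.1|)⁻¹ *
        (dominant q.1 q.2 (phase n k - q.1 - q.2) *
          (a k q.2 * b (-n - k) (phase n k - q.1 - q.2))) := fun k => hr.mul (hm k)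
    have e1 : ∀ σ, ENNReal.ofReal (M + |σ|)⁻¹ * interactionOn dominant a b n σ =
        ∑' k, ∫⁻ x, ENNReal.ofReal (M + |σ|)⁻¹ * (dominant σ x (phase n k - σ - x) *
          (a k x * b (-n - k) (phase n k - σ - x))) := by
      intro σ
      unfold interactionOn
      rw [← ENNReal.tsum_mul_left]
      refine tsum_congr fun k => ?_
      rw [lintegral_const_mul' _ _ ENNReal.ofReal_ne_top]
    simp_rw [e1]
    rw [lintegral_tsum fun k => (hrm k).lintegral_prod_right'.aemeasurable]
    refine ENNReal.tsum_le_tsum fun k => ?_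
    rw [lintegral_lintegral_swap (hrm k).aemeasurable]
    calc _ ≤ ∫⁻ x, ∫⁻ σ, ENNReal.ofReal (M + phase n k / 3)⁻¹ *
          (a k x * b (-n - k) ((phase n k - x) - σ)) := by
          refine lintegral_mono fun x => lintegral_mono fun σ => ?_
          simp only
          rw [show phase n k - x - σ = phase n k - σ - x by ring]
          unfold dominant
          split_ifs with hdom
          · rw [one_mul]
            have := phase_le_of_dominant (n := n) (k := k) (x := σ) (y := x)
              (z := phase n k - σ - x) (by ring) hdom.1 hdom.2
            have := phase_nonneg n k
            gcongr
            linarith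
          · simp
      _ = ∫⁻ x, ENNReal.ofReal (M + phase n k / 3)⁻¹ * (a k x * β (-n - k)) := by
          refine lintegral_congr fun x => ?_
          rw [lintegral_const_mul' _ _ ENNReal.ofReal_ne_top, lintegral_const_mul,
            lintegral_sub_left_eq_self]
          exact (hb _).comp (by fun_prop)
      _ = _ := by
          rw [lintegral_const_mul' _ _ ENNReal.ofReal_ne_top, lintegral_mul_const _ (ha k)]
  have h2 : ∀ n, ENNReal.ofReal (freqWeight n ^ s) *
      (∫⁻ σ, ENNReal.ofReal (M + |σ|)⁻¹ * interactionOn dominant a b n σ) ^ 2 ≤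
      ENNReal.ofReal (freqWeight n ^ (-(s + 11 / 6))) *
        (ENNReal.ofReal (9 * M ^ (-(1 / 6) : ℝ)) * (energyOne s a * energyOne s b)) := by
    intro n
    have hp := freqWeight_pos n
    set K : ℝ := 9 * M ^ (-(1 / 6) : ℝ) * freqWeight n ^ (-2 * s - 11 / 6) with hK
    have hK0 : 0 ≤ K := by positivity
    have h3 : (∑' k, ENNReal.ofReal (M + phase n k / 3)⁻¹ * (α k * β (-n - k))) ^ 2 ≤
        (∑' k, ENNReal.ofReal (freqWeight k ^ s) * α k ^ 2) *
          ∑' k, ENNReal.ofReal K *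
            (ENNReal.ofReal (freqWeight (-n - k) ^ s) * β (-n - k) ^ 2) := by
      refine sq_tsum_le_mul fun k => ?_
      have hk := freqWeight_pos k
      have hm := freqWeight_pos (-n - k)
      have hreal : ((M + phase n k / 3)⁻¹) ^ 2 ≤
          freqWeight k ^ s * (K * freqWeight (-n - k) ^ s) := by
        have hph := phase_nonneg n k
        set X := 1 + phase n k with hX
        have hX0 : 0 < X := by rw [hX]; linarith
        have k1 : freqWeight k ≤ X := by
          have := freqSq_le_phase_right n k; unfold freqWeight; linarith
        have k2 : freqWeight (-n - k) ≤ X := by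
          have := freqSq_le_phase_third n k; unfold freqWeight; linarith
        have k3 : freqWeight n ≤ X := by
          have := freqSq_le_phase n k; unfold freqWeight; linarith
        have i1 : X ^ s ≤ freqWeight k ^ s := Real.rpow_le_rpow_of_nonpos hk k1 (by linarith)
        have i2 : X ^ s ≤ freqWeight (-n - k) ^ s :=
          Real.rpow_le_rpow_of_nonpos hm k2 (by linarith)
        have i3 : X ^ (-2 * s - 11 / 6) ≤ freqWeight n ^ (-2 * s - 11 / 6) :=
          Real.rpow_le_rpow_of_nonpos hp k3 (by linarith)
        have j0 : 0 < M + phase n k / 3 := by positivity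
        have j1 : (M + phase n k / 3)⁻¹ ≤ 3 * (M + phase n k)⁻¹ := by
          rw [← div_eq_mul_inv, inv_eq_one_div, div_le_div_iff₀ j0 (by positivity)]
          linarith
        -- Of the two powers, `1/6` is kept as a gain in `M`. The power `X^(-11/6)` supplies `X^s`
        -- for each input and leaves `freqWeight n ^ (-(s + 11/6))` for the output, summable since
        -- `s + 11/6 > 1`.
        have j2 : ((M + phase n k)⁻¹) ^ 2 ≤ M ^ (-(1 / 6) : ℝ) * X ^ (-(11 / 6) : ℝ) := by
          have hW : 0 < M + phase n k := by positivity
          have : ((M + phase n k)⁻¹) ^ 2 = (M + phase n k) ^ (-(1 / 6) : ℝ) *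
              (M + phase n k) ^ (-(11 / 6) : ℝ) := by
            rw [← Real.rpow_add hW, inv_pow, ← Real.rpow_natCast, ← Real.rpow_neg hW.le]
            norm_num
          rw [this]
          have l1 : (M + phase n k) ^ (-(1 / 6) : ℝ) ≤ M ^ (-(1 / 6) : ℝ) :=
            Real.rpow_le_rpow_of_nonpos hM0 (by linarith) (by norm_num)
          have l2 : (M + phase n k) ^ (-(11 / 6) : ℝ) ≤ X ^ (-(11 / 6) : ℝ) :=
            Real.rpow_le_rpow_of_nonpos hX0 (by linarith) (by norm_num)
          gcongr
        calc ((M + phase n k / 3)⁻¹) ^ 2 ≤ (3 * (M + phase n k)⁻¹) ^ 2 := by gcongr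
          _ = 9 * ((M + phase n k)⁻¹) ^ 2 := by ring
          _ ≤ 9 * (M ^ (-(1 / 6) : ℝ) * X ^ (-(11 / 6) : ℝ)) := by gcongr
          _ = X ^ s * (9 * M ^ (-(1 / 6) : ℝ) * X ^ (-2 * s - 11 / 6) * X ^ s) := by
            have : X ^ (-(11 / 6) : ℝ) = X ^ s * (X ^ (-2 * s - 11 / 6) * X ^ s) := by
              rw [← Real.rpow_add hX0, ← Real.rpow_add hX0]
              congr 1; ring
            rw [this]; ring
          _ ≤ freqWeight k ^ s * (K * freqWeight (-n - k) ^ s) := by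
            rw [hK]; gcongr
      calc (ENNReal.ofReal (M + phase n k / 3)⁻¹ * (α k * β (-n - k))) ^ 2
          = ENNReal.ofReal (((M + phase n k / 3)⁻¹) ^ 2) * (α k ^ 2 * β (-n - k) ^ 2) := by
            rw [ENNReal.ofReal_pow (by have := phase_nonneg n k; positivity)]; ring
        _ ≤ ENNReal.ofReal (freqWeight k ^ s * (K * freqWeight (-n - k) ^ s)) *
            (α k ^ 2 * β (-n - k) ^ 2) := by gcongr
        _ = _ := by
            rw [ENNReal.ofReal_mul (by positivity), ENNReal.ofReal_mul hK0]; ring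
    have h4 : ∑' k, ENNReal.ofReal K *
            (ENNReal.ofReal (freqWeight (-n - k) ^ s) * β (-n - k) ^ 2) =
        ENNReal.ofReal K * energyOne s b := by
      rw [ENNReal.tsum_mul_left]
      congr 1
      exact (Equiv.subLeft (-n)).tsum_eq (fun k => ENNReal.ofReal (freqWeight k ^ s) * β k ^ 2)
    calc _ ≤ ENNReal.ofReal (freqWeight n ^ s) * (energyOne s a *
          (ENNReal.ofReal K * energyOne s b)) := by
          gcongr
          refine (pow_le_pow_left' (h1 n) 2).trans (h3.trans (le_of_eq ?_))
          rw [h4]; rfl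
      _ = ENNReal.ofReal (freqWeight n ^ s * K) * (energyOne s a * energyOne s b) := by
          rw [ENNReal.ofReal_mul (p := freqWeight n ^ s) (q := K) (by positivity)]; ring
      _ = _ := by
          rw [← mul_assoc (ENNReal.ofReal (freqWeight n ^ (-(s + 11 / 6)))),
            ← ENNReal.ofReal_mul (by positivity)]
          congr 2
          have : freqWeight n ^ (-(s + 11 / 6)) =
              freqWeight n ^ s * freqWeight n ^ (-2 * s - 11 / 6) := by
            rw [← Real.rpow_add hp]; congr 1; ring
          rw [hK, this]; ring
  refine (ENNReal.tsum_le_tsum h2).trans ?_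
  rw [ENNReal.tsum_mul_right]
  calc _ ≤ ENNReal.ofReal C * (ENNReal.ofReal (9 * M ^ (-(1 / 6) : ℝ)) *
        (energyOne s a * energyOne s b)) := by gcongr
    _ = _ := by
      rw [← mul_assoc, ← ENNReal.ofReal_mul (by positivity)]
      congr 2; ring

/-- Cauchy–Schwarz in `σ` against `(M + |σ|)^(-(1 + η))`, whose integral is `O(M^(-η))`. This
dictates the powers of `M + |σ|` and of `M` in `outWeight`. -/
theorem exists_energyOne_le_outWeight {s : ℝ} (hs : -(2 / 3) < s) :
    ∃ C : ℝ, 0 < C ∧ ∀ M : ℝ, 1 ≤ M → ∀ F : Freq d → ℝ → ℝ≥0∞, (∀ n, Measurable (F n)) →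
      energyOne s (fun n σ => ENNReal.ofReal (M + |σ|)⁻¹ * F n σ) ≤
        ENNReal.ofReal C * ∑' n, ∫⁻ σ, ENNReal.ofReal (outWeight M s n σ) * F n σ ^ 2 := by
  set η := 1 / 3 + s / 2 with hη
  obtain ⟨C, hC, h⟩ := exists_lintegral_bracket_le (b := 1 + η) (by linarith)
  refine ⟨C, hC, fun M hM F hF => ?_⟩
  have hM0 : 0 < M := by linarith
  rw [← ENNReal.tsum_mul_left]
  refine ENNReal.tsum_le_tsum fun n => ?_
  have hp := freqWeight_pos n
  have h1 : (∫⁻ σ, ENNReal.ofReal (M + |σ|)⁻¹ * F n σ) ^ 2 ≤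
      (∫⁻ σ, ENNReal.ofReal ((M + |σ|) ^ (-(1 + η)))) *
        ∫⁻ σ, ENNReal.ofReal ((M + |σ|) ^ (-1 + η)) * F n σ ^ 2 := by
    refine sq_lintegral_le_mul (by fun_prop) (Measurable.mul (by fun_prop) ((hF n).pow_const 2))
      fun σ => le_of_eq ?_
    have hσ : 0 < M + |σ| := by positivity
    rw [← mul_assoc, ← ENNReal.ofReal_mul (by positivity), mul_pow,
      ← ENNReal.ofReal_pow (by positivity), ← Real.rpow_add hσ]
    congr 2
    rw [inv_pow, ← Real.rpow_natCast, ← Real.rpow_neg hσ.le]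
    congr 1; push_cast; ring
  calc _ ≤ ENNReal.ofReal (freqWeight n ^ s) * (ENNReal.ofReal (C * M ^ (1 - (1 + η))) *
        ∫⁻ σ, ENNReal.ofReal ((M + |σ|) ^ (-1 + η)) * F n σ ^ 2) := by
        gcongr
        exact h1.trans (by gcongr; exact h M hM0)
    _ = ENNReal.ofReal C * ∫⁻ σ, ENNReal.ofReal (freqWeight n ^ s * M ^ (1 - (1 + η))) *
        (ENNReal.ofReal ((M + |σ|) ^ (-1 + η)) * F n σ ^ 2) := by
        rw [lintegral_const_mul' _ _ ENNReal.ofReal_ne_top, ← mul_assoc, ← mul_assoc,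
          ← ENNReal.ofReal_mul (by positivity), ← ENNReal.ofReal_mul (by positivity)]
        congr 2; ring
    _ ≤ _ := by
        refine mul_le_mul_right (lintegral_mono fun σ => ?_) _
        rw [← mul_assoc, ← ENNReal.ofReal_mul (by positivity)]
        refine mul_le_mul_left (ENNReal.ofReal_le_ofReal ?_) _
        unfold outWeight
        rw [← hη, show 1 - (1 + η) = -η by ring]
        have : 0 ≤ M ^ (-(1 / 2) : ℝ) * (M + |σ|) ^ (-1 + η) * M ^ (-η) := by positivity
        linarith

theorem energyTwo_le_outWeight {M s : ℝ} (hM : 1 ≤ M) (hs : -(2 / 3) < s) (hs' : s ≤ -(1 / 2))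
    (F : Freq d → ℝ → ℝ≥0∞) :
    energyTwo M s (fun n σ => ENNReal.ofReal (M + |σ|)⁻¹ * F n σ) ≤
      ENNReal.ofReal 4 * ∑' n, ∫⁻ σ, ENNReal.ofReal (outWeight M s n σ) * F n σ ^ 2 := by
  have hM0 : 0 < M := by linarith
  rw [← ENNReal.tsum_mul_left]
  refine ENNReal.tsum_le_tsum fun n => ?_
  rw [← lintegral_const_mul' _ _ ENNReal.ofReal_ne_top]
  refine lintegral_mono fun σ => ?_
  rw [mul_pow, ← mul_assoc, ← mul_assoc, ← ENNReal.ofReal_pow (by positivity),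
    ← ENNReal.ofReal_mul (modWeight_pos hM0 s n σ).le, ← ENNReal.ofReal_mul (by norm_num)]
  exact mul_le_mul_left
    (ENNReal.ofReal_le_ofReal (modWeight_mul_le_outWeight hM hs hs' n σ)) _

/-- The bilinear estimate. -/
theorem exists_energy_interaction_le (hd : d = 1 ∨ d = 2) {s : ℝ} (hs : -(2 / 3) < s)
    (hs' : s ≤ -(1 / 2)) :
    ∃ C : ℝ, 0 < C ∧ ∀ M : ℝ, 1 ≤ M → ∀ a b : Freq d → ℝ → ℝ≥0∞, (∀ n, Measurable (a n)) →
      (∀ n, Measurable (b n)) →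
      energy M s (fun n σ => ENNReal.ofReal (M + |σ|)⁻¹ * interaction a b n σ) ≤
        ENNReal.ofReal (C * M ^ (-(2 / 3 + s))) * (energy M s a * energy M s b) := by
  obtain ⟨C₁, hC₁, h₁⟩ := exists_energyOne_out_le hd hs hs'
  obtain ⟨C₂, hC₂, h₂⟩ := exists_out_kernel_le hd hs hs'
  obtain ⟨C₃, hC₃, h₃⟩ := exists_in_kernel_le hd hs hs'
  obtain ⟨C₄, hC₄, h₄⟩ := exists_energyOne_le_outWeight (d := d) hs
  refine ⟨2 * (C₁ + C₂) + 8 * ((C₄ + 4) * C₃), by positivity, fun M hM a b ha hb => ?_⟩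
  have hM0 : 0 < M := by linarith
  set E := energy M s a * energy M s b with hE
  set δ := M ^ (-(2 / 3 + s)) with hδ
  have hle1 : ∀ a : Freq d → ℝ → ℝ≥0∞, energyOne s a ≤ energy M s a := fun a => le_self_add
  have hle2 : ∀ a : Freq d → ℝ → ℝ≥0∞, energyTwo M s a ≤ energy M s a := fun a => le_add_self
  -- Because `s ≤ -1/2`, one has `2/3 + s ≤ 1/6`: the interactions with a dominant input give the
  -- weakest gain.
  have hδ1 : M ^ (-(1 / 6) : ℝ) ≤ δ := Real.rpow_le_rpow_of_exponent_le hM (by linarith)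
  have hδ2 : M ^ (-(1 / 3) : ℝ) ≤ δ := Real.rpow_le_rpow_of_exponent_le hM (by linarith)
  have hr : Measurable fun σ : ℝ => ENNReal.ofReal (M + |σ|)⁻¹ := by fun_prop
  have mout := measurable_interactionOn measurable_dominant ha hb
  have hout : energy M s (fun n σ => ENNReal.ofReal (M + |σ|)⁻¹ * interactionOn dominant a b n σ) ≤
      ENNReal.ofReal ((C₁ + C₂) * δ) * E := by
    have e1 : energyOne s (fun n σ => ENNReal.ofReal (M + |σ|)⁻¹ * interactionOn dominant a b n σ) ≤
        ENNReal.ofReal (C₁ * δ) * E := by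
      refine (h₁ M hM a b ha hb).trans ?_
      exact mul_le_mul' (ENNReal.ofReal_le_ofReal (by gcongr)) (mul_le_mul' (hle1 a) (hle1 b))
    have e2 : energyTwo M s
        (fun n σ => ENNReal.ofReal (M + |σ|)⁻¹ * interactionOn dominant a b n σ) ≤
        ENNReal.ofReal (C₂ * δ) * E := by
      have := tsum_lintegral_interactionOn_sq_le_of_out hM0 measurable_dominant
        (fun x y z => (dominant_sq x y z).le) ha hb
        (ω := fun n σ => ENNReal.ofReal (modWeight M s n σ * ((M + |σ|)⁻¹) ^ 2)) (h₂ M hM)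
      calc _ = ∑' n, ∫⁻ σ, ENNReal.ofReal (modWeight M s n σ * ((M + |σ|)⁻¹) ^ 2) *
            interactionOn dominant a b n σ ^ 2 := by
            refine tsum_congr fun n => lintegral_congr fun σ => ?_
            rw [ENNReal.ofReal_mul (modWeight_pos hM0 s n σ).le,
              ENNReal.ofReal_pow (by positivity)]
            ring
        _ ≤ _ := this
        _ ≤ _ := mul_le_mul' (ENNReal.ofReal_le_ofReal (by gcongr))
            (mul_le_mul' (hle2 a) (hle2 b))
    unfold energy
    rw [add_mul, ENNReal.ofReal_add (by positivity) (by positivity), add_mul]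
    exact add_le_add e1 e2
  have hin : ∀ a b : Freq d → ℝ → ℝ≥0∞, (∀ n, Measurable (a n)) → (∀ n, Measurable (b n)) →
      energy M s (fun n σ => ENNReal.ofReal (M + |σ|)⁻¹ *
        interactionOn (fun x y z => dominant y x z) a b n σ) ≤
      ENNReal.ofReal ((C₄ + 4) * C₃ * δ) * (energy M s a * energy M s b) := by
    intro a b ha hb
    have mF := measurable_interactionOn (χ := fun x y z => dominant y x z)
      measurable_dominant_swap ha hb
    have e0 := tsum_lintegral_interactionOn_sq_le_of_in hM0 (χ := fun x y z => dominant y x z)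
      measurable_dominant_swap (fun x y z => (dominant_sq y x z).le) ha hb
      (ω := fun n σ => ENNReal.ofReal (outWeight M s n σ))
      (fun n => (measurable_outWeight M s n).ennreal_ofReal) (h₃ M hM)
    calc _ ≤ ENNReal.ofReal C₄ * _ + ENNReal.ofReal 4 * _ :=
          add_le_add (h₄ M hM _ mF) (energyTwo_le_outWeight hM hs hs' _)
      _ = ENNReal.ofReal (C₄ + 4) * _ := by
          rw [← add_mul, ← ENNReal.ofReal_add hC₄.le (by norm_num)]
      _ ≤ ENNReal.ofReal (C₄ + 4) * (ENNReal.ofReal (C₃ * δ) *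
          (energyTwo M s a * energyTwo M s b)) := by gcongr
      _ ≤ ENNReal.ofReal (C₄ + 4) * (ENNReal.ofReal (C₃ * δ) *
          (energy M s a * energy M s b)) :=
          mul_le_mul_right (mul_le_mul_right (mul_le_mul' (hle2 a) (hle2 b)) _) _
      _ = _ := by
          rw [← mul_assoc, ← ENNReal.ofReal_mul (by positivity)]
          congr 2; ring
  have min1 := measurable_interactionOn (χ := fun x y z => dominant y x z)
    measurable_dominant_swap ha hb
  calc _ ≤ energy M s (fun n σ => ENNReal.ofReal (M + |σ|)⁻¹ * interactionOn dominant a b n σ +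
        (ENNReal.ofReal (M + |σ|)⁻¹ * interactionOn (fun x y z => dominant y x z) a b n σ +
        ENNReal.ofReal (M + |σ|)⁻¹ * interactionOn (fun x y z => dominant y x z) b a n σ)) := by
        refine energy_mono fun n σ => ?_
        rw [← mul_add, ← mul_add]
        gcongr
        exact interaction_le ha hb n σ
    _ ≤ 2 * (ENNReal.ofReal ((C₁ + C₂) * δ) * E +
        2 * (ENNReal.ofReal ((C₄ + 4) * C₃ * δ) * E + ENNReal.ofReal ((C₄ + 4) * C₃ * δ) * E)) := by
        have mo : ∀ n, Measurable fun σ =>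
          ENNReal.ofReal (M + |σ|)⁻¹ * interactionOn dominant a b n σ := fun n => hr.mul (mout n)
        have mi : ∀ n, Measurable fun σ => ENNReal.ofReal (M + |σ|)⁻¹ *
          interactionOn (fun x y z => dominant y x z) a b n σ := fun n => hr.mul (min1 n)
        refine (energy_add_le mo).trans (mul_le_mul_right (add_le_add hout ?_) _)
        refine (energy_add_le mi).trans
          (mul_le_mul_right (add_le_add (hin a b ha hb) ((hin b a hb ha).trans ?_)) _)
        rw [hE, mul_comm (energy M s a)]
    _ = _ := by
        have : ∀ x y : ℝ≥0∞, 2 * (x * E + 2 * (y * E + y * E)) = (2 * x + 8 * y) * E := by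
          intro x y; ring
        rw [this]
        congr 1
        rw [show (2 : ℝ≥0∞) = ENNReal.ofReal 2 by norm_num,
          show (8 : ℝ≥0∞) = ENNReal.ofReal 8 by norm_num, ← ENNReal.ofReal_mul (by norm_num),
          ← ENNReal.ofReal_mul (by norm_num), ← ENNReal.ofReal_add (by positivity) (by positivity)]
        congr 1; ring

end

/-! ### A smooth time cutoff, seen on the Fourier side. -/

section

/-- `K` is an integrable kernel whose Fourier transform is `1` on `[-1, 1]`; it decays, and its
increments decay, faster than `|x|^{-2-ρ}`. -/
structure IsCutoffKernel (ρ C : ℝ) (K : ℝ → ℂ) : Prop where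
  pos : 0 < C
  continuous : Continuous K
  integrable : Integrable K volume
  integral_exp_mul : ∀ t : ℝ, |t| ≤ 1 → ∫ x : ℝ, Complex.exp (Complex.I * t * x) * K x = 1
  norm_le : ∀ x, ‖K x‖ ≤ C * (1 + |x|) ^ (-(2 + ρ))
  norm_sub_le : ∀ x y, ‖K (x - y) - K x‖ ≤
    C * (|y| / (1 + |y|)) * ((1 + |x - y|) ^ (-(2 + ρ)) + (1 + |x|) ^ (-(2 + ρ)))

theorem schwartz_norm_le (f : SchwartzMap ℝ ℂ) (r : ℝ) :
    ∃ C : ℝ, 0 < C ∧ ∀ x, ‖f x‖ ≤ C * (1 + |x|) ^ (-r) := by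
  obtain ⟨k, hk⟩ := exists_nat_ge r
  set C := 2 ^ k * (Finset.Iic ((k, 0) : ℕ × ℕ)).sup
    (fun m => SchwartzMap.seminorm ℝ m.1 m.2) f with hC
  refine ⟨|C| + 1, by positivity, fun x => ?_⟩
  have h := SchwartzMap.one_add_le_sup_seminorm_apply (𝕜 := ℝ) (m := (k, 0)) (k := k) (n := 0)
    le_rfl le_rfl f x
  rw [norm_iteratedFDeriv_zero, Real.norm_eq_abs] at h
  have hx : 1 ≤ 1 + |x| := by linarith [abs_nonneg x]
  have hx0 : 0 < 1 + |x| := by linarith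
  calc ‖f x‖ ≤ (1 + |x|) ^ k * ‖f x‖ * (1 + |x|) ^ (-r) := by
        have : 1 ≤ (1 + |x|) ^ k * (1 + |x|) ^ (-r) := by
          rw [← Real.rpow_natCast, ← Real.rpow_add hx0]
          exact Real.one_le_rpow hx (by linarith)
        nlinarith [norm_nonneg (f x)]
    _ ≤ (|C| + 1) * (1 + |x|) ^ (-r) := by
        gcongr
        linarith [le_abs_self C]

/-- `K` is the Fourier transform of a smooth bump, hence a Schwartz function, and its derivative
decays as fast as `K` does. -/
theorem exists_isCutoffKernel {ρ : ℝ} (hρ : 0 ≤ ρ) : ∃ K C, IsCutoffKernel ρ C K := by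
  let β : ContDiffBump (0 : ℝ) := ⟨1, 2, one_pos, one_lt_two⟩
  have h1 : HasCompactSupport fun x : ℝ => (β x : ℂ) :=
    β.hasCompactSupport.comp_left (g := fun r : ℝ => (r : ℂ)) Complex.ofReal_zero
  have h2 : ContDiff ℝ ((⊤ : ℕ∞) : WithTop ℕ∞) fun x : ℝ => (β x : ℂ) :=
    Complex.ofRealCLM.contDiff.comp β.contDiff
  let φ : SchwartzMap ℝ ℂ := h1.toSchwartzMap h2
  let ψ : SchwartzMap ℝ ℂ := FourierTransform.fourier φ
  obtain ⟨C₁, hC₁, hK⟩ := schwartz_norm_le ψ (2 + ρ)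
  obtain ⟨C₂, hC₂, hK'⟩ := schwartz_norm_le (SchwartzMap.derivCLM ℝ ℂ ψ) (2 + ρ)
  have hinc : ∀ x y, |y| ≤ 1 → ‖ψ (x - y) - ψ x‖ ≤ C₂ * 2 ^ (2 + ρ) * (1 + |x|) ^ (-(2 + ρ)) * |y| := by
    intro x y hy
    have hconv : Convex ℝ (Icc (x - 1) (x + 1)) := convex_Icc _ _
    have := hconv.norm_image_sub_le_of_norm_hasDerivWithin_le (f := ψ) (f' := deriv ψ)
      (x := x) (y := x - y) (C := C₂ * 2 ^ (2 + ρ) * (1 + |x|) ^ (-(2 + ρ)))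
      (fun z _ => (SchwartzMap.hasDerivAt ψ z).hasDerivWithinAt) (fun z hz => ?_)
      ⟨by linarith, by linarith⟩ (by rw [abs_le] at hy; constructor <;> linarith [hy.1, hy.2])
    · simpa using this
    · refine (hK' z).trans ?_
      rw [mul_assoc]
      gcongr
      have h3 : |x| ≤ |z| + 1 := by
        have := abs_sub_abs_le_abs_sub x z
        have : |x - z| ≤ 1 := abs_le.2 ⟨by linarith [hz.2], by linarith [hz.1]⟩
        linarith
      have h4 : (1 + |x|) / 2 ≤ 1 + |z| := by linarith [abs_nonneg z]
      have h5 : 0 < (1 + |x|) / 2 := by positivity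
      calc (1 + |z|) ^ (-(2 + ρ)) ≤ ((1 + |x|) / 2) ^ (-(2 + ρ)) :=
            Real.rpow_le_rpow_of_nonpos h5 h4 (by linarith)
        _ = 2 ^ (2 + ρ) * (1 + |x|) ^ (-(2 + ρ)) := by
            rw [Real.div_rpow (by positivity) (by norm_num), Real.rpow_neg (by norm_num : (0:ℝ) ≤ 2),
              div_inv_eq_mul, mul_comm]
  set C := 2 * C₁ + 2 * (C₂ * 2 ^ (2 + ρ)) with hC
  refine ⟨ψ, C, by positivity, ψ.continuous, ψ.integrable, fun t ht => ?_, fun x => ?_, fun x y => ?_⟩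
  -- The Fourier transform is normalized with `e^{2πi}`, so the inversion is used at `t / 2π`, well
  -- inside the unit ball where the bump is one.
  · have h3 : FourierTransform.fourierInv ψ (t / (2 * Real.pi)) = φ (t / (2 * Real.pi)) :=
      congrArg (fun f : SchwartzMap ℝ ℂ => f (t / (2 * Real.pi)))
        (FourierTransform.fourierInv_fourier_eq φ)
    rw [SchwartzMap.fourierInv_coe, Real.fourierInv_eq'] at h3
    have h4 : φ (t / (2 * Real.pi)) = 1 := by
      have : β (t / (2 * Real.pi)) = 1 := by
        refine β.one_of_mem_closedBall ?_
        rw [mem_closedBall_zero_iff, Real.norm_eq_abs, abs_div,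
          abs_of_pos Real.two_pi_pos, div_le_iff₀ Real.two_pi_pos]
        change |t| ≤ 1 * _
        linarith [Real.pi_gt_three]
      change ((β (t / (2 * Real.pi)) : ℝ) : ℂ) = 1
      rw [this, Complex.ofReal_one]
    rw [← h4, ← h3]
    refine integral_congr_ae (ae_of_all _ fun x => ?_)
    simp only [smul_eq_mul]
    congr 2
    have : (2 * Real.pi * inner ℝ x (t / (2 * Real.pi)) : ℝ) = t * x := by
      simp only [RCLike.inner_apply, conj_trivial]
      field_simp
    rw [this]
    push_cast
    ring
  · refine (hK x).trans ?_
    gcongr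
    rw [hC]
    have : 0 ≤ C₂ * 2 ^ (2 + ρ) := by positivity
    linarith
  · have a1 : 0 ≤ (1 + |x|) ^ (-(2 + ρ)) := by positivity
    have a2 : 0 ≤ (1 + |x - y|) ^ (-(2 + ρ)) := by positivity
    have hy0 := abs_nonneg y
    have a3 : 0 ≤ C₂ * 2 ^ (2 + ρ) := by positivity
    -- Small increments are estimated by the mean value inequality, large ones by the triangle
    -- inequality; the quotient `|y| / (1 + |y|)` covers both up to a factor 2.
    rcases le_total |y| 1 with hy | hy
    · refine (hinc x y hy).trans ?_
      have : |y| ≤ 2 * (|y| / (1 + |y|)) := by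
        rw [mul_div_assoc', le_div_iff₀ (by positivity)]; nlinarith
      calc _ ≤ C₂ * 2 ^ (2 + ρ) * (1 + |x|) ^ (-(2 + ρ)) * (2 * (|y| / (1 + |y|))) := by gcongr
        _ = (2 * (C₂ * 2 ^ (2 + ρ))) * (|y| / (1 + |y|)) * (0 + (1 + |x|) ^ (-(2 + ρ))) := by ring
        _ ≤ _ := by gcongr; linarith
    · have : 1 ≤ 2 * (|y| / (1 + |y|)) := by
        rw [mul_div_assoc', le_div_iff₀ (by positivity)]; nlinarith
      calc _ ≤ C₁ * (1 + |x - y|) ^ (-(2 + ρ)) + C₁ * (1 + |x|) ^ (-(2 + ρ)) :=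
            (norm_sub_le _ _).trans (add_le_add (hK _) (hK _))
        _ = C₁ * 1 * ((1 + |x - y|) ^ (-(2 + ρ)) + (1 + |x|) ^ (-(2 + ρ))) := by ring
        _ ≤ C₁ * (2 * (|y| / (1 + |y|))) * ((1 + |x - y|) ^ (-(2 + ρ)) + (1 + |x|) ^ (-(2 + ρ))) := by
            gcongr
        _ = (2 * C₁) * (|y| / (1 + |y|)) * ((1 + |x - y|) ^ (-(2 + ρ)) + (1 + |x|) ^ (-(2 + ρ))) := by
            ring
        _ ≤ _ := by gcongr; linarith

end

/-! ### Localization in time is bounded on the resolution space. -/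

section

variable {d : ℕ}

theorem lintegral_conv {k f : ℝ → ℝ≥0∞} (hk : Measurable k) (hf : Measurable f) :
    ∫⁻ σ, ∫⁻ y, k (σ - y) * f y = (∫⁻ x, k x) * ∫⁻ y, f y := by
  have hm : Measurable fun q : ℝ × ℝ => k (q.1 - q.2) * f q.2 :=
    (hk.comp (measurable_fst.sub measurable_snd)).mul (hf.comp measurable_snd)
  rw [lintegral_lintegral_swap hm.aemeasurable]
  have h : ∀ y, ∫⁻ σ, k (σ - y) * f y = (∫⁻ x, k x) * f y := fun y => by
    rw [lintegral_mul_const _ (by fun_prop), lintegral_sub_right_eq_self]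
  simp_rw [h]
  rw [lintegral_const_mul _ hf]

theorem lintegral_sq_conv_le {k f : ℝ → ℝ≥0∞} (hk : Measurable k) (hf : Measurable f) :
    ∫⁻ σ, (∫⁻ y, k (σ - y) * f y) ^ 2 ≤ (∫⁻ x, k x) ^ 2 * ∫⁻ y, f y ^ 2 := by
  have h : ∀ σ, (∫⁻ y, k (σ - y) * f y) ^ 2 ≤
      (∫⁻ x, k x) * ∫⁻ y, k (σ - y) * f y ^ 2 := fun σ => by
    rw [← lintegral_sub_left_eq_self k σ]
    refine sq_lintegral_le_mul (by fun_prop) (by fun_prop) fun y => le_of_eq ?_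
    ring
  refine (lintegral_mono h).trans ?_
  have hm : Measurable fun q : ℝ × ℝ => k (q.1 - q.2) * f q.2 ^ 2 :=
    (hk.comp (measurable_fst.sub measurable_snd)).mul ((hf.comp measurable_snd).pow_const 2)
  rw [lintegral_const_mul _ hm.lintegral_prod_right',
    lintegral_conv (f := fun y => f y ^ 2) hk (hf.pow_const 2)]
  exact le_of_eq (by ring)

theorem lintegral_sq_conv_le' {k f : ℝ → ℝ≥0∞} (hk : Measurable k) (hf : Measurable f) :
    ∫⁻ σ, (∫⁻ y, k (σ - y) * f y) ^ 2 ≤ (∫⁻ x, k x ^ 2) * (∫⁻ y, f y) ^ 2 := by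
  have h : ∀ σ, (∫⁻ y, k (σ - y) * f y) ^ 2 ≤ (∫⁻ x, f x) * ∫⁻ y, k (σ - y) ^ 2 * f y := fun σ => by
    refine sq_lintegral_le_mul (by fun_prop) (by fun_prop) fun y => le_of_eq ?_
    ring
  refine (lintegral_mono h).trans ?_
  have hm : Measurable fun q : ℝ × ℝ => k (q.1 - q.2) ^ 2 * f q.2 :=
    ((hk.comp (measurable_fst.sub measurable_snd)).pow_const 2).mul (hf.comp measurable_snd)
  rw [lintegral_const_mul _ hm.lintegral_prod_right',
    lintegral_conv (k := fun y => k y ^ 2) (hk.pow_const 2) hf]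
  exact le_of_eq (by ring)

/-- An integrable majorant, on the scale `M`, of the kernels that localize in time. -/
def cutKernel (M x : ℝ) : ℝ := M * (M + |x|) ^ (-2 : ℝ)

theorem cutKernel_nonneg {M : ℝ} (hM : 0 < M) (x : ℝ) : 0 ≤ cutKernel M x := by
  unfold cutKernel; positivity

theorem measurable_cutKernel (M : ℝ) : Measurable (cutKernel M) := by
  unfold cutKernel; fun_prop

theorem exists_lintegral_cutKernel_le :
    ∃ C : ℝ, 0 < C ∧ ∀ M : ℝ, 0 < M → ∫⁻ x, ENNReal.ofReal (cutKernel M x) ≤ ENNReal.ofReal C := by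
  obtain ⟨C, hC, h⟩ := exists_lintegral_bracket_le (b := 2) (by norm_num)
  refine ⟨C, hC, fun M hM => ?_⟩
  unfold cutKernel
  simp_rw [ENNReal.ofReal_mul hM.le]
  rw [lintegral_const_mul' _ _ ENNReal.ofReal_ne_top]
  refine (mul_le_mul_right (h M hM) _).trans (le_of_eq ?_)
  rw [← ENNReal.ofReal_mul hM.le]
  congr 1
  rw [show (1 - 2 : ℝ) = -1 by norm_num, Real.rpow_neg_one]
  field_simp

/-- The factor multiplying `cutKernel` is the square root of the part of `modWeight` without the
frequency. The normalization `M^(-1/3)` in `modWeight` is the one that makes this integral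
independent of `M`. -/
theorem exists_lintegral_cutKernel_sq_le :
    ∃ C : ℝ, 0 < C ∧ ∀ M : ℝ, 0 < M →
      ∫⁻ x, ENNReal.ofReal (M ^ (-(1 / 6) : ℝ) * (M + |x|) ^ (2 / 3 : ℝ) * cutKernel M x) ^ 2 ≤
        ENNReal.ofReal C := by
  obtain ⟨C, hC, h⟩ := exists_lintegral_bracket_le (b := 8 / 3) (by norm_num)
  refine ⟨C, hC, fun M hM => ?_⟩
  have e : ∀ x : ℝ, ENNReal.ofReal (M ^ (-(1 / 6) : ℝ) * (M + |x|) ^ (2 / 3 : ℝ) *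
      cutKernel M x) ^ 2 =
      ENNReal.ofReal (M ^ (5 / 3 : ℝ)) * ENNReal.ofReal ((M + |x|) ^ (-(8 / 3) : ℝ)) := fun x => by
    have hx : 0 < M + |x| := by positivity
    have hc := cutKernel_nonneg hM x
    rw [← ENNReal.ofReal_pow (by positivity), ← ENNReal.ofReal_mul (by positivity)]
    congr 1
    unfold cutKernel
    have e1 : M ^ (5 / 3 : ℝ) = (M ^ (-(1 / 6) : ℝ) * M) ^ 2 := by
      nth_rw 3 [← Real.rpow_one M]
      rw [← Real.rpow_add hM, ← Real.rpow_natCast, ← Real.rpow_mul hM.le]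
      norm_num
    have e2 : (M + |x|) ^ (-(8 / 3) : ℝ) = ((M + |x|) ^ (2 / 3 : ℝ) * (M + |x|) ^ (-2 : ℝ)) ^ 2 := by
      rw [← Real.rpow_add hx, ← Real.rpow_natCast, ← Real.rpow_mul hx.le]
      norm_num
    rw [e1, e2]; ring
  simp_rw [e]
  rw [lintegral_const_mul' _ _ ENNReal.ofReal_ne_top]
  refine (mul_le_mul_right (h M hM) _).trans (le_of_eq ?_)
  rw [← ENNReal.ofReal_mul (by positivity)]
  congr 1
  rw [mul_left_comm, ← Real.rpow_add hM]
  norm_num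

/-- The part of `modWeight` that does not depend on the time scale. -/
def baseWeight (s : ℝ) (n : Freq d) (σ : ℝ) : ℝ := |σ| ^ (4 / 3 : ℝ) * (freqWeight n + |σ|) ^ s

theorem baseWeight_le_modWeight {M : ℝ} (hM : 0 < M) (s : ℝ) (n : Freq d) (σ : ℝ) :
    M ^ (-(1 / 3) : ℝ) * baseWeight s n σ ≤ modWeight M s n σ := by
  have := freqWeight_pos n
  unfold baseWeight modWeight
  rw [mul_assoc]
  gcongr
  linarith

/-- The function is a product of `(x / (p + x))^(2/3)` and `(p + x)^(s/2 + 2/3)`, both increasing.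
-/
theorem rpow_mul_rpow_le {s : ℝ} (hs : -(2 / 3) < s) (hs' : s ≤ -(1 / 2)) {p x y : ℝ} (hp : 0 < p)
    (hx : 0 ≤ x) (hxy : x ≤ y) :
    x ^ (2 / 3 : ℝ) * (p + x) ^ (s / 2) ≤ y ^ (2 / 3 : ℝ) * (p + y) ^ (s / 2) := by
  have hy : 0 ≤ y := hx.trans hxy
  have key : ∀ z : ℝ, 0 ≤ z → z ^ (2 / 3 : ℝ) * (p + z) ^ (s / 2) =
      (z / (p + z)) ^ (2 / 3 : ℝ) * (p + z) ^ (s / 2 + 2 / 3) := fun z hz => by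
    rw [Real.div_rpow hz (by positivity), Real.rpow_add (by positivity)]
    have : (p + z) ^ (2 / 3 : ℝ) ≠ 0 := by positivity
    field_simp
  rw [key x hx, key y hy]
  have h1 : x / (p + x) ≤ y / (p + y) := by
    rw [div_le_div_iff₀ (by positivity) (by positivity)]; nlinarith
  have h2 : 0 ≤ s / 2 + 2 / 3 := by linarith
  gcongr

/-- A substitute for the triangle inequality: if `|σ| ≤ 2|y|`, the weight passes to `y` by
monotonicity; otherwise `|σ| ≤ 2|σ - y|`, and it passes to the convolution kernel at the price of
`freqWeight n ^ (s/2)`. -/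
theorem sqrt_modWeight_le {M s : ℝ} (hM : 0 < M) (hs : -(2 / 3) < s) (hs' : s ≤ -(1 / 2))
    (n : Freq d) (σ y : ℝ) :
    M ^ (-(1 / 6) : ℝ) * (M + |σ|) ^ (2 / 3 : ℝ) * (freqWeight n + |σ|) ^ (s / 2) ≤
      3 * (M ^ (-(1 / 6) : ℝ) * (|y| ^ (2 / 3 : ℝ) * (freqWeight n + |y|) ^ (s / 2)) +
        freqWeight n ^ (s / 2) * (M ^ (-(1 / 6) : ℝ) * (M + |σ - y|) ^ (2 / 3 : ℝ))) := by
  have hp := freqWeight_pos n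
  set p := freqWeight n with hpdef
  set A := |y| ^ (2 / 3 : ℝ) * (p + |y|) ^ (s / 2) with hA
  set B := p ^ (s / 2) * (M + |σ - y|) ^ (2 / 3 : ℝ) with hB
  have hA0 : 0 ≤ A := by positivity
  have hB0 : 0 ≤ B := by positivity
  have two : (2 : ℝ) ^ (2 / 3 : ℝ) ≤ 2 := by
    calc (2 : ℝ) ^ (2 / 3 : ℝ) ≤ 2 ^ (1 : ℝ) :=
          Real.rpow_le_rpow_of_exponent_le (by norm_num) (by norm_num)
      _ = 2 := Real.rpow_one 2
  have mono : ∀ x, 0 ≤ x → (p + x) ^ (s / 2) ≤ p ^ (s / 2) := fun x hx =>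
    Real.rpow_le_rpow_of_nonpos hp (by linarith) (by linarith)
  have h1 : M ^ (2 / 3 : ℝ) * (p + |σ|) ^ (s / 2) ≤ B := by
    rw [hB, mul_comm]
    have := mono _ (abs_nonneg σ)
    gcongr
    linarith [abs_nonneg (σ - y)]
  have h2 : |σ| ^ (2 / 3 : ℝ) * (p + |σ|) ^ (s / 2) ≤ 2 * (A + B) := by
    rcases le_total |σ| (2 * |y|) with h | h
    · calc |σ| ^ (2 / 3 : ℝ) * (p + |σ|) ^ (s / 2)
          ≤ (2 * |y|) ^ (2 / 3 : ℝ) * (p + 2 * |y|) ^ (s / 2) :=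
            rpow_mul_rpow_le hs hs' hp (abs_nonneg _) h
        _ ≤ (2 * |y| ^ (2 / 3 : ℝ)) * (p + |y|) ^ (s / 2) := by
            rw [Real.mul_rpow (by norm_num) (abs_nonneg _)]
            refine mul_le_mul (by gcongr) ?_ (by positivity) (by positivity)
            exact Real.rpow_le_rpow_of_nonpos (by positivity) (by linarith [abs_nonneg y])
              (by linarith)
        _ ≤ 2 * (A + B) := by rw [hA]; linarith
    · have h3 : |σ| ≤ 2 * (M + |σ - y|) := by
        have := abs_sub_abs_le_abs_sub σ y
        linarith
      calc |σ| ^ (2 / 3 : ℝ) * (p + |σ|) ^ (s / 2)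
          ≤ (2 * (M + |σ - y|)) ^ (2 / 3 : ℝ) * p ^ (s / 2) :=
            mul_le_mul (by gcongr) (mono _ (abs_nonneg _)) (by positivity) (by positivity)
        _ ≤ (2 * (M + |σ - y|) ^ (2 / 3 : ℝ)) * p ^ (s / 2) := by
            rw [Real.mul_rpow (by norm_num) (by positivity)]
            gcongr
        _ ≤ 2 * (A + B) := by rw [hB]; linarith
  have h4 : (M + |σ|) ^ (2 / 3 : ℝ) ≤ M ^ (2 / 3 : ℝ) + |σ| ^ (2 / 3 : ℝ) :=
    Real.rpow_add_le_add_rpow hM.le (abs_nonneg _) (by norm_num) (by norm_num)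
  calc _ ≤ M ^ (-(1 / 6) : ℝ) * (M ^ (2 / 3 : ℝ) + |σ| ^ (2 / 3 : ℝ)) * (p + |σ|) ^ (s / 2) := by
        gcongr
    _ = M ^ (-(1 / 6) : ℝ) * (M ^ (2 / 3 : ℝ) * (p + |σ|) ^ (s / 2) +
          |σ| ^ (2 / 3 : ℝ) * (p + |σ|) ^ (s / 2)) := by ring
    _ ≤ M ^ (-(1 / 6) : ℝ) * (B + 2 * (A + B)) := by gcongr
    _ ≤ M ^ (-(1 / 6) : ℝ) * (3 * (A + B)) := by gcongr; linarith
    _ = _ := by rw [hB]; ring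

theorem modWeight_eq_sq {M s : ℝ} (hM : 0 < M) (n : Freq d) (σ : ℝ) :
    modWeight M s n σ =
      (M ^ (-(1 / 6) : ℝ) * (M + |σ|) ^ (2 / 3 : ℝ) * (freqWeight n + |σ|) ^ (s / 2)) ^ 2 := by
  have hp := freqWeight_pos n
  unfold modWeight
  rw [mul_pow, mul_pow, ← Real.rpow_natCast, ← Real.rpow_natCast, ← Real.rpow_natCast,
    ← Real.rpow_mul hM.le, ← Real.rpow_mul (by positivity), ← Real.rpow_mul (by positivity)]
  norm_num

theorem baseWeight_eq_sq {s : ℝ} (n : Freq d) (σ : ℝ) :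
    baseWeight s n σ = (|σ| ^ (2 / 3 : ℝ) * (freqWeight n + |σ|) ^ (s / 2)) ^ 2 := by
  have hp := freqWeight_pos n
  unfold baseWeight
  rw [mul_pow, ← Real.rpow_natCast, ← Real.rpow_natCast,
    ← Real.rpow_mul (by positivity), ← Real.rpow_mul (by positivity)]
  norm_num

/-- The weighted `L²` energy with the weight that does not depend on the time scale. -/
def energyBase (s : ℝ) (a : Freq d → ℝ → ℝ≥0∞) : ℝ≥0∞ :=
  ∑' n, ∫⁻ σ, ENNReal.ofReal (baseWeight s n σ) * a n σ ^ 2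

theorem energyBase_le_energyTwo {M s : ℝ} (hM : 0 < M) (a : Freq d → ℝ → ℝ≥0∞) :
    ENNReal.ofReal (M ^ (-(1 / 3) : ℝ)) * energyBase s a ≤ energyTwo M s a := by
  unfold energyBase energyTwo
  rw [← ENNReal.tsum_mul_left]
  refine ENNReal.tsum_le_tsum fun n => ?_
  rw [← lintegral_const_mul' _ _ ENNReal.ofReal_ne_top]
  refine lintegral_mono fun σ => ?_
  rw [← mul_assoc, ← ENNReal.ofReal_mul (by positivity)]
  exact mul_le_mul_left (ENNReal.ofReal_le_ofReal (baseWeight_le_modWeight hM s n σ)) _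

/-- Localization in time is bounded on the resolution space. -/
theorem exists_energy_cutKernel_conv_le {s : ℝ} (hs : -(2 / 3) < s) (hs' : s ≤ -(1 / 2)) :
    ∃ C : ℝ, 0 < C ∧ ∀ M : ℝ, 0 < M → ∀ f : Freq d → ℝ → ℝ≥0∞, (∀ n, Measurable (f n)) →
      energy M s (fun n σ => ∫⁻ y, ENNReal.ofReal (cutKernel M (σ - y)) * f n y) ≤
        ENNReal.ofReal C *
          (energyOne s f + ENNReal.ofReal (M ^ (-(1 / 3) : ℝ)) * energyBase s f) := by
  obtain ⟨C₁, hC₁, h₁⟩ := exists_lintegral_cutKernel_le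
  obtain ⟨C₂, hC₂, h₂⟩ := exists_lintegral_cutKernel_sq_le
  refine ⟨C₁ ^ 2 + 18 * (C₁ ^ 2 + C₂), by positivity, fun M hM f hf => ?_⟩
  have hκm : Measurable fun x => ENNReal.ofReal (cutKernel M x) :=
    (measurable_cutKernel M).ennreal_ofReal
  have e1 : energyOne s (fun n σ => ∫⁻ y, ENNReal.ofReal (cutKernel M (σ - y)) * f n y) ≤
      ENNReal.ofReal (C₁ ^ 2) * energyOne s f := by
    unfold energyOne
    rw [← ENNReal.tsum_mul_left]
    refine ENNReal.tsum_le_tsum fun n => ?_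
    rw [lintegral_conv hκm (hf n), mul_pow, mul_left_comm, ENNReal.ofReal_pow hC₁.le]
    exact mul_le_mul_left (pow_le_pow_left' (h₁ M hM) 2) _
  set W := ENNReal.ofReal (M ^ (-(1 / 3) : ℝ)) * energyBase s f with hW
  have e2 : energyTwo M s (fun n σ => ∫⁻ y, ENNReal.ofReal (cutKernel M (σ - y)) * f n y) ≤
      ENNReal.ofReal (18 * C₁ ^ 2) * W + ENNReal.ofReal (18 * C₂) * energyOne s f := by
    unfold energyTwo
    rw [hW]
    unfold energyBase energyOne
    rw [← ENNReal.tsum_mul_left, ← ENNReal.tsum_mul_left, ← ENNReal.tsum_mul_left,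
      ← ENNReal.tsum_add]
    refine ENNReal.tsum_le_tsum fun n => ?_
    have hp := freqWeight_pos n
    set F : ℝ → ℝ≥0∞ := fun y => ENNReal.ofReal (M ^ (-(1 / 6) : ℝ) *
      (|y| ^ (2 / 3 : ℝ) * (freqWeight n + |y|) ^ (s / 2))) * f n y with hF
    have hFm : Measurable F := Measurable.mul (by fun_prop) (hf n)
    set v : ℝ → ℝ≥0∞ := fun x =>
      ENNReal.ofReal (M ^ (-(1 / 6) : ℝ) * (M + |x|) ^ (2 / 3 : ℝ) * cutKernel M x) with hv
    have hvm : Measurable v := by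
      have := measurable_cutKernel M
      exact (Measurable.mul (by fun_prop) this).ennreal_ofReal
    set q := ENNReal.ofReal (freqWeight n ^ (s / 2)) with hq
    -- The first term is an `L¹ * L²` convolution and returns the weighted `L²` energy; the second
    -- is an `L² * L¹` convolution and returns the `ℓ²L¹` energy. The constant is `18 = 3² · 2`.
    have hpt : ∀ σ, ENNReal.ofReal (modWeight M s n σ) *
        (∫⁻ y, ENNReal.ofReal (cutKernel M (σ - y)) * f n y) ^ 2 ≤
        18 * ((∫⁻ y, ENNReal.ofReal (cutKernel M (σ - y)) * F y) ^ 2 +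
          q ^ 2 * (∫⁻ y, v (σ - y) * f n y) ^ 2) := by
      intro σ
      rw [modWeight_eq_sq hM, ENNReal.ofReal_pow (by positivity), ← mul_pow,
        ← lintegral_const_mul' _ _ ENNReal.ofReal_ne_top]
      have m1 : Measurable fun y => ENNReal.ofReal (cutKernel M (σ - y)) * F y :=
        (hκm.comp (g := fun x => ENNReal.ofReal (cutKernel M x)) (f := fun y => σ - y)
          (by fun_prop)).mul hFm
      calc _ ≤ (∫⁻ y, 3 * (ENNReal.ofReal (cutKernel M (σ - y)) * F y +
            q * (v (σ - y) * f n y))) ^ 2 := by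
            refine pow_le_pow_left' (lintegral_mono fun y => ?_) 2
            have hc := cutKernel_nonneg hM (σ - y)
            rw [← mul_assoc, ← ENNReal.ofReal_mul (by positivity)]
            calc _ ≤ ENNReal.ofReal (3 * (cutKernel M (σ - y) * (M ^ (-(1 / 6) : ℝ) *
                  (|y| ^ (2 / 3 : ℝ) * (freqWeight n + |y|) ^ (s / 2))) +
                  freqWeight n ^ (s / 2) * (M ^ (-(1 / 6) : ℝ) *
                    (M + |σ - y|) ^ (2 / 3 : ℝ) * cutKernel M (σ - y)))) * f n y := by
                  refine mul_le_mul_left (ENNReal.ofReal_le_ofReal ?_) _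
                  refine (mul_le_mul_of_nonneg_right (sqrt_modWeight_le hM hs hs' n σ y) hc).trans
                    (le_of_eq (by ring))
              _ = _ := by
                  rw [ENNReal.ofReal_mul (by norm_num), ENNReal.ofReal_add (by positivity)
                    (by positivity), ENNReal.ofReal_mul hc,
                    ENNReal.ofReal_mul (p := freqWeight n ^ (s / 2)) (by positivity)]
                  norm_num
                  simp only [hF, hv, hq]
                  ring
        _ = 9 * (∫⁻ y, ENNReal.ofReal (cutKernel M (σ - y)) * F y +
            q * (v (σ - y) * f n y)) ^ 2 := by
            rw [lintegral_const_mul' _ _ (by norm_num)]; ring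
        _ = 9 * ((∫⁻ y, ENNReal.ofReal (cutKernel M (σ - y)) * F y) +
            q * ∫⁻ y, v (σ - y) * f n y) ^ 2 := by
            rw [lintegral_add_left m1, lintegral_const_mul' _ _ ENNReal.ofReal_ne_top]
        _ ≤ 9 * (2 * ((∫⁻ y, ENNReal.ofReal (cutKernel M (σ - y)) * F y) ^ 2 +
            (q * ∫⁻ y, v (σ - y) * f n y) ^ 2)) := by
            exact mul_le_mul_right (add_sq_le_two_mul _ _) _
        _ = _ := by rw [mul_pow]; ring
    have c1 : Measurable fun σ => (∫⁻ y, ENNReal.ofReal (cutKernel M (σ - y)) * F y) ^ 2 := by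
      have : Measurable fun q : ℝ × ℝ => ENNReal.ofReal (cutKernel M (q.1 - q.2)) * F q.2 :=
        (hκm.comp (g := fun x => ENNReal.ofReal (cutKernel M x)) (f := fun q : ℝ × ℝ => q.1 - q.2)
          (by fun_prop)).mul (hFm.comp measurable_snd)
      exact this.lintegral_prod_right'.pow_const 2
    refine (lintegral_mono hpt).trans ?_
    rw [lintegral_const_mul' _ _ (by norm_num), lintegral_add_left c1,
      lintegral_const_mul' _ _ (ENNReal.pow_ne_top ENNReal.ofReal_ne_top)]
    have b1 : ∫⁻ σ, (∫⁻ y, ENNReal.ofReal (cutKernel M (σ - y)) * F y) ^ 2 ≤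
        ENNReal.ofReal (C₁ ^ 2) * (ENNReal.ofReal (M ^ (-(1 / 3) : ℝ)) *
          ∫⁻ σ, ENNReal.ofReal (baseWeight s n σ) * f n σ ^ 2) := by
      refine (lintegral_sq_conv_le hκm hFm).trans ?_
      rw [ENNReal.ofReal_pow hC₁.le]
      refine mul_le_mul' (pow_le_pow_left' (h₁ M hM) 2) (le_of_eq ?_)
      rw [← lintegral_const_mul' _ _ ENNReal.ofReal_ne_top]
      refine lintegral_congr fun y => ?_
      simp only [hF]
      rw [mul_pow, ← ENNReal.ofReal_pow (by positivity),
        ← mul_assoc (ENNReal.ofReal (M ^ (-(1 / 3) : ℝ))),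
        ← ENNReal.ofReal_mul (by positivity), baseWeight_eq_sq]
      congr 2
      rw [mul_pow]
      congr 1
      rw [← Real.rpow_natCast, ← Real.rpow_mul hM.le]
      norm_num
    have b2 : q ^ 2 * ∫⁻ σ, (∫⁻ y, v (σ - y) * f n y) ^ 2 ≤
        ENNReal.ofReal C₂ * (ENNReal.ofReal (freqWeight n ^ s) * (∫⁻ y, f n y) ^ 2) := by
      have hq2 : q ^ 2 = ENNReal.ofReal (freqWeight n ^ s) := by
        rw [hq, ← ENNReal.ofReal_pow (by positivity), ← Real.rpow_natCast, ← Real.rpow_mul hp.le]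
        norm_num
      rw [hq2, mul_left_comm]
      refine mul_le_mul_right ?_ _
      exact (lintegral_sq_conv_le' hvm (hf n)).trans (mul_le_mul_left (h₂ M hM) _)
    refine (mul_le_mul_right (add_le_add b1 b2) _).trans (le_of_eq ?_)
    rw [ENNReal.ofReal_mul (by norm_num), ENNReal.ofReal_mul (p := 18) (q := C₂) (by norm_num)]
    norm_num
    ring
  calc _ ≤ ENNReal.ofReal (C₁ ^ 2) * energyOne s f +
        (ENNReal.ofReal (18 * C₁ ^ 2) * W + ENNReal.ofReal (18 * C₂) * energyOne s f) :=
        add_le_add e1 e2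
    _ = ENNReal.ofReal (C₁ ^ 2 + 18 * C₂) * energyOne s f + ENNReal.ofReal (18 * C₁ ^ 2) * W := by
        rw [ENNReal.ofReal_add (by positivity) (by positivity)]; ring
    _ ≤ ENNReal.ofReal (C₁ ^ 2 + 18 * (C₁ ^ 2 + C₂)) * energyOne s f +
        ENNReal.ofReal (C₁ ^ 2 + 18 * (C₁ ^ 2 + C₂)) * W := by
        refine add_le_add ?_ ?_ <;>
        · refine mul_le_mul_left (ENNReal.ofReal_le_ofReal ?_) _
          nlinarith [sq_nonneg C₁]
    _ = _ := by rw [← mul_add]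

/-- Serves the free evolution and the boundary term `K (σ / M)` of the Duhamel kernel. In both,
frequency and modulation separate. -/
theorem exists_energy_cutKernel_mul_le {s : ℝ} (hs' : s ≤ -(1 / 2)) :
    ∃ C : ℝ, 0 < C ∧ ∀ M : ℝ, 0 < M → ∀ c : Freq d → ℝ≥0∞,
      energy M s (fun n σ => ENNReal.ofReal (cutKernel M σ) * c n) ≤
        ENNReal.ofReal C * ∑' n, ENNReal.ofReal (freqWeight n ^ s) * c n ^ 2 := by
  obtain ⟨C₁, hC₁, h₁⟩ := exists_lintegral_cutKernel_le
  obtain ⟨C₂, hC₂, h₂⟩ := exists_lintegral_cutKernel_sq_le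
  refine ⟨C₁ ^ 2 + C₂, by positivity, fun M hM c => ?_⟩
  have hκm : Measurable fun x => ENNReal.ofReal (cutKernel M x) :=
    (measurable_cutKernel M).ennreal_ofReal
  rw [ENNReal.ofReal_add (by positivity) hC₂.le, add_mul, ← ENNReal.tsum_mul_left,
    ← ENNReal.tsum_mul_left]
  refine add_le_add (ENNReal.tsum_le_tsum fun n => ?_) (ENNReal.tsum_le_tsum fun n => ?_)
  · rw [lintegral_mul_const _ hκm, mul_pow, mul_left_comm, ENNReal.ofReal_pow hC₁.le]
    exact mul_le_mul_left (pow_le_pow_left' (h₁ M hM) 2) _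
  · have hp := freqWeight_pos n
    have hpt : ∀ σ, ENNReal.ofReal (modWeight M s n σ) *
        (ENNReal.ofReal (cutKernel M σ) * c n) ^ 2 ≤
        ENNReal.ofReal (M ^ (-(1 / 6) : ℝ) * (M + |σ|) ^ (2 / 3 : ℝ) * cutKernel M σ) ^ 2 *
          (ENNReal.ofReal (freqWeight n ^ s) * c n ^ 2) := fun σ => by
      have hc := cutKernel_nonneg hM σ
      rw [mul_pow, ← mul_assoc, ← mul_assoc, ← ENNReal.ofReal_pow hc,
        ← ENNReal.ofReal_pow (by positivity), ← ENNReal.ofReal_mul (modWeight_pos hM s n σ).le,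
        ← ENNReal.ofReal_mul (by positivity)]
      refine mul_le_mul_left (ENNReal.ofReal_le_ofReal ?_) _
      rw [modWeight_eq_sq hM, mul_pow _ ((freqWeight n + |σ|) ^ (s / 2)), mul_pow _ (cutKernel M σ)]
      have : ((freqWeight n + |σ|) ^ (s / 2)) ^ 2 ≤ freqWeight n ^ s := by
        rw [← Real.rpow_natCast, ← Real.rpow_mul (by positivity)]
        norm_num
        exact Real.rpow_le_rpow_of_nonpos hp (by linarith [abs_nonneg σ]) (by linarith)
      calc _ ≤ (M ^ (-(1 / 6) : ℝ) * (M + |σ|) ^ (2 / 3 : ℝ)) ^ 2 * freqWeight n ^ s *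
            cutKernel M σ ^ 2 := by gcongr
        _ = _ := by ring
    refine (lintegral_mono hpt).trans ?_
    have hvm : Measurable fun σ =>
        ENNReal.ofReal (M ^ (-(1 / 6) : ℝ) * (M + |σ|) ^ (2 / 3 : ℝ) * cutKernel M σ) ^ 2 := by
      have := measurable_cutKernel M
      exact (Measurable.mul (by fun_prop) this).ennreal_ofReal.pow_const 2
    rw [lintegral_mul_const _ hvm]
    exact mul_le_mul_left (h₂ M hM) _

end

/-! ### Persistence of regularity and the truncated Duhamel operator. -/

section

variable {d : ℕ}

/-- The persistence weight. -/
def spread (M : ℝ) (n : Freq d) (σ : ℝ) : ℝ := freqWeight n + |σ| / M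

theorem measurable_spread (M : ℝ) (n : Freq d) : Measurable (spread M n) := by
  unfold spread; fun_prop

theorem one_le_spread {M : ℝ} (hM : 0 < M) (n : Freq d) (σ : ℝ) : 1 ≤ spread M n σ := by
  have := one_le_freqWeight n
  have : 0 ≤ |σ| / M := by positivity
  unfold spread; linarith

/-- Modulations enter `spread` in units of `M`, so moving the weight across a kernel of width `M`
costs a power of `1 + |σ - y| / M`. The additional decay `ρ` of the cutoff kernel absorbs it. -/
theorem spread_le_mul {M : ℝ} (hM : 0 < M) (n : Freq d) (σ y : ℝ) :
    spread M n σ ≤ spread M n y * (1 + |σ - y| / M) := by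
  have h1 := one_le_freqWeight n
  have h2 : |σ| / M ≤ |y| / M + |σ - y| / M := by
    rw [← add_div]
    gcongr
    have := abs_sub_abs_le_abs_sub σ y
    linarith
  have h3 : 0 ≤ |σ - y| / M := by positivity
  have h4 : 0 ≤ |y| / M := by positivity
  unfold spread
  nlinarith

theorem spread_le_mul' {M : ℝ} (hM : 0 < M) (n : Freq d) (σ : ℝ) :
    spread M n σ ≤ freqWeight n * (1 + |σ| / M) := by
  have h1 := one_le_freqWeight n
  have h3 : 0 ≤ |σ| / M := by positivity
  unfold spread
  nlinarith

theorem freqWeight_le_spread {M : ℝ} (hM : 0 < M) (n : Freq d) (σ : ℝ) :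
    freqWeight n ≤ spread M n σ := by
  have h3 : 0 ≤ |σ| / M := by positivity
  unfold spread
  linarith

theorem freqSq_le_two_mul (n k : Freq d) : freqSq n ≤ 2 * (freqSq k + freqSq (-n - k)) := by
  unfold freqSq
  rw [← Finset.sum_add_distrib, Finset.mul_sum]
  refine Finset.sum_le_sum fun i _ => ?_
  simp only [Pi.sub_apply, Pi.neg_apply]
  push_cast
  nlinarith [sq_nonneg ((n i : ℝ) + 2 * k i)]

/-- The output modulation is the phase minus the input modulations, and the phase is at most `3(|k|²
+ |n + k|²)`; division by `M ≥ 1` does no harm. With `|n|² ≤ 2(|k|² + |n + k|²)` this gives the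
constant 5, and a Leibniz rule for powers of the weight. -/
theorem spread_le_add {M : ℝ} (hM : 1 ≤ M) (n k : Freq d) (σ x : ℝ) :
    spread M n σ ≤ 5 * (spread M k x + spread M (-n - k) (phase n k - σ - x)) := by
  have hM0 : 0 < M := by linarith
  have h1 := freqSq_le_two_mul n k
  have hk : 0 ≤ freqSq k := freqSq_nonneg k
  have hm : 0 ≤ freqSq (-n - k) := freqSq_nonneg _
  set y := phase n k - σ - x with hy
  have h2 : |σ| ≤ phase n k + |x| + |y| := by
    have e : σ = phase n k - x - y := by rw [hy]; ring
    calc |σ| = |phase n k - x - y| := by rw [← e]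
      _ ≤ |phase n k| + |x| + |y| :=
          (abs_sub _ _).trans (add_le_add_left (abs_sub _ _) _)
      _ = _ := by rw [abs_of_nonneg (phase_nonneg n k)]
  have h3 : |σ| / M ≤ phase n k + |x| / M + |y| / M := by
    have : phase n k / M ≤ phase n k := div_le_self (phase_nonneg n k) hM
    calc |σ| / M ≤ (phase n k + |x| + |y|) / M := by gcongr
      _ = phase n k / M + |x| / M + |y| / M := by ring
      _ ≤ _ := by linarith
  have h4 : phase n k ≤ 3 * (freqSq k + freqSq (-n - k)) := by unfold phase; linarith
  have h5 : 0 ≤ |x| / M := by positivity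
  have h6 : 0 ≤ |y| / M := by positivity
  unfold spread freqWeight
  linarith

theorem spread_rpow_le_add {M ρ : ℝ} (hM : 1 ≤ M) (hρ : 0 ≤ ρ) (n k : Freq d) (σ x : ℝ) :
    spread M n σ ^ ρ ≤
      10 ^ ρ * (spread M k x ^ ρ + spread M (-n - k) (phase n k - σ - x) ^ ρ) := by
  have hM0 : 0 < M := by linarith
  have h := spread_le_add hM n k σ x
  have h0 := one_le_spread hM0 n σ
  have h1 := one_le_spread hM0 k x
  have h2 := one_le_spread hM0 (-n - k) (phase n k - σ - x)
  set a := spread M k x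
  set b := spread M (-n - k) (phase n k - σ - x)
  have ha : 0 ≤ a ^ ρ := by positivity
  have hb : 0 ≤ b ^ ρ := by positivity
  rcases le_total a b with hab | hab
  · calc spread M n σ ^ ρ ≤ (10 * b) ^ ρ := Real.rpow_le_rpow (by linarith) (by linarith) hρ
      _ = 10 ^ ρ * b ^ ρ := Real.mul_rpow (by norm_num) (by linarith)
      _ ≤ _ := by gcongr; linarith
  · calc spread M n σ ^ ρ ≤ (10 * a) ^ ρ := Real.rpow_le_rpow (by linarith) (by linarith) hρ
      _ = 10 ^ ρ * a ^ ρ := Real.mul_rpow (by norm_num) (by linarith)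
      _ ≤ _ := by gcongr; linarith

/-- The multiplication by a power of the persistence weight. -/
def weighted (M ρ : ℝ) (a : Freq d → ℝ → ℝ≥0∞) : Freq d → ℝ → ℝ≥0∞ :=
  fun n σ => ENNReal.ofReal (spread M n σ ^ ρ) * a n σ

theorem measurable_weighted {M ρ : ℝ} {a : Freq d → ℝ → ℝ≥0∞} (ha : ∀ n, Measurable (a n))
    (n : Freq d) : Measurable (weighted M ρ a n) :=
  ((measurable_spread M n).pow_const ρ).ennreal_ofReal.mul (ha n)

theorem le_weighted {M ρ : ℝ} (hM : 0 < M) (hρ : 0 ≤ ρ) (a : Freq d → ℝ → ℝ≥0∞) (n : Freq d)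
    (σ : ℝ) : a n σ ≤ weighted M ρ a n σ := by
  unfold weighted
  refine le_mul_of_one_le_left' ?_
  rw [← ENNReal.ofReal_one]
  exact ENNReal.ofReal_le_ofReal (Real.one_le_rpow (one_le_spread hM n σ) hρ)

theorem weighted_interaction_le {M ρ : ℝ} (hM : 1 ≤ M) (hρ : 0 ≤ ρ)
    {a b : Freq d → ℝ → ℝ≥0∞} (ha : ∀ n, Measurable (a n)) (hb : ∀ n, Measurable (b n))
    (n : Freq d) (σ : ℝ) :
    weighted M ρ (interaction a b) n σ ≤ ENNReal.ofReal (10 ^ ρ) *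
      (interaction (weighted M ρ a) b n σ + interaction a (weighted M ρ b) n σ) := by
  unfold weighted interaction
  rw [← ENNReal.tsum_mul_left, ← ENNReal.tsum_add, ← ENNReal.tsum_mul_left]
  refine ENNReal.tsum_le_tsum fun k => ?_
  have m1 : Measurable fun x => ENNReal.ofReal (spread M k x ^ ρ) * a k x *
      b (-n - k) (phase n k - σ - x) :=
    (measurable_weighted ha k).mul ((hb _).comp (by fun_prop))
  rw [← lintegral_const_mul' _ _ ENNReal.ofReal_ne_top, ← lintegral_add_left m1,
    ← lintegral_const_mul' _ _ ENNReal.ofReal_ne_top]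
  refine lintegral_mono fun x => ?_
  have h := ENNReal.ofReal_le_ofReal (spread_rpow_le_add hM hρ n k σ x)
  have hM0 : 0 < M := by linarith
  have h1 := one_le_spread hM0 k x
  have h2 := one_le_spread hM0 (-n - k) (phase n k - σ - x)
  rw [ENNReal.ofReal_mul (by positivity), ENNReal.ofReal_add (by positivity) (by positivity)] at h
  refine (mul_le_mul_left h _).trans (le_of_eq (by ring))

theorem measurable_weighted_interaction_sum {M ρ : ℝ} {a b : Freq d → ℝ → ℝ≥0∞}
    (ha : ∀ n, Measurable (a n)) (hb : ∀ n, Measurable (b n)) (n : Freq d) :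
    Measurable fun σ => ENNReal.ofReal (M + |σ|)⁻¹ *
      (interaction (weighted M ρ a) b n σ + interaction a (weighted M ρ b) n σ) :=
  Measurable.mul (by fun_prop) ((measurable_interaction (measurable_weighted ha) hb n).add
    (measurable_interaction ha (measurable_weighted hb) n))

/-- The kernel of the truncated Duhamel operator on the time scale `1 / M`. -/
def duhamelKernel (K : ℝ → ℂ) (M σ y : ℝ) : ℂ := (K ((σ - y) / M) - K (σ / M)) / ((M * y : ℝ) : ℂ)

theorem measurable_duhamelKernel {K : ℝ → ℂ} (hK : Continuous K) (M : ℝ) :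
    Measurable fun q : ℝ × ℝ => duhamelKernel K M q.1 q.2 := by
  unfold duhamelKernel
  have h1 : Continuous fun q : ℝ × ℝ => K ((q.1 - q.2) / M) - K (q.1 / M) := by fun_prop
  have h2 : Continuous fun q : ℝ × ℝ => ((M * q.2 : ℝ) : ℂ) := by fun_prop
  exact h1.measurable.div h2.measurable

theorem cutKernel_eq {M : ℝ} (hM : 0 < M) (x : ℝ) :
    cutKernel M x = M⁻¹ * (1 + |x| / M) ^ (-2 : ℝ) := by
  unfold cutKernel
  have : M + |x| = M * (1 + |x| / M) := by field_simp
  rw [this, Real.mul_rpow hM.le (by positivity), ← mul_assoc]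
  congr 1
  rw [show (-2 : ℝ) = -(2 : ℕ) by norm_num, Real.rpow_neg hM.le, Real.rpow_natCast]
  field_simp

/-- The increment of `K` vanishes to first order in `y`. This removes the singularity of the
quotient and leaves `(M + |y|)⁻¹`, the factor present in the bilinear estimate, times kernels of
mass `O(1)`. -/
theorem spread_rpow_mul_norm_duhamelKernel_le {ρ C : ℝ} (hρ : 0 ≤ ρ) {K : ℝ → ℂ}
    (hK : IsCutoffKernel ρ C K) {M : ℝ} (hM : 0 < M) (n : Freq d) (σ y : ℝ) :
    spread M n σ ^ ρ * ‖duhamelKernel K M σ y‖ ≤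
      C * ((M + |y|)⁻¹ * spread M n y ^ ρ * (cutKernel M (σ - y) + cutKernel M σ)) := by
  have hC := hK.pos
  have hs0 := one_le_spread hM n σ
  have hs1 := one_le_spread hM n y
  have hc1 := cutKernel_nonneg hM (σ - y)
  have hc2 := cutKernel_nonneg hM σ
  -- At `y = 0` division by zero makes the kernel zero.
  rcases eq_or_ne y 0 with rfl | hy
  · simp only [duhamelKernel, mul_zero, Complex.ofReal_zero, div_zero, norm_zero]
    positivity
  have hy0 : 0 < |y| := abs_pos.2 hy
  have key : ∀ x, spread M n σ ≤ spread M n y * (1 + |x| / M) →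
      spread M n σ ^ ρ * (1 + |x / M|) ^ (-(2 + ρ)) ≤ spread M n y ^ ρ * (M * cutKernel M x) := by
    intro x hx
    have hx0 : 0 < 1 + |x| / M := by positivity
    rw [cutKernel_eq hM, mul_inv_cancel_left₀ hM.ne', abs_div, abs_of_pos hM]
    calc _ ≤ (spread M n y * (1 + |x| / M)) ^ ρ * (1 + |x| / M) ^ (-(2 + ρ)) := by gcongr
      _ = spread M n y ^ ρ * ((1 + |x| / M) ^ ρ * (1 + |x| / M) ^ (-(2 + ρ))) := by
          rw [Real.mul_rpow (by linarith) hx0.le]; ring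
      _ = _ := by
          rw [← Real.rpow_add hx0]; congr 2; ring
  have k1 := key (σ - y) (spread_le_mul hM n σ y)
  have k2 := key σ ((spread_le_mul' hM n σ).trans (by gcongr; exact freqWeight_le_spread hM n y))
  have hD := hK.norm_sub_le (σ / M) (y / M)
  rw [← sub_div] at hD
  have e1 : ‖duhamelKernel K M σ y‖ = ‖K ((σ - y) / M) - K (σ / M)‖ * (M * |y|)⁻¹ := by
    unfold duhamelKernel
    rw [norm_div, Complex.norm_real, Real.norm_eq_abs, abs_mul, abs_of_pos hM, div_eq_mul_inv]
  have e2 : |y / M| / (1 + |y / M|) * (M * |y|)⁻¹ = (M + |y|)⁻¹ * M⁻¹ := by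
    rw [abs_div, abs_of_pos hM]
    field_simp
  rw [e1]
  calc _ ≤ spread M n σ ^ ρ * (C * (|y / M| / (1 + |y / M|)) *
        ((1 + |(σ - y) / M|) ^ (-(2 + ρ)) + (1 + |σ / M|) ^ (-(2 + ρ))) * (M * |y|)⁻¹) := by gcongr
    _ = C * (|y / M| / (1 + |y / M|) * (M * |y|)⁻¹) *
        (spread M n σ ^ ρ * (1 + |(σ - y) / M|) ^ (-(2 + ρ)) +
          spread M n σ ^ ρ * (1 + |σ / M|) ^ (-(2 + ρ))) := by ring
    _ ≤ C * (|y / M| / (1 + |y / M|) * (M * |y|)⁻¹) *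
        (spread M n y ^ ρ * (M * cutKernel M (σ - y)) + spread M n y ^ ρ * (M * cutKernel M σ)) := by
        gcongr
    _ = C * ((M + |y|)⁻¹ * M⁻¹) *
        (spread M n y ^ ρ * (M * cutKernel M (σ - y)) + spread M n y ^ ρ * (M * cutKernel M σ)) := by
        rw [e2]
    _ = _ := by field_simp

/-- The resolution norm with persistence of regularity. -/
def persEnergy (M s ρ : ℝ) (a : Freq d → ℝ → ℝ≥0∞) : ℝ≥0∞ := energy M s (weighted M ρ a)

theorem energy_le_persEnergy {M s ρ : ℝ} (hM : 0 < M) (hρ : 0 ≤ ρ) (a : Freq d → ℝ → ℝ≥0∞) :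
    energy M s a ≤ persEnergy M s ρ a :=
  energy_mono (le_weighted hM hρ a)

/-- The majorant of the truncated Duhamel operator applied to the interaction of `a` and `b`. -/
def duhamelMajorant (K : ℝ → ℂ) (M : ℝ) (a b : Freq d → ℝ → ℝ≥0∞) : Freq d → ℝ → ℝ≥0∞ :=
  fun n σ => ∫⁻ y, ‖duhamelKernel K M σ y‖ₑ * interaction a b n y

/-- The bilinear estimate for the truncated Duhamel operator. -/
theorem exists_persEnergy_duhamelMajorant_le (hd : d = 1 ∨ d = 2) {s : ℝ} (hs : -(2 / 3) < s)
    (hs' : s ≤ -(1 / 2)) {ρ C₀ : ℝ} (hρ : 0 ≤ ρ) {K : ℝ → ℂ} (hK : IsCutoffKernel ρ C₀ K) :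
    ∃ C : ℝ, 0 < C ∧ ∀ M : ℝ, 1 ≤ M → ∀ a b : Freq d → ℝ → ℝ≥0∞, (∀ n, Measurable (a n)) →
      (∀ n, Measurable (b n)) →
      persEnergy M s ρ (duhamelMajorant K M a b) ≤
        ENNReal.ofReal (C * M ^ (-(2 / 3 + s))) * (persEnergy M s ρ a * persEnergy M s ρ b) := by
  obtain ⟨C₁, hC₁, h₁⟩ := exists_energy_interaction_le hd hs hs'
  obtain ⟨C₂, hC₂, h₂⟩ := exists_energy_cutKernel_conv_le (d := d) hs hs'
  obtain ⟨C₃, hC₃, h₃⟩ := exists_energy_cutKernel_mul_le (d := d) hs'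
  have hC₀ := hK.pos
  refine ⟨(C₀ * 10 ^ ρ) ^ 2 * (2 * ((C₂ + C₃) * (4 * C₁))), by positivity,
    fun M hM a b ha hb => ?_⟩
  have hM0 : 0 < M := by linarith
  set f : Freq d → ℝ → ℝ≥0∞ := fun n σ => ENNReal.ofReal (M + |σ|)⁻¹ *
    (interaction (weighted M ρ a) b n σ + interaction a (weighted M ρ b) n σ) with hf
  have hfm : ∀ n, Measurable (f n) := measurable_weighted_interaction_sum ha hb
  have hκm : Measurable fun x => ENNReal.ofReal (cutKernel M x) :=
    (measurable_cutKernel M).ennreal_ofReal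
  have hcm : ∀ n, Measurable fun σ => ∫⁻ y, ENNReal.ofReal (cutKernel M (σ - y)) * f n y :=
      fun n => by
    have : Measurable fun q : ℝ × ℝ => ENNReal.ofReal (cutKernel M (q.1 - q.2)) * f n q.2 :=
      (hκm.comp (g := fun x => ENNReal.ofReal (cutKernel M x)) (f := fun q : ℝ × ℝ => q.1 - q.2)
        (by fun_prop)).mul ((hfm n).comp measurable_snd)
    exact this.lintegral_prod_right'
  -- The two terms of the Duhamel kernel become a convolution with `cutKernel` and a product of
  -- `cutKernel` with a function of the frequency, both estimated in the section on time
  -- localization.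
  have hpt : ∀ n σ, weighted M ρ (duhamelMajorant K M a b) n σ ≤ ENNReal.ofReal (C₀ * 10 ^ ρ) *
      ((∫⁻ y, ENNReal.ofReal (cutKernel M (σ - y)) * f n y) +
        ENNReal.ofReal (cutKernel M σ) * ∫⁻ y, f n y) := by
    intro n σ
    unfold weighted duhamelMajorant
    have m1 : Measurable fun y => ENNReal.ofReal (cutKernel M (σ - y)) * f n y :=
      (hκm.comp (g := fun x => ENNReal.ofReal (cutKernel M x)) (f := fun y => σ - y)
        (by fun_prop)).mul (hfm n)
    rw [← lintegral_const_mul' _ _ ENNReal.ofReal_ne_top,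
      ← lintegral_const_mul' (ENNReal.ofReal (cutKernel M σ)) _ ENNReal.ofReal_ne_top,
      ← lintegral_add_left m1, ← lintegral_const_mul' _ _ ENNReal.ofReal_ne_top]
    refine lintegral_mono fun y => ?_
    have hb1 := one_le_spread hM0 n y
    have hb2 := one_le_spread hM0 n σ
    have hc1 := cutKernel_nonneg hM0 (σ - y)
    have hc2 := cutKernel_nonneg hM0 σ
    have h4 := spread_rpow_mul_norm_duhamelKernel_le hρ hK hM0 n σ y
    have h5 : ENNReal.ofReal (spread M n y ^ ρ) * interaction a b n y ≤ ENNReal.ofReal (10 ^ ρ) *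
        (interaction (weighted M ρ a) b n y + interaction a (weighted M ρ b) n y) :=
      weighted_interaction_le hM hρ ha hb n y
    calc _ = ENNReal.ofReal (spread M n σ ^ ρ * ‖duhamelKernel K M σ y‖) *
          interaction a b n y := by
          rw [ENNReal.ofReal_mul (by positivity), ofReal_norm, mul_assoc]
      _ ≤ ENNReal.ofReal (C₀ * ((M + |y|)⁻¹ * spread M n y ^ ρ *
          (cutKernel M (σ - y) + cutKernel M σ))) * interaction a b n y :=
          mul_le_mul_left (ENNReal.ofReal_le_ofReal h4) _
      _ = ENNReal.ofReal C₀ * ENNReal.ofReal (M + |y|)⁻¹ *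
          (ENNReal.ofReal (cutKernel M (σ - y)) + ENNReal.ofReal (cutKernel M σ)) *
          (ENNReal.ofReal (spread M n y ^ ρ) * interaction a b n y) := by
          rw [ENNReal.ofReal_mul hC₀.le, ENNReal.ofReal_mul (by positivity),
            ENNReal.ofReal_mul (by positivity), ENNReal.ofReal_add hc1 hc2]
          ring
      _ ≤ ENNReal.ofReal C₀ * ENNReal.ofReal (M + |y|)⁻¹ *
          (ENNReal.ofReal (cutKernel M (σ - y)) + ENNReal.ofReal (cutKernel M σ)) * _ :=
          mul_le_mul_right h5 _
      _ = _ := by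
          rw [ENNReal.ofReal_mul hC₀.le, hf]
          ring
  have hE : energyOne s f + energyTwo M s f ≤ ENNReal.ofReal (4 * C₁ * M ^ (-(2 / 3 + s))) *
      (persEnergy M s ρ a * persEnergy M s ρ b) := by
    change energy M s f ≤ _
    have e1 : f = fun n σ => ENNReal.ofReal (M + |σ|)⁻¹ * interaction (weighted M ρ a) b n σ +
        ENNReal.ofReal (M + |σ|)⁻¹ * interaction a (weighted M ρ b) n σ := by
      funext n σ; simp only [hf, mul_add]
    have m1 : ∀ n, Measurable fun σ => ENNReal.ofReal (M + |σ|)⁻¹ *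
        interaction (weighted M ρ a) b n σ := fun n =>
      Measurable.mul (by fun_prop) (measurable_interaction (measurable_weighted ha) hb n)
    rw [e1]
    refine (energy_add_le m1).trans ?_
    have i1 := h₁ M hM (weighted M ρ a) b (measurable_weighted ha) hb
    have i2 := h₁ M hM a (weighted M ρ b) ha (measurable_weighted hb)
    have j1 := i1.trans (mul_le_mul_right (mul_le_mul_right
      (energy_le_persEnergy (s := s) hM0 hρ b) _) _)
    have j2 := i2.trans (mul_le_mul_right (mul_le_mul_left
      (energy_le_persEnergy (s := s) hM0 hρ a) _) _)
    refine (mul_le_mul_right (add_le_add j1 j2) _).trans (le_of_eq ?_)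
    rw [mul_assoc (4 : ℝ), ENNReal.ofReal_mul (p := (4 : ℝ)) (by norm_num)]
    unfold persEnergy
    norm_num
    ring
  have hE2 : energyOne s f + ENNReal.ofReal (M ^ (-(1 / 3) : ℝ)) * energyBase s f ≤
      energyOne s f + energyTwo M s f := by
    gcongr
    exact energyBase_le_energyTwo hM0 f
  unfold persEnergy at hE ⊢
  refine (energy_mono hpt).trans ?_
  rw [energy_const_mul _ _ _ ENNReal.ofReal_ne_top]
  have h6 : energy M s (fun n σ => (∫⁻ y, ENNReal.ofReal (cutKernel M (σ - y)) * f n y) +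
        ENNReal.ofReal (cutKernel M σ) * ∫⁻ y, f n y) ≤
      2 * (ENNReal.ofReal (C₂ + C₃) * (energyOne s f + energyTwo M s f)) := by
    refine (energy_add_le hcm).trans (mul_le_mul_right ?_ _)
    rw [ENNReal.ofReal_add hC₂.le hC₃.le, add_mul]
    refine add_le_add ((h₂ M hM0 f hfm).trans (mul_le_mul_right hE2 _))
      ((h₃ M hM0 fun n => ∫⁻ y, f n y).trans (mul_le_mul_right ?_ _))
    exact le_self_add
  refine (mul_le_mul_right (h6.trans (mul_le_mul_right (mul_le_mul_right hE _) _)) _).trans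
    (le_of_eq ?_)
  rw [← ENNReal.ofReal_pow (by positivity), show (2 : ℝ≥0∞) = ENNReal.ofReal 2 by norm_num,
    ← mul_assoc (ENNReal.ofReal (C₂ + C₃)), ← ENNReal.ofReal_mul (by positivity),
    ← mul_assoc (ENNReal.ofReal 2), ← ENNReal.ofReal_mul (by positivity),
    ← mul_assoc (ENNReal.ofReal ((C₀ * 10 ^ ρ) ^ 2)), ← ENNReal.ofReal_mul (by positivity)]
  congr 2
  ring

/-- The linear estimate. -/
theorem exists_persEnergy_linear_le {s : ℝ} (hs' : s ≤ -(1 / 2)) {ρ C₀ : ℝ} (hρ : 0 ≤ ρ)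
    {K : ℝ → ℂ} (hK : IsCutoffKernel ρ C₀ K) :
    ∃ C : ℝ, 0 < C ∧ ∀ M : ℝ, 1 ≤ M → ∀ c : Freq d → ℝ≥0∞,
      persEnergy M s ρ (fun n σ => ENNReal.ofReal (M⁻¹ * ‖K (σ / M)‖) * c n) ≤
        ENNReal.ofReal C * ∑' n, ENNReal.ofReal (freqWeight n ^ (s + 2 * ρ)) * c n ^ 2 := by
  obtain ⟨C₃, hC₃, h₃⟩ := exists_energy_cutKernel_mul_le (d := d) hs'
  have hC₀ := hK.pos
  refine ⟨C₀ ^ 2 * C₃, by positivity, fun M hM c => ?_⟩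
  have hM0 : 0 < M := by linarith
  have hpt : ∀ n σ, weighted M ρ (fun n σ => ENNReal.ofReal (M⁻¹ * ‖K (σ / M)‖) * c n) n σ ≤
      ENNReal.ofReal C₀ * (ENNReal.ofReal (cutKernel M σ) *
        (ENNReal.ofReal (freqWeight n ^ ρ) * c n)) := by
    intro n σ
    have hp := freqWeight_pos n
    have hx0 : 0 < 1 + |σ| / M := by positivity
    have hs0 := one_le_spread hM0 n σ
    have hc := cutKernel_nonneg hM0 σ
    unfold weighted
    rw [← mul_assoc, ← mul_assoc, ← mul_assoc, ← ENNReal.ofReal_mul (by positivity),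
      ← ENNReal.ofReal_mul hC₀.le, ← ENNReal.ofReal_mul (by positivity)]
    refine mul_le_mul_left (ENNReal.ofReal_le_ofReal ?_) _
    have h1 := hK.norm_le (σ / M)
    rw [abs_div, abs_of_pos hM0] at h1
    calc spread M n σ ^ ρ * (M⁻¹ * ‖K (σ / M)‖) ≤ (freqWeight n * (1 + |σ| / M)) ^ ρ *
          (M⁻¹ * (C₀ * (1 + |σ| / M) ^ (-(2 + ρ)))) := by
          gcongr; exact spread_le_mul' hM0 n σ
      _ = C₀ * (M⁻¹ * ((1 + |σ| / M) ^ ρ * (1 + |σ| / M) ^ (-(2 + ρ)))) * freqWeight n ^ ρ := by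
          rw [Real.mul_rpow hp.le hx0.le]; ring
      _ = _ := by
          rw [cutKernel_eq hM0, ← Real.rpow_add hx0]
          congr 4; ring
  unfold persEnergy
  refine (energy_mono hpt).trans ?_
  rw [energy_const_mul _ _ _ ENNReal.ofReal_ne_top]
  refine (mul_le_mul_right (h₃ M hM0 _) _).trans (le_of_eq ?_)
  rw [← mul_assoc, ← ENNReal.ofReal_pow hC₀.le, ← ENNReal.ofReal_mul (by positivity)]
  congr 1
  refine tsum_congr fun n => ?_
  have hp := freqWeight_pos n
  rw [mul_pow, ← mul_assoc, ← ENNReal.ofReal_pow (by positivity),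
    ← ENNReal.ofReal_mul (by positivity)]
  congr 2
  rw [← Real.rpow_natCast, ← Real.rpow_mul hp.le, ← Real.rpow_add hp]
  congr 1
  push_cast; ring

end

/-! ### Duhamel's formula on the Fourier side. -/

section

variable {d : ℕ}

/-- The `n`-th Fourier coefficient at time `t` of the space-time function whose space-time Fourier
transform, in terms of the modulation, is `A`. -/
def evol (A : Freq d → ℝ → ℂ) (t : ℝ) (n : Freq d) : ℂ :=
  Complex.exp (-(Complex.I * t * freqSq n)) * ∫ σ : ℝ, Complex.exp (Complex.I * t * σ) * A n σ

/-- The contribution of the pair of frequencies `(k, -n - k)` to the space-time Fourier transform of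
the product of the conjugates, in terms of the modulations. -/
def pairConv (A B : Freq d → ℝ → ℂ) (n k : Freq d) (y : ℝ) : ℂ :=
  ∫ x, conj (A k x) * conj (B (-n - k) (phase n k - y - x))

/-- The space-time Fourier transform of the product of the conjugates, in terms of the
modulations. -/
def fullConv (A B : Freq d → ℝ → ℂ) (n : Freq d) (y : ℝ) : ℂ := ∑' k, pairConv A B n k y

/-- The truncated Duhamel operator applied to the product of the conjugates. -/
def duhamelOp (K : ℝ → ℂ) (M : ℝ) (A B : Freq d → ℝ → ℂ) (n : Freq d) (σ : ℝ) : ℂ :=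
  ∫ y, duhamelKernel K M σ y * fullConv A B n y

theorem norm_exp_I_mul_mul (t x : ℝ) : ‖Complex.exp (Complex.I * t * x)‖ = 1 := by
  rw [mul_assoc, ← Complex.ofReal_mul, mul_comm, Complex.norm_exp_ofReal_mul_I]

theorem norm_exp_neg_I_mul_mul (t x : ℝ) : ‖Complex.exp (-(Complex.I * t * x))‖ = 1 := by
  rw [mul_assoc, ← Complex.ofReal_mul, mul_comm, ← neg_mul, ← Complex.ofReal_neg,
    Complex.norm_exp_ofReal_mul_I]

theorem conj_exp_I_mul_mul (t x : ℝ) :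
    conj (Complex.exp (Complex.I * t * x)) = Complex.exp (-(Complex.I * t * x)) := by
  rw [← Complex.exp_conj]; simp

theorem conj_exp_neg_I_mul_mul (t x : ℝ) :
    conj (Complex.exp (-(Complex.I * t * x))) = Complex.exp (Complex.I * t * x) := by
  rw [← Complex.exp_conj]; simp

theorem integrable_exp_mul {f : ℝ → ℂ} (hf : Integrable f) (t : ℝ) :
    Integrable fun x : ℝ => Complex.exp (Complex.I * t * x) * f x := by
  refine hf.bdd_mul (c := 1) ?_ (ae_of_all _ fun x => (norm_exp_I_mul_mul t x).le)
  exact (by fun_prop : Continuous fun x : ℝ => Complex.exp (Complex.I * t * x)).aestronglyMeasurable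

theorem integrable_conj {f : ℝ → ℂ} (hf : Integrable f) : Integrable fun x => conj (f x) :=
  (Complex.conjLIE.integrable_comp_iff (φ := f)).2 hf

theorem measurable_conj_comp {f : ℝ → ℂ} (hf : Measurable f) : Measurable fun x => conj (f x) :=
  Complex.continuous_conj.measurable.comp hf

theorem measurable_pairConv_integrand {A B : Freq d → ℝ → ℂ} (hA : ∀ n, Measurable (A n))
    (hB : ∀ n, Measurable (B n)) (n k : Freq d) :
    Measurable fun q : ℝ × ℝ => conj (A k q.2) * conj (B (-n - k) (phase n k - q.1 - q.2)) :=
  ((measurable_conj_comp (hA k)).comp measurable_snd).mul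
    ((measurable_conj_comp (hB (-n - k))).comp (by fun_prop))

theorem measurable_pairConv {A B : Freq d → ℝ → ℂ} (hA : ∀ n, Measurable (A n))
    (hB : ∀ n, Measurable (B n)) (n k : Freq d) : Measurable (pairConv A B n k) :=
  (StronglyMeasurable.integral_prod_right
    (f := fun y x => conj (A k x) * conj (B (-n - k) (phase n k - y - x)))
    (measurable_pairConv_integrand hA hB n k).stronglyMeasurable).measurable

theorem measurable_fullConv {A B : Freq d → ℝ → ℂ} (hA : ∀ n, Measurable (A n))
    (hB : ∀ n, Measurable (B n)) (n : Freq d) : Measurable (fullConv A B n) :=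
  Measurable.tsum fun k => measurable_pairConv hA hB n k

theorem measurable_duhamelOp {K : ℝ → ℂ} (hK : Continuous K) (M : ℝ) {A B : Freq d → ℝ → ℂ}
    (hA : ∀ n, Measurable (A n)) (hB : ∀ n, Measurable (B n)) (n : Freq d) :
    Measurable (duhamelOp K M A B n) := by
  have : Measurable fun q : ℝ × ℝ => duhamelKernel K M q.1 q.2 * fullConv A B n q.2 :=
    (measurable_duhamelKernel hK M).mul ((measurable_fullConv hA hB n).comp measurable_snd)
  exact (StronglyMeasurable.integral_prod_right
    (f := fun σ y => duhamelKernel K M σ y * fullConv A B n y) this.stronglyMeasurable).measurable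

/-- The pointwise norm of `A`. -/
def absFn (A : Freq d → ℝ → ℂ) : Freq d → ℝ → ℝ≥0∞ := fun n σ => ‖A n σ‖ₑ

theorem measurable_absFn {A : Freq d → ℝ → ℂ} (hA : ∀ n, Measurable (A n)) (n : Freq d) :
    Measurable (absFn A n) := (hA n).enorm

theorem enorm_conj (z : ℂ) : ‖conj z‖ₑ = ‖z‖ₑ := by
  rw [← ofReal_norm, ← ofReal_norm, RCLike.norm_conj]

theorem enorm_pairConv_le (A B : Freq d → ℝ → ℂ) (n k : Freq d) (y : ℝ) :
    ‖pairConv A B n k y‖ₑ ≤ ∫⁻ x, absFn A k x * absFn B (-n - k) (phase n k - y - x) := by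
  refine (enorm_integral_le_lintegral_enorm _).trans (le_of_eq (lintegral_congr fun x => ?_))
  rw [enorm_mul, enorm_conj, enorm_conj]; rfl

theorem tsum_enorm_pairConv_le (A B : Freq d → ℝ → ℂ) (n : Freq d) (y : ℝ) :
    ∑' k, ‖pairConv A B n k y‖ₑ ≤ interaction (absFn A) (absFn B) n y :=
  ENNReal.tsum_le_tsum fun k => enorm_pairConv_le A B n k y

theorem enorm_fullConv_le (A B : Freq d → ℝ → ℂ) (n : Freq d) (y : ℝ) :
    ‖fullConv A B n y‖ₑ ≤ interaction (absFn A) (absFn B) n y :=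
  enorm_tsum_le_tsum_enorm.trans (tsum_enorm_pairConv_le A B n y)

theorem enorm_duhamelOp_le (K : ℝ → ℂ) (M : ℝ) (A B : Freq d → ℝ → ℂ) (n : Freq d) (σ : ℝ) :
    absFn (duhamelOp K M A B) n σ ≤ duhamelMajorant K M (absFn A) (absFn B) n σ := by
  refine (enorm_integral_le_lintegral_enorm _).trans (lintegral_mono fun y => ?_)
  rw [enorm_mul]
  exact mul_le_mul_right (enorm_fullConv_le A B n y) _

theorem pairConv_eq_convolution (A B : Freq d → ℝ → ℂ) (n k : Freq d) (y : ℝ) :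
    pairConv A B n k y = convolution (fun x => conj (A k x)) (fun x => conj (B (-n - k) x))
      (ContinuousLinearMap.mul ℂ ℂ) volume (phase n k - y) := by
  rw [convolution_def]; rfl

theorem integrable_pairConv {A B : Freq d → ℝ → ℂ} {n k : Freq d} (hA : Integrable (A k))
    (hB : Integrable (B (-n - k))) : Integrable (pairConv A B n k) := by
  have h := (integrable_conj hA).integrable_convolution (ContinuousLinearMap.mul ℂ ℂ)
    (integrable_conj hB)
  have := h.comp_sub_left (phase n k)
  refine this.congr (ae_of_all _ fun y => ?_)
  simp only [pairConv_eq_convolution]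

/-- Conjugation reverses the sign of the modulation, so `pairConv` is a convolution evaluated at
`phase n k - y`; the shift produces the oscillation `e^{i t phase}`. -/
theorem integral_exp_mul_pairConv {A B : Freq d → ℝ → ℂ} {n k : Freq d} (hA : Integrable (A k))
    (hB : Integrable (B (-n - k))) (t : ℝ) :
    ∫ y : ℝ, Complex.exp (Complex.I * t * y) * pairConv A B n k y =
      Complex.exp (Complex.I * t * phase n k) *
        (conj (∫ σ : ℝ, Complex.exp (Complex.I * t * σ) * A k σ) *
          conj (∫ σ : ℝ, Complex.exp (Complex.I * t * σ) * B (-n - k) σ)) := by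
  have h := integral_convolution (μ := volume) (ν := volume) (ContinuousLinearMap.mul ℂ ℂ)
    (integrable_conj (integrable_exp_mul hA t)) (integrable_conj (integrable_exp_mul hB t))
  rw [integral_conj, integral_conj] at h
  rw [ContinuousLinearMap.mul_apply'] at h
  rw [← h, ← integral_sub_left_eq_self _ volume (phase n k), ← integral_const_mul]
  refine integral_congr_ae (ae_of_all _ fun y => ?_)
  simp only
  rw [pairConv, convolution_def, ← integral_const_mul, ← integral_const_mul]
  refine integral_congr_ae (ae_of_all _ fun x => ?_)
  simp only [ContinuousLinearMap.mul_apply', map_mul, conj_exp_I_mul_mul, sub_sub_cancel]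
  have : Complex.exp (Complex.I * t * ((phase n k - y : ℝ) : ℂ)) =
      Complex.exp (Complex.I * t * phase n k) * (Complex.exp (-(Complex.I * t * x)) *
        Complex.exp (-(Complex.I * t * ((y - x : ℝ) : ℂ)))) := by
    rw [← Complex.exp_add, ← Complex.exp_add]
    congr 1
    push_cast; ring
  rw [this]; ring

theorem exp_mul_conj_evol_mul_conj_evol {A B : Freq d → ℝ → ℂ} {n k : Freq d}
    (hA : Integrable (A k)) (hB : Integrable (B (-n - k))) (t t' : ℝ) :
    Complex.exp (-(Complex.I * (t - t') * freqSq n)) *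
        (conj (evol A t' k) * conj (evol B t' (-n - k))) =
      Complex.exp (-(Complex.I * t * freqSq n)) *
        ∫ y : ℝ, Complex.exp (Complex.I * t' * y) * pairConv A B n k y := by
  rw [integral_exp_mul_pairConv hA hB]
  unfold evol
  rw [map_mul, map_mul, conj_exp_neg_I_mul_mul, conj_exp_neg_I_mul_mul]
  have : Complex.exp (-(Complex.I * (t - t') * freqSq n)) *
      (Complex.exp (Complex.I * t' * freqSq k) * Complex.exp (Complex.I * t' * freqSq (-n - k))) =
      Complex.exp (-(Complex.I * t * freqSq n)) * Complex.exp (Complex.I * t' * phase n k) := by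
    rw [← Complex.exp_add, ← Complex.exp_add, ← Complex.exp_add]
    congr 1
    unfold phase
    push_cast; ring
  rw [← mul_assoc _ (Complex.exp (Complex.I * t' * phase n k)), ← this]
  ring

/-- The integral of `e^{i t' y}` over `t' ∈ [0, t]`. -/
def timeIntegral (t y : ℝ) : ℂ := ∫ t' in (0 : ℝ)..t, Complex.exp (Complex.I * t' * y)

theorem timeIntegral_eq (t : ℝ) {y : ℝ} (hy : y ≠ 0) :
    timeIntegral t y = (Complex.exp (Complex.I * t * y) - 1) / (Complex.I * y) := by
  unfold timeIntegral
  have hc : Complex.I * y ≠ 0 := mul_ne_zero Complex.I_ne_zero (Complex.ofReal_ne_zero.2 hy)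
  have h := integral_exp_mul_complex (a := 0) (b := t) hc
  rw [Complex.ofReal_zero, mul_zero, Complex.exp_zero] at h
  rw [mul_right_comm, ← h]
  refine intervalIntegral.integral_congr fun x _ => ?_
  simp only [mul_right_comm]

/-- The bounds `|t|` and `2 / |y|` are combined into the weight that the bilinear estimate controls.
-/
theorem norm_timeIntegral_mul_le {M : ℝ} (hM : 0 < M) (t y : ℝ) :
    ‖timeIntegral t y‖ ≤ (M * |t| + 2) * (M + |y|)⁻¹ := by
  have h1 : ‖timeIntegral t y‖ ≤ |t| := by
    have := intervalIntegral.norm_integral_le_of_norm_le_const (a := 0) (b := t) (C := 1)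
      (f := fun t' : ℝ => Complex.exp (Complex.I * t' * y)) fun x _ => (norm_exp_I_mul_mul x y).le
    simpa [timeIntegral] using this
  have h2 : ‖timeIntegral t y‖ * |y| ≤ 2 := by
    rcases eq_or_ne y 0 with rfl | hy
    · simp
    · have hy0 : 0 < |y| := abs_pos.2 hy
      rw [timeIntegral_eq t hy, norm_div, norm_mul, Complex.norm_I, one_mul, Complex.norm_real,
        Real.norm_eq_abs, div_mul_cancel₀ _ hy0.ne']
      refine (norm_sub_le _ _).trans ?_
      rw [norm_exp_I_mul_mul, norm_one]; norm_num
  rw [← div_eq_mul_inv, le_div_iff₀ (by positivity), mul_add]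
  have : ‖timeIntegral t y‖ * M ≤ |t| * M := by gcongr
  linarith

theorem continuous_timeIntegral (t : ℝ) : Continuous (timeIntegral t) := by
  unfold timeIntegral
  exact intervalIntegral.continuous_parametric_intervalIntegral_of_continuous' (by fun_prop) 0 t

theorem intervalIntegral_integral_exp_mul {f : ℝ → ℂ} (hf : Integrable f) (t : ℝ) :
    ∫ t' in (0 : ℝ)..t, ∫ y : ℝ, Complex.exp (Complex.I * t' * y) * f y =
      ∫ y : ℝ, timeIntegral t y * f y := by
  rw [intervalIntegral_integral_swap]
  · refine integral_congr_ae (ae_of_all _ fun y => ?_)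
    simp only [timeIntegral, intervalIntegral.integral_mul_const]
  · have : IsFiniteMeasure (volume.restrict (Set.uIoc 0 t)) := by
      unfold Set.uIoc; infer_instance
    have h1 : Integrable (fun q : ℝ × ℝ => f q.2)
        ((volume.restrict (Set.uIoc 0 t)).prod volume) := hf.comp_snd _
    refine h1.bdd_mul (c := 1) ?_ (ae_of_all _ fun q => (norm_exp_I_mul_mul q.1 q.2).le)
    exact (by fun_prop :
      Continuous fun q : ℝ × ℝ => Complex.exp (Complex.I * q.1 * q.2)).aestronglyMeasurable

/-- The time integral of the pair interaction. -/
theorem integral_evol_pair {A B : Freq d → ℝ → ℂ} {n k : Freq d}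
    (hA : Integrable (A k)) (hB : Integrable (B (-n - k))) (t : ℝ) :
    ∫ t' in (0 : ℝ)..t, Complex.exp (-(Complex.I * (t - t') * freqSq n)) *
        (conj (evol A t' k) * conj (evol B t' (-n - k))) =
      Complex.exp (-(Complex.I * t * freqSq n)) * ∫ y : ℝ, timeIntegral t y * pairConv A B n k y := by
  simp_rw [exp_mul_conj_evol_mul_conj_evol hA hB]
  rw [intervalIntegral.integral_const_mul, intervalIntegral_integral_exp_mul
    (integrable_pairConv hA hB)]

theorem summable_pairConv {A B : Freq d → ℝ → ℂ} {n : Freq d} {y : ℝ}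
    (h : interaction (absFn A) (absFn B) n y < ∞) : Summable fun k => pairConv A B n k y := by
  have h1 : ∑' k, ‖pairConv A B n k y‖ₑ ≠ ∞ := ((tsum_enorm_pairConv_le A B n y).trans_lt h).ne
  refine Summable.of_norm ?_
  have := ENNReal.summable_toReal h1
  simpa only [toReal_enorm] using this

/-- The sum over pairs of frequencies converges absolutely only after integration in time: the decay
of `timeIntegral` in `y` makes the total finite, and Tonelli and Fubini do the rest. -/
theorem hasSum_integral_timeIntegral {M : ℝ} (hM : 0 < M) {A B : Freq d → ℝ → ℂ}
    (hA : ∀ n, Measurable (A n)) (hB : ∀ n, Measurable (B n)) {n : Freq d}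
    (h : ∫⁻ y, ENNReal.ofReal (M + |y|)⁻¹ * interaction (absFn A) (absFn B) n y < ∞) (t : ℝ) :
    HasSum (fun k => ∫ y : ℝ, timeIntegral t y * pairConv A B n k y)
      (∫ y : ℝ, timeIntegral t y * fullConv A B n y) := by
  have hm : ∀ k, Measurable fun y => timeIntegral t y * pairConv A B n k y := fun k =>
    (continuous_timeIntegral t).measurable.mul (measurable_pairConv hA hB n k)
  have hsum : ∑' k, ∫⁻ y, ‖timeIntegral t y * pairConv A B n k y‖ₑ < ∞ := by
    rw [← lintegral_tsum fun k => (hm k).enorm.aemeasurable]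
    have hb : ∀ y, ∑' k, ‖timeIntegral t y * pairConv A B n k y‖ₑ ≤ ENNReal.ofReal (M * |t| + 2) *
        (ENNReal.ofReal (M + |y|)⁻¹ * interaction (absFn A) (absFn B) n y) := fun y => by
      simp_rw [enorm_mul]
      rw [ENNReal.tsum_mul_left, ← mul_assoc, ← ENNReal.ofReal_mul (by positivity)]
      refine mul_le_mul' ?_ (tsum_enorm_pairConv_le A B n y)
      rw [← ofReal_norm]
      exact ENNReal.ofReal_le_ofReal (norm_timeIntegral_mul_le hM t y)
    refine (lintegral_mono hb).trans_lt ?_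
    rw [lintegral_const_mul' _ _ ENNReal.ofReal_ne_top]
    exact ENNReal.mul_lt_top ENNReal.ofReal_lt_top h
  have hint : ∀ k, Integrable fun y => timeIntegral t y * pairConv A B n k y := fun k =>
    ⟨(hm k).aestronglyMeasurable, (ENNReal.le_tsum k).trans_lt hsum⟩
  have hnorm : Summable fun k => ∫ y, ‖timeIntegral t y * pairConv A B n k y‖ := by
    refine (ENNReal.summable_toReal hsum.ne).congr fun k => ?_
    rw [integral_norm_eq_lintegral_enorm (hm k).aestronglyMeasurable]
  have := hasSum_integral_of_summable_integral_norm hint hnorm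
  simpa only [fullConv, tsum_mul_left] using this

theorem integral_exp_mul_comp_div {ρ C : ℝ} {K : ℝ → ℂ} (hK : IsCutoffKernel ρ C K) {M : ℝ}
    (hM : 0 < M) {t : ℝ} (ht : |t| ≤ M⁻¹) :
    ∫ σ : ℝ, Complex.exp (Complex.I * t * σ) * K (σ / M) = M := by
  have htM : |t * M| ≤ 1 := by
    rw [abs_mul, abs_of_pos hM]
    calc |t| * M ≤ M⁻¹ * M := by gcongr
      _ = 1 := inv_mul_cancel₀ hM.ne'
  have h := Measure.integral_comp_div
    (fun x : ℝ => Complex.exp (Complex.I * ((t * M : ℝ) : ℂ) * x) * K x) M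
  rw [hK.integral_exp_mul _ htM, abs_of_pos hM] at h
  simp only [Complex.real_smul, mul_one] at h
  rw [← h]
  refine integral_congr_ae (ae_of_all _ fun σ => ?_)
  simp only
  congr 2
  push_cast
  have : (M : ℂ) ≠ 0 := Complex.ofReal_ne_zero.2 hM.ne'
  field_simp

/-- For `|t| ≤ M⁻¹` the cutoff equals one, so the transform of the kernel is `(e^{ity} - 1) / y`: on
this interval the truncated operator is the exact Duhamel operator, up to the factor `i`. -/
theorem integral_exp_mul_duhamelKernel {ρ C : ℝ} {K : ℝ → ℂ} (hK : IsCutoffKernel ρ C K) {M : ℝ}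
    (hM : 0 < M) {t : ℝ} (ht : |t| ≤ M⁻¹) {y : ℝ} (hy : y ≠ 0) :
    ∫ σ : ℝ, Complex.exp (Complex.I * t * σ) * duhamelKernel K M σ y =
      Complex.I * timeIntegral t y := by
  have hKM : Integrable fun σ : ℝ => K (σ / M) := hK.integrable.comp_div hM.ne'
  have e0 := integral_exp_mul_comp_div hK hM ht
  have e1 : ∫ σ : ℝ, Complex.exp (Complex.I * t * σ) * K ((σ - y) / M) =
      Complex.exp (Complex.I * t * y) * M := by
    rw [← e0, ← integral_sub_right_eq_self
      (fun σ : ℝ => Complex.exp (Complex.I * t * σ) * K (σ / M)) y, ← integral_const_mul]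
    refine integral_congr_ae (ae_of_all _ fun σ => ?_)
    simp only
    rw [← mul_assoc, ← Complex.exp_add]
    congr 2
    push_cast; ring
  have i0 := integrable_exp_mul hKM t
  have i1 := integrable_exp_mul (hKM.comp_sub_right y) t
  have hM' : (M : ℂ) ≠ 0 := Complex.ofReal_ne_zero.2 hM.ne'
  have hy' : (y : ℂ) ≠ 0 := Complex.ofReal_ne_zero.2 hy
  calc _ = ∫ σ : ℝ, (Complex.exp (Complex.I * t * σ) * K ((σ - y) / M) -
        Complex.exp (Complex.I * t * σ) * K (σ / M)) * ((M * y : ℝ) : ℂ)⁻¹ := by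
        refine integral_congr_ae (ae_of_all _ fun σ => ?_)
        simp only [duhamelKernel]
        ring
    _ = (Complex.exp (Complex.I * t * y) * M - M) * ((M * y : ℝ) : ℂ)⁻¹ := by
        rw [integral_mul_const, integral_sub i1 i0, e0, e1]
    _ = _ := by
        rw [timeIntegral_eq t hy]
        push_cast
        field_simp

theorem integrable_duhamel_prod {K : ℝ → ℂ} (hK : Continuous K) {M : ℝ} {A B : Freq d → ℝ → ℂ}
    (hA : ∀ n, Measurable (A n)) (hB : ∀ n, Measurable (B n)) {n : Freq d}
    (h : ∫⁻ σ, duhamelMajorant K M (absFn A) (absFn B) n σ < ∞) :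
    Integrable (fun q : ℝ × ℝ => duhamelKernel K M q.1 q.2 * fullConv A B n q.2)
      (volume.prod volume) := by
  have hm : Measurable fun q : ℝ × ℝ => duhamelKernel K M q.1 q.2 * fullConv A B n q.2 :=
    (measurable_duhamelKernel hK M).mul ((measurable_fullConv hA hB n).comp measurable_snd)
  refine ⟨hm.aestronglyMeasurable, ?_⟩
  unfold HasFiniteIntegral
  rw [lintegral_prod _ hm.enorm.aemeasurable]
  refine lt_of_le_of_lt (lintegral_mono fun σ => lintegral_mono fun y => ?_) h
  rw [enorm_mul]
  exact mul_le_mul_right (enorm_fullConv_le A B n y) _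

/-- Duhamel's formula in terms of the space-time Fourier transforms. -/
theorem hasSum_duhamel_evol {ρ C : ℝ} {K : ℝ → ℂ} (hK : IsCutoffKernel ρ C K) {M : ℝ} (hM : 0 < M)
    {A B : Freq d → ℝ → ℂ} (hA : ∀ n, Measurable (A n)) (hB : ∀ n, Measurable (B n))
    (iA : ∀ n, Integrable (A n)) (iB : ∀ n, Integrable (B n)) {n : Freq d}
    (h1 : ∫⁻ y, ENNReal.ofReal (M + |y|)⁻¹ * interaction (absFn A) (absFn B) n y < ∞)
    (h2 : ∫⁻ σ, duhamelMajorant K M (absFn A) (absFn B) n σ < ∞) {t : ℝ} (ht : |t| ≤ M⁻¹) :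
    HasSum (fun k => ∫ t' in (0 : ℝ)..t, Complex.exp (-(Complex.I * (t - t') * freqSq n)) *
        (conj (evol A t' k) * conj (evol B t' (-n - k))))
      (-Complex.I * evol (duhamelOp K M A B) t n) := by
  simp_rw [integral_evol_pair (iA _) (iB _)]
  have hprod := integrable_duhamel_prod hK.continuous hA hB h2
  have hsum := (hasSum_integral_timeIntegral hM hA hB h1 t).mul_left
    (Complex.exp (-(Complex.I * t * freqSq n)))
  have hI : ∫ y : ℝ, timeIntegral t y * fullConv A B n y =
      -Complex.I * ∫ σ : ℝ, Complex.exp (Complex.I * t * σ) * duhamelOp K M A B n σ := by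
    have e1 : ∀ᵐ y : ℝ, timeIntegral t y * fullConv A B n y = -Complex.I *
        ∫ σ : ℝ, Complex.exp (Complex.I * t * σ) *
          (duhamelKernel K M σ y * fullConv A B n y) := by
      -- At `y = 0` the kernel has the junk value zero, whereas `timeIntegral t 0 = t`.
      have h0 : ∀ᵐ y : ℝ, y ≠ 0 := by simp [ae_iff]
      filter_upwards [h0] with y hy
      simp_rw [← mul_assoc]
      rw [integral_mul_const, integral_exp_mul_duhamelKernel hK hM ht hy, ← mul_assoc]
      rw [← mul_assoc, neg_mul, Complex.I_mul_I, neg_neg, one_mul]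
    rw [integral_congr_ae e1, integral_const_mul]
    congr 1
    rw [integral_integral_swap]
    · refine integral_congr_ae (ae_of_all _ fun σ => ?_)
      simp only [duhamelOp, integral_const_mul]
    · have h3 : Integrable (fun q : ℝ × ℝ => Complex.exp (Complex.I * t * q.1) *
          (duhamelKernel K M q.1 q.2 * fullConv A B n q.2)) (volume.prod volume) := by
        refine hprod.bdd_mul (c := 1) ?_ (ae_of_all _ fun q => (norm_exp_I_mul_mul t q.1).le)
        exact (by fun_prop :
          Continuous fun q : ℝ × ℝ => Complex.exp (Complex.I * t * q.1)).aestronglyMeasurable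
      exact h3.swap
  have he : -Complex.I * evol (duhamelOp K M A B) t n =
      Complex.exp (-(Complex.I * t * freqSq n)) * ∫ y : ℝ, timeIntegral t y * fullConv A B n y := by
    rw [hI]
    unfold evol
    ring
  rw [he]
  exact hsum

end

/-! ### The bilinear estimate for complex-valued functions, and differences. -/

section

variable {d : ℕ}

/-- The square of the resolution norm of a complex-valued function. -/
def resEnergy (M s ρ : ℝ) (A : Freq d → ℝ → ℂ) : ℝ≥0∞ := persEnergy M s ρ (absFn A)

theorem persEnergy_mono_ae {M s ρ : ℝ} {a b : Freq d → ℝ → ℝ≥0∞}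
    (h : ∀ n, ∀ᵐ σ, a n σ ≤ b n σ) : persEnergy M s ρ a ≤ persEnergy M s ρ b :=
  energy_mono_ae fun n => (h n).mono fun _ hσ => mul_le_mul_right hσ _

theorem persEnergy_add_le {M s ρ : ℝ} {a b : Freq d → ℝ → ℝ≥0∞} (ha : ∀ n, Measurable (a n)) :
    persEnergy M s ρ (fun n σ => a n σ + b n σ) ≤ 2 * (persEnergy M s ρ a + persEnergy M s ρ b) := by
  have h := energy_add_le (M := M) (s := s) (b := weighted M ρ b)
    (measurable_weighted (M := M) (ρ := ρ) ha)
  unfold persEnergy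
  convert h using 2
  funext n σ
  simp only [weighted, mul_add]

theorem resEnergy_le_of_ae_le {M s ρ : ℝ} {A B C : Freq d → ℝ → ℂ} (hB : ∀ n, Measurable (B n))
    (h : ∀ n, ∀ᵐ σ, ‖A n σ‖ₑ ≤ ‖B n σ‖ₑ + ‖C n σ‖ₑ) :
    resEnergy M s ρ A ≤ 2 * (resEnergy M s ρ B + resEnergy M s ρ C) :=
  (persEnergy_mono_ae h).trans (persEnergy_add_le (measurable_absFn hB))

theorem resEnergy_sub_le {M s ρ : ℝ} {A B : Freq d → ℝ → ℂ} (hA : ∀ n, Measurable (A n)) :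
    resEnergy M s ρ (A - B) ≤ 2 * (resEnergy M s ρ A + resEnergy M s ρ B) :=
  resEnergy_le_of_ae_le hA fun _ => ae_of_all _ fun _ => enorm_sub_le

theorem resEnergy_sub_comm {M s ρ : ℝ} (A B : Freq d → ℝ → ℂ) :
    resEnergy M s ρ (A - B) = resEnergy M s ρ (B - A) := by
  unfold resEnergy
  congr 1
  funext n σ
  exact enorm_sub_rev _ _

theorem mul_sq_lintegral_le_energyOne (s : ℝ) (a : Freq d → ℝ → ℝ≥0∞) (n : Freq d) :
    ENNReal.ofReal (freqWeight n ^ s) * (∫⁻ σ, a n σ) ^ 2 ≤ energyOne s a :=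
  ENNReal.le_tsum (f := fun n => ENNReal.ofReal (freqWeight n ^ s) * (∫⁻ σ, a n σ) ^ 2) n

theorem lintegral_lt_top_of_energyOne {s : ℝ} {a : Freq d → ℝ → ℝ≥0∞} (h : energyOne s a < ∞)
    (n : Freq d) : ∫⁻ σ, a n σ < ∞ := by
  have hp := freqWeight_pos n
  have h1 := (mul_sq_lintegral_le_energyOne s a n).trans_lt h
  by_contra! h2
  rw [top_le_iff.1 h2] at h1
  have h3 : ENNReal.ofReal (freqWeight n ^ s) ≠ 0 := by
    rw [Ne, ENNReal.ofReal_eq_zero, not_le]; positivity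
  rw [ENNReal.top_pow (by norm_num), ENNReal.mul_top h3] at h1
  exact lt_irrefl _ h1

theorem lintegral_eq_zero_of_energyOne {s : ℝ} {a : Freq d → ℝ → ℝ≥0∞} (h : energyOne s a = 0)
    (n : Freq d) : ∫⁻ σ, a n σ = 0 := by
  have hp := freqWeight_pos n
  have h1 := mul_sq_lintegral_le_energyOne s a n
  rw [h, nonpos_iff_eq_zero, mul_eq_zero] at h1
  have h3 : ENNReal.ofReal (freqWeight n ^ s) ≠ 0 := by
    rw [Ne, ENNReal.ofReal_eq_zero, not_le]; positivity
  simpa using h1.resolve_left h3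

theorem energyOne_le_energy (M s : ℝ) (a : Freq d → ℝ → ℝ≥0∞) : energyOne s a ≤ energy M s a :=
  le_self_add

theorem energyOne_le_persEnergy {M s ρ : ℝ} (hM : 0 < M) (hρ : 0 ≤ ρ) (a : Freq d → ℝ → ℝ≥0∞) :
    energyOne s a ≤ persEnergy M s ρ a :=
  (energyOne_le_energy M s a).trans (energy_le_persEnergy hM hρ a)

theorem lintegral_lt_top_of_persEnergy {M s ρ : ℝ} (hM : 0 < M) (hρ : 0 ≤ ρ)
    {a : Freq d → ℝ → ℝ≥0∞} (h : persEnergy M s ρ a < ∞) (n : Freq d) : ∫⁻ σ, a n σ < ∞ :=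
  lintegral_lt_top_of_energyOne ((energyOne_le_persEnergy hM hρ a).trans_lt h) n

theorem integrable_of_resEnergy {M s ρ : ℝ} (hM : 0 < M) (hρ : 0 ≤ ρ) {A : Freq d → ℝ → ℂ}
    (hA : ∀ n, Measurable (A n)) (h : resEnergy M s ρ A < ∞) (n : Freq d) : Integrable (A n) :=
  ⟨(hA n).aestronglyMeasurable, lintegral_lt_top_of_persEnergy hM hρ h n⟩

theorem ae_eq_of_resEnergy_sub {M s ρ : ℝ} (hM : 0 < M) (hρ : 0 ≤ ρ) {A B : Freq d → ℝ → ℂ}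
    (hA : ∀ n, Measurable (A n)) (hB : ∀ n, Measurable (B n)) (h : resEnergy M s ρ (A - B) = 0)
    (n : Freq d) : ∀ᵐ σ, A n σ = B n σ := by
  have h1 : energyOne s (absFn (A - B)) = 0 :=
    nonpos_iff_eq_zero.1 ((energyOne_le_persEnergy (ρ := ρ) hM hρ _).trans h.le)
  have h2 := lintegral_eq_zero_of_energyOne h1 n
  rw [lintegral_eq_zero_iff (measurable_absFn (A := A - B) (fun n => (hA n).sub (hB n)) n)] at h2
  filter_upwards [h2] with σ hσ
  simpa [absFn, sub_eq_zero] using hσ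

/-- The data of the bilinear estimates on the time scale `1 / M`: `κ` is the constant in the
estimate of the truncated Duhamel operator. -/
structure IsBilinear (d : ℕ) (s ρ : ℝ) (K : ℝ → ℂ) (M : ℝ) (κ : ℝ≥0∞) : Prop where
  pos : 0 < M
  rho_nonneg : 0 ≤ ρ
  continuous : Continuous K
  le : ∀ a b : Freq d → ℝ → ℝ≥0∞, (∀ n, Measurable (a n)) → (∀ n, Measurable (b n)) →
    persEnergy M s ρ (duhamelMajorant K M a b) ≤ κ * (persEnergy M s ρ a * persEnergy M s ρ b)
  kappa_lt_top : κ < ∞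
  lintegral_lt_top : ∀ a b : Freq d → ℝ → ℝ≥0∞, (∀ n, Measurable (a n)) →
    (∀ n, Measurable (b n)) → persEnergy M s ρ a < ∞ → persEnergy M s ρ b < ∞ →
    ∀ n, ∫⁻ y, ENNReal.ofReal (M + |y|)⁻¹ * interaction a b n y < ∞

theorem exists_isBilinear (hd : d = 1 ∨ d = 2) {s : ℝ} (hs : -(2 / 3) < s)
    (hs' : s ≤ -(1 / 2)) {ρ C₀ : ℝ} (hρ : 0 ≤ ρ) {K : ℝ → ℂ} (hK : IsCutoffKernel ρ C₀ K) :
    ∃ C : ℝ, 0 < C ∧ ∀ M : ℝ, 1 ≤ M →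
      IsBilinear d s ρ K M (ENNReal.ofReal (C * M ^ (-(2 / 3 + s)))) := by
  obtain ⟨C, hC, h⟩ := exists_persEnergy_duhamelMajorant_le hd hs hs' hρ hK
  obtain ⟨C', -, h'⟩ := exists_energy_interaction_le hd hs hs'
  refine ⟨C, hC, fun M hM => ?_⟩
  have hM0 : 0 < M := by linarith
  refine ⟨hM0, hρ, hK.continuous, h M hM, ENNReal.ofReal_lt_top, fun a b ha hb ha' hb' n => ?_⟩
  refine lintegral_lt_top_of_energyOne (s := s) ((energyOne_le_energy M s _).trans_lt
    ((h' M hM a b ha hb).trans_lt (ENNReal.mul_lt_top ENNReal.ofReal_lt_top (ENNReal.mul_lt_top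
      ((energy_le_persEnergy hM0 hρ a).trans_lt ha')
      ((energy_le_persEnergy hM0 hρ b).trans_lt hb'))))) n

section Difference

variable {s ρ M : ℝ} {κ : ℝ≥0∞} {K : ℝ → ℂ}

theorem IsBilinear.lintegral_majorant_lt_top (h : IsBilinear d s ρ K M κ)
    {a b : Freq d → ℝ → ℝ≥0∞} (ha : ∀ n, Measurable (a n)) (hb : ∀ n, Measurable (b n))
    (ha' : persEnergy M s ρ a < ∞) (hb' : persEnergy M s ρ b < ∞) (n : Freq d) :
    ∫⁻ σ, duhamelMajorant K M a b n σ < ∞ :=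
  lintegral_lt_top_of_persEnergy h.pos h.rho_nonneg ((h.le a b ha hb).trans_lt
    (ENNReal.mul_lt_top h.kappa_lt_top (ENNReal.mul_lt_top ha' hb'))) n

/-- The series and integrals that define `fullConv` are additive only where they converge
absolutely; this provides that for almost every modulation. -/
theorem IsBilinear.ae_interaction_lt_top (h : IsBilinear d s ρ K M κ)
    {a b : Freq d → ℝ → ℝ≥0∞} (ha : ∀ n, Measurable (a n)) (hb : ∀ n, Measurable (b n))
    (ha' : persEnergy M s ρ a < ∞) (hb' : persEnergy M s ρ b < ∞) (n : Freq d) :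
    ∀ᵐ y, interaction a b n y < ∞ := by
  have hM := h.pos
  have hm : Measurable fun y => ENNReal.ofReal (M + |y|)⁻¹ * interaction a b n y :=
    Measurable.mul (by fun_prop) (measurable_interaction ha hb n)
  filter_upwards [ae_lt_top hm (h.lintegral_lt_top a b ha hb ha' hb' n).ne] with y hy
  by_contra! h2
  have h3 : ENNReal.ofReal (M + |y|)⁻¹ ≠ 0 := by
    rw [Ne, ENNReal.ofReal_eq_zero, not_le]; positivity
  rw [top_le_iff.1 h2, ENNReal.mul_top h3] at hy
  exact lt_irrefl _ hy

theorem IsBilinear.resEnergy_duhamelOp_le (h : IsBilinear d s ρ K M κ) {A B : Freq d → ℝ → ℂ}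
    (hA : ∀ n, Measurable (A n)) (hB : ∀ n, Measurable (B n)) :
    resEnergy M s ρ (duhamelOp K M A B) ≤ κ * (resEnergy M s ρ A * resEnergy M s ρ B) :=
  (persEnergy_mono_ae fun n => ae_of_all _ (enorm_duhamelOp_le K M A B n)).trans
    (h.le _ _ (measurable_absFn hA) (measurable_absFn hB))

theorem integrable_pairConv_integrand {A B : Freq d → ℝ → ℂ} (hA : ∀ n, Measurable (A n))
    (hB : ∀ n, Measurable (B n)) {n : Freq d} {y : ℝ}
    (h : interaction (absFn A) (absFn B) n y < ∞) (k : Freq d) :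
    Integrable fun x => conj (A k x) * conj (B (-n - k) (phase n k - y - x)) := by
  refine ⟨((measurable_pairConv_integrand hA hB n k).comp
    (measurable_prodMk_left (x := y))).aestronglyMeasurable, ?_⟩
  refine lt_of_le_of_lt ?_ ((ENNReal.le_tsum k).trans_lt h)
  refine lintegral_mono fun x => le_of_eq ?_
  simp only
  rw [enorm_mul, enorm_conj, enorm_conj]; rfl

theorem fullConv_sub_left {A A' B : Freq d → ℝ → ℂ} (hA : ∀ n, Measurable (A n))
    (hA' : ∀ n, Measurable (A' n)) (hB : ∀ n, Measurable (B n)) {n : Freq d} {y : ℝ}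
    (h : interaction (absFn A) (absFn B) n y < ∞) (h' : interaction (absFn A') (absFn B) n y < ∞) :
    fullConv (A - A') B n y = fullConv A B n y - fullConv A' B n y := by
  unfold fullConv
  rw [← (summable_pairConv h).tsum_sub (summable_pairConv h')]
  refine tsum_congr fun k => ?_
  unfold pairConv
  rw [← integral_sub (integrable_pairConv_integrand hA hB h k)
    (integrable_pairConv_integrand hA' hB h' k)]
  refine integral_congr_ae (ae_of_all _ fun x => ?_)
  simp only [Pi.sub_apply, map_sub, sub_mul]

theorem fullConv_sub_right {A B B' : Freq d → ℝ → ℂ} (hA : ∀ n, Measurable (A n))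
    (hB : ∀ n, Measurable (B n)) (hB' : ∀ n, Measurable (B' n)) {n : Freq d} {y : ℝ}
    (h : interaction (absFn A) (absFn B) n y < ∞) (h' : interaction (absFn A) (absFn B') n y < ∞) :
    fullConv A (B - B') n y = fullConv A B n y - fullConv A B' n y := by
  unfold fullConv
  rw [← (summable_pairConv h).tsum_sub (summable_pairConv h')]
  refine tsum_congr fun k => ?_
  unfold pairConv
  rw [← integral_sub (integrable_pairConv_integrand hA hB h k)
    (integrable_pairConv_integrand hA hB' h' k)]
  refine integral_congr_ae (ae_of_all _ fun x => ?_)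
  simp only [Pi.sub_apply, map_sub, mul_sub]

theorem IsBilinear.ae_integrable (h : IsBilinear d s ρ K M κ) {A B : Freq d → ℝ → ℂ}
    (hA : ∀ n, Measurable (A n)) (hB : ∀ n, Measurable (B n)) (fA : resEnergy M s ρ A < ∞)
    (fB : resEnergy M s ρ B < ∞) (n : Freq d) :
    ∀ᵐ σ, Integrable fun y => duhamelKernel K M σ y * fullConv A B n y :=
  (integrable_duhamel_prod h.continuous hA hB (h.lintegral_majorant_lt_top (measurable_absFn hA)
    (measurable_absFn hB) fA fB n)).prod_right_ae

theorem IsBilinear.duhamelOp_sub_left (h : IsBilinear d s ρ K M κ) {A A' B : Freq d → ℝ → ℂ}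
    (hA : ∀ n, Measurable (A n)) (hA' : ∀ n, Measurable (A' n)) (hB : ∀ n, Measurable (B n))
    (fA : resEnergy M s ρ A < ∞) (fA' : resEnergy M s ρ A' < ∞) (fB : resEnergy M s ρ B < ∞)
    (n : Freq d) :
    ∀ᵐ σ, duhamelOp K M (A - A') B n σ = duhamelOp K M A B n σ - duhamelOp K M A' B n σ := by
  have h1 := h.ae_interaction_lt_top (measurable_absFn hA) (measurable_absFn hB) fA fB n
  have h2 := h.ae_interaction_lt_top (measurable_absFn hA') (measurable_absFn hB) fA' fB n
  filter_upwards [h.ae_integrable hA hB fA fB n, h.ae_integrable hA' hB fA' fB n] with σ i1 i2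
  unfold duhamelOp
  rw [← integral_sub i1 i2]
  refine integral_congr_ae ?_
  filter_upwards [h1, h2] with y hy1 hy2
  rw [fullConv_sub_left hA hA' hB hy1 hy2, mul_sub]

theorem IsBilinear.duhamelOp_sub_right (h : IsBilinear d s ρ K M κ) {A B B' : Freq d → ℝ → ℂ}
    (hA : ∀ n, Measurable (A n)) (hB : ∀ n, Measurable (B n)) (hB' : ∀ n, Measurable (B' n))
    (fA : resEnergy M s ρ A < ∞) (fB : resEnergy M s ρ B < ∞) (fB' : resEnergy M s ρ B' < ∞)
    (n : Freq d) :
    ∀ᵐ σ, duhamelOp K M A (B - B') n σ = duhamelOp K M A B n σ - duhamelOp K M A B' n σ := by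
  have h1 := h.ae_interaction_lt_top (measurable_absFn hA) (measurable_absFn hB) fA fB n
  have h2 := h.ae_interaction_lt_top (measurable_absFn hA) (measurable_absFn hB') fA fB' n
  filter_upwards [h.ae_integrable hA hB fA fB n, h.ae_integrable hA hB' fA fB' n] with σ i1 i2
  unfold duhamelOp
  rw [← integral_sub i1 i2]
  refine integral_congr_ae ?_
  filter_upwards [h1, h2] with y hy1 hy2
  rw [fullConv_sub_right hA hB hB' hy1 hy2, mul_sub]

/-- The quadratic term is polarized as `(A, A) - (B, B) = (A - B, A) + (B, A - B)`. -/
theorem IsBilinear.resEnergy_duhamelOp_sub_le (h : IsBilinear d s ρ K M κ) {A B : Freq d → ℝ → ℂ}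
    (hA : ∀ n, Measurable (A n)) (hB : ∀ n, Measurable (B n)) (fA : resEnergy M s ρ A < ∞)
    (fB : resEnergy M s ρ B < ∞) :
    resEnergy M s ρ (duhamelOp K M A A - duhamelOp K M B B) ≤
      2 * (κ * (resEnergy M s ρ A + resEnergy M s ρ B)) * resEnergy M s ρ (A - B) := by
  have hAB : ∀ n, Measurable ((A - B) n) := fun n => (hA n).sub (hB n)
  have h1 := resEnergy_le_of_ae_le (M := M) (s := s) (ρ := ρ)
    (A := duhamelOp K M A A - duhamelOp K M B B) (B := duhamelOp K M (A - B) A)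
    (C := duhamelOp K M B (A - B)) (fun n => measurable_duhamelOp h.continuous M hAB hA n)
    (fun n => by
      filter_upwards [h.duhamelOp_sub_left hA hB hA fA fB fA n,
        h.duhamelOp_sub_right hB hA hB fB fA fB n] with σ e1 e2
      rw [e1, e2]
      simp only [Pi.sub_apply]
      rw [← sub_add_sub_cancel _ (duhamelOp K M B A n σ) (duhamelOp K M B B n σ)]
      exact enorm_add_le _ _)
  refine h1.trans ((mul_le_mul_right (add_le_add (h.resEnergy_duhamelOp_le hAB hA)
    (h.resEnergy_duhamelOp_le hB hAB)) _).trans (le_of_eq (by ring)))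

end Difference

end

/-! ### Picard iteration. -/

section

variable {d : ℕ}

/-- Cauchy–Schwarz against `2^(-j)`. It replaces the triangle inequality for infinite sums, as all
estimates are stated for squares of norms. -/
theorem sq_tsum_le_geometric (x : ℕ → ℝ≥0∞) : (∑' j, x j) ^ 2 ≤ 2 * ∑' j, 2 ^ j * x j ^ 2 := by
  have h := sq_tsum_le_mul (f := x) (u := fun j => (2⁻¹ : ℝ≥0∞) ^ j) (v := fun j => 2 ^ j * x j ^ 2)
    fun j => by
      rw [← mul_assoc, ← mul_pow, ENNReal.inv_mul_cancel (by norm_num) (by norm_num), one_pow,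
        one_mul]
  rwa [ENNReal.tsum_geometric, ENNReal.one_sub_inv_two, inv_inv] at h

theorem energyOne_tsum_le {s : ℝ} {a : ℕ → Freq d → ℝ → ℝ≥0∞} (ha : ∀ j n, Measurable (a j n)) :
    energyOne s (fun n σ => ∑' j, a j n σ) ≤ 2 * ∑' j, 2 ^ j * energyOne s (a j) := by
  unfold energyOne
  simp_rw [← ENNReal.tsum_mul_left]
  rw [ENNReal.tsum_comm]
  refine ENNReal.tsum_le_tsum fun n => ?_
  rw [lintegral_tsum fun j => (ha j n).aemeasurable]
  refine (mul_le_mul_right (sq_tsum_le_geometric _) _).trans (le_of_eq ?_)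
  rw [← ENNReal.tsum_mul_left, ← ENNReal.tsum_mul_left]
  exact tsum_congr fun j => by ring

theorem energyTwo_tsum_le {M s : ℝ} {a : ℕ → Freq d → ℝ → ℝ≥0∞} (ha : ∀ j n, Measurable (a j n)) :
    energyTwo M s (fun n σ => ∑' j, a j n σ) ≤ 2 * ∑' j, 2 ^ j * energyTwo M s (a j) := by
  unfold energyTwo
  simp_rw [← ENNReal.tsum_mul_left]
  rw [ENNReal.tsum_comm]
  refine ENNReal.tsum_le_tsum fun n => ?_
  have hm : ∀ j, Measurable fun σ => ENNReal.ofReal (modWeight M s n σ) * a j n σ ^ 2 := fun j =>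
    (measurable_modWeight M s n).ennreal_ofReal.mul ((ha j n).pow_const 2)
  have e : ∀ j, 2 * (2 ^ j * ∫⁻ σ, ENNReal.ofReal (modWeight M s n σ) * a j n σ ^ 2) =
      ∫⁻ σ, 2 * 2 ^ j * (ENNReal.ofReal (modWeight M s n σ) * a j n σ ^ 2) := fun j => by
    rw [lintegral_const_mul _ (hm j), mul_assoc]
  simp_rw [e]
  rw [← lintegral_tsum fun j => ((hm j).const_mul _).aemeasurable]
  refine lintegral_mono fun σ => ?_
  refine (mul_le_mul_right (sq_tsum_le_geometric _) _).trans (le_of_eq ?_)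
  rw [← ENNReal.tsum_mul_left, ← ENNReal.tsum_mul_left]
  exact tsum_congr fun j => by ring

theorem persEnergy_tsum_le {M s ρ : ℝ} {a : ℕ → Freq d → ℝ → ℝ≥0∞}
    (ha : ∀ j n, Measurable (a j n)) :
    persEnergy M s ρ (fun n σ => ∑' j, a j n σ) ≤ 2 * ∑' j, 2 ^ j * persEnergy M s ρ (a j) := by
  have e : weighted M ρ (fun n σ => ∑' j, a j n σ) = fun n σ => ∑' j, weighted M ρ (a j) n σ := by
    funext n σ
    simp only [weighted, ENNReal.tsum_mul_left]
  have hm : ∀ j n, Measurable (weighted M ρ (a j) n) := fun j => measurable_weighted (ha j)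
  unfold persEnergy energy
  rw [e]
  refine (add_le_add (energyOne_tsum_le hm) (energyTwo_tsum_le hm)).trans (le_of_eq ?_)
  simp_rw [mul_add]
  rw [ENNReal.tsum_add, mul_add]

/-- The term `x / 8` is absorbed on the left, which requires that `x` be finite. -/
theorem le_four_mul_of_le {x y : ℝ≥0∞} (hx : x ≠ ∞) (h : x ≤ 2 * (y + 16⁻¹ * x)) :
    x ≤ 4 * y := by
  rcases eq_or_ne y ∞ with rfl | hy
  · rw [ENNReal.mul_top (by norm_num)]; exact le_top
  lift x to NNReal using hx
  lift y to NNReal using hy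
  have h16 : (16⁻¹ : ℝ≥0∞) * x ≠ ∞ := ENNReal.mul_ne_top (by norm_num) ENNReal.coe_ne_top
  have h4 := ENNReal.toReal_mono (ENNReal.mul_ne_top (by norm_num)
    (ENNReal.add_ne_top.2 ⟨ENNReal.coe_ne_top, h16⟩)) h
  rw [ENNReal.toReal_mul, ENNReal.toReal_add ENNReal.coe_ne_top h16, ENNReal.toReal_mul] at h4
  simp only [ENNReal.coe_toReal, ENNReal.toReal_inv, ENNReal.toReal_ofNat] at h4
  have h5 : (x : ℝ) ≤ 4 * y := by
    have := y.coe_nonneg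
    have := x.coe_nonneg
    linarith
  exact_mod_cast h5

section Picard

variable {s ρ M : ℝ} {κ E : ℝ≥0∞} {K : ℝ → ℂ}

/-- The integral equation in terms of the space-time Fourier transform, with the linear part `L`. -/
def duhamelMap (K : ℝ → ℂ) (M : ℝ) (L G : Freq d → ℝ → ℂ) : Freq d → ℝ → ℂ :=
  L - duhamelOp K M G G

theorem measurable_duhamelMap (hK : Continuous K) (M : ℝ) {L G : Freq d → ℝ → ℂ}
    (hL : ∀ n, Measurable (L n)) (hG : ∀ n, Measurable (G n)) (n : Freq d) :
    Measurable (duhamelMap K M L G n) :=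
  (hL n).sub (measurable_duhamelOp hK M hG hG n)

theorem inv_256_mul_16 : (256⁻¹ : ℝ≥0∞) * 16 = 16⁻¹ := by
  rw [show (256 : ℝ≥0∞) = 16 * 16 by norm_num,
    ENNReal.mul_inv (Or.inl (by norm_num)) (Or.inl (by norm_num)), mul_assoc,
    ENNReal.inv_mul_cancel (by norm_num) (by norm_num), mul_one]

/-- On the ball of energy `4E` the Lipschitz constant is `2κ(4E + 4E) = 16κE ≤ 1/16`. A constant
below one would not suffice: it must beat the factors `2` and `2^j` lost by working with squared
norms. -/
theorem IsBilinear.resEnergy_duhamelOp_sub_le' (h : IsBilinear d s ρ K M κ) (hE : E < ∞)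
    (hκ : κ * E ≤ 256⁻¹) {A B : Freq d → ℝ → ℂ}
    (hA : ∀ n, Measurable (A n)) (hB : ∀ n, Measurable (B n)) (fA : resEnergy M s ρ A ≤ 4 * E)
    (fB : resEnergy M s ρ B ≤ 4 * E) :
    resEnergy M s ρ (duhamelOp K M A A - duhamelOp K M B B) ≤
      16⁻¹ * resEnergy M s ρ (A - B) := by
  have hE4 : 4 * E < ∞ := ENNReal.mul_lt_top (by norm_num) hE
  refine (h.resEnergy_duhamelOp_sub_le hA hB (fA.trans_lt hE4) (fB.trans_lt hE4)).trans ?_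
  refine mul_le_mul_left ?_ _
  calc 2 * (κ * (resEnergy M s ρ A + resEnergy M s ρ B)) ≤ 2 * (κ * (4 * E + 4 * E)) := by gcongr
    _ = (κ * E) * 16 := by ring
    _ ≤ 256⁻¹ * 16 := by gcongr
    _ = 16⁻¹ := inv_256_mul_16

theorem IsBilinear.resEnergy_duhamelMap_sub_le (h : IsBilinear d s ρ K M κ) (hE : E < ∞)
    (hκ : κ * E ≤ 256⁻¹) {A B L : Freq d → ℝ → ℂ}
    (hA : ∀ n, Measurable (A n)) (hB : ∀ n, Measurable (B n)) (fA : resEnergy M s ρ A ≤ 4 * E)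
    (fB : resEnergy M s ρ B ≤ 4 * E) :
    resEnergy M s ρ (duhamelMap K M L A - duhamelMap K M L B) ≤
      16⁻¹ * resEnergy M s ρ (A - B) := by
  unfold duhamelMap
  rw [sub_sub_sub_cancel_left, resEnergy_sub_comm]
  exact h.resEnergy_duhamelOp_sub_le' hE hκ hA hB fA fB

theorem IsBilinear.resEnergy_duhamelMap_le (h : IsBilinear d s ρ K M κ)
    (hκ : κ * E ≤ 256⁻¹) {A L : Freq d → ℝ → ℂ} (hL : ∀ n, Measurable (L n))
    (hA : ∀ n, Measurable (A n)) (fL : resEnergy M s ρ L ≤ E) (fA : resEnergy M s ρ A ≤ 4 * E) :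
    resEnergy M s ρ (duhamelMap K M L A) ≤ 4 * E := by
  refine (resEnergy_sub_le hL).trans ?_
  calc 2 * (resEnergy M s ρ L + resEnergy M s ρ (duhamelOp K M A A))
      ≤ 2 * (E + κ * ((4 * E) * (4 * E))) := by
        gcongr
        exact (h.resEnergy_duhamelOp_le hA hA).trans (by gcongr)
    _ = 2 * (E + (κ * E) * 16 * E) := by ring
    _ ≤ 2 * (E + 256⁻¹ * 16 * E) := by gcongr
    _ ≤ 2 * (E + 1 * E) := by
        rw [inv_256_mul_16]
        gcongr
        exact ENNReal.inv_le_one.2 (by norm_num)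
    _ = 4 * E := by ring

/-- The Picard iterates. -/
def picard (K : ℝ → ℂ) (M : ℝ) (L : Freq d → ℝ → ℂ) : ℕ → Freq d → ℝ → ℂ
  | 0 => 0
  | j + 1 => duhamelMap K M L (picard K M L j)

theorem measurable_picard (hK : Continuous K) (M : ℝ) {L : Freq d → ℝ → ℂ}
    (hL : ∀ n, Measurable (L n)) (j : ℕ) : ∀ n, Measurable (picard K M L j n) := by
  induction j with
  | zero => exact fun n => measurable_const
  | succ j ih => exact measurable_duhamelMap hK M hL ih

theorem resEnergy_zero : resEnergy M s ρ (0 : Freq d → ℝ → ℂ) = 0 := by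
  simp [resEnergy, persEnergy, energy, energyOne, energyTwo, weighted, absFn]

theorem IsBilinear.resEnergy_picard_le (h : IsBilinear d s ρ K M κ)
    (hκ : κ * E ≤ 256⁻¹) {L : Freq d → ℝ → ℂ} (hL : ∀ n, Measurable (L n))
    (fL : resEnergy M s ρ L ≤ E) (j : ℕ) : resEnergy M s ρ (picard K M L j) ≤ 4 * E := by
  induction j with
  | zero => rw [picard, resEnergy_zero]; exact zero_le
  | succ j ih =>
    exact h.resEnergy_duhamelMap_le hκ hL (measurable_picard h.continuous M hL j) fL ih

theorem duhamelOp_zero : duhamelOp K M (0 : Freq d → ℝ → ℂ) 0 = 0 := by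
  funext n σ
  simp [duhamelOp, fullConv, pairConv]

theorem IsBilinear.resEnergy_picard_sub_le (h : IsBilinear d s ρ K M κ) (hE : E < ∞)
    (hκ : κ * E ≤ 256⁻¹) {L : Freq d → ℝ → ℂ} (hL : ∀ n, Measurable (L n))
    (fL : resEnergy M s ρ L ≤ E) (j : ℕ) :
    resEnergy M s ρ (picard K M L (j + 1) - picard K M L j) ≤ 16⁻¹ ^ j * E := by
  induction j with
  | zero =>
    simp only [picard, duhamelMap, duhamelOp_zero, sub_zero, pow_zero, one_mul]
    exact fL
  | succ j ih =>
    have := h.resEnergy_duhamelMap_sub_le hE hκ (L := L)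
      (measurable_picard h.continuous M hL (j + 1)) (measurable_picard h.continuous M hL j)
      (h.resEnergy_picard_le hκ hL fL (j + 1)) (h.resEnergy_picard_le hκ hL fL j)
    refine this.trans ?_
    rw [pow_succ, mul_comm (16⁻¹ ^ j), mul_assoc]
    exact mul_le_mul_right ih _

theorem tsum_geometric_le (j : ℕ) :
    2 * ∑' i : ℕ, 2 ^ i * ((16⁻¹ : ℝ≥0∞) ^ (i + j) * E) ≤ 16⁻¹ ^ j * (4 * E) := by
  have h : ∀ i : ℕ, 2 ^ i * ((16⁻¹ : ℝ≥0∞) ^ (i + j) * E) ≤ 2⁻¹ ^ i * (16⁻¹ ^ j * E) := fun i => by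
    have h1 : (2 : ℝ≥0∞) * 16⁻¹ ≤ 2⁻¹ := by
      rw [← div_eq_mul_inv]
      refine ENNReal.div_le_of_le_mul ?_
      rw [show (16 : ℝ≥0∞) = 2 * 8 by norm_num, ← mul_assoc,
        ENNReal.inv_mul_cancel (by norm_num) (by norm_num)]
      norm_num
    calc 2 ^ i * ((16⁻¹ : ℝ≥0∞) ^ (i + j) * E) = (2 * 16⁻¹) ^ i * (16⁻¹ ^ j * E) := by
          rw [pow_add, mul_pow]; ring
      _ ≤ _ := by gcongr
  refine (mul_le_mul_right (ENNReal.tsum_le_tsum h) _).trans (le_of_eq ?_)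
  rw [ENNReal.tsum_mul_right, ENNReal.tsum_geometric, ENNReal.one_sub_inv_two, inv_inv]
  ring

/-- The integral equation has a solution. -/
theorem IsBilinear.exists_fixedPoint (h : IsBilinear d s ρ K M κ) (hE : E < ∞)
    (hκ : κ * E ≤ 256⁻¹) {L : Freq d → ℝ → ℂ} (hL : ∀ n, Measurable (L n))
    (fL : resEnergy M s ρ L ≤ E) :
    ∃ G : Freq d → ℝ → ℂ, (∀ n, Measurable (G n)) ∧ resEnergy M s ρ G ≤ 4 * E ∧
      ∀ n, ∀ᵐ σ, G n σ = duhamelMap K M L G n σ := by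
  set P := picard K M L with hP
  have hPm := measurable_picard h.continuous M hL
  have hPE := h.resEnergy_picard_le hκ hL fL
  set D : ℕ → Freq d → ℝ → ℂ := fun j => P (j + 1) - P j with hD
  have hDm : ∀ j n, Measurable (D j n) := fun j n => (hPm (j + 1) n).sub (hPm j n)
  have hDE : ∀ j, resEnergy M s ρ (D j) ≤ 16⁻¹ ^ j * E := h.resEnergy_picard_sub_le hE hκ hL fL
  -- The limit is the pointwise sum of the increments, almost everywhere convergent by the energy
  -- bound, so that completeness of the resolution space is not needed.
  set G : Freq d → ℝ → ℂ := fun n σ => ∑' j, D j n σ with hG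
  have hGm : ∀ n, Measurable (G n) := fun n => Measurable.tsum fun j => hDm j n
  have htail : ∀ j, persEnergy M s ρ (fun n σ => ∑' i, absFn (D (i + j)) n σ) ≤
      16⁻¹ ^ j * (4 * E) := fun j => by
    refine (persEnergy_tsum_le fun i => measurable_absFn (hDm (i + j))).trans ?_
    refine (mul_le_mul_right (ENNReal.tsum_le_tsum fun i => mul_le_mul_right (hDE (i + j)) _)
      _).trans (tsum_geometric_le j)
  have hsum : ∀ n, ∀ᵐ σ, Summable fun j => D j n σ := fun n => by
    have h0 := htail 0
    simp only [add_zero, pow_zero, one_mul] at h0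
    have hm : Measurable fun σ => ∑' j, absFn (D j) n σ :=
      Measurable.tsum fun j => measurable_absFn (hDm j) n
    have := lintegral_lt_top_of_persEnergy h.pos h.rho_nonneg
      (h0.trans_lt (ENNReal.mul_lt_top (by norm_num) hE)) n
    filter_upwards [ae_lt_top hm this.ne] with σ hσ
    refine Summable.of_norm ?_
    simpa only [absFn, toReal_enorm] using ENNReal.summable_toReal hσ.ne
  have hGP : ∀ j, resEnergy M s ρ (G - P j) ≤ 16⁻¹ ^ j * (4 * E) := fun j => by
    refine le_trans (persEnergy_mono_ae fun n => ?_) (htail j)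
    filter_upwards [hsum n] with σ hσ
    have e1 : P j n σ = ∑ i ∈ Finset.range j, D i n σ := by
      have := Finset.sum_range_sub (fun i => P i n σ) j
      simp only [hD, Pi.sub_apply]
      rw [this]
      simp [hP, picard]
    have e2 : (G - P j) n σ = ∑' i, D (i + j) n σ := by
      simp only [Pi.sub_apply, hG, e1]
      rw [← hσ.sum_add_tsum_nat_add j, add_sub_cancel_left]
    simp only [absFn] at e2 ⊢
    rw [e2]
    exact enorm_tsum_le_tsum_enorm
  have hGE : resEnergy M s ρ G ≤ 4 * E := by
    have := hGP 0
    simpa [hP, picard] using this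
  have hΨm := measurable_duhamelMap h.continuous M hL hGm
  refine ⟨G, hGm, hGE, ae_eq_of_resEnergy_sub (s := s) h.pos h.rho_nonneg hGm hΨm ?_⟩
  -- Both `G` and its image are close to the iterate `P (j + 1)`, so the defect of the equation has
  -- energy zero.
  have hle : ∀ j, resEnergy M s ρ (G - duhamelMap K M L G) ≤ 16⁻¹ ^ j * (16 * E) := fun j => by
    have h1 := resEnergy_le_of_ae_le (M := M) (s := s) (ρ := ρ) (A := G - duhamelMap K M L G)
      (B := G - P (j + 1)) (C := P (j + 1) - duhamelMap K M L G)
      (fun n => (hGm n).sub (hPm (j + 1) n)) (fun n => ae_of_all _ fun σ => by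
        simp only [Pi.sub_apply]
        rw [← sub_add_sub_cancel _ (P (j + 1) n σ) _]
        exact enorm_add_le _ _)
    have h2 : resEnergy M s ρ (P (j + 1) - duhamelMap K M L G) ≤ 16⁻¹ ^ j * (4 * E) := by
      refine (h.resEnergy_duhamelMap_sub_le hE hκ (L := L) (hPm j) hGm (hPE j) hGE).trans ?_
      rw [resEnergy_sub_comm]
      refine le_trans ?_ (hGP j)
      exact mul_le_of_le_one_left' (ENNReal.inv_le_one.2 (by norm_num))
    have h3 : resEnergy M s ρ (G - P (j + 1)) ≤ 16⁻¹ ^ j * (4 * E) := by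
      refine (hGP (j + 1)).trans (mul_le_mul_left ?_ _)
      exact pow_le_pow_right_of_le_one' (ENNReal.inv_le_one.2 (by norm_num)) (Nat.le_succ j)
    refine h1.trans ((mul_le_mul_right (add_le_add h3 h2) _).trans (le_of_eq ?_))
    ring
  have hlim : Tendsto (fun j : ℕ => (16⁻¹ : ℝ≥0∞) ^ j * (16 * E)) atTop (𝓝 (0 * (16 * E))) := by
    refine ENNReal.Tendsto.mul_const (ENNReal.tendsto_pow_atTop_nhds_zero_of_lt_one ?_)
      (Or.inr (ENNReal.mul_lt_top (by norm_num) hE).ne)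
    exact ENNReal.inv_lt_one.2 (by norm_num)
  rw [zero_mul] at hlim
  exact nonpos_iff_eq_zero.1 (ge_of_tendsto' hlim hle)

/-- The solution of the integral equation depends continuously on the linear part. -/
theorem IsBilinear.resEnergy_fixedPoint_sub_le (h : IsBilinear d s ρ K M κ) (hE : E < ∞)
    (hκ : κ * E ≤ 256⁻¹) {L L' G G' : Freq d → ℝ → ℂ} (hL : ∀ n, Measurable (L n))
    (hL' : ∀ n, Measurable (L' n)) (hG : ∀ n, Measurable (G n)) (hG' : ∀ n, Measurable (G' n))
    (fG : resEnergy M s ρ G ≤ 4 * E) (fG' : resEnergy M s ρ G' ≤ 4 * E)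
    (eG : ∀ n, ∀ᵐ σ, G n σ = duhamelMap K M L G n σ)
    (eG' : ∀ n, ∀ᵐ σ, G' n σ = duhamelMap K M L' G' n σ) :
    resEnergy M s ρ (G - G') ≤ 4 * resEnergy M s ρ (L - L') := by
  have h1 := resEnergy_le_of_ae_le (M := M) (s := s) (ρ := ρ) (A := G - G')
    (B := L - L') (C := duhamelOp K M G G - duhamelOp K M G' G')
    (fun n => (hL n).sub (hL' n)) (fun n => by
      filter_upwards [eG n, eG' n] with σ e1 e2
      simp only [Pi.sub_apply, e1, e2, duhamelMap]
      rw [sub_sub_sub_comm]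
      exact enorm_sub_le)
  have h2 := h.resEnergy_duhamelOp_sub_le' hE hκ hG hG' fG fG'
  set N := resEnergy M s ρ (G - G') with hN
  set N₀ := resEnergy M s ρ (L - L') with hN₀
  have hNt : N ≠ ∞ := by
    refine ((resEnergy_sub_le hG).trans_lt ?_).ne
    exact ENNReal.mul_lt_top (by norm_num) (ENNReal.add_lt_top.2
      ⟨fG.trans_lt (ENNReal.mul_lt_top (by norm_num) hE),
        fG'.trans_lt (ENNReal.mul_lt_top (by norm_num) hE)⟩)
  have h3 : N ≤ 2 * (N₀ + 16⁻¹ * N) := h1.trans (mul_le_mul_right (add_le_add_right h2 _) _)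
  exact le_four_mul_of_le hNt h3

end Picard

end

/-! ### Translation and localization in time, and uniqueness on a short interval. -/

section

variable {d : ℕ}

theorem continuous_evol {A : Freq d → ℝ → ℂ} {n : Freq d} (hA : Integrable (A n)) :
    Continuous fun t => evol A t n := by
  unfold evol
  refine Continuous.mul (by fun_prop) ?_
  refine continuous_of_dominated (bound := fun σ => ‖A n σ‖)
    (fun t => (integrable_exp_mul hA t).aestronglyMeasurable) (fun t => ae_of_all _ fun σ => ?_)
    hA.norm (ae_of_all _ fun σ => by fun_prop)
  rw [norm_mul, norm_exp_I_mul_mul, one_mul]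

theorem evol_sub {A B : Freq d → ℝ → ℂ} {n : Freq d} (hA : Integrable (A n))
    (hB : Integrable (B n)) (t : ℝ) : evol (A - B) t n = evol A t n - evol B t n := by
  unfold evol
  rw [← mul_sub, ← integral_sub (integrable_exp_mul hA t) (integrable_exp_mul hB t)]
  simp only [Pi.sub_apply, mul_sub]

theorem evol_add {A B : Freq d → ℝ → ℂ} {n : Freq d} (hA : Integrable (A n))
    (hB : Integrable (B n)) (t : ℝ) : evol (A + B) t n = evol A t n + evol B t n := by
  unfold evol
  rw [← mul_add, ← integral_add (integrable_exp_mul hA t) (integrable_exp_mul hB t)]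
  simp only [Pi.add_apply, mul_add]

theorem evol_neg (A : Freq d → ℝ → ℂ) (t : ℝ) (n : Freq d) : evol (-A) t n = -evol A t n := by
  unfold evol
  simp only [Pi.neg_apply, mul_neg, integral_neg]

theorem evol_congr_ae {A B : Freq d → ℝ → ℂ} {n : Freq d} (h : ∀ᵐ σ, A n σ = B n σ) (t : ℝ) :
    evol A t n = evol B t n := by
  unfold evol
  congr 1
  refine integral_congr_ae ?_
  filter_upwards [h] with σ hσ
  rw [hσ]

theorem enorm_evol_le (A : Freq d → ℝ → ℂ) (t : ℝ) (n : Freq d) :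
    ‖evol A t n‖ₑ ≤ ∫⁻ σ, absFn A n σ := by
  unfold evol
  rw [enorm_mul, ← ofReal_norm, norm_exp_neg_I_mul_mul, ENNReal.ofReal_one, one_mul]
  refine (enorm_integral_le_lintegral_enorm _).trans (lintegral_mono fun σ => ?_)
  rw [enorm_mul, ← ofReal_norm, norm_exp_I_mul_mul, ENNReal.ofReal_one, one_mul]
  exact le_rfl

/-- The translation in time by `t₀`. -/
def timeShift (t₀ : ℝ) (A : Freq d → ℝ → ℂ) : Freq d → ℝ → ℂ := fun n σ =>
  Complex.exp (-(Complex.I * t₀ * freqSq n)) * (Complex.exp (Complex.I * t₀ * σ) * A n σ)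

theorem measurable_timeShift (t₀ : ℝ) {A : Freq d → ℝ → ℂ} (hA : ∀ n, Measurable (A n))
    (n : Freq d) : Measurable (timeShift t₀ A n) :=
  Measurable.const_mul ((by fun_prop :
    Continuous fun σ : ℝ => Complex.exp (Complex.I * t₀ * σ)).measurable.mul (hA n)) _

/-- A translation in time multiplies the transform by a unimodular factor, so all energies are the
same around every base time. -/
theorem absFn_timeShift (t₀ : ℝ) (A : Freq d → ℝ → ℂ) : absFn (timeShift t₀ A) = absFn A := by
  funext n σ
  simp only [absFn, timeShift]
  rw [enorm_mul, enorm_mul, ← ofReal_norm, ← ofReal_norm, norm_exp_neg_I_mul_mul,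
    norm_exp_I_mul_mul, ENNReal.ofReal_one, one_mul, one_mul]

theorem evol_timeShift (t₀ : ℝ) (A : Freq d → ℝ → ℂ) (t : ℝ) (n : Freq d) :
    evol (timeShift t₀ A) t n = evol A (t₀ + t) n := by
  unfold evol
  rw [← integral_const_mul, ← integral_const_mul]
  refine integral_congr_ae (ae_of_all _ fun σ => ?_)
  simp only [timeShift]
  simp only [← mul_assoc, ← Complex.exp_add]
  congr 2
  push_cast; ring

/-- The multiplication by a cutoff in time on the scale `1 / M`. -/
def timeCut (K : ℝ → ℂ) (M : ℝ) (A : Freq d → ℝ → ℂ) : Freq d → ℝ → ℂ := fun n σ =>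
  ∫ y, A n y * ((M⁻¹ : ℝ) * K ((σ - y) / M))

theorem measurable_timeCut {K : ℝ → ℂ} (hK : Continuous K) (M : ℝ) {A : Freq d → ℝ → ℂ}
    (hA : ∀ n, Measurable (A n)) (n : Freq d) : Measurable (timeCut K M A n) := by
  have h : Measurable fun q : ℝ × ℝ => A n q.2 * ((M⁻¹ : ℝ) * K ((q.1 - q.2) / M)) :=
    ((hA n).comp measurable_snd).mul (by fun_prop :
      Continuous fun q : ℝ × ℝ => ((M⁻¹ : ℝ) : ℂ) * K ((q.1 - q.2) / M)).measurable
  exact (StronglyMeasurable.integral_prod_right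
    (f := fun σ y => A n y * ((M⁻¹ : ℝ) * K ((σ - y) / M))) h.stronglyMeasurable).measurable

theorem integral_exp_mul_scaled {ρ C : ℝ} {K : ℝ → ℂ} (hK : IsCutoffKernel ρ C K) {M : ℝ}
    (hM : 0 < M) {t : ℝ} (ht : |t| ≤ M⁻¹) :
    ∫ σ : ℝ, Complex.exp (Complex.I * t * σ) * ((M⁻¹ : ℝ) * K (σ / M)) = 1 := by
  have h : ∀ σ : ℝ, Complex.exp (Complex.I * t * σ) * ((M⁻¹ : ℝ) * K (σ / M)) =
      (M⁻¹ : ℝ) * (Complex.exp (Complex.I * t * σ) * K (σ / M)) := fun σ => mul_left_comm _ _ _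
  simp_rw [h]
  rw [integral_const_mul, integral_exp_mul_comp_div hK hM ht, ← Complex.ofReal_mul,
    inv_mul_cancel₀ hM.ne', Complex.ofReal_one]

theorem integrable_scaled {ρ C : ℝ} {K : ℝ → ℂ} (hK : IsCutoffKernel ρ C K) {M : ℝ}
    (hM : 0 < M) : Integrable fun σ : ℝ => ((M⁻¹ : ℝ) : ℂ) * K (σ / M) :=
  (hK.integrable.comp_div hM.ne').const_mul _

theorem evol_timeCut {ρ C : ℝ} {K : ℝ → ℂ} (hK : IsCutoffKernel ρ C K) {M : ℝ}
    (hM : 0 < M) {A : Freq d → ℝ → ℂ} {n : Freq d} (hA : Integrable (A n)) {t : ℝ}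
    (ht : |t| ≤ M⁻¹) : evol (timeCut K M A) t n = evol A t n := by
  have h := integral_convolution (μ := volume) (ν := volume) (ContinuousLinearMap.mul ℂ ℂ)
    (integrable_exp_mul hA t) (integrable_exp_mul (integrable_scaled hK hM) t)
  rw [integral_exp_mul_scaled hK hM ht, ContinuousLinearMap.mul_apply', mul_one] at h
  unfold evol
  rw [← h]
  congr 1
  refine integral_congr_ae (ae_of_all _ fun σ => ?_)
  simp only [convolution_def, timeCut]
  rw [← integral_const_mul]
  refine integral_congr_ae (ae_of_all _ fun y => ?_)
  simp only [ContinuousLinearMap.mul_apply']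
  have : Complex.exp (Complex.I * t * σ) = Complex.exp (Complex.I * t * y) *
      Complex.exp (Complex.I * t * ((σ - y : ℝ) : ℂ)) := by
    rw [← Complex.exp_add]; congr 1; push_cast; ring
  rw [this]; ring

theorem weighted_zero (M : ℝ) (a : Freq d → ℝ → ℝ≥0∞) : weighted M 0 a = a := by
  funext n σ
  simp [weighted]

/-- Neither the constant nor the right-hand side depends on `M`, as the factor `M^(-1/3)` in front
of `energyBase` is at most one. Uniqueness can therefore choose `M` after the two solutions. -/
theorem exists_resEnergy_timeCut_le {s : ℝ} (hs : -(2 / 3) < s) (hs' : s ≤ -(1 / 2)) {C₀ : ℝ}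
    {K : ℝ → ℂ} (hK : IsCutoffKernel 0 C₀ K) :
    ∃ C : ℝ, 0 < C ∧ ∀ M : ℝ, 1 ≤ M → ∀ A : Freq d → ℝ → ℂ, (∀ n, Measurable (A n)) →
      resEnergy M s 0 (timeCut K M A) ≤
        ENNReal.ofReal C * (energyOne s (absFn A) + energyBase s (absFn A)) := by
  obtain ⟨C, hC, h⟩ := exists_energy_cutKernel_conv_le (d := d) hs hs'
  have hC₀ := hK.pos
  refine ⟨C₀ ^ 2 * C, by positivity, fun M hM A hA => ?_⟩
  have hM0 : 0 < M := by linarith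
  have hpt : ∀ n σ, absFn (timeCut K M A) n σ ≤ ENNReal.ofReal C₀ *
      ∫⁻ y, ENNReal.ofReal (cutKernel M (σ - y)) * absFn A n y := fun n σ => by
    refine (enorm_integral_le_lintegral_enorm _).trans ?_
    rw [← lintegral_const_mul' _ _ ENNReal.ofReal_ne_top]
    refine lintegral_mono fun y => ?_
    rw [enorm_mul, mul_comm, ← mul_assoc, ← ENNReal.ofReal_mul hC₀.le]
    refine mul_le_mul_left ?_ _
    rw [← ofReal_norm]
    refine ENNReal.ofReal_le_ofReal ?_
    have h1 := hK.norm_le ((σ - y) / M)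
    rw [norm_mul, Complex.norm_real, Real.norm_of_nonneg (by positivity), cutKernel_eq hM0,
      mul_left_comm]
    rw [abs_div, abs_of_pos hM0, add_zero] at h1
    gcongr
  unfold resEnergy persEnergy
  rw [weighted_zero]
  refine (energy_mono hpt).trans ?_
  rw [energy_const_mul _ _ _ ENNReal.ofReal_ne_top]
  refine (mul_le_mul_right (h M hM0 _ (measurable_absFn hA)) _).trans ?_
  rw [← mul_assoc, ← ENNReal.ofReal_pow hC₀.le, ← ENNReal.ofReal_mul (by positivity)]
  refine mul_le_mul_right (add_le_add_right ?_ _) _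
  refine mul_le_of_le_one_left' ?_
  rw [← ENNReal.ofReal_one]
  exact ENNReal.ofReal_le_ofReal (Real.rpow_le_one_of_one_le_of_nonpos hM (by norm_num))

/-- The integrand of the Duhamel integral over `[0, t]` for the pair of frequencies
`(k, -n - k)`. -/
def pairIntegrand (A B : Freq d → ℝ → ℂ) (t : ℝ) (n k : Freq d) (t' : ℝ) : ℂ :=
  Complex.exp (-(Complex.I * (t - t') * freqSq n)) *
    (conj (evol A t' k) * conj (evol B t' (-n - k)))

theorem continuous_pairIntegrand {A B : Freq d → ℝ → ℂ} (hA : ∀ n, Integrable (A n))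
    (hB : ∀ n, Integrable (B n)) (t : ℝ) (n k : Freq d) : Continuous (pairIntegrand A B t n k) := by
  unfold pairIntegrand
  exact Continuous.mul (by fun_prop) ((Complex.continuous_conj.comp (continuous_evol (hA k))).mul
    (Complex.continuous_conj.comp (continuous_evol (hB (-n - k)))))

section Uniqueness

variable {s M : ℝ} {κ E : ℝ≥0∞} {K : ℝ → ℂ}

theorem IsBilinear.hasSum_pairIntegrand {ρ C : ℝ} (h : IsBilinear d s ρ K M κ)
    (hK : IsCutoffKernel ρ C K) {A B : Freq d → ℝ → ℂ} (hA : ∀ n, Measurable (A n))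
    (hB : ∀ n, Measurable (B n)) (fA : resEnergy M s ρ A < ∞) (fB : resEnergy M s ρ B < ∞)
    (n : Freq d) {t : ℝ} (ht : |t| ≤ M⁻¹) :
    HasSum (fun k => ∫ t' in (0 : ℝ)..t, pairIntegrand A B t n k t')
      (-Complex.I * evol (duhamelOp K M A B) t n) :=
  hasSum_duhamel_evol hK h.pos hA hB (integrable_of_resEnergy h.pos h.rho_nonneg hA fA)
    (integrable_of_resEnergy h.pos h.rho_nonneg hB fB)
    (h.lintegral_lt_top _ _ (measurable_absFn hA) (measurable_absFn hB) fA fB n)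
    (h.lintegral_majorant_lt_top (measurable_absFn hA) (measurable_absFn hB) fA fB n) ht

theorem resEnergy_neg (ρ : ℝ) (A : Freq d → ℝ → ℂ) :
    resEnergy M s ρ (-A) = resEnergy M s ρ A := by
  unfold resEnergy
  congr 1
  funext n σ
  exact enorm_neg _

theorem IsBilinear.resEnergy_duhamelOp_lt_top {ρ : ℝ} (h : IsBilinear d s ρ K M κ)
    {A B : Freq d → ℝ → ℂ} (hA : ∀ n, Measurable (A n))
    (hB : ∀ n, Measurable (B n)) (fA : resEnergy M s ρ A < ∞) (fB : resEnergy M s ρ B < ∞) :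
    resEnergy M s ρ (duhamelOp K M A B) < ∞ :=
  (h.resEnergy_duhamelOp_le hA hB).trans_lt
    (ENNReal.mul_lt_top h.kappa_lt_top (ENNReal.mul_lt_top fA fB))

/-- Improvement of the extension of the difference of two solutions. -/
theorem IsBilinear.exists_extension_le {ρ C : ℝ} (h : IsBilinear d s ρ K M κ)
    (hK : IsCutoffKernel ρ C K) {J : Set ℝ} (hJ : ∀ t ∈ J, |t| ≤ M⁻¹)
    (hJ0 : ∀ t ∈ J, uIcc 0 t ⊆ J) (hE : E < ∞) (hκ : κ * E ≤ 256⁻¹) {A B : Freq d → ℝ → ℂ}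
    (hA : ∀ n, Measurable (A n)) (hB : ∀ n, Measurable (B n)) (fA : resEnergy M s ρ A ≤ E)
    (fB : resEnergy M s ρ B ≤ E)
    (hsol : ∀ t ∈ J, ∀ n, ∃ S, HasSum (fun k => ∫ t' in (0 : ℝ)..t,
      (pairIntegrand A A t n k t' - pairIntegrand B B t n k t')) S ∧
        evol A t n - evol B t n = -Complex.I * S)
    {H : Freq d → ℝ → ℂ} (hH : ∀ n, Measurable (H n)) (fH : resEnergy M s ρ H < ∞)
    (eH : ∀ t ∈ J, ∀ n, evol A t n - evol B t n = evol H t n) :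
    ∃ H' : Freq d → ℝ → ℂ, (∀ n, Measurable (H' n)) ∧
      resEnergy M s ρ H' ≤ 16⁻¹ * resEnergy M s ρ H ∧
      ∀ t ∈ J, ∀ n, evol A t n - evol B t n = evol H' t n := by
  have fA' := fA.trans_lt hE
  have fB' := fB.trans_lt hE
  have iA := integrable_of_resEnergy h.pos h.rho_nonneg hA fA'
  have iB := integrable_of_resEnergy h.pos h.rho_nonneg hB fB'
  have iH := integrable_of_resEnergy h.pos h.rho_nonneg hH fH
  set X := duhamelOp K M H A with hX
  set Y := duhamelOp K M B H with hY
  have mX : ∀ n, Measurable (X n) := measurable_duhamelOp h.continuous M hH hA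
  have mY : ∀ n, Measurable (Y n) := measurable_duhamelOp h.continuous M hB hH
  have iX := integrable_of_resEnergy h.pos h.rho_nonneg mX
    (h.resEnergy_duhamelOp_lt_top hH hA fH fA')
  have iY := integrable_of_resEnergy h.pos h.rho_nonneg mY
    (h.resEnergy_duhamelOp_lt_top hB hH fB' fH)
  -- Polarization of the Duhamel term needs the difference only on `J`, where `H` represents it. So
  -- `-(X + Y)` is again an extension of the difference, and its energy is at most `4κE ≤ 1/16`
  -- times that of `H`.
  refine ⟨-(X + Y), fun n => ((mX n).add (mY n)).neg, ?_, fun t ht n => ?_⟩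
  · rw [resEnergy_neg]
    refine (resEnergy_le_of_ae_le (B := X) (C := Y) mX fun n => ae_of_all _ fun σ =>
      enorm_add_le _ _).trans ?_
    calc _ ≤ 2 * (κ * (resEnergy M s ρ H * E) + κ * (E * resEnergy M s ρ H)) := by
          refine mul_le_mul_right (add_le_add
            ((h.resEnergy_duhamelOp_le hH hA).trans (by gcongr))
            ((h.resEnergy_duhamelOp_le hB hH).trans (by gcongr))) _
      _ = (κ * E) * 4 * resEnergy M s ρ H := by ring
      _ ≤ (256⁻¹ * 16) * resEnergy M s ρ H := by gcongr; norm_num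
      _ = _ := by rw [inv_256_mul_16]
  · obtain ⟨S, hS, eS⟩ := hsol t ht n
    have h1 := h.hasSum_pairIntegrand hK hH hA fH fA' n (hJ t ht)
    have h2 := h.hasSum_pairIntegrand hK hB hH fB' fH n (hJ t ht)
    have h3 := h1.add h2
    have e : (fun k => (∫ t' in (0 : ℝ)..t, pairIntegrand H A t n k t') +
        ∫ t' in (0 : ℝ)..t, pairIntegrand B H t n k t') = fun k => ∫ t' in (0 : ℝ)..t,
          (pairIntegrand A A t n k t' - pairIntegrand B B t n k t') := by
      funext k
      rw [← intervalIntegral.integral_add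
        ((continuous_pairIntegrand iH iA t n k).intervalIntegrable _ _)
        ((continuous_pairIntegrand iB iH t n k).intervalIntegrable _ _)]
      refine intervalIntegral.integral_congr fun t' ht' => ?_
      have e1 := eH t' (hJ0 t ht ht') k
      have e2 := eH t' (hJ0 t ht ht') (-n - k)
      simp only [pairIntegrand]
      rw [← e1, ← e2, map_sub, map_sub]
      ring
    rw [e] at h3
    rw [eS, hS.unique h3, evol_neg, evol_add (iX n) (iY n)]
    linear_combination (evol X t n + evol Y t n) * Complex.I_mul_I

/-- Uniqueness on the time scale `1 / M`. -/
theorem IsBilinear.evol_eq {ρ C : ℝ} (h : IsBilinear d s ρ K M κ)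
    (hK : IsCutoffKernel ρ C K) {J : Set ℝ} (hJ : ∀ t ∈ J, |t| ≤ M⁻¹)
    (hJ0 : ∀ t ∈ J, uIcc 0 t ⊆ J) (hE : E < ∞) (hκ : κ * E ≤ 256⁻¹) {A B : Freq d → ℝ → ℂ}
    (hA : ∀ n, Measurable (A n)) (hB : ∀ n, Measurable (B n)) (fA : resEnergy M s ρ A ≤ E)
    (fB : resEnergy M s ρ B ≤ E)
    (hsol : ∀ t ∈ J, ∀ n, ∃ S, HasSum (fun k => ∫ t' in (0 : ℝ)..t,
      (pairIntegrand A A t n k t' - pairIntegrand B B t n k t')) S ∧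
        evol A t n - evol B t n = -Complex.I * S) :
    ∀ t ∈ J, ∀ n, evol A t n = evol B t n := by
  have fA' := fA.trans_lt hE
  have fB' := fB.trans_lt hE
  have hE4 : 4 * E < ∞ := ENNReal.mul_lt_top (by norm_num) hE
  -- The difference of the two full extensions does not solve an equation outside `J`; the
  -- improvement is therefore iterated over extensions of its restriction, whose infimum of energies
  -- turns out to be zero.
  have hex : ∀ j : ℕ, ∃ H : Freq d → ℝ → ℂ, (∀ n, Measurable (H n)) ∧
      resEnergy M s ρ H ≤ 16⁻¹ ^ j * (4 * E) ∧
      ∀ t ∈ J, ∀ n, evol A t n - evol B t n = evol H t n := by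
    intro j
    induction j with
    | zero =>
      refine ⟨A - B, fun n => (hA n).sub (hB n), ?_, fun t _ n => ?_⟩
      · rw [pow_zero, one_mul]
        refine (resEnergy_sub_le hA).trans ?_
        calc _ ≤ 2 * (E + E) := by gcongr
          _ = 4 * E := by ring
      · rw [evol_sub (integrable_of_resEnergy h.pos h.rho_nonneg hA fA' n)
          (integrable_of_resEnergy h.pos h.rho_nonneg hB fB' n)]
    | succ j ih =>
      obtain ⟨H, mH, fH, eH⟩ := ih
      have fH' : resEnergy M s ρ H < ∞ := by
        refine fH.trans_lt (ENNReal.mul_lt_top (ENNReal.pow_lt_top ?_) hE4)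
        exact ENNReal.inv_lt_top.2 (by norm_num)
      obtain ⟨H', mH', fH'', eH'⟩ :=
        h.exists_extension_le hK hJ hJ0 hE hκ hA hB fA fB hsol mH fH' eH
      refine ⟨H', mH', fH''.trans ?_, eH'⟩
      rw [pow_succ, mul_comm (16⁻¹ ^ j), mul_assoc]
      exact mul_le_mul_right fH _
  intro t ht n
  have hp := freqWeight_pos n
  have hle : ∀ j : ℕ, ENNReal.ofReal (freqWeight n ^ s) * ‖evol A t n - evol B t n‖ₑ ^ 2 ≤
      16⁻¹ ^ j * (4 * E) := fun j => by
    obtain ⟨H, -, fH, eH⟩ := hex j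
    rw [eH t ht n]
    refine le_trans ?_ ((energyOne_le_persEnergy h.pos h.rho_nonneg _).trans fH)
    refine le_trans ?_ (mul_sq_lintegral_le_energyOne s (absFn H) n)
    exact mul_le_mul_right (pow_le_pow_left' (enorm_evol_le H t n) 2) _
  have hlim : Tendsto (fun j : ℕ => (16⁻¹ : ℝ≥0∞) ^ j * (4 * E)) atTop (𝓝 (0 * (4 * E))) := by
    refine ENNReal.Tendsto.mul_const (ENNReal.tendsto_pow_atTop_nhds_zero_of_lt_one ?_)
      (Or.inr hE4.ne)
    exact ENNReal.inv_lt_one.2 (by norm_num)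
  rw [zero_mul] at hlim
  have h0 := nonpos_iff_eq_zero.1 (ge_of_tendsto' hlim hle)
  have h3 : ENNReal.ofReal (freqWeight n ^ s) ≠ 0 := by
    rw [Ne, ENNReal.ofReal_eq_zero, not_le]; positivity
  rw [mul_eq_zero, or_iff_right h3, sq_eq_zero_iff, enorm_eq_zero, sub_eq_zero] at h0
  exact h0

end Uniqueness

end

/-! ### Uniqueness on the whole interval. -/

section

variable {d : ℕ}

/-- A short time scale replaces smallness of the data. -/
theorem exists_scale {C δ : ℝ} (hδ : 0 < δ) {E : ℝ≥0∞} (hE : E < ∞) :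
    ∃ M : ℝ, 1 ≤ M ∧ ENNReal.ofReal (C * M ^ (-δ)) * E ≤ 256⁻¹ := by
  lift E to NNReal using hE.ne
  have h1 : Tendsto (fun M : ℝ => C * M ^ (-δ) * E) atTop (𝓝 (C * 0 * E)) :=
    ((tendsto_rpow_neg_atTop hδ).const_mul C).mul_const _
  rw [mul_zero, zero_mul] at h1
  have h2 := (h1.eventually (gt_mem_nhds (by norm_num : (0 : ℝ) < 256⁻¹))).and
    (eventually_ge_atTop 1)
  obtain ⟨M, hM, hM1⟩ := h2.exists
  refine ⟨M, hM1, ?_⟩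
  rw [← ENNReal.ofReal_coe_nnreal, ← ENNReal.ofReal_mul' E.coe_nonneg]
  refine (ENNReal.ofReal_le_ofReal hM.le).trans (le_of_eq ?_)
  rw [ENNReal.ofReal_inv_of_pos (by norm_num)]
  norm_num

/-- `A` is the space-time Fourier transform, in terms of the modulation, of an extension of a
solution on `[-T, T]` with initial Fourier coefficients `c`. -/
def SolvesOn (T : ℝ) (c : Freq d → ℂ) (A : Freq d → ℝ → ℂ) : Prop :=
  ∀ t : ℝ, |t| ≤ T → ∀ n, ∃ S, HasSum (fun k => ∫ t' in (0 : ℝ)..t, pairIntegrand A A t n k t') S ∧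
    evol A t n = Complex.exp (-(Complex.I * t * freqSq n)) * c n - Complex.I * S

theorem pairIntegrand_add (A : Freq d → ℝ → ℂ) (t₀ t t' : ℝ) (n k : Freq d) :
    pairIntegrand A A (t₀ + t : ℝ) n k t' =
      Complex.exp (-(Complex.I * t * freqSq n)) * pairIntegrand A A t₀ n k t' := by
  unfold pairIntegrand
  have : Complex.exp (-(Complex.I * ((t₀ + t : ℝ) - t') * freqSq n)) =
      Complex.exp (-(Complex.I * t * freqSq n)) *
        Complex.exp (-(Complex.I * (t₀ - t') * freqSq n)) := by
    rw [← Complex.exp_add]; congr 1; push_cast; ring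
  rw [this, mul_assoc]

theorem integral_pairIntegrand_shift {A : Freq d → ℝ → ℂ} (hA : ∀ n, Integrable (A n))
    (t₀ t : ℝ) (n k : Freq d) :
    ∫ t' in (0 : ℝ)..t, pairIntegrand A A (t₀ + t : ℝ) n k (t₀ + t') =
      (∫ t' in (0 : ℝ)..(t₀ + t), pairIntegrand A A (t₀ + t : ℝ) n k t') -
        Complex.exp (-(Complex.I * t * freqSq n)) *
          ∫ t' in (0 : ℝ)..t₀, pairIntegrand A A t₀ n k t' := by
  rw [← intervalIntegral.integral_const_mul]
  simp_rw [← pairIntegrand_add]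
  rw [intervalIntegral.integral_comp_add_left (fun x => pairIntegrand A A (t₀ + t : ℝ) n k x),
    add_zero, eq_sub_iff_add_eq', intervalIntegral.integral_add_adjacent_intervals]
  · exact (continuous_pairIntegrand hA hA _ n k).intervalIntegrable _ _
  · exact (continuous_pairIntegrand hA hA _ n k).intervalIntegrable _ _

/-- Duhamel's formula restarted at `t₀`: subtract from the formula at `t₀ + t` the free evolution of
the formula at `t₀`, pair of frequencies by pair of frequencies. -/
theorem SolvesOn.hasSum_sub {T : ℝ} {c : Freq d → ℂ} {A : Freq d → ℝ → ℂ} (h : SolvesOn T c A)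
    (hA : ∀ n, Integrable (A n)) {t₀ t : ℝ} (h₀ : |t₀| ≤ T) (h₁ : |t₀ + t| ≤ T) (n : Freq d) :
    ∃ S, HasSum (fun k => ∫ t' in (0 : ℝ)..t, pairIntegrand A A (t₀ + t : ℝ) n k (t₀ + t')) S ∧
      evol A (t₀ + t) n = Complex.exp (-(Complex.I * t * freqSq n)) * evol A t₀ n -
        Complex.I * S := by
  obtain ⟨S₀, hS₀, e₀⟩ := h t₀ h₀ n
  obtain ⟨S₁, hS₁, e₁⟩ := h (t₀ + t) h₁ n
  refine ⟨S₁ - Complex.exp (-(Complex.I * t * freqSq n)) * S₀, ?_, ?_⟩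
  · simp_rw [integral_pairIntegrand_shift hA]
    exact hS₁.sub (hS₀.mul_left _)
  · rw [e₀, e₁]
    have : Complex.exp (-(Complex.I * (t₀ + t : ℝ) * freqSq n)) =
        Complex.exp (-(Complex.I * t * freqSq n)) * Complex.exp (-(Complex.I * t₀ * freqSq n)) := by
      rw [← Complex.exp_add]; congr 1; push_cast; ring
    rw [this]; ring

theorem uIcc_zero_subset {δ T t₀ t : ℝ} (h0 : |t₀| ≤ T) (h1 : |t| ≤ δ) (h2 : |t₀ + t| ≤ T) :
    uIcc 0 t ⊆ {t | |t| ≤ δ ∧ |t₀ + t| ≤ T} := by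
  intro x hx
  rw [abs_le] at h0 h1 h2
  rw [mem_uIcc] at hx
  change |x| ≤ δ ∧ |t₀ + x| ≤ T
  rw [abs_le, abs_le]
  rcases hx with hx | hx <;> refine ⟨⟨?_, ?_⟩, ?_, ?_⟩ <;> linarith [h0.1, h0.2, h1.1, h1.2,
    h2.1, h2.2, hx.1, hx.2]

/-- Agreement at `t₀` propagates to the times of `[-T, T]` within distance `1 / M`: the extensions
are translated by `t₀` and cut off, which does not alter them on that interval, and
`IsBilinear.evol_eq` applies. -/
theorem SolvesOn.step {s M T C : ℝ} {κ E : ℝ≥0∞} {K : ℝ → ℂ} (h : IsBilinear d s 0 K M κ)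
    (hK : IsCutoffKernel 0 C K) (hE : E < ∞) (hκ : κ * E ≤ 256⁻¹) {c : Freq d → ℂ}
    {A B : Freq d → ℝ → ℂ} (hA : ∀ n, Measurable (A n)) (hB : ∀ n, Measurable (B n))
    (iA : ∀ n, Integrable (A n)) (iB : ∀ n, Integrable (B n)) {t₀ : ℝ}
    (fA : resEnergy M s 0 (timeCut K M (timeShift t₀ A)) ≤ E)
    (fB : resEnergy M s 0 (timeCut K M (timeShift t₀ B)) ≤ E) (sA : SolvesOn T c A)
    (sB : SolvesOn T c B) (h₀ : |t₀| ≤ T) (heq : ∀ n, evol A t₀ n = evol B t₀ n) {t : ℝ}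
    (ht : |t| ≤ M⁻¹) (h₁ : |t₀ + t| ≤ T) (n : Freq d) : evol A (t₀ + t) n = evol B (t₀ + t) n := by
  have shift_int : ∀ A : Freq d → ℝ → ℂ, (∀ n, Measurable (A n)) → (∀ n, Integrable (A n)) →
      ∀ n, Integrable (timeShift t₀ A n) := fun A hA iA n => by
    refine ⟨(measurable_timeShift t₀ hA n).aestronglyMeasurable, ?_⟩
    have := congrFun (absFn_timeShift t₀ A) n
    have h2 := (iA n).2
    unfold HasFiniteIntegral at h2 ⊢
    change ∫⁻ σ, absFn (timeShift t₀ A) n σ < ∞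
    rw [this]
    exact h2
  have ev : ∀ A : Freq d → ℝ → ℂ, (∀ n, Measurable (A n)) → (∀ n, Integrable (A n)) →
      ∀ t : ℝ, |t| ≤ M⁻¹ → ∀ n, evol (timeCut K M (timeShift t₀ A)) t n = evol A (t₀ + t) n :=
    fun A hA iA t ht n => by
      rw [evol_timeCut hK h.pos (shift_int A hA iA n) ht, evol_timeShift]
  have ep : ∀ A : Freq d → ℝ → ℂ, (∀ n, Measurable (A n)) → (∀ n, Integrable (A n)) →
      ∀ t t' : ℝ, |t'| ≤ M⁻¹ → ∀ n k, pairIntegrand (timeCut K M (timeShift t₀ A))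
        (timeCut K M (timeShift t₀ A)) t n k t' = pairIntegrand A A (t₀ + t : ℝ) n k (t₀ + t') :=
    fun A hA iA t t' ht' n k => by
      unfold pairIntegrand
      rw [ev A hA iA t' ht', ev A hA iA t' ht']
      congr 3
      push_cast; ring
  set J : Set ℝ := {t | |t| ≤ M⁻¹ ∧ |t₀ + t| ≤ T} with hJ
  have hJ0 : ∀ t ∈ J, uIcc 0 t ⊆ J := fun t ht => uIcc_zero_subset h₀ ht.1 ht.2
  have key := h.evol_eq hK (J := J) (fun t ht => ht.1) hJ0 hE hκ
    (measurable_timeCut h.continuous M (measurable_timeShift t₀ hA))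
    (measurable_timeCut h.continuous M (measurable_timeShift t₀ hB)) fA fB (fun t ht n => by
      obtain ⟨S, hS, eS⟩ := sA.hasSum_sub iA h₀ ht.2 n
      obtain ⟨S', hS', eS'⟩ := sB.hasSum_sub iB h₀ ht.2 n
      refine ⟨S - S', ?_, ?_⟩
      · have hfun : (fun k => ∫ t' in (0 : ℝ)..t,
            (pairIntegrand (timeCut K M (timeShift t₀ A)) (timeCut K M (timeShift t₀ A)) t n k t' -
              pairIntegrand (timeCut K M (timeShift t₀ B)) (timeCut K M (timeShift t₀ B)) t n k
                t')) = fun k =>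
            (∫ t' in (0 : ℝ)..t, pairIntegrand A A (t₀ + t : ℝ) n k (t₀ + t')) -
              ∫ t' in (0 : ℝ)..t, pairIntegrand B B (t₀ + t : ℝ) n k (t₀ + t') := by
          funext k
          have hcont : ∀ A : Freq d → ℝ → ℂ, (∀ n, Integrable (A n)) → Continuous fun t' : ℝ =>
              pairIntegrand A A (t₀ + t : ℝ) n k (t₀ + t') := fun A iA =>
            (continuous_pairIntegrand iA iA _ n k).comp (continuous_const.add continuous_id)
          rw [← intervalIntegral.integral_sub ((hcont A iA).intervalIntegrable _ _)
            ((hcont B iB).intervalIntegrable _ _)]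
          refine intervalIntegral.integral_congr fun t' ht' => ?_
          have ht'' := (hJ0 t ht ht').1
          rw [ep A hA iA t t' ht'', ep B hB iB t t' ht'']
        rw [hfun]
        exact hS.sub hS'
      · rw [ev A hA iA t ht.1, ev B hB iB t ht.1, eS, eS', heq n]
        ring) t ⟨ht, h₁⟩ n
  rwa [ev A hA iA t ht, ev B hB iB t ht] at key

/-- Uniqueness in terms of the space-time Fourier transforms. -/
theorem SolvesOn.evol_eq (hd : d = 1 ∨ d = 2) {s : ℝ} (hs : -(2 / 3) < s) (hs' : s ≤ -(1 / 2))
    {T : ℝ} {c : Freq d → ℂ} {A B : Freq d → ℝ → ℂ} (hA : ∀ n, Measurable (A n))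
    (hB : ∀ n, Measurable (B n)) (fA : energyOne s (absFn A) < ∞) (fB : energyOne s (absFn B) < ∞)
    (gA : energyBase s (absFn A) < ∞) (gB : energyBase s (absFn B) < ∞)
    (sA : SolvesOn T c A) (sB : SolvesOn T c B) {t : ℝ} (ht : |t| ≤ T) (n : Freq d) :
    evol A t n = evol B t n := by
  obtain ⟨K, C₀, hK⟩ := exists_isCutoffKernel (le_refl (0 : ℝ))
  obtain ⟨C₁, -, h₁⟩ := exists_isBilinear hd hs hs' le_rfl hK
  obtain ⟨C₂, -, h₂⟩ := exists_resEnergy_timeCut_le (d := d) hs hs' hK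
  have iA : ∀ n, Integrable (A n) := fun n =>
    ⟨(hA n).aestronglyMeasurable, lintegral_lt_top_of_energyOne fA n⟩
  have iB : ∀ n, Integrable (B n) := fun n =>
    ⟨(hB n).aestronglyMeasurable, lintegral_lt_top_of_energyOne fB n⟩
  -- `E` bounds the localized extensions around every base time and for every `M ≥ 1`, so one `M`
  -- serves all steps.
  set E : ℝ≥0∞ := ENNReal.ofReal C₂ * (energyOne s (absFn A) + energyBase s (absFn A)) +
    ENNReal.ofReal C₂ * (energyOne s (absFn B) + energyBase s (absFn B)) with hE
  have hE' : E < ∞ := ENNReal.add_lt_top.2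
    ⟨ENNReal.mul_lt_top ENNReal.ofReal_lt_top (ENNReal.add_lt_top.2 ⟨fA, gA⟩),
      ENNReal.mul_lt_top ENNReal.ofReal_lt_top (ENNReal.add_lt_top.2 ⟨fB, gB⟩)⟩
  obtain ⟨M, hM, hκ⟩ := exists_scale (C := C₁) (δ := 2 / 3 + s) (by linarith) hE'
  have hM0 : 0 < M := by linarith
  have eA : ∀ t₀, resEnergy M s 0 (timeCut K M (timeShift t₀ A)) ≤ E := fun t₀ => by
    refine (h₂ M hM _ (measurable_timeShift t₀ hA)).trans ?_
    rw [absFn_timeShift]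
    exact le_self_add
  have eB : ∀ t₀, resEnergy M s 0 (timeCut K M (timeShift t₀ B)) ≤ E := fun t₀ => by
    refine (h₂ M hM _ (measurable_timeShift t₀ hB)).trans ?_
    rw [absFn_timeShift]
    exact le_add_self
  have main : ∀ j : ℕ, ∀ t : ℝ, |t| ≤ T → |t| ≤ j * M⁻¹ → ∀ n, evol A t n = evol B t n := by
    intro j
    induction j with
    | zero =>
      intro t ht h0 n
      have : t = 0 := by simpa using h0
      subst this
      obtain ⟨S, hS, eS⟩ := sA 0 ht n
      obtain ⟨S', hS', eS'⟩ := sB 0 ht n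
      simp only [intervalIntegral.integral_same] at hS hS'
      rw [eS, eS', hS.unique hS']
    | succ j ih =>
      intro t ht hj n
      have hj1 : (0 : ℝ) < j + 1 := by positivity
      -- The base point lies between `0` and `t`, within `1 / M` of `t`, which treats both time
      -- directions at once and never leaves `[-T, T]`.
      set t₀ := t * (j / (j + 1)) with ht₀
      have hfrac : (j : ℝ) / (j + 1) ≤ 1 := (div_le_one hj1).2 (by linarith)
      have hfrac0 : 0 ≤ (j : ℝ) / (j + 1) := by positivity
      have a0 : |t₀| = |t| * (j / (j + 1)) := by rw [ht₀, abs_mul, abs_of_nonneg hfrac0]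
      have a1 : |t₀| ≤ T := by
        rw [a0]
        exact (mul_le_of_le_one_right (abs_nonneg t) hfrac).trans ht
      push_cast at hj
      have a2 : |t₀| ≤ j * M⁻¹ := by
        rw [a0]
        calc |t| * (j / (j + 1)) ≤ ((j + 1) * M⁻¹) * (j / (j + 1)) := by gcongr
          _ = j * M⁻¹ := by field_simp
      have a3 : |t - t₀| ≤ M⁻¹ := by
        have : t - t₀ = t * (1 / (j + 1)) := by rw [ht₀]; field_simp; ring
        rw [this, abs_mul, abs_of_nonneg (by positivity : (0 : ℝ) ≤ 1 / (j + 1))]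
        calc |t| * (1 / (j + 1)) ≤ ((j + 1) * M⁻¹) * (1 / (j + 1)) := by gcongr
          _ = M⁻¹ := by field_simp
      have := SolvesOn.step (h₁ M hM) hK hE' hκ hA hB iA iB (eA t₀) (eB t₀) sA sB a1
        (ih t₀ a1 a2) a3 (by rwa [add_sub_cancel]) n
      rwa [add_sub_cancel] at this
  obtain ⟨j, hj⟩ := exists_nat_ge (T * M)
  refine main j t ht (ht.trans ?_) n
  calc T = T * M * M⁻¹ := by field_simp
    _ ≤ j * M⁻¹ := by gcongr

end

/-! ### Comparison of the resolution energies with the `Z^{s,2/3}` norm. -/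

section

variable {d : ℕ}

theorem mixedNorm_lt_top_iff {p : ℝ≥0∞} {g : Freq d → ℝ → ℂ} :
    mixedNorm p g < ∞ ↔ ∑' n, eLpNorm (g n) p volume ^ 2 < ∞ := by
  unfold mixedNorm
  rw [ENNReal.rpow_lt_top_iff_of_pos (by norm_num)]

theorem eLpNorm_two_pow_two (f : ℝ → ℂ) : eLpNorm f 2 volume ^ 2 = ∫⁻ x, ‖f x‖ₑ ^ 2 := by
  have h := eLpNorm_nnreal_pow_eq_lintegral (f := f) (μ := (volume : Measure ℝ)) (p := 2)
    (by norm_num)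
  simpa using h

theorem mixedNorm_congr_ae {p : ℝ≥0∞} {g g' : Freq d → ℝ → ℂ} (h : ∀ n, g n =ᵐ[volume] g' n) :
    mixedNorm p g = mixedNorm p g' := by
  unfold mixedNorm
  congr 1
  exact tsum_congr fun n => by rw [eLpNorm_congr_ae (h n)]

theorem ZNorm_congr_ae {s b : ℝ} {g g' : Freq d → ℝ → ℂ} (h : ∀ n, g n =ᵐ[volume] g' n) :
    ZNorm s b g = ZNorm s b g' := by
  have hlo : ∀ n, projLo g n =ᵐ[volume] projLo g' n := fun n => by
    filter_upwards [h n] with τ hτ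
    simp only [projLo, indicator, hτ]
  have hhi : ∀ n, projHi g n =ᵐ[volume] projHi g' n := fun n => by
    filter_upwards [h n] with τ hτ
    simp only [projHi, indicator, hτ]
  unfold ZNorm XNorm YNorm
  congr 1
  · exact mixedNorm_congr_ae fun n => (hlo n).mono fun τ hτ => by simp only [hτ]
  congr 1
  · exact mixedNorm_congr_ae fun n => (hhi n).mono fun τ hτ => by simp only [hτ]
  · exact mixedNorm_congr_ae fun n => (hhi n).mono fun τ hτ => by simp only [hτ]

/-- The change of variables from the modulation to the time frequency. -/
def toTime (A : Freq d → ℝ → ℂ) : Freq d → ℝ → ℂ := fun n τ => A n (modulation n τ)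

/-- The modulations that are small with respect to the frequency. -/
def loSet (n : Freq d) : Set ℝ := {σ | |σ| < 2⁻¹ ^ 10 * freqSq n}

theorem measurableSet_loSet (n : Freq d) : MeasurableSet (loSet n) :=
  measurableSet_lt (by fun_prop) measurable_const

theorem compl_loSet (n : Freq d) : (loSet n)ᶜ = {σ | 2⁻¹ ^ 10 * freqSq n ≤ |σ|} := by
  ext σ; simp [loSet]

theorem lintegral_modulation (n : Freq d) (F : ℝ → ℝ≥0∞) :
    ∫⁻ τ, F (modulation n τ) = ∫⁻ σ, F σ :=
  lintegral_add_right_eq_self F (freqSq n)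

theorem freqBracket_rpow (s : ℝ) (n : Freq d) : freqBracket n ^ s = freqWeight n ^ (s / 2) := by
  have hp := freqWeight_pos n
  unfold freqBracket
  rw [Real.sqrt_eq_rpow]
  change (freqWeight n ^ (1 / 2 : ℝ)) ^ s = _
  rw [← Real.rpow_mul hp.le]
  congr 1; ring

theorem bracket_rpow (b σ : ℝ) : bracket σ ^ b = (1 + σ ^ 2) ^ (b / 2) := by
  unfold bracket
  rw [Real.sqrt_eq_rpow, ← Real.rpow_mul (by positivity)]
  congr 1; ring

theorem enorm_ofReal_mul_indicator_sq {r : ℝ} (hr : 0 ≤ r) (S : Set ℝ) (f : ℝ → ℂ) (x : ℝ) :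
    ‖(r : ℂ) * S.indicator f x‖ₑ ^ 2 =
      S.indicator (fun x => ENNReal.ofReal (r ^ 2) * ‖f x‖ₑ ^ 2) x := by
  have h0 : ‖(r : ℂ)‖ₑ = ENNReal.ofReal r := by
    rw [← ofReal_norm, Complex.norm_real, Real.norm_of_nonneg hr]
  by_cases h : x ∈ S
  · rw [indicator_of_mem h, indicator_of_mem h, enorm_mul, mul_pow, h0, ENNReal.ofReal_pow hr]
  · rw [indicator_of_notMem h, indicator_of_notMem h]; simp

theorem projLo_toTime (A : Freq d → ℝ → ℂ) (n : Freq d) (τ : ℝ) :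
    projLo (toTime A) n τ = (loSet n).indicator (A n) (modulation n τ) := rfl

theorem projHi_toTime (A : Freq d → ℝ → ℂ) (n : Freq d) (τ : ℝ) :
    projHi (toTime A) n τ = (loSet n)ᶜ.indicator (A n) (modulation n τ) := by
  rw [compl_loSet]; rfl

theorem rpow_half_pow_two {x : ℝ} (hx : 0 ≤ x) (r : ℝ) : (x ^ (r / 2)) ^ 2 = x ^ r := by
  rw [← Real.rpow_natCast, ← Real.rpow_mul hx]
  congr 1; push_cast; ring

/-- The square of the `X^{s,2/3}` norm of the low-modulation part. -/
def lowEnergy (s : ℝ) (a : Freq d → ℝ → ℝ≥0∞) : ℝ≥0∞ :=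
  ∑' n, ∫⁻ σ in loSet n, ENNReal.ofReal (freqWeight n ^ s * (1 + σ ^ 2) ^ (2 / 3 : ℝ)) * a n σ ^ 2

/-- The square of the `ℓ² L¹` component of the `Y^{s,2/3}` norm of the high-modulation part. -/
def highEnergyOne (s : ℝ) (a : Freq d → ℝ → ℝ≥0∞) : ℝ≥0∞ :=
  ∑' n, ENNReal.ofReal (freqWeight n ^ s) * (∫⁻ σ in (loSet n)ᶜ, a n σ) ^ 2

/-- The square of the `ℓ² L²` component of the `Y^{s,2/3}` norm of the high-modulation part. -/
def highEnergyTwo (s : ℝ) (a : Freq d → ℝ → ℝ≥0∞) : ℝ≥0∞ :=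
  ∑' n, ∫⁻ σ in (loSet n)ᶜ, ENNReal.ofReal ((1 + σ ^ 2) ^ (s / 2 + 2 / 3)) * a n σ ^ 2

/-- Only finiteness of the `Z` norm matters, so its three components can be handled as separate
squares in the modulation variable. -/
theorem ZNorm_toTime_lt_top_iff {s : ℝ} {A : Freq d → ℝ → ℂ} :
    ZNorm s (2 / 3) (toTime A) < ∞ ↔
      lowEnergy s (absFn A) < ∞ ∧ highEnergyOne s (absFn A) < ∞ ∧ highEnergyTwo s (absFn A) < ∞ := by
  unfold ZNorm YNorm XNorm
  rw [ENNReal.add_lt_top, ENNReal.add_lt_top, mixedNorm_lt_top_iff, mixedNorm_lt_top_iff,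
    mixedNorm_lt_top_iff]
  have e1 : ∑' n, eLpNorm (fun τ => ((freqBracket n ^ s * bracket (modulation n τ) ^ (2 / 3 : ℝ) : ℝ)
      : ℂ) * projLo (toTime A) n τ) 2 volume ^ 2 = lowEnergy s (absFn A) := by
    refine tsum_congr fun n => ?_
    have hp := freqWeight_pos n
    rw [eLpNorm_two_pow_two, ← lintegral_indicator (measurableSet_loSet n),
      ← lintegral_modulation n ((loSet n).indicator _)]
    refine lintegral_congr fun τ => ?_
    have hσ : 0 ≤ 1 + modulation n τ ^ 2 := by positivity
    rw [projLo_toTime, freqBracket_rpow, bracket_rpow,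
      enorm_ofReal_mul_indicator_sq (by positivity)]
    by_cases h : modulation n τ ∈ loSet n
    · rw [indicator_of_mem h, indicator_of_mem h, mul_pow, rpow_half_pow_two hp.le,
        rpow_half_pow_two hσ]
      rfl
    · rw [indicator_of_notMem h, indicator_of_notMem h]
  have e2 : ∑' n, eLpNorm (fun τ => ((freqBracket n ^ s : ℝ) : ℂ) * projHi (toTime A) n τ) 1
      volume ^ 2 = highEnergyOne s (absFn A) := by
    refine tsum_congr fun n => ?_
    have hp := freqWeight_pos n
    rw [eLpNorm_one_eq_lintegral_enorm, ← lintegral_indicator (measurableSet_loSet n).compl,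
      ← lintegral_modulation n ((loSet n)ᶜ.indicator _)]
    have : ∀ τ, ‖((freqBracket n ^ s : ℝ) : ℂ) * projHi (toTime A) n τ‖ₑ =
        ENNReal.ofReal (freqWeight n ^ (s / 2)) *
          (loSet n)ᶜ.indicator (fun σ => absFn A n σ) (modulation n τ) := fun τ => by
      rw [projHi_toTime, freqBracket_rpow, enorm_mul, ← ofReal_norm, Complex.norm_real,
        Real.norm_of_nonneg (by positivity)]
      congr 1
      by_cases h : modulation n τ ∈ (loSet n)ᶜ
      · rw [indicator_of_mem h, indicator_of_mem h]; rfl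
      · rw [indicator_of_notMem h, indicator_of_notMem h, enorm_zero]
    simp_rw [this]
    rw [lintegral_const_mul' _ _ ENNReal.ofReal_ne_top, mul_pow,
      ← ENNReal.ofReal_pow (by positivity), rpow_half_pow_two hp.le]
  have e3 : ∑' n, eLpNorm (fun τ => ((bracket (modulation n τ) ^ (s / 2 + 2 / 3) : ℝ) : ℂ) *
      projHi (toTime A) n τ) 2 volume ^ 2 = highEnergyTwo s (absFn A) := by
    refine tsum_congr fun n => ?_
    rw [eLpNorm_two_pow_two, ← lintegral_indicator (measurableSet_loSet n).compl,
      ← lintegral_modulation n ((loSet n)ᶜ.indicator _)]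
    refine lintegral_congr fun τ => ?_
    have hσ : 0 ≤ 1 + modulation n τ ^ 2 := by positivity
    rw [projHi_toTime, bracket_rpow, enorm_ofReal_mul_indicator_sq (by positivity)]
    by_cases h : modulation n τ ∈ (loSet n)ᶜ
    · rw [indicator_of_mem h, indicator_of_mem h, rpow_half_pow_two hσ]
      rfl
    · rw [indicator_of_notMem h, indicator_of_notMem h]
  rw [e1, e2, e3]

theorem tsum_lintegral_compl (a : Freq d → ℝ → ℝ≥0∞) :
    ∑' n, ∫⁻ σ, a n σ = (∑' n, ∫⁻ σ in loSet n, a n σ) + ∑' n, ∫⁻ σ in (loSet n)ᶜ, a n σ := by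
  rw [← ENNReal.tsum_add]
  exact tsum_congr fun n => (lintegral_add_compl _ (measurableSet_loSet n)).symm

/-- As `s₀ ≤ 0`, the factor `(freqWeight n + |σ|)^s₀` may be replaced by the same power of
`freqWeight n` in the low region and of `√(1 + σ²)` in the high region. -/
theorem energyBase_lt_top {s s₀ : ℝ} (hs : s₀ ≤ s) (hs' : s₀ ≤ 0) {a : Freq d → ℝ → ℝ≥0∞}
    (h1 : lowEnergy s a < ∞) (h2 : highEnergyTwo s a < ∞) : energyBase s₀ a < ∞ := by
  unfold energyBase
  rw [tsum_lintegral_compl]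
  have hb : ∀ σ : ℝ, |σ| ^ (4 / 3 : ℝ) ≤ (1 + σ ^ 2) ^ (2 / 3 : ℝ) := fun σ => by
    have : |σ| ^ (4 / 3 : ℝ) = (σ ^ 2) ^ (2 / 3 : ℝ) := by
      rw [← sq_abs, ← Real.rpow_natCast, ← Real.rpow_mul (abs_nonneg σ)]
      norm_num
    rw [this]
    gcongr
    linarith
  refine (add_le_add (ENNReal.tsum_le_tsum fun n => lintegral_mono fun σ => ?_)
    (ENNReal.tsum_le_tsum fun n => lintegral_mono fun σ => ?_)).trans_lt
    (ENNReal.add_lt_top.2 ⟨h1, h2⟩)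
  · refine mul_le_mul_left (ENNReal.ofReal_le_ofReal ?_) _
    have hp := freqWeight_pos n
    have hp1 := one_le_freqWeight n
    unfold baseWeight
    rw [mul_comm]
    have i1 : (freqWeight n + |σ|) ^ s₀ ≤ freqWeight n ^ s :=
      (Real.rpow_le_rpow_of_nonpos hp (by linarith [abs_nonneg σ]) hs').trans
        (Real.rpow_le_rpow_of_exponent_le hp1 hs)
    exact mul_le_mul i1 (hb σ) (by positivity) (by positivity)
  · refine mul_le_mul_left (ENNReal.ofReal_le_ofReal ?_) _
    have hp1 := one_le_freqWeight n
    unfold baseWeight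
    have hX : 1 ≤ 1 + σ ^ 2 := by nlinarith [sq_nonneg σ]
    have i1 : (freqWeight n + |σ|) ^ s₀ ≤ (1 + σ ^ 2) ^ (s₀ / 2) := by
      have : √(1 + σ ^ 2) ≤ freqWeight n + |σ| := by
        rw [Real.sqrt_le_left (by positivity)]
        nlinarith [abs_nonneg σ, sq_abs σ]
      calc (freqWeight n + |σ|) ^ s₀ ≤ √(1 + σ ^ 2) ^ s₀ :=
            Real.rpow_le_rpow_of_nonpos (by positivity) this hs'
        _ = (1 + σ ^ 2) ^ (s₀ / 2) := by
            rw [Real.sqrt_eq_rpow, ← Real.rpow_mul (by positivity)]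
            congr 1; ring
    calc |σ| ^ (4 / 3 : ℝ) * (freqWeight n + |σ|) ^ s₀
        ≤ (1 + σ ^ 2) ^ (2 / 3 : ℝ) * (1 + σ ^ 2) ^ (s₀ / 2) := by
          have := hb σ
          gcongr
      _ = (1 + σ ^ 2) ^ (s₀ / 2 + 2 / 3) := by
          rw [← Real.rpow_add (by positivity)]; congr 1; ring
      _ ≤ (1 + σ ^ 2) ^ (s / 2 + 2 / 3) := Real.rpow_le_rpow_of_exponent_le hX (by linarith)

theorem lintegral_one_add_sq_lt_top :
    ∫⁻ σ : ℝ, ENNReal.ofReal ((1 + σ ^ 2) ^ (-(2 / 3) : ℝ)) < ∞ := by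
  have h := (integrable_rpow_neg_one_add_norm_sq (E := ℝ) (μ := volume) (r := 4 / 3)
    (by norm_num)).lintegral_lt_top
  refine lt_of_eq_of_lt (lintegral_congr fun σ => ?_) h
  congr 2
  · rw [Real.norm_eq_abs, sq_abs]
  · norm_num

/-- At low modulation the `L¹` bound follows from the weighted `L²` bound, because `⟨σ⟩^(-4/3)` is
integrable; at high modulation it is part of the `Y` norm. -/
theorem energyOne_lt_top {s s₀ : ℝ} (hs : s₀ ≤ s) {a : Freq d → ℝ → ℝ≥0∞}
    (ha : ∀ n, Measurable (a n))
    (h1 : lowEnergy s a < ∞) (h2 : highEnergyOne s a < ∞) : energyOne s₀ a < ∞ := by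
  set c := ∫⁻ σ : ℝ, ENNReal.ofReal ((1 + σ ^ 2) ^ (-(2 / 3) : ℝ)) with hc
  have hc' : c < ∞ := lintegral_one_add_sq_lt_top
  have hlo : ∀ n, ENNReal.ofReal (freqWeight n ^ s) * (∫⁻ σ in loSet n, a n σ) ^ 2 ≤
      c * ∫⁻ σ in loSet n,
        ENNReal.ofReal (freqWeight n ^ s * (1 + σ ^ 2) ^ (2 / 3 : ℝ)) * a n σ ^ 2 := fun n => by
    have hp := freqWeight_pos n
    have h3 : (∫⁻ σ in loSet n, a n σ) ^ 2 ≤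
        (∫⁻ σ in loSet n, ENNReal.ofReal ((1 + σ ^ 2) ^ (-(2 / 3) : ℝ))) *
          ∫⁻ σ in loSet n, ENNReal.ofReal ((1 + σ ^ 2) ^ (2 / 3 : ℝ)) * a n σ ^ 2 := by
      refine sq_lintegral_le_mul (by fun_prop) (Measurable.mul (by fun_prop) ((ha n).pow_const 2))
        fun σ => le_of_eq ?_
      rw [← mul_assoc, ← ENNReal.ofReal_mul (by positivity), ← Real.rpow_add (by positivity)]
      norm_num
    calc _ ≤ ENNReal.ofReal (freqWeight n ^ s) * (c *
          ∫⁻ σ in loSet n, ENNReal.ofReal ((1 + σ ^ 2) ^ (2 / 3 : ℝ)) * a n σ ^ 2) := by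
          refine mul_le_mul_right (h3.trans (mul_le_mul_left ?_ _)) _
          exact setLIntegral_le_lintegral _ _
      _ = _ := by
          rw [mul_left_comm, ← lintegral_const_mul' _ _ ENNReal.ofReal_ne_top]
          congr 1
          refine lintegral_congr fun σ => ?_
          rw [← mul_assoc, ← ENNReal.ofReal_mul (by positivity)]
  have hle : energyOne s₀ a ≤ 2 * (c * lowEnergy s a + highEnergyOne s a) := by
    unfold energyOne lowEnergy highEnergyOne
    rw [← ENNReal.tsum_mul_left, ← ENNReal.tsum_add, ← ENNReal.tsum_mul_left]
    refine ENNReal.tsum_le_tsum fun n => ?_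
    have hp1 := one_le_freqWeight n
    rw [← lintegral_add_compl _ (measurableSet_loSet n)]
    calc _ ≤ ENNReal.ofReal (freqWeight n ^ s) * (2 * ((∫⁻ σ in loSet n, a n σ) ^ 2 +
          (∫⁻ σ in (loSet n)ᶜ, a n σ) ^ 2)) :=
          mul_le_mul' (ENNReal.ofReal_le_ofReal (Real.rpow_le_rpow_of_exponent_le hp1 hs))
            (add_sq_le_two_mul _ _)
      _ = 2 * (ENNReal.ofReal (freqWeight n ^ s) * (∫⁻ σ in loSet n, a n σ) ^ 2 +
          ENNReal.ofReal (freqWeight n ^ s) * (∫⁻ σ in (loSet n)ᶜ, a n σ) ^ 2) := by ring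
      _ ≤ _ := mul_le_mul_right (add_le_add_left (hlo n) _) _
  exact hle.trans_lt (ENNReal.mul_lt_top (by norm_num)
    (ENNReal.add_lt_top.2 ⟨ENNReal.mul_lt_top hc' h1, h2⟩))

theorem mul_lintegral_le_energyTwo {M s₀ ρ C : ℝ} (hM : 0 < M) (hC : 0 ≤ C)
    {a : Freq d → ℝ → ℝ≥0∞} {S : Freq d → Set ℝ} (hS : ∀ n, MeasurableSet (S n))
    {w : Freq d → ℝ → ℝ}
    (hw : ∀ n, ∀ σ ∈ S n, w n σ ≤ C * (modWeight M s₀ n σ * (spread M n σ ^ ρ) ^ 2)) :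
    ∑' n, ∫⁻ σ in S n, ENNReal.ofReal (w n σ) * a n σ ^ 2 ≤
      ENNReal.ofReal C * persEnergy M s₀ ρ a := by
  refine le_trans ?_ (mul_le_mul_right (le_add_self : energyTwo M s₀ (weighted M ρ a) ≤ _) _)
  unfold energyTwo
  rw [← ENNReal.tsum_mul_left]
  refine ENNReal.tsum_le_tsum fun n => ?_
  rw [← lintegral_const_mul' _ _ ENNReal.ofReal_ne_top]
  refine le_trans (setLIntegral_mono' (hS n) fun σ hσ => ?_) (setLIntegral_le_lintegral _ _)
  have h1 := one_le_spread hM n σ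
  unfold weighted
  rw [mul_pow, ← mul_assoc (ENNReal.ofReal (modWeight M s₀ n σ)), ← mul_assoc,
    ← ENNReal.ofReal_pow (by positivity), ← ENNReal.ofReal_mul (modWeight_pos hM s₀ n σ).le,
    ← ENNReal.ofReal_mul hC]
  exact mul_le_mul_left (ENNReal.ofReal_le_ofReal (hw n σ hσ)) _

theorem one_add_sq_rpow_le {M : ℝ} (hM : 1 ≤ M) (σ : ℝ) :
    (1 + σ ^ 2) ^ (2 / 3 : ℝ) ≤ (M + |σ|) ^ (4 / 3 : ℝ) := by
  have hσ := abs_nonneg σ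
  have : (M + |σ|) ^ (4 / 3 : ℝ) = ((M + |σ|) ^ 2) ^ (2 / 3 : ℝ) := by
    rw [← Real.rpow_natCast, ← Real.rpow_mul (by linarith)]
    norm_num
  rw [this]
  have h2 : 1 + σ ^ 2 ≤ (M + |σ|) ^ 2 := by nlinarith [sq_abs σ]
  gcongr

theorem modWeight_eq_mul {M s₀ : ℝ} (hM : 0 < M) (n : Freq d) (σ : ℝ) :
    M ^ (1 / 3 : ℝ) * modWeight M s₀ n σ =
      (M + |σ|) ^ (4 / 3 : ℝ) * (freqWeight n + |σ|) ^ s₀ := by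
  unfold modWeight
  rw [← mul_assoc, ← mul_assoc, ← Real.rpow_add hM]
  norm_num

/-- Here `|σ| ≤ freqWeight n`, so `freqWeight n + |σ|` is comparable to `freqWeight n`, and `spread
^ ρ` supplies the missing `2ρ` derivatives. -/
theorem lowEnergy_lt_top {M s₀ ρ : ℝ} (hM : 1 ≤ M) (hs₀ : s₀ ≤ 0) (hρ : 0 ≤ ρ)
    {a : Freq d → ℝ → ℝ≥0∞} (h : persEnergy M s₀ ρ a < ∞) : lowEnergy (s₀ + 2 * ρ) a < ∞ := by
  have hM0 : 0 < M := by linarith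
  refine (mul_lintegral_le_energyTwo (M := M) (s₀ := s₀) (ρ := ρ)
    (C := 2 ^ (-s₀) * M ^ (1 / 3 : ℝ)) hM0 (by positivity)
    measurableSet_loSet fun n σ hσ => ?_).trans_lt (ENNReal.mul_lt_top ENNReal.ofReal_lt_top h)
  have hp := freqWeight_pos n
  have hq : 0 ≤ freqSq n := freqSq_nonneg n
  have hσ' : |σ| ≤ freqWeight n := by
    have h1 : |σ| < 2⁻¹ ^ 10 * freqSq n := hσ
    unfold freqWeight
    norm_num at h1
    linarith
  have i1 : freqWeight n ^ s₀ ≤ 2 ^ (-s₀) * (freqWeight n + |σ|) ^ s₀ := by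
    have : (2 * freqWeight n) ^ s₀ ≤ (freqWeight n + |σ|) ^ s₀ :=
      Real.rpow_le_rpow_of_nonpos (by positivity) (by linarith) hs₀
    calc freqWeight n ^ s₀ = 2 ^ (-s₀) * (2 * freqWeight n) ^ s₀ := by
          rw [Real.mul_rpow (by norm_num) hp.le, ← mul_assoc, ← Real.rpow_add (by norm_num)]
          simp
      _ ≤ _ := by gcongr
  have i2 : freqWeight n ^ (2 * ρ) ≤ (spread M n σ ^ ρ) ^ 2 := by
    rw [show (2 * ρ) = ρ * (2 : ℕ) by push_cast; ring, Real.rpow_mul hp.le, Real.rpow_natCast]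
    have := freqWeight_le_spread hM0 n σ
    gcongr
  have i3 := one_add_sq_rpow_le hM σ
  calc freqWeight n ^ (s₀ + 2 * ρ) * (1 + σ ^ 2) ^ (2 / 3 : ℝ)
      = freqWeight n ^ s₀ * freqWeight n ^ (2 * ρ) * (1 + σ ^ 2) ^ (2 / 3 : ℝ) := by
        rw [Real.rpow_add hp]
    _ ≤ (2 ^ (-s₀) * (freqWeight n + |σ|) ^ s₀) * (spread M n σ ^ ρ) ^ 2 *
        (M + |σ|) ^ (4 / 3 : ℝ) := by gcongr
    _ = 2 ^ (-s₀) * ((M + |σ|) ^ (4 / 3 : ℝ) * (freqWeight n + |σ|) ^ s₀) *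
        (spread M n σ ^ ρ) ^ 2 := by ring
    _ = _ := by rw [← modWeight_eq_mul hM0]; ring

/-- Here `freqWeight n + |σ|` is comparable to `⟨σ⟩`, and the additional power `⟨σ⟩^(2ρ)` comes from
the modulation in `spread`, at the price of a power of `M`. -/
theorem highEnergyTwo_lt_top {M s₀ ρ : ℝ} (hM : 1 ≤ M) (hs₀ : s₀ ≤ 0) (hρ : 0 ≤ ρ)
    {a : Freq d → ℝ → ℝ≥0∞} (h : persEnergy M s₀ ρ a < ∞) :
    highEnergyTwo (s₀ + 2 * ρ) a < ∞ := by
  have hM0 : 0 < M := by linarith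
  refine (mul_lintegral_le_energyTwo (M := M) (s₀ := s₀) (ρ := ρ)
    (C := (2 ^ 12 : ℝ) ^ (-s₀) * M ^ (2 * ρ) * M ^ (1 / 3 : ℝ)) hM0 (by positivity)
    (w := fun _ σ => (1 + σ ^ 2) ^ ((s₀ + 2 * ρ) / 2 + 2 / 3))
    (fun n => (measurableSet_loSet n).compl) fun n σ hσ => ?_).trans_lt
    (ENNReal.mul_lt_top ENNReal.ofReal_lt_top h)
  have hp := freqWeight_pos n
  have hp1 := one_le_freqWeight n
  have hσ0 := abs_nonneg σ
  set X := √(1 + σ ^ 2) with hX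
  have hX0 : 0 < X := by positivity
  have hX1 : X ≤ 1 + |σ| := by
    rw [hX, Real.sqrt_le_left (by positivity)]
    nlinarith [sq_abs σ]
  have hX2 : 1 + |σ| ≤ 2 * X := by
    have a1 : |σ| ≤ X := Real.abs_le_sqrt (by linarith)
    have a2 : 1 ≤ X := Real.one_le_sqrt.2 (by nlinarith [sq_nonneg σ])
    linarith
  have hXp : ∀ r : ℝ, (1 + σ ^ 2) ^ (r / 2) = X ^ r := fun r => by
    rw [hX, Real.sqrt_eq_rpow, ← Real.rpow_mul (by positivity)]
    congr 1; ring
  -- `|n|² ≤ 2^10 |σ|`, and the two further summands `1` and `|σ|` are at most `X`; `2^12` is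
  -- generous.
  have hσ' : freqWeight n + |σ| ≤ 2 ^ 12 * X := by
    have h1 : σ ∈ {σ | 2⁻¹ ^ 10 * freqSq n ≤ |σ|} := by rwa [← compl_loSet]
    have h2 : 2⁻¹ ^ 10 * freqSq n ≤ |σ| := h1
    unfold freqWeight
    norm_num at h2 ⊢
    linarith
  have i1 : X ^ s₀ ≤ (2 ^ 12 : ℝ) ^ (-s₀) * (freqWeight n + |σ|) ^ s₀ := by
    have : (2 ^ 12 * X) ^ s₀ ≤ (freqWeight n + |σ|) ^ s₀ :=
      Real.rpow_le_rpow_of_nonpos (by positivity) hσ' hs₀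
    calc X ^ s₀ = (2 ^ 12 : ℝ) ^ (-s₀) * (2 ^ 12 * X) ^ s₀ := by
          rw [Real.mul_rpow (by norm_num) hX0.le, ← mul_assoc, ← Real.rpow_add (by norm_num)]
          simp
      _ ≤ _ := by gcongr
  have i2 : X ^ (2 * ρ) ≤ M ^ (2 * ρ) * (spread M n σ ^ ρ) ^ 2 := by
    have hsp := one_le_spread hM0 n σ
    have : X ≤ M * spread M n σ := by
      have : M * spread M n σ = M * freqWeight n + |σ| := by
        unfold spread; field_simp
      rw [this]
      nlinarith
    calc X ^ (2 * ρ) ≤ (M * spread M n σ) ^ (2 * ρ) := by gcongr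
      _ = M ^ (2 * ρ) * (spread M n σ ^ ρ) ^ 2 := by
          rw [Real.mul_rpow hM0.le (by linarith), show (2 * ρ) = ρ * (2 : ℕ) by push_cast; ring,
            Real.rpow_mul (by linarith : 0 ≤ spread M n σ), Real.rpow_natCast]
  have i3 : X ^ (4 / 3 : ℝ) ≤ (M + |σ|) ^ (4 / 3 : ℝ) := by
    have : X ≤ M + |σ| := by linarith
    gcongr
  calc (1 + σ ^ 2) ^ ((s₀ + 2 * ρ) / 2 + 2 / 3)
      = X ^ (s₀ + 2 * ρ + 4 / 3) := by rw [← hXp]; congr 1; ring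
    _ = X ^ s₀ * X ^ (2 * ρ) * X ^ (4 / 3 : ℝ) := by rw [Real.rpow_add hX0, Real.rpow_add hX0]
    _ ≤ ((2 ^ 12 : ℝ) ^ (-s₀) * (freqWeight n + |σ|) ^ s₀) *
        (M ^ (2 * ρ) * (spread M n σ ^ ρ) ^ 2) * (M + |σ|) ^ (4 / 3 : ℝ) := by gcongr
    _ = (2 ^ 12 : ℝ) ^ (-s₀) * M ^ (2 * ρ) * ((M + |σ|) ^ (4 / 3 : ℝ) *
        (freqWeight n + |σ|) ^ s₀) * (spread M n σ ^ ρ) ^ 2 := by ring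
    _ = _ := by rw [← modWeight_eq_mul hM0]; ring

/-- The resolution norm controls the `ℓ² L¹` norm at the higher regularity. -/
theorem energyOne_le_persEnergy_add {M s₀ ρ : ℝ} (hM : 0 < M) (hρ : 0 ≤ ρ)
    (a : Freq d → ℝ → ℝ≥0∞) : energyOne (s₀ + 2 * ρ) a ≤ persEnergy M s₀ ρ a := by
  refine le_trans (ENNReal.tsum_le_tsum fun n => ?_) (energyOne_le_energy M s₀ (weighted M ρ a))
  have hp := freqWeight_pos n
  rw [Real.rpow_add hp, ENNReal.ofReal_mul (by positivity), mul_assoc,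
    show (2 * ρ) = ρ * (2 : ℕ) by push_cast; ring, Real.rpow_mul hp.le, Real.rpow_natCast,
    ENNReal.ofReal_pow (by positivity), ← mul_pow]
  refine mul_le_mul_right (pow_le_pow_left' ?_ 2) _
  rw [← lintegral_const_mul' _ _ ENNReal.ofReal_ne_top]
  refine lintegral_mono fun σ => mul_le_mul_left (ENNReal.ofReal_le_ofReal ?_) _
  have := freqWeight_le_spread hM n σ
  gcongr

theorem ZNorm_toTime_lt_top {M s₀ ρ : ℝ} (hM : 1 ≤ M) (hs₀ : s₀ ≤ 0) (hρ : 0 ≤ ρ)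
    {A : Freq d → ℝ → ℂ} (h : resEnergy M s₀ ρ A < ∞) :
    ZNorm (s₀ + 2 * ρ) (2 / 3) (toTime A) < ∞ := by
  rw [ZNorm_toTime_lt_top_iff]
  refine ⟨lowEnergy_lt_top hM hs₀ hρ h, ?_, highEnergyTwo_lt_top hM hs₀ hρ h⟩
  refine lt_of_le_of_lt (ENNReal.tsum_le_tsum fun n => ?_)
    ((energyOne_le_persEnergy_add (by linarith : 0 < M) hρ (absFn A)).trans_lt h)
  exact mul_le_mul_right (pow_le_pow_left' (setLIntegral_le_lintegral _ _) 2) _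

end

/-! ### Sobolev spaces, the flow, and uniqueness in the solution class. -/

section

variable {d : ℕ} {s : ℝ}

/-- The square of the `H^s` norm in terms of the Fourier coefficients. -/
def sobolevEnergy (s : ℝ) (f : Freq d → ℂ) : ℝ≥0∞ :=
  ∑' n, ENNReal.ofReal (freqWeight n ^ s) * ‖f n‖ₑ ^ 2

theorem ofReal_sobolev_term (s : ℝ) (n : Freq d) (z : ℂ) :
    ENNReal.ofReal ((freqBracket n ^ s * ‖z‖) ^ 2) =
      ENNReal.ofReal (freqWeight n ^ s) * ‖z‖ₑ ^ 2 := by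
  have hp := freqWeight_pos n
  rw [freqBracket_rpow, mul_pow, rpow_half_pow_two hp.le, ENNReal.ofReal_mul (by positivity),
    ENNReal.ofReal_pow (norm_nonneg _), ofReal_norm]

theorem norm_sobolev_term (s : ℝ) (n : Freq d) (z : ℂ) :
    ‖((freqBracket n ^ s : ℝ) : ℂ) * z‖ ^ (2 : ℝ≥0∞).toReal = (freqBracket n ^ s * ‖z‖) ^ 2 := by
  have hp := (Real.rpow_pos_of_pos (Hs.freqBracket_pos n) s).le
  rw [norm_mul, Complex.norm_real, Real.norm_of_nonneg hp]
  simp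

theorem mem_hsSubmodule_iff {f : Freq d → ℂ} :
    f ∈ hsSubmodule d s ↔ Summable fun n => (freqBracket n ^ s * ‖f n‖) ^ 2 := by
  change Memℓp (fun n => ((freqBracket n ^ s : ℝ) : ℂ) * f n) 2 ↔ _
  rw [memℓp_gen_iff (by norm_num)]
  simp_rw [norm_sobolev_term]

theorem mem_hsSubmodule_of_sobolevEnergy {f : Freq d → ℂ} (h : sobolevEnergy s f < ∞) :
    f ∈ hsSubmodule d s := by
  rw [mem_hsSubmodule_iff]
  refine (ENNReal.summable_toReal h.ne).congr fun n => ?_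
  rw [← ofReal_sobolev_term, ENNReal.toReal_ofReal (by positivity)]

theorem enorm_sq_eq_sobolevEnergy (u : Hs d s) : ‖u‖ₑ ^ 2 = sobolevEnergy s u.coeff := by
  have hu : Summable fun n => (freqBracket n ^ s * ‖u.coeff n‖) ^ 2 := mem_hsSubmodule_iff.1 u.2
  rw [← ofReal_norm, ← ENNReal.ofReal_pow (norm_nonneg _), Hs.norm_sq_eq,
    ENNReal.ofReal_tsum_of_nonneg (fun n => by positivity) hu]
  exact tsum_congr fun n => ofReal_sobolev_term s n _

open Classical in
/-- The element of `H^s` with given Fourier coefficients (zero if they are not in `H^s`). -/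
def toHs (s : ℝ) (f : Freq d → ℂ) : Hs d s :=
  if h : f ∈ hsSubmodule d s then (⟨f, h⟩ : hsSubmodule d s) else (0 : hsSubmodule d s)

theorem coeff_toHs {f : Freq d → ℂ} (h : sobolevEnergy s f < ∞) : (toHs s f).coeff = f := by
  have := mem_hsSubmodule_of_sobolevEnergy h
  exact congrArg Subtype.val (dif_pos this)

theorem Hs.ext_coeff {u v : Hs d s} (h : ∀ n, u.coeff n = v.coeff n) : u = v :=
  Subtype.ext (funext h)

theorem Hs.coeff_sub (u v : Hs d s) (n : Freq d) : (u - v).coeff n = u.coeff n - v.coeff n := rfl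

theorem sobolevEnergy_evol_le (A : Freq d → ℝ → ℂ) (t : ℝ) :
    sobolevEnergy s (evol A t) ≤ energyOne s (absFn A) :=
  ENNReal.tsum_le_tsum fun n =>
    mul_le_mul_right (pow_le_pow_left' (enorm_evol_le A t n) 2) _

theorem coeff_toHs_evol {A : Freq d → ℝ → ℂ} (h : energyOne s (absFn A) < ∞) (t : ℝ) (n : Freq d) :
    (toHs s (evol A t)).coeff n = evol A t n :=
  congrFun (coeff_toHs ((sobolevEnergy_evol_le A t).trans_lt h)) n

theorem integrable_of_energyOne {A : Freq d → ℝ → ℂ} (hA : ∀ n, Measurable (A n))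
    (h : energyOne s (absFn A) < ∞) (n : Freq d) : Integrable (A n) :=
  ⟨(hA n).aestronglyMeasurable, lintegral_lt_top_of_energyOne h n⟩

theorem enorm_toHs_evol_sub_le {A B : Freq d → ℝ → ℂ} (hA : ∀ n, Measurable (A n))
    (hB : ∀ n, Measurable (B n)) (fA : energyOne s (absFn A) < ∞)
    (fB : energyOne s (absFn B) < ∞) (t : ℝ) :
    ‖toHs s (evol A t) - toHs s (evol B t)‖ₑ ^ 2 ≤ energyOne s (absFn (A - B)) := by
  rw [enorm_sq_eq_sobolevEnergy]
  refine le_of_eq_of_le ?_ (sobolevEnergy_evol_le (A - B) t)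
  refine tsum_congr fun n => ?_
  rw [Hs.coeff_sub, coeff_toHs_evol fA, coeff_toHs_evol fB,
    evol_sub (integrable_of_energyOne hA fA n) (integrable_of_energyOne hB fB n)]

/-- Each coefficient is continuous in time and bounded by its `L¹` norm in `σ`, so dominated
convergence applies to the sum over `n`. This is the role of the `ℓ²L¹` component. -/
theorem continuous_toHs_evol {A : Freq d → ℝ → ℂ} (hA : ∀ n, Measurable (A n))
    (fA : energyOne s (absFn A) < ∞) : Continuous fun t => toHs s (evol A t) := by
  refine continuous_iff_continuousAt.2 fun t₀ => ?_
  refine tendsto_iff_norm_sub_tendsto_zero.2 ?_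
  have key : Tendsto (fun t => ‖toHs s (evol A t) - toHs s (evol A t₀)‖ ^ 2) (𝓝 t₀) (𝓝 0) := by
    simp_rw [Hs.norm_sq_eq, Hs.coeff_sub, coeff_toHs_evol fA]
    have h0 : (∑' n : Freq d, (0 : ℝ)) = 0 := tsum_zero
    rw [← h0]
    refine tendsto_tsum_of_dominated_convergence
      (bound := fun n => 4 * (ENNReal.ofReal (freqWeight n ^ s) *
        (∫⁻ σ, absFn A n σ) ^ 2).toReal)
      ((ENNReal.summable_toReal fA.ne).mul_left 4) (fun n => ?_) (Eventually.of_forall fun t n => ?_)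
    · have hc := (continuous_evol (integrable_of_energyOne hA fA n)).tendsto t₀
      have := (((hc.sub_const (evol A t₀ n)).norm).const_mul (freqBracket n ^ s)).pow 2
      simpa using this
    · have hne : ENNReal.ofReal (freqWeight n ^ s) * (∫⁻ σ, absFn A n σ) ^ 2 ≠ ∞ :=
        ((mul_sq_lintegral_le_energyOne s (absFn A) n).trans_lt fA).ne
      rw [Real.norm_of_nonneg (by positivity), ← ENNReal.toReal_ofNat, ← ENNReal.toReal_mul]
      refine (ENNReal.ofReal_le_iff_le_toReal (ENNReal.mul_ne_top (by norm_num) hne)).1 ?_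
      rw [ofReal_sobolev_term]
      calc _ ≤ ENNReal.ofReal (freqWeight n ^ s) *
            ((∫⁻ σ, absFn A n σ) + ∫⁻ σ, absFn A n σ) ^ 2 :=
            mul_le_mul_right (pow_le_pow_left' (enorm_sub_le.trans
              (add_le_add (enorm_evol_le A t n) (enorm_evol_le A t₀ n))) 2) _
        _ = _ := by ring
  have := key.sqrt
  simpa [Real.sqrt_sq (norm_nonneg _)] using this

/-- The space-time Fourier transform of an extension of the free solution from `[-M⁻¹, M⁻¹]`. -/
def freeExtension (K : ℝ → ℂ) (M : ℝ) (c : Freq d → ℂ) : Freq d → ℝ → ℂ :=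
  fun n σ => ((M⁻¹ : ℝ) : ℂ) * K (σ / M) * c n

theorem measurable_freeExtension {K : ℝ → ℂ} (hK : Continuous K) (M : ℝ) (c : Freq d → ℂ)
    (n : Freq d) : Measurable (freeExtension K M c n) := by
  unfold freeExtension
  have : Continuous fun σ : ℝ => ((M⁻¹ : ℝ) : ℂ) * K (σ / M) * c n := by fun_prop
  exact this.measurable

theorem evol_freeExtension {ρ C : ℝ} {K : ℝ → ℂ} (hK : IsCutoffKernel ρ C K) {M : ℝ} (hM : 0 < M)
    (c : Freq d → ℂ) {t : ℝ} (ht : |t| ≤ M⁻¹) (n : Freq d) :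
    evol (freeExtension K M c) t n = Complex.exp (-(Complex.I * t * freqSq n)) * c n := by
  unfold evol freeExtension
  simp_rw [← mul_assoc (Complex.exp _)]
  rw [integral_mul_const]
  have := integral_exp_mul_scaled hK hM ht
  simp_rw [← mul_assoc (Complex.exp _)] at this
  rw [this, one_mul]

theorem freeExtension_sub (K : ℝ → ℂ) (M : ℝ) (c c' : Freq d → ℂ) :
    freeExtension K M c - freeExtension K M c' = freeExtension K M (c - c') := by
  funext n σ
  simp only [freeExtension, Pi.sub_apply]
  ring

theorem exists_resEnergy_freeExtension_le (d : ℕ) {s : ℝ} (hs' : s ≤ -(1 / 2)) {ρ C₀ : ℝ}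
    (hρ : 0 ≤ ρ) {K : ℝ → ℂ} (hK : IsCutoffKernel ρ C₀ K) :
    ∃ C : ℝ, 0 < C ∧ ∀ M : ℝ, 1 ≤ M → ∀ c : Freq d → ℂ,
      resEnergy M s ρ (freeExtension K M c) ≤ ENNReal.ofReal C * sobolevEnergy (s + 2 * ρ) c := by
  obtain ⟨C, hC, h⟩ := exists_persEnergy_linear_le (d := d) hs' hρ hK
  refine ⟨C, hC, fun M hM c => le_of_eq_of_le ?_ (h M hM fun n => ‖c n‖ₑ)⟩
  unfold resEnergy
  congr 1
  funext n σ
  have hM' : 0 ≤ M⁻¹ := by positivity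
  unfold absFn freeExtension
  rw [enorm_mul, ← ofReal_norm (_ * _), norm_mul, Complex.norm_real, Real.norm_of_nonneg hM']

theorem IsBilinear.solvesOn {ρ M C : ℝ} {κ : ℝ≥0∞} {K : ℝ → ℂ} (h : IsBilinear d s ρ K M κ)
    (hK : IsCutoffKernel ρ C K) {c : Freq d → ℂ} {G : Freq d → ℝ → ℂ}
    (hG : ∀ n, Measurable (G n)) (fG : resEnergy M s ρ G < ∞)
    (fL : resEnergy M s ρ (freeExtension K M c) < ∞)
    (eG : ∀ n, ∀ᵐ σ, G n σ = duhamelMap K M (freeExtension K M c) G n σ) :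
    SolvesOn M⁻¹ c G := by
  intro t ht n
  refine ⟨_, h.hasSum_pairIntegrand hK hG hG fG fG n ht, ?_⟩
  have iL := integrable_of_resEnergy h.pos h.rho_nonneg
    (measurable_freeExtension h.continuous M c) fL n
  have iD := integrable_of_resEnergy h.pos h.rho_nonneg (measurable_duhamelOp h.continuous M hG hG)
    (h.resEnergy_duhamelOp_lt_top hG hG fG fG) n
  rw [evol_congr_ae (eG n), duhamelMap, evol_sub iL iD, evol_freeExtension hK h.pos c ht]
  linear_combination (-evol (duhamelOp K M G G) t n) * Complex.I_sq

theorem SolvesOn.isSolution {T : ℝ} (hT : 0 ≤ T) {u₀ : Hs d s} {A : Freq d → ℝ → ℂ}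
    (hA : ∀ n, Measurable (A n)) (fA : energyOne s (absFn A) < ∞) (h : SolvesOn T u₀.coeff A) :
    IsSolution T u₀ fun t => toHs s (evol A t) where
  continuousOn := (continuous_toHs_evol hA fA).continuousOn
  initial := Hs.ext_coeff fun n => by
    obtain ⟨S, hS, e⟩ := h 0 (by simpa using hT) n
    have h0 : S = 0 := by
      simp only [intervalIntegral.integral_same] at hS
      exact hS.unique hasSum_zero
    rw [coeff_toHs_evol fA, e, h0]
    simp
  duhamel t ht n := by
    obtain ⟨S, hS, e⟩ := h t (abs_le.2 ht) n
    refine ⟨S, ?_, ?_⟩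
    · have : duhamelInteraction (fun t => toHs s (evol A t)) t n =
          fun k => ∫ t' in (0 : ℝ)..t, pairIntegrand A A t n k t' := by
        funext k
        unfold duhamelInteraction pairIntegrand
        simp only [coeff_toHs_evol fA]
      rwa [this]
    · rw [coeff_toHs_evol fA, e]
      rfl

theorem evol_eq_integral_toTime (A : Freq d → ℝ → ℂ) (t : ℝ) (n : Freq d) :
    evol A t n = ∫ τ : ℝ, Complex.exp (Complex.I * t * τ) * toTime A n τ := by
  unfold evol toTime modulation
  rw [← integral_add_right_eq_self (fun σ : ℝ => Complex.exp (Complex.I * t * σ) * A n σ)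
    (freqSq n), ← integral_const_mul]
  refine integral_congr_ae (ae_of_all _ fun τ => ?_)
  simp only
  rw [← mul_assoc, ← Complex.exp_add]
  congr 2
  push_cast; ring

theorem memZT_toHs_evol {T : ℝ} {A : Freq d → ℝ → ℂ} (hA : ∀ n, Measurable (A n))
    (fA : energyOne s (absFn A) < ∞) (hZ : ZNorm s (2 / 3) (toTime A) < ∞) :
    MemZT (2 / 3) T fun t => toHs s (evol A t) := by
  have hext : IsExtension T (fun t => toHs s (evol A t)) (toTime A) :=
    ⟨fun n => (integrable_of_energyOne hA fA n).comp_add_right (freqSq n),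
      fun t _ n => (coeff_toHs_evol fA t n).trans (evol_eq_integral_toTime A t n)⟩
  exact (iInf₂_le (toTime A) hext).trans_lt hZ

/-- The passage from the solution class to the uniqueness argument, which requires finite energies
at the lower regularity only. -/
theorem MemZT.exists_evol {s₀ T : ℝ} (hs : s₀ ≤ s) (hs' : s₀ ≤ 0) {v : ℝ → Hs d s}
    (h : MemZT (2 / 3) T v) :
    ∃ A : Freq d → ℝ → ℂ, (∀ n, Measurable (A n)) ∧ energyOne s₀ (absFn A) < ∞ ∧
      energyBase s₀ (absFn A) < ∞ ∧ ∀ t, |t| ≤ T → ∀ n, (v t).coeff n = evol A t n := by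
  obtain ⟨g, hg⟩ := iInf_lt_iff.1 h
  obtain ⟨hext, hZ⟩ := iInf_lt_iff.1 hg
  -- An extension is measurable only up to null sets; neither its `Z` norm nor its time evolution
  -- sees the change of representative.
  set g' : Freq d → ℝ → ℂ := fun n => (hext.integrable n).aestronglyMeasurable.mk _ with hg'
  have hgm : ∀ n, Measurable (g' n) := fun n =>
    (hext.integrable n).aestronglyMeasurable.stronglyMeasurable_mk.measurable
  have hae : ∀ n, g n =ᵐ[volume] g' n := fun n => (hext.integrable n).aestronglyMeasurable.ae_eq_mk
  set A : Freq d → ℝ → ℂ := fun n σ => g' n (σ - freqSq n) with hA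
  have hAm : ∀ n, Measurable (A n) := fun n => (hgm n).comp (measurable_id.sub_const _)
  have hAt : toTime A = g' := by
    funext n τ
    simp only [toTime, modulation, hA, add_sub_cancel_right]
  rw [ZNorm_congr_ae hae, ← hAt, ZNorm_toTime_lt_top_iff] at hZ
  refine ⟨A, hAm, energyOne_lt_top hs (measurable_absFn hAm) hZ.1 hZ.2.1,
    energyBase_lt_top hs hs' hZ.1 hZ.2.2, fun t ht n => ?_⟩
  rw [hext.eq_on t (abs_le.1 ht) n, evol_eq_integral_toTime, hAt]
  refine integral_congr_ae ((hae n).mono fun τ hτ => ?_)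
  simp only [hτ]

theorem IsSolution.solvesOn {T : ℝ} {u₀ : Hs d s} {v : ℝ → Hs d s} (h : IsSolution T u₀ v)
    {A : Freq d → ℝ → ℂ} (hA : ∀ t, |t| ≤ T → ∀ n, (v t).coeff n = evol A t n) :
    SolvesOn T u₀.coeff A := by
  intro t ht n
  obtain ⟨S, hS, e⟩ := h.duhamel t (abs_le.1 ht) n
  refine ⟨S, ?_, (hA t ht n).symm.trans e⟩
  have : duhamelInteraction v t n = fun k => ∫ t' in (0 : ℝ)..t, pairIntegrand A A t n k t' := by
    funext k
    refine intervalIntegral.integral_congr fun t' ht' => ?_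
    have ht'' : |t'| ≤ T := by
      refine le_trans ?_ ht
      simpa using abs_sub_left_of_mem_uIcc ht'
    simp only [pairIntegrand, hA t' ht'']
  rwa [← this]

/-- Uniqueness is inherited from the regularity `min s (-1/2)`, so no persistence weight is needed
here. -/
theorem IsSolution.eqOn (hd : d = 1 ∨ d = 2) (hs : -(2 / 3) < s) {T : ℝ} {u₀ : Hs d s}
    {v w : ℝ → Hs d s} (hv : IsSolution T u₀ v) (hw : IsSolution T u₀ w)
    (zv : MemZT (2 / 3) T v) (zw : MemZT (2 / 3) T w) : EqOn v w (Icc (-T) T) := by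
  have h0 : min s (-(1 / 2)) ≤ 0 := (min_le_right _ _).trans (by norm_num)
  obtain ⟨A, hA, fA, gA, eA⟩ := zv.exists_evol (min_le_left s (-(1 / 2))) h0
  obtain ⟨B, hB, fB, gB, eB⟩ := zw.exists_evol (min_le_left s (-(1 / 2))) h0
  intro t ht
  have ht' : |t| ≤ T := abs_le.2 ht
  refine Hs.ext_coeff fun n => ?_
  rw [eA t ht' n, eB t ht' n]
  exact SolvesOn.evol_eq hd (lt_min hs (by norm_num)) (min_le_right _ _) hA hB fA fB gA gB
    (hv.solvesOn eA) (hw.solvesOn eB) ht' n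

/-- On balls of `H^s` there is a flow, given by space-time Fourier transforms that depend
continuously on the data. -/
theorem exists_spacetime_flow (hd : d = 1 ∨ d = 2) (hs : -(2 / 3) < s) (R : ℝ) :
    ∃ T : ℝ, 0 < T ∧ ∃ C : ℝ, ∃ Γ : Hs d s → Freq d → ℝ → ℂ,
      (∀ u : Hs d s, ‖u‖ ≤ R → (∀ n, Measurable (Γ u n)) ∧ energyOne s (absFn (Γ u)) < ∞ ∧
        ZNorm s (2 / 3) (toTime (Γ u)) < ∞ ∧ SolvesOn T u.coeff (Γ u)) ∧
      ∀ u v : Hs d s, ‖u‖ ≤ R → ‖v‖ ≤ R →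
        energyOne s (absFn (Γ u - Γ v)) ≤ ENNReal.ofReal C * ‖u - v‖ₑ ^ 2 := by
  -- The bilinear estimate is used at `s₀ = min s (-1/2)`; the remaining `2ρ` derivatives are
  -- carried by the persistence weight, so `T` depends on the `H^s` norm of the data.
  obtain ⟨s₀, hs₀, hs₀', ρ, hρ, rfl⟩ : ∃ s₀ : ℝ, -(2 / 3) < s₀ ∧ s₀ ≤ -(1 / 2) ∧
      ∃ ρ : ℝ, 0 ≤ ρ ∧ s = s₀ + 2 * ρ :=
    ⟨min s (-(1 / 2)), lt_min hs (by norm_num), min_le_right _ _, (s - min s (-(1 / 2))) / 2,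
      by linarith [min_le_left s (-(1 / 2))], by ring⟩
  obtain ⟨K, C₀, hK⟩ := exists_isCutoffKernel hρ
  obtain ⟨C₁, -, h₁⟩ := exists_isBilinear hd hs₀ hs₀' hρ hK
  obtain ⟨C₂, hC₂, h₂⟩ := exists_resEnergy_freeExtension_le d hs₀' hρ hK
  set E : ℝ≥0∞ := ENNReal.ofReal C₂ * ENNReal.ofReal R ^ 2 with hE
  have hE' : E < ∞ :=
    ENNReal.mul_lt_top ENNReal.ofReal_lt_top (ENNReal.pow_lt_top ENNReal.ofReal_lt_top)
  obtain ⟨M, hM, hκ⟩ := exists_scale (C := C₁) (by linarith : 0 < 2 / 3 + s₀) hE'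
  have h := h₁ M hM
  have hM0 : 0 < M := h.pos
  have fL : ∀ u : Hs d (s₀ + 2 * ρ), ‖u‖ ≤ R →
      resEnergy M s₀ ρ (freeExtension K M u.coeff) ≤ E := fun u hu => by
    refine (h₂ M hM u.coeff).trans (mul_le_mul_right ?_ _)
    rw [← enorm_sq_eq_sobolevEnergy, ← ofReal_norm]
    exact pow_le_pow_left' (ENNReal.ofReal_le_ofReal hu) 2
  have mL : ∀ u : Hs d (s₀ + 2 * ρ), ∀ n, Measurable (freeExtension K M u.coeff n) := fun u =>
    measurable_freeExtension h.continuous M u.coeff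
  -- The condition on the norm is placed inside, so that the choice is a function on the whole
  -- space, arbitrary outside the ball.
  have ex : ∀ u : Hs d (s₀ + 2 * ρ), ∃ G : Freq d → ℝ → ℂ, ‖u‖ ≤ R →
      (∀ n, Measurable (G n)) ∧ resEnergy M s₀ ρ G ≤ 4 * E ∧
      ∀ n, ∀ᵐ σ, G n σ = duhamelMap K M (freeExtension K M u.coeff) G n σ := fun u => by
    by_cases hu : ‖u‖ ≤ R
    · obtain ⟨G, hG⟩ := h.exists_fixedPoint hE' hκ (mL u) (fL u hu)
      exact ⟨G, fun _ => hG⟩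
    · exact ⟨0, fun hu' => absurd hu' hu⟩
  choose Γ hΓ using ex
  have f4 : 4 * E < ∞ := ENNReal.mul_lt_top (by norm_num) hE'
  refine ⟨M⁻¹, inv_pos.2 hM0, 4 * C₂, Γ, fun u hu => ?_, fun u v hu hv => ?_⟩
  · obtain ⟨m, f, e⟩ := hΓ u hu
    exact ⟨m, (energyOne_le_persEnergy_add hM0 hρ _).trans_lt (f.trans_lt f4),
      ZNorm_toTime_lt_top hM (by linarith) hρ (f.trans_lt f4),
      h.solvesOn hK m (f.trans_lt f4) ((fL u hu).trans_lt hE') e⟩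
  · obtain ⟨m, f, e⟩ := hΓ u hu
    obtain ⟨m', f', e'⟩ := hΓ v hv
    refine (energyOne_le_persEnergy_add hM0 hρ _).trans
      ((h.resEnergy_fixedPoint_sub_le hE' hκ (mL u) (mL v) m m' f f' e e').trans ?_)
    rw [freeExtension_sub, ENNReal.ofReal_mul (by norm_num), mul_assoc, enorm_sq_eq_sobolevEnergy]
    refine mul_le_mul' (by norm_num) ((h₂ M hM _).trans (le_of_eq ?_))
    rfl

/-- The flow is even Lipschitz on the ball, uniformly in time; only continuity is extracted. -/
theorem tendstoUniformlyOn_of_enorm_sq_le {E F α : Type*} [NormedAddCommGroup E]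
    [NormedAddCommGroup F] {Φ : E → α → F} {S : Set E} {J : Set α} {C : ℝ} {u : E}
    (h : ∀ v ∈ S, ∀ t ∈ J, ‖Φ u t - Φ v t‖ₑ ^ 2 ≤ ENNReal.ofReal C * ‖u - v‖ₑ ^ 2) :
    TendstoUniformlyOn Φ (Φ u) (𝓝[S] u) J := by
  rw [Metric.tendstoUniformlyOn_iff]
  intro ε hε
  -- The maximum handles a negative `C`, for which `ENNReal.ofReal C` is zero.
  have hlim : Tendsto (fun v : E => max C 0 * ‖u - v‖ ^ 2) (𝓝[S] u) (𝓝 0) := by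
    have hc : Continuous fun v : E => max C 0 * ‖u - v‖ ^ 2 := by fun_prop
    have := hc.tendsto u
    rw [sub_self, norm_zero, zero_pow two_ne_zero, mul_zero] at this
    exact this.mono_left nhdsWithin_le_nhds
  filter_upwards [hlim.eventually (gt_mem_nhds (by positivity : 0 < ε ^ 2)), self_mem_nhdsWithin]
    with v hv hvS t ht
  have h1 := h v hvS t ht
  rw [dist_eq_norm]
  have h2 : ‖Φ u t - Φ v t‖ ^ 2 ≤ max C 0 * ‖u - v‖ ^ 2 := by
    rw [← ENNReal.ofReal_le_ofReal_iff (by positivity), ENNReal.ofReal_mul (by positivity),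
      ENNReal.ofReal_pow (norm_nonneg _), ENNReal.ofReal_pow (norm_nonneg _), ofReal_norm,
      ofReal_norm]
    exact h1.trans (mul_le_mul_left (ENNReal.ofReal_le_ofReal (le_max_left _ _)) _)
  exact lt_of_pow_lt_pow_left₀ 2 hε.le (h2.trans_lt hv)

end

end PeriodicNLS

end

theorem theorem1p1 (d : ℕ) (hd : d = 1 ∨ d = 2) (s : ℝ) (hs : -(2 / 3 : ℝ) < s) :
    ∀ R : ℝ, 0 < R → ∃ T : ℝ, 0 < T ∧
      ∃ Φ : PeriodicNLS.Hs d s → ℝ → PeriodicNLS.Hs d s,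
        (∀ u₀ : PeriodicNLS.Hs d s, ‖u₀‖ ≤ R →
          PeriodicNLS.IsSolution T u₀ (Φ u₀) ∧
          PeriodicNLS.MemZT (2 / 3) T (Φ u₀) ∧
          ∀ v : ℝ → PeriodicNLS.Hs d s,
            PeriodicNLS.IsSolution T u₀ v → PeriodicNLS.MemZT (2 / 3) T v →
              Set.EqOn v (Φ u₀) (Set.Icc (-T) T)) ∧
        (∀ u₀ : PeriodicNLS.Hs d s, ‖u₀‖ ≤ R →
          TendstoUniformlyOn Φ (Φ u₀)
            (nhdsWithin u₀ (Metric.closedBall 0 R)) (Set.Icc (-T) T)) := by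
  intro R _
  obtain ⟨T, hT, C, Γ, hΓ, hC⟩ := PeriodicNLS.exists_spacetime_flow hd hs R
  refine ⟨T, hT, fun u t => PeriodicNLS.toHs s (PeriodicNLS.evol (Γ u) t), fun u hu => ?_,
    fun u hu => ?_⟩
  · obtain ⟨m, f, z, sol⟩ := hΓ u hu
    have h1 := sol.isSolution hT.le m f
    have h2 := PeriodicNLS.memZT_toHs_evol (T := T) m f z
    exact ⟨h1, h2, fun v hv zv => hv.eqOn hd hs h1 zv h2⟩
  · refine PeriodicNLS.tendstoUniformlyOn_of_enorm_sq_le (C := C) fun v hv t _ => ?_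
    have hv' := mem_closedBall_zero_iff.1 hv
    obtain ⟨m, f, -, -⟩ := hΓ u hu
    obtain ⟨m', f', -, -⟩ := hΓ v hv'
    exact (PeriodicNLS.enorm_toHs_evol_sub_le m m' f f' t).trans (hC u v hu hv')
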